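/- **Notation.** $d$ is the dimension, $\log=\log_2$, $\varepsilon=1/\log^2 d$, and $a\approx_\varepsilon b$ means $|a-b|\le\varepsilon$. All asymptotics are for $d\to\infty$. Write $a\le_d b$ if $a\le 2^{o(d)}b$, and $a=_d b$ if $2^{-o(d)}b\le a\le 2^{o(d)}b$. $\mathcal S^{d-1}$ is the unit sphere of $\mathbb R^d$ and $p_\theta=(1-\cos^2\theta)^{d/2}$. $\mathcal W_d(\alpha,\beta\mid\theta)$ is the probability that a uniformly random $\mathbf c\in\mathcal S^{d-1}$ satisfies $\langle\mathbf v,\mathbf c\rangle\ge\cos\alpha$ and $\langle\mathbf w,\mathbf c\rangle\ge\cos\beta$, where $\mathbf v,\mathbf w$ are fixed unit vectors with $\langle\mathbf v,\mathbf w\rangle=\cos\theta$. For angles that may depend on $d$, $\mathcal W_d(\alpha,\beta\mid\theta)$ is *well-defined* if there is a constant $\kappa'>0$ such that for all large $d$ one of the following holds: (1) $\theta\neq0$ and $\kappa'\le\frac{\cos^2\alpha+\cos^2\beta-2\cos\alpha\cos\beta\cos\theta}{\sin^2\theta}\le1-\kappa'$; (2) $\alpha=\beta$ and $\frac{2\cos^2\alpha}{1+\cos\theta}\le1-\kappa'$.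 **Random product codes.** Put $b=\lfloor\log d\rfloor$ and split the $d$ coordinates into $b$ consecutive blocks, each of length $\lfloor d/b\rfloor$ or $\lceil d/b\rceil$. Fix a sequence $N=N(d)\ge1$ with $N=2^{o(d/\log d)}$. The distribution $\mathrm{RPC}(d,b,M)$ is that of $\mathcal C=\bigcup_{\mathbf Q\in\mathcal Q}\mathbf Q(\mathcal C^{(1)}\times\dots\times\mathcal C^{(b)})$, where $\mathcal Q$ consists of $N$ independent Haar-random elements of $\mathrm{SO}(d)$ and $\mathcal C^{(i)}$ consists of $\lceil M^{1/b}\rceil$ independent uniform points of the sphere of radius $1/\sqrt b$ in the $i$-th block, all independent. **Good triples.** Let $L,\mathcal C,\mathcal C'\subseteq\mathcal S^{d-1}$ be finite. For $\mathbf v\in\mathbb R^d$ put $R(\mathbf v)=\{\mathbf c\in\mathcal C:\langle\mathbf v,\mathbf c\rangle\approx_\varepsilon\cos\alpha\}$ and $R'(\mathbf v)=\{\mathbf c\in\mathcal C':\langle\mathbf v,\mathbf c\rangle\approx_\varepsilon\cos\alpha'\}$, and write $\mathbf w_{\mathbf x\mathbf y}=\frac{\mathbf x-\mathbf y}{\|\mathbf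 x-\mathbf y\|}$ (read as $\mathbf 0$ if $\mathbf x=\mathbf y$). Let $M_1$ be the set of $(\mathbf x,\mathbf y)\in L^2$ with $\langle\mathbf x,\mathbf y\rangle\approx_\varepsilon\cos\theta$ and $R(\mathbf x)\cap R(\mathbf y)\ne\emptyset$. Let $M_1^*$ be the set of $(\mathbf x,\mathbf y)\in M_1$ with $|R(\mathbf x)|\le2^{d/\log d}$. Let $\mathcal T$ be the set of triples $(\mathbf x,\mathbf y,\mathbf z)$ of pairwise distinct elements of $L$ with $\langle\mathbf x,\mathbf y\rangle\approx_\varepsilon\cos\theta$, $\langle\mathbf w_{\mathbf x\mathbf y},\mathbf z\rangle\approx_\varepsilon\cos\theta'$, $R(\mathbf x)\cap R(\mathbf y)\neq\emptyset$ and $R'(\mathbf w_{\mathbf x\mathbf y})\cap R'(\mathbf z)\ne\emptyset$. Let $\mathcal T^*$ be the set of those triples in $\mathcal T$ with $|R(\mathbf x)|\le 2^{d/\log d}$ and $|R'(\mathbf w_{\mathbf x\mathbf y})|\le2^{d/\log d}$. Then $(L,\mathcal C,\mathcal C')$ is *good* if 1. $|\{\mathbf x\in L:\langle\mathbf x,\mathbf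 c\rangle\approx_\varepsilon\cos\alpha\}|=_d|L|p_\alpha$ for all $\mathbf c\in\mathcal C$, and $|\{\mathbf x\in L:\langle\mathbf x,\mathbf c'\rangle\approx_\varepsilon\cos\alpha'\}|=_d|L|p_{\alpha'}$ for all $\mathbf c'\in\mathcal C'$; 2. $|\{\mathbf z\in L:\langle\mathbf w_{\mathbf x\mathbf y},\mathbf z\rangle\approx_\varepsilon\cos\theta',\ R'(\mathbf w_{\mathbf x\mathbf y})\cap R'(\mathbf z)\ne\emptyset\}|\le_d\max\{1,|L|\,\mathcal W_d(\theta',\alpha'\mid\alpha')\}$ for all $(\mathbf x,\mathbf y)\in L^2$; 3. $|M_1|=_d|M_1^*|=_d|L|^2\,\mathcal W_d(\theta,\alpha\mid\alpha)$; 4. $|\mathcal T|=_d|\mathcal T^*|=_d|L|^3\,\mathcal W_d(\theta,\alpha\mid\alpha)\,\mathcal W_d(\theta',\alpha'\mid\alpha')$. **Statement.** Let $m=m(d)$ be integers with $m=2^{\Theta(d)}$, let $\kappa\in(0,\pi/4)$ be constant, and let $\theta,\theta',\alpha,\alpha'$ (possibly depending on $d$) lie in $[\kappa,\pi/2-\kappa]$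 for all large $d$. Suppose that $\mathcal W_d(\theta,\alpha\mid\alpha)$, $\mathcal W_d(\alpha,\alpha\mid\theta)$, $\mathcal W_d(\theta',\alpha'\mid\alpha')$, $\mathcal W_d(\alpha',\alpha'\mid\theta')$ are well-defined, that $\cos^2\alpha\le\cos\theta$ and $\cos^2\alpha'\le\cos\theta'$ for all large $d$, that $m\,p_{\theta'}\le_d1$, and that $$\min\{m\,p_\alpha,\ m\,p_{\alpha'},\ m\,\mathcal W_d(\theta,\alpha\mid\alpha),\ m^2\,\mathcal W_d(\theta',\alpha'\mid\alpha')\}=2^{\Omega(d)}.$$ Let $L$ be a set of $m$ independent uniform samples from $\mathcal S^{d-1}$, $\mathcal C\sim\mathrm{RPC}(d,b,1/p_\alpha)$ and $\mathcal C'\sim\mathrm{RPC}(d,b,1/p_{\alpha'})$, all independent. Then $$\Pr_{L,\mathcal C,\mathcal C'}[(L,\mathcal C,\mathcal C')\text{ is good}]\ge2^{-o(d)}.$$ That is, there is a function $\eta(d)=o(d)$ such that for all large $d$, with probability at least $2^{-\eta(d)}$, conditions 1-4 hold with every factor $2^{\pm o(d)}$ in them replaced by $2^{\pm\eta(d)}$.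 -/

import Mathlib

open MeasureTheory Filter Asymptotics Set Topology

noncomputable section

namespace GoodRPC

/-! ### Uniform distributions -/

/-- The uniform probability distribution on the unit sphere of `ℝ^ι`: the normalized surface
measure. -/
def unifSphere (ι : Type) [Fintype ι] :
    Measure (Metric.sphere (0 : EuclideanSpace ℝ ι) 1) :=
  ((volume : Measure (EuclideanSpace ℝ ι)).toSphere univ)⁻¹ •
    (volume : Measure (EuclideanSpace ℝ ι)).toSphere

theorem isProbabilityMeasure_unifSphere (ι : Type) [Fintype ι] [Nonempty ι] :
    IsProbabilityMeasure (unifSphere ι) := by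
  refine ⟨?_⟩
  have h0 : (volume : Measure (EuclideanSpace ℝ ι)).toSphere univ ≠ 0 := by
    rw [Measure.measure_univ_ne_zero]
    exact Measure.toSphere_ne_zero _
  simp only [unifSphere, Measure.smul_apply, smul_eq_mul]
  exact ENNReal.inv_mul_cancel h0 (measure_ne_top _ _)

/-- The group `SO(d)` of rotation matrices. -/
abbrev SO (d : ℕ) : Type := Matrix.specialOrthogonalGroup (Fin d) ℝ

theorem isCompact_SO (d : ℕ) :
    IsCompact (Matrix.specialOrthogonalGroup (Fin d) ℝ : Set (Matrix (Fin d) (Fin d) ℝ)) := by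
  have hset : (Matrix.specialOrthogonalGroup (Fin d) ℝ : Set (Matrix (Fin d) (Fin d) ℝ)) =
      {A | A * A.transpose = 1 ∧ A.det = 1} := by
    ext A
    rw [SetLike.mem_coe, Matrix.mem_specialOrthogonalGroup_iff, Matrix.mem_orthogonalGroup_iff]
    rfl
  have hK : IsCompact (Set.pi univ fun _ : Fin d => Set.pi univ fun _ : Fin d =>
      Icc (-1 : ℝ) 1) :=
    isCompact_univ_pi fun _ => isCompact_univ_pi fun _ => isCompact_Icc
  rw [hset]
  refine IsCompact.of_isClosed_subset (X := Matrix (Fin d) (Fin d) ℝ) hK ?_ ?_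
  · exact (isClosed_eq (by fun_prop) continuous_const).inter
      (isClosed_eq (by fun_prop) continuous_const)
  · rintro A ⟨hA, -⟩ i - j -
    have h1 : ∑ k, A i k * A i k = 1 := by
      have := congrFun (congrFun hA i) i
      simpa [Matrix.mul_apply] using this
    have h2 : A i j * A i j ≤ 1 := by
      rw [← h1]
      exact Finset.single_le_sum (f := fun k => A i k * A i k)
        (fun k _ => mul_self_nonneg _) (Finset.mem_univ j)
    exact abs_le.mp (abs_le_one_iff_mul_self_le_one.mpr h2)

instance (d : ℕ) : CompactSpace (SO d) := isCompact_iff_compactSpace.mp (isCompact_SO d)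

instance (d : ℕ) : IsTopologicalGroup (SO d) where
  continuous_inv := by
    refine Continuous.subtype_mk (f := fun A : SO d => (A : Matrix (Fin d) (Fin d) ℝ).transpose)
      ?_ _
    exact continuous_subtype_val.matrix_transpose

instance (d : ℕ) : MeasurableSpace (SO d) := borel _

instance (d : ℕ) : BorelSpace (SO d) := ⟨rfl⟩

/-- The uniform probability distribution on `SO(d)`: the Haar measure of total mass one. -/
def unifSO (d : ℕ) : Measure (SO d) := Measure.haarMeasure ⊤

theorem isProbabilityMeasure_unifSO (d : ℕ) : IsProbabilityMeasure (unifSO d) :=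
  ⟨Measure.haarMeasure_self⟩

/-! ### Caps and wedges -/

/-- The global tolerance `ε = 1 / log₂(d)²`. -/
def tol (d : ℕ) : ℝ := 1 / Real.logb 2 d ^ 2

/-- `a ≈_ε b`. -/
def Approx (d : ℕ) (a b : ℝ) : Prop := |a - b| ≤ tol d

/-- `p_θ = (1 - cos² θ)^{d/2}`. -/
def capP (d : ℕ) (θ : ℝ) : ℝ := (1 - Real.cos θ ^ 2) ^ ((d : ℝ) / 2)

/-- The unit vector `cos θ • e₀ + sin θ • e₁` of `ℝ^d` (for `d ≥ 2`). -/
def planeVec (d : ℕ) (θ : ℝ) : EuclideanSpace ℝ (Fin d) :=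
  WithLp.toLp 2 fun j => if j.val = 0 then Real.cos θ else if j.val = 1 then Real.sin θ else 0

/-- The wedge ratio `W_d(α, β ∣ θ)`: the probability that a uniformly random unit vector has inner
product at least `cos α` with `v` and at least `cos β` with `w`, for unit vectors `v`, `w` with
`⟪v, w⟫ = cos θ`. By rotation invariance the choice of `v`, `w` does not matter; here
`v = e₀` and `w = cos θ • e₀ + sin θ • e₁`. -/
def wedge (d : ℕ) (α β θ : ℝ) : ℝ :=
  (unifSphere (Fin d)).real
    {c | Real.cos α ≤ inner ℝ (planeVec d 0) (c : EuclideanSpace ℝ (Fin d)) ∧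
      Real.cos β ≤ inner ℝ (planeVec d θ) (c : EuclideanSpace ℝ (Fin d))}

theorem inner_planeVec (d : ℕ) (hd : 2 ≤ d) (θ φ : ℝ) :
    inner ℝ (planeVec d θ) (planeVec d φ) = Real.cos (φ - θ) := by
  obtain ⟨n, rfl⟩ := Nat.exists_eq_add_of_le' hd
  simp [planeVec, PiLp.inner_apply, Fin.sum_univ_succ, Real.cos_sub]

/-- "`W_d(α, β ∣ θ)` is well-defined", for angles that may vary with the dimension: the constant
`κ'` does not depend on `d`. -/
def WedgeWellDefined (α β θ : ℕ → ℝ) : Prop :=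
  ∃ κ' : ℝ, 0 < κ' ∧ ∀ᶠ d in atTop,
    (θ d ≠ 0 ∧
      κ' ≤ (Real.cos (α d) ^ 2 + Real.cos (β d) ^ 2 -
        2 * Real.cos (α d) * Real.cos (β d) * Real.cos (θ d)) / Real.sin (θ d) ^ 2 ∧
      (Real.cos (α d) ^ 2 + Real.cos (β d) ^ 2 -
        2 * Real.cos (α d) * Real.cos (β d) * Real.cos (θ d)) / Real.sin (θ d) ^ 2 ≤ 1 - κ') ∨
    (α d = β d ∧ 2 * Real.cos (α d) ^ 2 / (1 + Real.cos (θ d)) ≤ 1 - κ')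

/-! ### Random product codes -/

/-- The coordinates `0, …, d - 1` are split into `b` consecutive blocks, each of `⌊d/b⌋` or `⌈d/b⌉`
coordinates; coordinate `j` lies in block `⌊j b / d⌋`. If `b ∣ d`, all blocks have length `d/b`. -/
abbrev Block (d b i : ℕ) : Type := {j : Fin d // j.val * b / d = i}

/-- The number `M^{1/b}` of points per block, rounded up to an integer. -/
def blockSize (b : ℕ) (M : ℝ) : ℕ := ⌈M ^ (1 / (b : ℝ))⌉₊

/-- The concatenation of `u_1/√b, …, u_b/√b`, where `u_i` is a unit vector supported on block `i`:
a point of the product of the spheres of radius `1/√b`. -/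
def concat (d b : ℕ) (u : (i : Fin b) → Metric.sphere (0 : EuclideanSpace ℝ (Block d b i)) 1) :
    EuclideanSpace ℝ (Fin d) :=
  WithLp.toLp 2 fun j =>
    if h : j.val * b / d < b then
      (u ⟨j.val * b / d, h⟩ : EuclideanSpace ℝ (Block d b (j.val * b / d))) ⟨j, rfl⟩ / √(b : ℝ)
    else 0

/-- The randomness of a random product code: `N` rotations, and for each of the `b` blocks
`M^{1/b}` points of the sphere. -/
abbrev RPCSeed (d b N : ℕ) (M : ℝ) : Type :=
  (Fin N → SO d) ×
    ((i : Fin b) → Fin (blockSize b M) → Metric.sphere (0 : EuclideanSpace ℝ (Block d b i)) 1)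

/-- All rotations and all points are independent and uniform. -/
def rpcLaw (d b N : ℕ) (M : ℝ) : Measure (RPCSeed d b N M) :=
  (Measure.pi fun _ => unifSO d).prod
    (Measure.pi fun i : Fin b => Measure.pi fun _ => unifSphere (Block d b i))

/-- The code `⋃_Q Q(C⁽¹⁾ × ⋯ × C⁽ᵇ⁾)`. Under `rpcLaw d b N M` this is `RPC(d, b, M)`, with `N`
rotations. -/
def rpcCode {d b N : ℕ} {M : ℝ} (σ : RPCSeed d b N M) : Set (EuclideanSpace ℝ (Fin d)) :=
  {v | ∃ (q : Fin N) (k : Fin b → Fin (blockSize b M)),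
    v = WithLp.toLp 2 (Matrix.mulVec (σ.1 q : Matrix (Fin d) (Fin d) ℝ)
      (concat d b fun i => σ.2 i (k i)).ofLp)}

/-! ### Good triples `(L, C, C')` -/

section Good

variable {d : ℕ}

/-- `R_{(C,α)}(x) = {c ∈ C : ⟪x, c⟫ ≈_ε cos α}`. -/
def nbr (C : Set (EuclideanSpace ℝ (Fin d))) (α : ℝ) (x : EuclideanSpace ℝ (Fin d)) :
    Set (EuclideanSpace ℝ (Fin d)) :=
  {c ∈ C | Approx d (inner ℝ x c) (Real.cos α)}

/-- `(R_L)⁻¹(c) = {x ∈ L : ⟪x, c⟫ ≈_ε cos α}`. -/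
def bucket (L : Set (EuclideanSpace ℝ (Fin d))) (α : ℝ) (c : EuclideanSpace ℝ (Fin d)) :
    Set (EuclideanSpace ℝ (Fin d)) :=
  {x ∈ L | Approx d (inner ℝ x c) (Real.cos α)}

/-- The normalized difference `(x - y) / ‖x - y‖`. -/
def dir (x y : EuclideanSpace ℝ (Fin d)) : EuclideanSpace ℝ (Fin d) := ‖x - y‖⁻¹ • (x - y)

/-- `M₁(R)` for `R = R_{(C,α)}`. -/
def M1 (θ α : ℝ) (L C : Set (EuclideanSpace ℝ (Fin d))) :
    Set (EuclideanSpace ℝ (Fin d) × EuclideanSpace ℝ (Fin d)) :=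
  {t | t.1 ∈ L ∧ t.2 ∈ L ∧ Approx d (inner ℝ t.1 t.2) (Real.cos θ) ∧
    (nbr C α t.1 ∩ nbr C α t.2).Nonempty}

/-- `|A| ≤ 2^{d / log₂ d}`. -/
def Small (A : Set (EuclideanSpace ℝ (Fin d))) : Prop :=
  (A.ncard : ℝ) ≤ 2 ^ ((d : ℝ) / Real.logb 2 d)

/-- `M₁*(R)`. -/
def M1s (θ α : ℝ) (L C : Set (EuclideanSpace ℝ (Fin d))) :
    Set (EuclideanSpace ℝ (Fin d) × EuclideanSpace ℝ (Fin d)) :=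
  {t ∈ M1 θ α L C | Small (nbr C α t.1)}

/-- `T_sol(L, θ, θ')`, a set of triples of pairwise distinct elements of `L`. -/
def Tsol (θ θ' : ℝ) (L : Set (EuclideanSpace ℝ (Fin d))) :
    Set (EuclideanSpace ℝ (Fin d) × EuclideanSpace ℝ (Fin d) × EuclideanSpace ℝ (Fin d)) :=
  {t | t.1 ∈ L ∧ t.2.1 ∈ L ∧ t.2.2 ∈ L ∧ t.1 ≠ t.2.1 ∧ t.1 ≠ t.2.2 ∧ t.2.1 ≠ t.2.2 ∧
    Approx d (inner ℝ t.1 t.2.1) (Real.cos θ) ∧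
    Approx d (inner ℝ (dir t.1 t.2.1) t.2.2) (Real.cos θ')}

/-- `T(R, R')` for `R = R_{(C,α)}` and `R' = R_{(C',α')}`. -/
def TR (θ θ' α α' : ℝ) (L C C' : Set (EuclideanSpace ℝ (Fin d))) :
    Set (EuclideanSpace ℝ (Fin d) × EuclideanSpace ℝ (Fin d) × EuclideanSpace ℝ (Fin d)) :=
  {t ∈ Tsol θ θ' L | (nbr C α t.1 ∩ nbr C α t.2.1).Nonempty ∧
    (nbr C' α' (dir t.1 t.2.1) ∩ nbr C' α' t.2.2).Nonempty}

/-- `T*(R, R')`. -/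
def TRs (θ θ' α α' : ℝ) (L C C' : Set (EuclideanSpace ℝ (Fin d))) :
    Set (EuclideanSpace ℝ (Fin d) × EuclideanSpace ℝ (Fin d) × EuclideanSpace ℝ (Fin d)) :=
  {t ∈ TR θ θ' α α' L C C' | Small (nbr C α t.1) ∧ Small (nbr C' α' (dir t.1 t.2.1))}

/-- `2^{-s} b ≤ a ≤ 2^s b`. With `s = o(d)` this is `a =_d b`. -/
def EqUpTo (s a b : ℝ) : Prop := 2 ^ (-s) * b ≤ a ∧ a ≤ 2 ^ s * b

/-- `(L, C, C')` is `(θ, θ', α, α')`-good, where `s` is the exponent of all subexponential factors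
`2^{o(d)}`. The sets `L`, `C`, `C'` are finite subsets of the unit sphere in all uses. -/
structure Good (s θ θ' α α' : ℝ) (L C C' : Set (EuclideanSpace ℝ (Fin d))) : Prop where
  bucket_card : ∀ c ∈ C, EqUpTo s (bucket L α c).ncard (L.ncard * capP d α)
  bucket_card' : ∀ c ∈ C', EqUpTo s (bucket L α' c).ncard (L.ncard * capP d α')
  third_card : ∀ x ∈ L, ∀ y ∈ L,
    ({z ∈ L | Approx d (inner ℝ (dir x y) z) (Real.cos θ') ∧
      (nbr C' α' (dir x y) ∩ nbr C' α' z).Nonempty}.ncard : ℝ) ≤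
        2 ^ s * max 1 (L.ncard * wedge d θ' α' α')
  pairs_eq : EqUpTo s (M1 θ α L C).ncard (M1s θ α L C).ncard
  pairs_card : EqUpTo s (M1s θ α L C).ncard ((L.ncard : ℝ) ^ 2 * wedge d θ α α)
  triples_eq : EqUpTo s (TR θ θ' α α' L C C').ncard (TRs θ θ' α α' L C C').ncard
  triples_card : EqUpTo s (TRs θ θ' α α' L C C').ncard
    ((L.ncard : ℝ) ^ 3 * wedge d θ α α * wedge d θ' α' α')

end Good

/-- The joint law of `m` independent uniform unit vectors and of the seeds of two independent
random product codes `RPC(d, ⌊log₂ d⌋, 1/p_α)` and `RPC(d, ⌊log₂ d⌋, 1/p_α')`, with `N` rotations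
each. -/
def jointLaw (d m N : ℕ) (α α' : ℝ) :
    Measure ((Fin m → Metric.sphere (0 : EuclideanSpace ℝ (Fin d)) 1) ×
      RPCSeed d (Nat.log 2 d) N (1 / capP d α) × RPCSeed d (Nat.log 2 d) N (1 / capP d α')) :=
  (Measure.pi fun _ => unifSphere (Fin d)).prod
    ((rpcLaw d (Nat.log 2 d) N (1 / capP d α)).prod (rpcLaw d (Nat.log 2 d) N (1 / capP d α')))

end GoodRPC

end

open GoodRPC

noncomputable section

namespace GoodRPC

open Metric
open scoped ENNReal Pointwise Matrix

/-! ### The uniform measure on the sphere through volumes of cones -/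

/-- The part of the cone over `A` inside the open ball of radius `R`, without the apex. -/
def coneSet {E : Type*} [NormedAddCommGroup E] [NormedSpace ℝ E] (A : Set E) (R : ℝ) : Set E :=
  {x | x ≠ 0 ∧ ‖x‖ < R ∧ ‖x‖⁻¹ • x ∈ A}

section Cone

variable {ι : Type} [Fintype ι]

theorem measurableSet_coneSet {A : Set (EuclideanSpace ℝ ι)} (hA : MeasurableSet A) (R : ℝ) :
    MeasurableSet (coneSet A R) := by
  have h1 : MeasurableSet {x : EuclideanSpace ℝ ι | x ≠ 0} := (measurableSet_singleton 0).compl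
  have h2 : MeasurableSet {x : EuclideanSpace ℝ ι | ‖x‖ < R} :=
    measurableSet_lt measurable_norm measurable_const
  have h3 : Measurable fun x : EuclideanSpace ℝ ι => ‖x‖⁻¹ • x := by fun_prop
  exact h1.inter (h2.inter (h3 hA))

theorem coneSet_eq_smul {E : Type*} [NormedAddCommGroup E] [NormedSpace ℝ E] (A : Set E) {R : ℝ}
    (hR : 0 < R) : coneSet A R = R • coneSet A 1 := by
  ext x
  rw [mem_smul_set_iff_inv_smul_mem₀ hR.ne']
  simp only [coneSet, mem_ofPred_eq, norm_smul, norm_inv, Real.norm_eq_abs, abs_of_pos hR]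
  have h1 : R⁻¹ • x ≠ 0 ↔ x ≠ 0 := by simp [hR.ne']
  have h2 : R⁻¹ * ‖x‖ < 1 ↔ ‖x‖ < R := by
    rw [inv_mul_lt_iff₀ hR, mul_one]
  have h3 : (R⁻¹ * ‖x‖)⁻¹ • R⁻¹ • x = ‖x‖⁻¹ • x := by
    rw [smul_smul]; congr 1; field_simp
  rw [h1, h2, h3]

theorem volume_coneSet_one [Nonempty ι] {A : Set (EuclideanSpace ℝ ι)} (hA : MeasurableSet A) :
    volume (coneSet A 1) = volume (ball (0 : EuclideanSpace ℝ ι) 1) *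
      unifSphere ι {c | (c : EuclideanSpace ℝ ι) ∈ A} := by
  have hs : MeasurableSet {c : sphere (0 : EuclideanSpace ℝ ι) 1 | (c : EuclideanSpace ℝ ι) ∈ A} :=
    measurable_subtype_coe hA
  have hset : Ioo (0 : ℝ) 1 • (((↑) : sphere (0 : EuclideanSpace ℝ ι) 1 → EuclideanSpace ℝ ι) ''
      {c | (c : EuclideanSpace ℝ ι) ∈ A}) = coneSet A 1 := by
    ext x
    simp only [Set.mem_smul, coneSet, mem_ofPred_eq]
    constructor
    · rintro ⟨r, hr, y, ⟨c, hc, rfl⟩, rfl⟩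
      have hn : ‖(c : EuclideanSpace ℝ ι)‖ = 1 := by simp
      have hc0 : (c : EuclideanSpace ℝ ι) ≠ 0 := by rw [← norm_ne_zero_iff, hn]; simp
      refine ⟨smul_ne_zero hr.1.ne' hc0, ?_, ?_⟩
      · rw [norm_smul, hn, mul_one, Real.norm_eq_abs, abs_of_pos hr.1]; exact hr.2
      · rw [norm_smul, hn, mul_one, Real.norm_eq_abs, abs_of_pos hr.1, smul_smul,
          inv_mul_cancel₀ hr.1.ne', one_smul]
        exact hc
    · rintro ⟨h0, h1, h2⟩
      have hn : 0 < ‖x‖ := norm_pos_iff.2 h0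
      refine ⟨‖x‖, ⟨hn, h1⟩, ‖x‖⁻¹ • x, ⟨⟨‖x‖⁻¹ • x, ?_⟩, h2, rfl⟩, ?_⟩
      · simp [norm_smul, hn.ne']
      · simp [smul_smul, hn.ne']
  have h0 : volume (ball (0 : EuclideanSpace ℝ ι) 1) ≠ 0 :=
    (isOpen_ball.measure_pos _ (by simp)).ne'
  have h1 : volume (ball (0 : EuclideanSpace ℝ ι) 1) ≠ ⊤ := measure_ball_lt_top.ne
  have hd : (Module.finrank ℝ (EuclideanSpace ℝ ι) : ℝ≥0∞) ≠ 0 := by simp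
  have hd' : (Module.finrank ℝ (EuclideanSpace ℝ ι) : ℝ≥0∞) ≠ ⊤ := by simp
  rw [unifSphere, Measure.smul_apply, smul_eq_mul, Measure.toSphere_apply' _ hs, hset,
    Measure.toSphere_apply_univ, ENNReal.mul_inv (Or.inl hd) (Or.inl hd')]
  rw [show ∀ a b c e : ℝ≥0∞, b * (a⁻¹ * b⁻¹ * (a * c)) = (a⁻¹ * a) * (b⁻¹ * b) * c by
    intros; ring]
  · rw [ENNReal.inv_mul_cancel hd hd', ENNReal.inv_mul_cancel h0 h1, one_mul, one_mul]
  · exact 0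

theorem volume_coneSet [Nonempty ι] {A : Set (EuclideanSpace ℝ ι)} (hA : MeasurableSet A) {R : ℝ}
    (hR : 0 < R) : volume (coneSet A R) = ENNReal.ofReal (R ^ Fintype.card ι) *
      (volume (ball (0 : EuclideanSpace ℝ ι) 1) *
        unifSphere ι {c | (c : EuclideanSpace ℝ ι) ∈ A}) := by
  rw [coneSet_eq_smul A hR, Measure.addHaar_smul, volume_coneSet_one hA, finrank_euclideanSpace,
    abs_of_pos (by positivity)]

theorem volume_affine_image (t : EuclideanSpace ℝ ι) {ρ : ℝ} (hρ : 0 ≤ ρ)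
    (T : Set (EuclideanSpace ℝ ι)) :
    volume ((fun r => t + ρ • r) '' T) = ENNReal.ofReal (ρ ^ Fintype.card ι) * volume T := by
  have : (fun r => t + ρ • r) '' T = (fun x => t + x) '' (ρ • T) := by
    rw [← image_smul, image_image]
  rw [this, image_add_left, measure_preimage_add, Measure.addHaar_smul, finrank_euclideanSpace,
    abs_of_nonneg (by positivity)]

/-- A lower bound for the uniform measure of a set whose cone contains an affine copy of `T`. -/
theorem unifSphere_ge_of_affine [Nonempty ι] {A T : Set (EuclideanSpace ℝ ι)}
    (hA : MeasurableSet A) (t : EuclideanSpace ℝ ι) {ρ R : ℝ} (hρ : 0 ≤ ρ) (hR : 0 < R)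
    (hT : volume (ball (0 : EuclideanSpace ℝ ι) 1) ≤ 2 * volume T)
    (h : ∀ r ∈ T, t + ρ • r ∈ coneSet A R) :
    ENNReal.ofReal ((ρ / R) ^ Fintype.card ι / 2) ≤
      unifSphere ι {c | (c : EuclideanSpace ℝ ι) ∈ A} := by
  have h0 : volume (ball (0 : EuclideanSpace ℝ ι) 1) ≠ 0 :=
    (isOpen_ball.measure_pos _ (by simp)).ne'
  have h1 : volume (ball (0 : EuclideanSpace ℝ ι) 1) ≠ ⊤ := measure_ball_lt_top.ne
  have h2 : ENNReal.ofReal (ρ ^ Fintype.card ι) * volume T ≤ ENNReal.ofReal (R ^ Fintype.card ι) *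
      (volume (ball (0 : EuclideanSpace ℝ ι) 1) *
        unifSphere ι {c | (c : EuclideanSpace ℝ ι) ∈ A}) := by
    rw [← volume_coneSet hA hR, ← volume_affine_image t hρ]
    exact measure_mono (image_subset_iff.2 h)
  set V := volume (ball (0 : EuclideanSpace ℝ ι) 1)
  set U := unifSphere ι {c | (c : EuclideanSpace ℝ ι) ∈ A}
  have hRn : ENNReal.ofReal (R ^ Fintype.card ι) ≠ 0 := by
    simp only [ne_eq, ENNReal.ofReal_eq_zero, not_le]; positivity
  have h3 : ENNReal.ofReal (ρ ^ Fintype.card ι) * V ≤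
      (2 * (ENNReal.ofReal (R ^ Fintype.card ι) * U)) * V := by
    calc _ ≤ ENNReal.ofReal (ρ ^ Fintype.card ι) * (2 * volume T) := by gcongr
      _ = 2 * (ENNReal.ofReal (ρ ^ Fintype.card ι) * volume T) := by ring
      _ ≤ 2 * (ENNReal.ofReal (R ^ Fintype.card ι) * (V * U)) := by gcongr
      _ = _ := by ring
  have h4 := (ENNReal.mul_le_mul_iff_left h0 h1).1 h3
  have h5 : ENNReal.ofReal ((ρ / R) ^ Fintype.card ι / 2) =
      ENNReal.ofReal (ρ ^ Fintype.card ι) / (2 * ENNReal.ofReal (R ^ Fintype.card ι)) := by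
    rw [← ENNReal.ofReal_ofNat 2, ← ENNReal.ofReal_mul (by norm_num),
      ← ENNReal.ofReal_div_of_pos (by positivity)]
    congr 1; rw [div_pow]; field_simp
  rw [h5]
  refine ENNReal.div_le_of_le_mul ?_
  calc _ ≤ _ := h4
    _ = _ := by ring

/-- Only a thin shell is needed to bound the uniform measure from above. -/
theorem volume_mul_unifSphere_le [Nonempty ι] {A : Set (EuclideanSpace ℝ ι)}
    (hA : MeasurableSet A) {δ : ℝ} (hδ1 : δ < 1)
    (hδ : (1 - δ) ^ Fintype.card ι ≤ 1 / 2) :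
    volume (ball (0 : EuclideanSpace ℝ ι) 1) * unifSphere ι {c | (c : EuclideanSpace ℝ ι) ∈ A} ≤
      2 * volume (coneSet A 1 ∩ {x | 1 - δ ≤ ‖x‖}) := by
  set V := volume (ball (0 : EuclideanSpace ℝ ι) 1)
  set U := unifSphere ι {c | (c : EuclideanSpace ℝ ι) ∈ A} with hU
  have hp := isProbabilityMeasure_unifSphere ι
  have hVU : V * U ≠ ⊤ := ENNReal.mul_ne_top measure_ball_lt_top.ne (measure_ne_top _ _)
  have h1 : V * U ≤ volume (coneSet A 1 ∩ {x | 1 - δ ≤ ‖x‖}) + volume (coneSet A (1 - δ)) := by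
    rw [← volume_coneSet_one hA]
    refine (measure_mono ?_).trans (measure_union_le _ _)
    rintro x hx
    by_cases hxd : 1 - δ ≤ ‖x‖
    · exact Or.inl ⟨hx, hxd⟩
    · exact Or.inr ⟨hx.1, not_le.1 hxd, hx.2.2⟩
  rw [volume_coneSet hA (by linarith)] at h1
  have h2 : ENNReal.ofReal ((1 - δ) ^ Fintype.card ι) * (V * U) ≤ (V * U) / 2 := by
    rw [ENNReal.div_eq_inv_mul]
    gcongr
    refine (ENNReal.ofReal_le_ofReal hδ).trans ?_
    rw [one_div, ENNReal.ofReal_inv_of_pos (by norm_num)]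
    simp
  have h3 : V * U ≤ volume (coneSet A 1 ∩ {x | 1 - δ ≤ ‖x‖}) + (V * U) / 2 :=
    h1.trans (by gcongr)
  have h4 : (V * U) / 2 + (V * U) / 2 ≤
      volume (coneSet A 1 ∩ {x | 1 - δ ≤ ‖x‖}) + (V * U) / 2 := by rwa [ENNReal.add_halves]
  have h5 := (ENNReal.add_le_add_iff_right (ENNReal.div_ne_top hVU (by norm_num))).1 h4
  rw [ENNReal.div_le_iff (by norm_num) (by norm_num)] at h5
  rwa [mul_comm 2]

theorem volume_closedBall_sqrt_le [Nonempty ι] (t : EuclideanSpace ℝ ι) {s : ℝ} (hs : 0 ≤ s) :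
    volume (closedBall t (√s)) =
      ENNReal.ofReal (s ^ ((Fintype.card ι : ℝ) / 2)) *
        volume (ball (0 : EuclideanSpace ℝ ι) 1) := by
  rw [Measure.addHaar_closedBall _ _ (Real.sqrt_nonneg _), finrank_euclideanSpace]
  congr 2
  rw [Real.sqrt_eq_rpow, ← Real.rpow_natCast, ← Real.rpow_mul hs]
  congr 1; ring

theorem mem_closedBall_of_inner_le {E : Type*} [NormedAddCommGroup E] [InnerProductSpace ℝ E]
    {x u : E} {h R : ℝ} (hu : ‖u‖ ≤ 1) (h0 : 0 ≤ h) (hx : ‖x‖ ^ 2 ≤ R)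
    (hxu : h ≤ inner ℝ x u) : x ∈ closedBall (h • u) (√(R - h ^ 2)) := by
  rw [mem_closedBall, dist_eq_norm]
  refine Real.le_sqrt_of_sq_le ?_
  rw [@norm_sub_sq ℝ, inner_smul_right, norm_smul, Real.norm_eq_abs, mul_pow, sq_abs]
  have : ‖u‖ ^ 2 ≤ 1 := by nlinarith [norm_nonneg u]
  simp only [RCLike.re_to_real]
  nlinarith [sq_nonneg h]

/-- An upper bound for the uniform measure of a spherical cap. -/
theorem unifSphere_cap_le [Nonempty ι] {u : EuclideanSpace ℝ ι} (hu : ‖u‖ ≤ 1) {h δ : ℝ}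
    (h0 : 0 ≤ h) (h1 : h ≤ 1) (hδ0 : 0 ≤ δ) (hδ1 : δ < 1)
    (hδ : (1 - δ) ^ Fintype.card ι ≤ 1 / 2) :
    unifSphere ι {c | h ≤ inner ℝ (c : EuclideanSpace ℝ ι) u} ≤
      ENNReal.ofReal (2 * (1 - (h * (1 - δ)) ^ 2) ^ ((Fintype.card ι : ℝ) / 2)) := by
  have hA : MeasurableSet {x : EuclideanSpace ℝ ι | h ≤ inner ℝ x u} :=
    measurableSet_le measurable_const (by fun_prop)
  have h2 := volume_mul_unifSphere_le hA hδ1 hδ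
  have hh : (h * (1 - δ)) ^ 2 ≤ 1 := by
    have : h * (1 - δ) ≤ 1 := by nlinarith
    have : 0 ≤ h * (1 - δ) := mul_nonneg h0 (by linarith)
    nlinarith
  have h3 : coneSet {x : EuclideanSpace ℝ ι | h ≤ inner ℝ x u} 1 ∩ {x | 1 - δ ≤ ‖x‖} ⊆
      closedBall ((h * (1 - δ)) • u) (√(1 - (h * (1 - δ)) ^ 2)) := by
    rintro x ⟨⟨hx0, hx1, hx2⟩, hx3⟩
    refine mem_closedBall_of_inner_le hu (mul_nonneg h0 (by linarith)) ?_ ?_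
    · nlinarith [norm_nonneg x]
    · rw [mem_ofPred_eq, inner_smul_left] at hx2
      have hn : 0 < ‖x‖ := norm_pos_iff.2 hx0
      simp only [map_inv₀, conj_trivial] at hx2
      rw [le_inv_mul_iff₀ hn] at hx2
      rw [mem_ofPred_eq] at hx3
      nlinarith
  have h4 := h2.trans (mul_le_mul_right (measure_mono h3) 2)
  rw [volume_closedBall_sqrt_le _ (by linarith)] at h4
  have hV0 : volume (ball (0 : EuclideanSpace ℝ ι) 1) ≠ 0 :=
    (isOpen_ball.measure_pos _ (by simp)).ne'
  have hV1 : volume (ball (0 : EuclideanSpace ℝ ι) 1) ≠ ⊤ := measure_ball_lt_top.ne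
  rw [ENNReal.ofReal_mul (by norm_num), ENNReal.ofReal_ofNat]
  refine (ENNReal.mul_le_mul_iff_right hV0 hV1).1 ?_
  calc _ ≤ _ := h4
    _ = _ := by ring

theorem unifSphere_map_isometry (f : EuclideanSpace ℝ ι ≃ₗᵢ[ℝ] EuclideanSpace ℝ ι)
    [Nonempty ι] {A : Set (EuclideanSpace ℝ ι)} (hA : MeasurableSet A) :
    unifSphere ι {c | f (c : EuclideanSpace ℝ ι) ∈ A} =
      unifSphere ι {c | (c : EuclideanSpace ℝ ι) ∈ A} := by
  have hfA : MeasurableSet (f ⁻¹' A) := f.continuous.measurable hA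
  have h0 : volume (ball (0 : EuclideanSpace ℝ ι) 1) ≠ 0 :=
    (isOpen_ball.measure_pos _ (by simp)).ne'
  have h1 : volume (ball (0 : EuclideanSpace ℝ ι) 1) ≠ ⊤ := measure_ball_lt_top.ne
  refine (ENNReal.mul_right_inj h0 h1).1 ?_
  have e1 := volume_coneSet_one hA
  have e2 := volume_coneSet_one hfA
  have e3 : coneSet (f ⁻¹' A) 1 = f ⁻¹' (coneSet A 1) := by
    ext x; simp [coneSet]
  rw [e3, f.measurePreserving.measure_preimage (measurableSet_coneSet hA 1).nullMeasurableSet] at e2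
  rw [← e1, e2]; rfl

theorem unifSphere_singleton [Nontrivial ι] (x : EuclideanSpace ℝ ι) :
    unifSphere ι {c | (c : EuclideanSpace ℝ ι) = x} = 0 := by
  have h0 : volume (ball (0 : EuclideanSpace ℝ ι) 1) ≠ 0 :=
    (isOpen_ball.measure_pos _ (by simp)).ne'
  have e1 := volume_coneSet_one (measurableSet_singleton x)
  have e2 : volume (coneSet {x} 1) = 0 := by
    refine measure_mono_null (t := ((ℝ ∙ x : Submodule ℝ _) : Set (EuclideanSpace ℝ ι))) ?_ ?_
    · rintro y ⟨h0, -, h2⟩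
      rw [mem_singleton_iff] at h2
      rw [SetLike.mem_coe, Submodule.mem_span_singleton]
      refine ⟨‖y‖, ?_⟩
      rw [← h2, smul_smul, mul_inv_cancel₀ (norm_ne_zero_iff.2 h0), one_smul]
    · refine Measure.addHaar_submodule _ _ fun h => ?_
      have h3 := finrank_span_le_card (R := ℝ) ({x} : Set (EuclideanSpace ℝ ι))
      rw [toFinset_singleton, Finset.card_singleton] at h3
      rw [h, finrank_top, finrank_euclideanSpace] at h3
      have := Fintype.one_lt_card (α := ι)
      omega
  rw [e2] at e1
  exact (mul_eq_zero.1 e1.symm).resolve_left h0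

end Cone

/-! ### Typical points of the ball -/

section Ball

variable {ι : Type} [Fintype ι]

theorem rpow_half_le_exp {s : ℝ} (hs : 0 ≤ 1 - s) (n : ℝ) (hn : 0 ≤ n) :
    (1 - s) ^ (n / 2) ≤ Real.exp (-(n * s / 2)) := by
  calc (1 - s) ^ (n / 2) ≤ Real.exp (-s) ^ (n / 2) := by
        gcongr
        linarith [Real.add_one_le_exp (-s)]
    _ = _ := by rw [← Real.exp_mul]; congr 1; ring

theorem volume_ball_inner_ge [Nonempty ι] {a : EuclideanSpace ℝ ι} (ha : ‖a‖ ≤ 1) {η : ℝ}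
    (h0 : 0 ≤ η) (h1 : η ≤ 1) :
    volume {r ∈ ball (0 : EuclideanSpace ℝ ι) 1 | η ≤ inner ℝ r a} ≤
      ENNReal.ofReal (Real.exp (-(Fintype.card ι * η ^ 2 / 2))) *
        volume (ball (0 : EuclideanSpace ℝ ι) 1) := by
  have hsub : {r ∈ ball (0 : EuclideanSpace ℝ ι) 1 | η ≤ inner ℝ r a} ⊆
      closedBall (η • a) (√(1 - η ^ 2)) := by
    rintro r ⟨hr, hra⟩
    rw [mem_ball_zero_iff] at hr
    exact mem_closedBall_of_inner_le ha h0 (by nlinarith [norm_nonneg r]) hra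
  have hs : 0 ≤ 1 - η ^ 2 := by nlinarith
  refine (measure_mono hsub).trans ?_
  rw [volume_closedBall_sqrt_le _ hs]
  gcongr
  exact rpow_half_le_exp hs _ (by positivity)

theorem volume_closedBall_one_sub_le [Nonempty ι] {η : ℝ} (h1 : η ≤ 1) :
    volume (closedBall (0 : EuclideanSpace ℝ ι) (1 - η)) ≤
      ENNReal.ofReal (Real.exp (-(Fintype.card ι * η))) *
        volume (ball (0 : EuclideanSpace ℝ ι) 1) := by
  rw [Measure.addHaar_closedBall _ _ (by linarith), finrank_euclideanSpace]
  gcongr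
  calc (1 - η) ^ Fintype.card ι ≤ Real.exp (-η) ^ Fintype.card ι := by
        gcongr
        linarith [Real.add_one_le_exp (-η)]
    _ = _ := by rw [← Real.exp_nat_mul]; congr 1; ring

theorem volume_image_diagonal (c : ι → ℝ) (s : Set (EuclideanSpace ℝ ι)) :
    volume ((fun x : EuclideanSpace ℝ ι => WithLp.toLp 2 fun j => c j * x j) '' s) =
      ENNReal.ofReal |∏ j, c j| * volume s := by
  classical
  have h := Measure.addHaar_image_linearMap (volume : Measure (EuclideanSpace ℝ ι))
    (Matrix.toLin (EuclideanSpace.basisFun ι ℝ).toBasis (EuclideanSpace.basisFun ι ℝ).toBasis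
      (Matrix.diagonal c)) s
  rw [LinearMap.det_toLin, Matrix.det_diagonal] at h
  rw [← h]
  congr 1
  refine image_congr fun x _ => ?_
  ext j
  rw [Matrix.toLin_apply]
  simp [Matrix.mulVec_diagonal, Finset.sum_apply, Pi.single_apply]

theorem one_add_le_exp_sub {h : ℝ} (h0 : 0 ≤ h) (h1 : h ≤ 1) :
    1 + h ≤ Real.exp (h - h ^ 2 / 4) := by
  have h2 := Real.quadratic_le_exp_of_nonneg (x := h - h ^ 2 / 4) (by nlinarith)
  have h3 : 0 ≤ h ^ 2 * (1 - h) := by nlinarith [sq_nonneg h]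
  nlinarith [sq_nonneg (h ^ 2)]

theorem volume_ball_block_ge [Nonempty ι] (I : Finset ι) {h : ℝ} (h0 : 0 ≤ h) (h1 : h ≤ 1) :
    volume {r ∈ ball (0 : EuclideanSpace ℝ ι) 1 |
        (1 + h) * I.card / Fintype.card ι ≤ ∑ j ∈ I, r j ^ 2} ≤
      ENNReal.ofReal (Real.exp (-(I.card * h ^ 2 / 8))) *
        volume (ball (0 : EuclideanSpace ℝ ι) 1) := by
  classical
  set n : ℝ := (Fintype.card ι : ℝ) with hn
  set p : ℝ := (I.card : ℝ) with hp
  have hn0 : 0 < n := by rw [hn]; exact_mod_cast Fintype.card_pos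
  have hpn : p + (Iᶜ).card = n := by rw [hp, hn]; exact_mod_cast Finset.card_add_card_compl I
  set q : ℝ := ((Iᶜ).card : ℝ) with hq
  have hp0 : 0 ≤ p := by positivity
  have hq0 : 0 ≤ q := by positivity
  have hsum : ∀ r : EuclideanSpace ℝ ι, ‖r‖ ^ 2 = ∑ j ∈ I, r j ^ 2 + ∑ j ∈ Iᶜ, r j ^ 2 := by
    intro r
    rw [Finset.sum_add_sum_compl, EuclideanSpace.norm_sq_eq]
    simp
  rcases le_or_gt n ((1 + h) * p) with hbig | hsmall
  · have : {r ∈ ball (0 : EuclideanSpace ℝ ι) 1 | (1 + h) * p / n ≤ ∑ j ∈ I, r j ^ 2} = ∅ := by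
      rw [eq_empty_iff_forall_notMem]
      rintro r ⟨hr, hr2⟩
      rw [mem_ball_zero_iff] at hr
      have h3 : 1 ≤ (1 + h) * p / n := by rwa [le_div_iff₀ hn0, one_mul]
      have h4 : 0 ≤ ∑ j ∈ Iᶜ, r j ^ 2 := Finset.sum_nonneg fun _ _ => sq_nonneg _
      nlinarith [hsum r, norm_nonneg r]
    rw [this]; simp
  have hq1 : 0 < q := by nlinarith
  set B : ℝ := 1 - h * p / q with hB
  have hB0 : 0 < B := by
    rw [hB, sub_pos, div_lt_one hq1]; nlinarith
  have hA0 : 0 < 1 + h := by linarith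
  set c : ι → ℝ := fun j => if j ∈ I then √(1 + h) else √B with hc
  have hc2 : ∀ j, c j ^ 2 = if j ∈ I then 1 + h else B := by
    intro j; simp only [hc]; split_ifs
    · exact Real.sq_sqrt hA0.le
    · exact Real.sq_sqrt hB0.le
  have hcpos : ∀ j, 0 < c j := by
    intro j; simp only [hc]; split_ifs
    · exact Real.sqrt_pos.2 hA0
    · exact Real.sqrt_pos.2 hB0
  have hsub : {r ∈ ball (0 : EuclideanSpace ℝ ι) 1 | (1 + h) * p / n ≤ ∑ j ∈ I, r j ^ 2} ⊆
      (fun x : EuclideanSpace ℝ ι => WithLp.toLp 2 fun j => c j * x j) '' closedBall 0 1 := by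
    rintro r ⟨hr, hr2⟩
    rw [mem_ball_zero_iff] at hr
    refine ⟨WithLp.toLp 2 fun j => (c j)⁻¹ * r j, ?_, ?_⟩
    · rw [mem_closedBall_zero_iff, ← sq_le_one_iff₀ (norm_nonneg _), hsum]
      have e1 : ∑ j ∈ I, ((c j)⁻¹ * r j) ^ 2 = (1 + h)⁻¹ * ∑ j ∈ I, r j ^ 2 := by
        rw [Finset.mul_sum]
        refine Finset.sum_congr rfl fun j hj => ?_
        rw [mul_pow, inv_pow, hc2, if_pos hj]
      have e2 : ∑ j ∈ Iᶜ, ((c j)⁻¹ * r j) ^ 2 = B⁻¹ * ∑ j ∈ Iᶜ, r j ^ 2 := by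
        rw [Finset.mul_sum]
        refine Finset.sum_congr rfl fun j hj => ?_
        rw [mul_pow, inv_pow, hc2, if_neg (Finset.mem_compl.1 hj)]
      change ∑ j ∈ I, ((c j)⁻¹ * r j) ^ 2 + ∑ j ∈ Iᶜ, ((c j)⁻¹ * r j) ^ 2 ≤ 1
      rw [e1, e2]
      have h5 : ‖r‖ ^ 2 ≤ 1 := by nlinarith [norm_nonneg r]
      rw [hsum] at h5
      set s := ∑ j ∈ I, r j ^ 2
      set s' := ∑ j ∈ Iᶜ, r j ^ 2
      have hBn : B * q = q - h * p := by rw [hB]; field_simp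
      rw [div_le_iff₀ hn0] at hr2
      have h6 : (1 + h)⁻¹ * s + B⁻¹ * s' = (B * s + (1 + h) * s') / ((1 + h) * B) := by
        field_simp
      rw [h6, div_le_one (by positivity)]
      refine le_of_mul_le_mul_right ?_ hq1
      have h7 : (B * s + (1 + h) * s') * q = (q - h * p) * s + (1 + h) * q * s' := by
        rw [← hBn]; ring
      have h8 : (1 + h) * B * q = (1 + h) * (q - h * p) := by rw [← hBn]; ring
      rw [h7, h8]
      have h9 : (1 + h) * q * s' ≤ (1 + h) * q * (1 - s) := by
        gcongr; linarith
      have h10 : 0 ≤ h * (s * n - (1 + h) * p) := mul_nonneg h0 (by linarith)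
      rw [← hpn] at h10
      nlinarith
    · ext j
      simp [(hcpos j).ne']
  have hprod : ∏ j, c j = √(1 + h) ^ I.card * √B ^ (Iᶜ).card := by
    rw [← Finset.prod_mul_prod_compl I]
    congr 1
    · rw [← Finset.prod_const]; exact Finset.prod_congr rfl fun j hj => if_pos hj
    · rw [← Finset.prod_const]
      exact Finset.prod_congr rfl fun j hj => if_neg (Finset.mem_compl.1 hj)
  have hprod0 : 0 ≤ ∏ j, c j := Finset.prod_nonneg fun j _ => (hcpos j).le
  have hle1 : √(1 + h) ^ I.card ≤ Real.exp (p * (h - h ^ 2 / 4) / 2) := by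
    calc √(1 + h) ^ I.card ≤ (Real.exp ((h - h ^ 2 / 4) / 2)) ^ I.card := by
          gcongr
          rw [Real.exp_half]
          exact Real.sqrt_le_sqrt (one_add_le_exp_sub h0 h1)
      _ = _ := by rw [← Real.exp_nat_mul]; congr 1; rw [hp]; ring
  have hle2 : √B ^ (Iᶜ).card ≤ Real.exp (-(h * p / 2)) := by
    calc √B ^ (Iᶜ).card ≤ (Real.exp (-(h * p / q) / 2)) ^ (Iᶜ).card := by
          gcongr
          rw [Real.exp_half]
          refine Real.sqrt_le_sqrt ?_
          rw [hB]; linarith [Real.add_one_le_exp (-(h * p / q))]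
      _ = _ := by
          rw [← Real.exp_nat_mul]; congr 1; rw [← hq]; field_simp
  refine (measure_mono hsub).trans ?_
  rw [volume_image_diagonal, abs_of_nonneg hprod0, hprod, Measure.addHaar_closedBall_eq_addHaar_ball]
  gcongr
  calc _ ≤ Real.exp (p * (h - h ^ 2 / 4) / 2) * Real.exp (-(h * p / 2)) := by gcongr
    _ = _ := by rw [← Real.exp_add]; congr 1; ring

/-- The points of the unit ball close to the sphere, nearly orthogonal to the vectors `a k`, and
without much more than the expected squared norm on the coordinate sets `I i`. -/
def typicalSet {K β : Type*} (a : K → EuclideanSpace ℝ ι) (I : β → Finset ι) (η h : ℝ) :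
    Set (EuclideanSpace ℝ ι) :=
  {r | ‖r‖ < 1 ∧ 1 - η < ‖r‖ ∧ (∀ k, |inner ℝ r (a k)| < η) ∧
    ∀ i, ∑ j ∈ I i, r j ^ 2 < (1 + h) * (I i).card / Fintype.card ι}

theorem volume_ball_le_two_mul_typicalSet [Nonempty ι] {K β : Type*} [Fintype K] [Fintype β]
    {a : K → EuclideanSpace ℝ ι} (ha : ∀ k, ‖a k‖ ≤ 1) (I : β → Finset ι) {η h τ : ℝ}
    (hη0 : 0 ≤ η) (hη1 : η ≤ 1) (h0 : 0 ≤ h) (h1 : h ≤ 1)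
    (hτ1 : Real.exp (-(Fintype.card ι * η ^ 2 / 2)) ≤ τ)
    (hτ2 : ∀ i, Real.exp (-((I i).card * h ^ 2 / 8)) ≤ τ)
    (hτ : (1 + 2 * Fintype.card K + Fintype.card β) * τ ≤ 1 / 2) :
    volume (ball (0 : EuclideanSpace ℝ ι) 1) ≤ 2 * volume (typicalSet a I η h) := by
  set V := volume (ball (0 : EuclideanSpace ℝ ι) 1) with hV
  have hτ0 : 0 ≤ τ := (Real.exp_pos _).le.trans hτ1
  have hVt : V ≠ ⊤ := measure_ball_lt_top.ne
  have hsub : ball (0 : EuclideanSpace ℝ ι) 1 ⊆ typicalSet a I η h ∪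
      (closedBall (0 : EuclideanSpace ℝ ι) (1 - η) ∪
      ((⋃ k, {r ∈ ball (0 : EuclideanSpace ℝ ι) 1 | η ≤ inner ℝ r (a k)}) ∪
      ((⋃ k, {r ∈ ball (0 : EuclideanSpace ℝ ι) 1 | η ≤ inner ℝ r (-a k)}) ∪
      ⋃ i, {r ∈ ball (0 : EuclideanSpace ℝ ι) 1 |
        (1 + h) * (I i).card / Fintype.card ι ≤ ∑ j ∈ I i, r j ^ 2}))) := by
    intro r hr
    by_contra hcon
    simp only [mem_union, mem_iUnion, not_or, not_exists] at hcon
    obtain ⟨c1, c2, c3, c4, c5⟩ := hcon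
    refine c1 ⟨by simpa using hr, ?_, ?_, ?_⟩
    · simpa using c2
    · intro k
      rw [abs_lt]
      constructor
      · by_contra hk
        exact c4 k ⟨hr, by rw [inner_neg_right]; linarith⟩
      · by_contra hk
        exact c3 k ⟨hr, by linarith⟩
    · intro i
      by_contra hk
      exact c5 i ⟨hr, not_lt.1 hk⟩
  have hb1 : volume (closedBall (0 : EuclideanSpace ℝ ι) (1 - η)) ≤ ENNReal.ofReal τ * V := by
    refine (volume_closedBall_one_sub_le hη1).trans ?_
    gcongr
    refine le_trans ?_ hτ1
    gcongr
    have : η ^ 2 / 2 ≤ η := by nlinarith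
    calc (Fintype.card ι : ℝ) * η ^ 2 / 2 = Fintype.card ι * (η ^ 2 / 2) := by ring
      _ ≤ _ := by gcongr
  have hb2 : ∀ k, volume {r ∈ ball (0 : EuclideanSpace ℝ ι) 1 | η ≤ inner ℝ r (a k)} ≤
      ENNReal.ofReal τ * V := fun k =>
    (volume_ball_inner_ge (ha k) hη0 hη1).trans (by gcongr)
  have hb3 : ∀ k, volume {r ∈ ball (0 : EuclideanSpace ℝ ι) 1 | η ≤ inner ℝ r (-a k)} ≤
      ENNReal.ofReal τ * V := fun k =>
    (volume_ball_inner_ge (by rw [norm_neg]; exact ha k) hη0 hη1).trans (by gcongr)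
  have hb4 : ∀ i, volume {r ∈ ball (0 : EuclideanSpace ℝ ι) 1 |
        (1 + h) * (I i).card / Fintype.card ι ≤ ∑ j ∈ I i, r j ^ 2} ≤ ENNReal.ofReal τ * V :=
    fun i => (volume_ball_block_ge (I i) h0 h1).trans (by gcongr; exact hτ2 i)
  have hU : ∀ {J : Type _} [Fintype J] (s : J → Set (EuclideanSpace ℝ ι)),
      (∀ j, volume (s j) ≤ ENNReal.ofReal τ * V) →
      volume (⋃ j, s j) ≤ Fintype.card J * (ENNReal.ofReal τ * V) := by
    intro J _ s hs
    refine (measure_iUnion_fintype_le _ _).trans ?_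
    refine (Finset.sum_le_sum fun j _ => hs j).trans ?_
    simp
  have hU' : ∀ {J : Type _} [Fintype J] (s : J → Set (EuclideanSpace ℝ ι)),
      (∀ j, volume (s j) ≤ ENNReal.ofReal τ * V) →
      volume (⋃ j, s j) ≤ Fintype.card J * (ENNReal.ofReal τ * V) := by
    intro J _ s hs
    refine (measure_iUnion_fintype_le _ _).trans ?_
    refine (Finset.sum_le_sum fun j _ => hs j).trans ?_
    simp
  have hbound : V ≤ volume (typicalSet a I η h) + V / 2 := by
    calc V ≤ volume (typicalSet a I η h) + (ENNReal.ofReal τ * V +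
          (Fintype.card K * (ENNReal.ofReal τ * V) + (Fintype.card K * (ENNReal.ofReal τ * V) +
            Fintype.card β * (ENNReal.ofReal τ * V)))) := by
          refine (measure_mono hsub).trans ?_
          refine (measure_union_le _ _).trans (add_le_add le_rfl ?_)
          refine (measure_union_le _ _).trans (add_le_add hb1 ?_)
          refine (measure_union_le _ _).trans (add_le_add (hU _ hb2) ?_)
          exact (measure_union_le _ _).trans (add_le_add (hU _ hb3) (hU' _ hb4))
      _ = volume (typicalSet a I η h) +
          ENNReal.ofReal ((1 + 2 * Fintype.card K + Fintype.card β) * τ) * V := by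
          rw [ENNReal.ofReal_mul (by positivity), ENNReal.ofReal_add (by positivity)
            (by positivity), ENNReal.ofReal_add (by positivity) (by positivity),
            ENNReal.ofReal_mul (by positivity)]
          simp only [ENNReal.ofReal_one, ENNReal.ofReal_ofNat, ENNReal.ofReal_natCast]
          ring
      _ ≤ _ := by
          gcongr
          rw [ENNReal.div_eq_inv_mul]
          gcongr
          refine (ENNReal.ofReal_le_ofReal hτ).trans ?_
          rw [one_div, ENNReal.ofReal_inv_of_pos (by norm_num)]
          simp
  have h4 : V / 2 + V / 2 ≤ volume (typicalSet a I η h) + V / 2 := by rwa [ENNReal.add_halves]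
  have h5 := (ENNReal.add_le_add_iff_right (ENNReal.div_ne_top hVt (by norm_num))).1 h4
  rw [ENNReal.div_le_iff (by norm_num) (by norm_num)] at h5
  rwa [mul_comm 2]

end Ball

/-! ### Caps and wedges: explicit bounds -/

section Explicit

theorem abs_norm_affine_sub_one_le {E : Type*} [NormedAddCommGroup E] [InnerProductSpace ℝ E]
    {t r : E} {ρ η : ℝ} (htρ : ‖t‖ ^ 2 + ρ ^ 2 = 1) (hρ : 0 ≤ ρ) (hη : 0 ≤ η)
    (hr1 : ‖r‖ < 1) (hr2 : 1 - η < ‖r‖) (hrt : |inner ℝ r t| ≤ η) : |‖t + ρ • r‖ - 1| ≤ 4 * η := by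
  have h1 : ‖t + ρ • r‖ ^ 2 = 1 + 2 * ρ * inner ℝ r t - ρ ^ 2 * (1 - ‖r‖ ^ 2) := by
    rw [@norm_add_sq ℝ, norm_smul, inner_smul_right, real_inner_comm, Real.norm_eq_abs, mul_pow,
      sq_abs]
    simp only [RCLike.re_to_real]
    linear_combination htρ
  have hρ1 : ρ ^ 2 ≤ 1 := by nlinarith [sq_nonneg ‖t‖]
  have hρ1' : ρ ≤ 1 := by nlinarith
  have h2 : 0 ≤ 1 - ‖r‖ ^ 2 := by nlinarith [norm_nonneg r]
  have h3 : 1 - ‖r‖ ^ 2 ≤ 2 * η := by nlinarith [norm_nonneg r]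
  have h4 : |ρ * inner ℝ r t| ≤ η := by
    rw [abs_mul, abs_of_nonneg hρ]
    calc ρ * |inner ℝ r t| ≤ 1 * η := by gcongr
      _ = η := one_mul _
  rw [abs_le] at h4
  have h5 : ρ ^ 2 * (1 - ‖r‖ ^ 2) ≤ 2 * η := by nlinarith [sq_nonneg ρ]
  have h6 : 0 ≤ ρ ^ 2 * (1 - ‖r‖ ^ 2) := by positivity
  have hn := norm_nonneg (t + ρ • r)
  rw [abs_le]
  constructor
  · by_contra hcon
    push Not at hcon
    nlinarith
  · by_contra hcon
    push Not at hcon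
    nlinarith

theorem abs_inv_mul_sub_le {s y M η : ℝ} (hη : 0 ≤ η) (hη8 : η ≤ 1 / 8) (hs : |s - 1| ≤ 4 * η)
    (hy : |y| ≤ M) : |s⁻¹ * y - y| ≤ 8 * η * M := by
  rw [abs_le] at hs
  have hs0 : 1 / 2 ≤ s := by linarith
  have h1 : s⁻¹ * y - y = s⁻¹ * (1 - s) * y := by field_simp
  have h2 : s⁻¹ ≤ 2 := by
    rw [inv_le_comm₀ (by linarith) (by norm_num)]; linarith
  have h3 : |1 - s| ≤ 4 * η := by rw [abs_le]; constructor <;> linarith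
  rw [h1, abs_mul, abs_mul, abs_of_pos (inv_pos.2 (by linarith : (0:ℝ) < s))]
  calc s⁻¹ * |1 - s| * |y| ≤ 2 * (4 * η) * M := by gcongr
    _ = _ := by ring

variable {ι : Type} [Fintype ι]

theorem unifSphere_ge_of_typicalSet [Nonempty ι] {K β : Type*}
    {a : K → EuclideanSpace ℝ ι} {I : β → Finset ι} {η h ρ : ℝ} {t : EuclideanSpace ℝ ι}
    {A : Set (EuclideanSpace ℝ ι)} (hA : MeasurableSet A)
    (hvol : volume (ball (0 : EuclideanSpace ℝ ι) 1) ≤ 2 * volume (typicalSet a I η h))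
    (hη : 0 < η) (hη8 : η ≤ 1 / 8) (htρ : ‖t‖ ^ 2 + ρ ^ 2 = 1) (hρ : 0 ≤ ρ)
    (ht : ∀ r ∈ typicalSet a I η h, |inner ℝ r t| ≤ η)
    (hz : ∀ r ∈ typicalSet a I η h, |‖t + ρ • r‖ - 1| ≤ 4 * η →
      ‖t + ρ • r‖⁻¹ • (t + ρ • r) ∈ A) :
    ENNReal.ofReal ((ρ / (1 + 5 * η)) ^ Fintype.card ι / 2) ≤
      unifSphere ι {c | (c : EuclideanSpace ℝ ι) ∈ A} := by
  refine unifSphere_ge_of_affine hA t hρ (by linarith) hvol fun r hr => ?_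
  have h1 := abs_norm_affine_sub_one_le htρ hρ hη.le hr.1 hr.2.1 (ht r hr)
  have h2 := hz r hr h1
  rw [abs_le] at h1
  refine ⟨?_, by linarith, h2⟩
  rw [← norm_pos_iff]
  linarith

theorem unifSphere_band_ge [Nonempty ι] {c : EuclideanSpace ℝ ι} (hc : ‖c‖ = 1) {a e η : ℝ}
    (ha0 : 0 ≤ a) (ha1 : a ≤ 1) (hη : 0 < η) (hη8 : η ≤ 1 / 8) (he : 20 * η ≤ e)
    (hn : Real.exp (-(Fintype.card ι * η ^ 2 / 2)) ≤ 1 / 6) :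
    ENNReal.ofReal ((√(1 - a ^ 2) / (1 + 5 * η)) ^ Fintype.card ι / 2) ≤
      unifSphere ι {x | |inner ℝ (x : EuclideanSpace ℝ ι) c - a| ≤ e} := by
  have hA : MeasurableSet {x : EuclideanSpace ℝ ι | |inner ℝ x c - a| ≤ e} :=
    measurableSet_le (by fun_prop) measurable_const
  have ha2 : 0 ≤ 1 - a ^ 2 := by nlinarith
  have hvol := volume_ball_le_two_mul_typicalSet (a := fun _ : Unit => c) (fun _ => hc.le)
    (I := (Empty.elim : Empty → Finset ι)) (h := 0) hη.le (by linarith) le_rfl (by norm_num) hn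
    (fun i => i.elim) (by norm_num)
  refine unifSphere_ge_of_typicalSet (t := a • c) hA hvol hη hη8 ?_ (Real.sqrt_nonneg _) ?_ ?_
  · rw [norm_smul, hc, Real.sq_sqrt ha2, mul_one, Real.norm_eq_abs, sq_abs]; ring
  · intro r hr
    rw [inner_smul_right, abs_mul, abs_of_nonneg ha0]
    have := hr.2.2.1 ()
    calc a * |inner ℝ r c| ≤ 1 * η := by gcongr
      _ = η := one_mul _
  · intro r hr hx
    rw [mem_ofPred_eq, inner_smul_left]
    simp only [map_inv₀, conj_trivial]
    have h1 : inner ℝ (a • c + √(1 - a ^ 2) • r) c = a + √(1 - a ^ 2) * inner ℝ r c := by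
      rw [inner_add_left, inner_smul_left, inner_smul_left, real_inner_self_eq_norm_sq, hc]
      simp
    have hr1 := hr.2.2.1 ()
    have h2 : |√(1 - a ^ 2) * inner ℝ r c| ≤ η := by
      rw [abs_mul, abs_of_nonneg (Real.sqrt_nonneg _)]
      have : √(1 - a ^ 2) ≤ 1 := by rw [Real.sqrt_le_one]; nlinarith
      calc √(1 - a ^ 2) * |inner ℝ r c| ≤ 1 * η := by gcongr
        _ = η := one_mul _
    have h3 : |inner ℝ (a • c + √(1 - a ^ 2) • r) c| ≤ 2 := by
      rw [h1, abs_le]; rw [abs_le] at h2; constructor <;> linarith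
    have h4 := abs_inv_mul_sub_le hη.le hη8 hx h3
    rw [h1] at h4 ⊢
    rw [abs_le] at h2 h4 ⊢
    constructor <;> linarith

/-- The squared norm of the shortest vector with inner products `a` and `g` with two unit vectors
whose inner product is `a`. -/
def gramG (a g : ℝ) : ℝ := (g ^ 2 + a ^ 2 - 2 * a ^ 2 * g) / (1 - a ^ 2)

/-- Quantitative admissibility of the cosines `a = cos α` and `g = cos θ`. -/
structure Adm (k a g : ℝ) : Prop where
  pos : 0 < k
  a_ge : k ≤ a
  a_le : a ≤ 1 - k
  g_ge : k ≤ g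
  g_le : g ≤ 1 - k
  corner : a ^ 2 ≤ g
  det : k ≤ 1 - 2 * a ^ 2 - g ^ 2 + 2 * a ^ 2 * g

namespace Adm

variable {k a g : ℝ} (h : Adm k a g)
include h

theorem one_sub_sq_pos : k ≤ 1 - a ^ 2 := by
  nlinarith [h.pos, h.a_ge, h.a_le]

theorem one_sub_gramG : 1 - gramG a g = (1 - 2 * a ^ 2 - g ^ 2 + 2 * a ^ 2 * g) / (1 - a ^ 2) := by
  have := h.one_sub_sq_pos
  have h1 : 1 - a ^ 2 ≠ 0 := by linarith [h.pos]
  rw [gramG]; field_simp; ring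

theorem le_one_sub_gramG : k ≤ 1 - gramG a g := by
  have h1 := h.one_sub_sq_pos
  have h0 := h.pos
  rw [h.one_sub_gramG, le_div_iff₀ (by linarith)]
  nlinarith [h.det, sq_nonneg a]

theorem sq_le_gramG : k ^ 2 ≤ gramG a g := by
  have h1 := h.one_sub_sq_pos
  have h0 := h.pos
  have h2 : a ^ 2 ≤ gramG a g := by
    rw [gramG, le_div_iff₀ (by linarith)]
    nlinarith [sq_nonneg (g - a ^ 2)]
  nlinarith [h.a_ge]

end Adm

theorem unifSphere_wedge_le [Nonempty ι] {x c : EuclideanSpace ℝ ι} (hx : ‖x‖ = 1) (hc : ‖c‖ = 1)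
    {k a g e : ℝ} (hA : Adm k a g) (he0 : 0 < e) (he : 16 * e ≤ k ^ 2)
    (hn : (1 - e) ^ Fintype.card ι ≤ 1 / 2) (hxc : |inner ℝ x c - a| ≤ e) :
    unifSphere ι {y | g - e ≤ inner ℝ x (y : EuclideanSpace ℝ ι) ∧
        a - e ≤ inner ℝ (y : EuclideanSpace ℝ ι) c} ≤
      ENNReal.ofReal (2 * (1 - gramG a g + 8 * e) ^ ((Fintype.card ι : ℝ) / 2)) := by
  have h1 := hA.one_sub_sq_pos
  have hk := hA.pos
  have ha := hA.a_ge
  have hg := hA.g_ge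
  have hcor := hA.corner
  have hg1 := hA.g_le
  have hGk := hA.sq_le_gramG
  have hG1 := hA.le_one_sub_gramG
  have ha2 : 0 < 1 - a ^ 2 := by linarith
  have hk1 : k ≤ 1 := by nlinarith
  obtain ⟨G, hG⟩ : ∃ G, gramG a g = G := ⟨_, rfl⟩
  rw [hG] at hGk hG1 ⊢
  obtain ⟨l, hl⟩ : ∃ l, l = (g - a ^ 2) / (1 - a ^ 2) := ⟨_, rfl⟩
  obtain ⟨μ, hμ⟩ : ∃ μ, μ = a * (1 - g) / (1 - a ^ 2) := ⟨_, rfl⟩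
  have hl0 : 0 ≤ l := by rw [hl]; exact div_nonneg (by linarith) ha2.le
  have hl1 : l ≤ 1 := by rw [hl, div_le_one ha2]; linarith
  have hμ0 : 0 ≤ μ := by
    rw [hμ]; exact div_nonneg (mul_nonneg (by linarith) (by linarith)) ha2.le
  have hμ1 : μ ≤ 1 := by rw [hμ, div_le_one ha2]; nlinarith
  have e1 : l * g + μ * a = G := by rw [hl, hμ, ← hG, gramG]; field_simp; ring
  have e2 : l ^ 2 + μ ^ 2 + 2 * l * μ * a = G := by rw [hl, hμ, ← hG, gramG]; field_simp; ring
  obtain ⟨t, ht⟩ : ∃ t, t = l • x + μ • c := ⟨_, rfl⟩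
  have htn : ‖t‖ ^ 2 = l ^ 2 + μ ^ 2 + 2 * l * μ * inner ℝ x c := by
    rw [ht, @norm_add_sq ℝ, norm_smul, norm_smul, hx, hc, inner_smul_left, inner_smul_right]
    simp only [RCLike.re_to_real, conj_trivial, mul_one, Real.norm_eq_abs, sq_abs]
    ring
  rw [abs_le] at hxc
  have hlμ : l * μ ≤ 1 := mul_le_one₀ hl1 hμ0 hμ1
  have hlμ0 : 0 ≤ l * μ := mul_nonneg hl0 hμ0
  have hlμs : |l * μ * (inner ℝ x c - a)| ≤ e := by
    rw [abs_mul, abs_of_nonneg hlμ0]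
    calc l * μ * |inner ℝ x c - a| ≤ 1 * e := by gcongr; rw [abs_le]; exact hxc
      _ = e := one_mul _
  rw [abs_le] at hlμs
  have htn1 : ‖t‖ ^ 2 ≤ G + 2 * e := by
    rw [htn]; linarith
  have htn0 : G - 2 * e ≤ ‖t‖ ^ 2 := by
    rw [htn]; linarith
  have hG6 : 0 < G - 6 * e := by linarith
  have hG0 : 0 < G - 2 * e := by linarith
  have he1 : e ≤ 1 / 16 := by linarith [pow_le_one₀ (n := 2) hk.le hk1]
  have htpos : 0 < ‖t‖ := by
    by_contra hcon
    have : ‖t‖ = 0 := le_antisymm (not_lt.1 hcon) (norm_nonneg _)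
    rw [this] at htn0
    norm_num at htn0
    linarith
  have htsq : (G - 2 * e) ^ 2 ≤ ‖t‖ ^ 2 := by
    have : (G - 2 * e) ^ 2 ≤ G - 2 * e := by
      rw [sq]; exact mul_le_of_le_one_left hG0.le (by linarith)
    linarith
  set h : ℝ := (G - 2 * e) / ‖t‖ with hh
  have hh0 : 0 ≤ h := div_nonneg hG0.le htpos.le
  have hh1 : h ≤ 1 := by
    rw [hh, div_le_one htpos]
    exact le_of_sq_le_sq htsq htpos.le
  have hcap := unifSphere_cap_le (u := ‖t‖⁻¹ • t) (by rw [norm_smul]; simp [htpos.ne'])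
    hh0 hh1 he0.le (by linarith) hn
  refine (measure_mono ?_).trans (hcap.trans (ENNReal.ofReal_le_ofReal ?_))
  · rintro y ⟨hy1, hy2⟩
    rw [mem_ofPred_eq, inner_smul_right, hh, div_eq_inv_mul]
    refine mul_le_mul_of_nonneg_left ?_ (inv_nonneg.2 htpos.le)
    rw [ht, inner_add_right, inner_smul_right, inner_smul_right]
    have hy1' : g - e ≤ inner ℝ (y : EuclideanSpace ℝ ι) x := by rwa [real_inner_comm]
    have q1 : l * (g - e) ≤ l * inner ℝ (y : EuclideanSpace ℝ ι) x :=
      mul_le_mul_of_nonneg_left hy1' hl0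
    have q2 : μ * (a - e) ≤ μ * inner ℝ (y : EuclideanSpace ℝ ι) c :=
      mul_le_mul_of_nonneg_left hy2 hμ0
    have q3 : l * e ≤ e := mul_le_of_le_one_left he0.le hl1
    have q4 : μ * e ≤ e := mul_le_of_le_one_left he0.le hμ1
    linarith
  · have hh2 : G - 6 * e ≤ h ^ 2 := by
      rw [hh, div_pow, le_div_iff₀ (by positivity)]
      have : (G - 6 * e) * ‖t‖ ^ 2 ≤ (G - 6 * e) * (G + 2 * e) := by
        gcongr
      linarith [sq_nonneg e]
    have hh3 : G - 8 * e ≤ (h * (1 - e)) ^ 2 := by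
      rw [mul_pow]
      have q1 : 1 - 2 * e ≤ (1 - e) ^ 2 := by linarith [sq_nonneg e]
      have q2 : h ^ 2 ≤ 1 := pow_le_one₀ hh0 hh1
      have q3 : h ^ 2 * e ≤ e := mul_le_of_le_one_left he0.le q2
      linarith [mul_le_mul_of_nonneg_left q1 (sq_nonneg h)]
    gcongr
    · have q1 : 0 ≤ h * (1 - e) := mul_nonneg hh0 (by linarith)
      have q2 : h * (1 - e) ≤ 1 := mul_le_one₀ hh1 (by linarith) (by linarith)
      linarith [pow_le_one₀ (n := 2) q1 q2]
    · linarith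

theorem unifSphere_wedge_ge [Nonempty ι] {x c : EuclideanSpace ℝ ι} (hx : ‖x‖ = 1) (hc : ‖c‖ = 1)
    {k a g β η : ℝ} (hA : Adm k a g) (hβ : 12 * β ≤ k) (hη : 0 < η) (hη8 : η ≤ 1 / 8)
    (hηβ : 20 * η ≤ β * k)
    (hn : Real.exp (-(Fintype.card ι * η ^ 2 / 2)) ≤ 1 / 14) (hxc : inner ℝ x c = a) :
    ENNReal.ofReal ((√(1 - gramG a g - 3 * β) / (1 + 5 * η)) ^ Fintype.card ι / 2) ≤
    unifSphere ι {y | g ≤ inner ℝ x (y : EuclideanSpace ℝ ι) ∧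
        a ≤ inner ℝ c (y : EuclideanSpace ℝ ι)} := by
  have hmeas : MeasurableSet {y : EuclideanSpace ℝ ι | g ≤ inner ℝ x y ∧ a ≤ inner ℝ c y} := by
    have m1 : MeasurableSet {y : EuclideanSpace ℝ ι | g ≤ inner ℝ x y} :=
      measurableSet_le measurable_const (by fun_prop)
    have m2 : MeasurableSet {y : EuclideanSpace ℝ ι | a ≤ inner ℝ c y} :=
      measurableSet_le measurable_const (by fun_prop)
    exact m1.inter m2
  have h1 := hA.one_sub_sq_pos
  have hk := hA.pos
  have ha := hA.a_ge
  have hg := hA.g_ge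
  have hg1 := hA.g_le
  have ha1 := hA.a_le
  have hGk := hA.sq_le_gramG
  have hG1 := hA.le_one_sub_gramG
  have ha2 : 0 < 1 - a ^ 2 := by linarith
  have hk1 : k ≤ 1 := by nlinarith
  have hβ0 : 0 < β := by
    by_contra hcon
    push Not at hcon
    nlinarith
  obtain ⟨G, hG⟩ : ∃ G, gramG a g = G := ⟨_, rfl⟩
  rw [hG] at hGk hG1 ⊢
  have hcor := hA.corner
  obtain ⟨l, hl⟩ : ∃ l, l = (g - a ^ 2) / (1 - a ^ 2) := ⟨_, rfl⟩
  obtain ⟨μ, hμ⟩ : ∃ μ, μ = a * (1 - g) / (1 - a ^ 2) := ⟨_, rfl⟩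
  have hl0 : 0 ≤ l := by rw [hl]; exact div_nonneg (by linarith) ha2.le
  have hl1 : l ≤ 1 := by rw [hl, div_le_one ha2]; linarith
  have hμ0 : 0 ≤ μ := by
    rw [hμ]; exact div_nonneg (mul_nonneg (by linarith) (by linarith)) ha2.le
  have hμ1 : μ ≤ 1 := by rw [hμ, div_le_one ha2]; nlinarith
  have e1 : l + μ * a = g := by rw [hl, hμ]; field_simp; ring
  have e2 : l * a + μ = a := by rw [hl, hμ]; field_simp; ring
  have e3 : l ^ 2 + μ ^ 2 + 2 * l * μ * a = G := by rw [hl, hμ, ← hG, gramG]; field_simp; ring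
  have hG0 : G ≤ 1 := by linarith
  obtain ⟨t, ht⟩ : ∃ t, t = (1 + β) • (l • x + μ • c) := ⟨_, rfl⟩
  have htn : ‖t‖ ^ 2 = (1 + β) ^ 2 * G := by
    rw [ht, norm_smul, mul_pow, @norm_add_sq ℝ _ _ _ _ (l • x) (μ • c), norm_smul, norm_smul, hx,
      hc, inner_smul_left, inner_smul_right, hxc, ← e3]
    simp only [RCLike.re_to_real, conj_trivial, mul_one, Real.norm_eq_abs, sq_abs]
    ring
  have hG00 : 0 ≤ G := (sq_nonneg k).trans hGk
  have hβ1 : β ≤ 1 / 12 := by linarith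
  have hbb : (1 + β) ^ 2 * G ≤ G + 3 * β := by
    have p1 : β * G ≤ β := mul_le_of_le_one_right hβ0.le hG0
    have p2 : β * (β * G) ≤ 1 * β := by gcongr; linarith
    linarith
  have hρ2 : 0 ≤ 1 - (1 + β) ^ 2 * G := by linarith
  obtain ⟨ρ, hρ⟩ : ∃ ρ, ρ = √(1 - (1 + β) ^ 2 * G) := ⟨_, rfl⟩
  have hρ0 : 0 ≤ ρ := by rw [hρ]; exact Real.sqrt_nonneg _
  have hρ1 : ρ ≤ 1 := by
    rw [hρ, Real.sqrt_le_one]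
    linarith [mul_nonneg (sq_nonneg (1 + β)) hG00]
  have hρsq : ρ ^ 2 = 1 - (1 + β) ^ 2 * G := by rw [hρ, Real.sq_sqrt hρ2]
  have htle : ‖t‖ ≤ 1 := by rw [← sq_le_one_iff₀ (norm_nonneg _), htn]; linarith
  obtain ⟨av, hav⟩ : ∃ av : Fin 3 → EuclideanSpace ℝ ι, av = ![x, c, t] := ⟨_, rfl⟩
  have hvol := volume_ball_le_two_mul_typicalSet (a := av) (by
      intro i; rw [hav]; fin_cases i <;> simp [hx, hc, htle])
    (I := (Empty.elim : Empty → Finset ι)) (h := 0) hη.le (by linarith) le_rfl (by norm_num) hn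
    (fun i => i.elim) (by norm_num)
  have hmono : ENNReal.ofReal ((√(1 - G - 3 * β) / (1 + 5 * η)) ^ Fintype.card ι / 2) ≤
      ENNReal.ofReal ((ρ / (1 + 5 * η)) ^ Fintype.card ι / 2) := by
    gcongr
    rw [hρ]
    exact Real.sqrt_le_sqrt (by linarith)
  refine hmono.trans (unifSphere_ge_of_typicalSet (t := t) hmeas hvol hη hη8 ?_ hρ0 ?_ ?_)
  · rw [htn, hρsq]; ring
  · intro r hr
    have := hr.2.2.1 2
    simp only [hav, Matrix.cons_val] at this
    exact this.le
  · intro r hr hxx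
    have r0 := hr.2.2.1 0
    have r1 := hr.2.2.1 1
    simp only [hav, Matrix.cons_val] at r0 r1
    have key : ∀ v : EuclideanSpace ℝ ι, ∀ q : ℝ, k ≤ q → q ≤ 1 → inner ℝ t v = (1 + β) * q →
        |inner ℝ r v| < η → q ≤ inner ℝ v (‖t + ρ • r‖⁻¹ • (t + ρ • r)) := by
      intro v q hq hq1 htv hrv
      rw [inner_smul_right, real_inner_comm, inner_add_left, inner_smul_left, htv, conj_trivial]
      have p1 : |ρ * inner ℝ r v| ≤ η := by
        rw [abs_mul, abs_of_nonneg hρ0]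
        calc ρ * |inner ℝ r v| ≤ 1 * η := by gcongr
          _ = η := one_mul _
      rw [abs_le] at p1
      have p2 : |(1 + β) * q + ρ * inner ℝ r v| ≤ 2 := by
        have p4 : β * q ≤ β * 1 := by gcongr
        have p5 : 0 ≤ β * q := mul_nonneg hβ0.le (by linarith)
        rw [abs_le]; constructor <;> linarith
      have p3 := abs_inv_mul_sub_le hη.le hη8 hxx p2
      rw [abs_le] at p3
      have p4 : β * k ≤ β * q := by gcongr
      linarith
    constructor
    · refine key x g hg (by linarith) ?_ r0
      rw [ht, inner_smul_left, inner_add_left, inner_smul_left, inner_smul_left,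
        real_inner_self_eq_norm_sq, hx, real_inner_comm, hxc]
      simp only [conj_trivial]
      linear_combination (1 + β) * e1
    · refine key c a ha (by linarith) ?_ r1
      rw [ht, inner_smul_left, inner_add_left, inner_smul_left, inner_smul_left,
        real_inner_self_eq_norm_sq, hc, hxc]
      simp only [conj_trivial]
      linear_combination (1 + β) * e2

end Explicit

/-! ### Pairs of points near a common center, and their direction -/

section Pair

variable {ι : Type} [Fintype ι]

/-- The part of a cone in the shell between the radii `1 - δ` and `1`. -/
def shellSet (A : Set (EuclideanSpace ℝ ι)) (δ : ℝ) : Set (EuclideanSpace ℝ ι) :=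
  coneSet A 1 ∩ {x | 1 - δ ≤ ‖x‖}

theorem volume_sq_mul_unifSphere_prod_le [Nonempty ι]
    {A : Set (EuclideanSpace ℝ ι × EuclideanSpace ℝ ι)} (hA : MeasurableSet A) {δ : ℝ}
    (hδ1 : δ < 1) (hδ : (1 - δ) ^ Fintype.card ι ≤ 1 / 2) :
    volume (ball (0 : EuclideanSpace ℝ ι) 1) * (volume (ball (0 : EuclideanSpace ℝ ι) 1) *
      ((unifSphere ι).prod (unifSphere ι))
        {p | ((p.1 : EuclideanSpace ℝ ι), (p.2 : EuclideanSpace ℝ ι)) ∈ A}) ≤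
      4 * ((volume : Measure (EuclideanSpace ℝ ι)).prod volume)
        {p | p.1 ∈ shellSet univ δ ∧ p.2 ∈ shellSet univ δ ∧
          (‖p.1‖⁻¹ • p.1, ‖p.2‖⁻¹ • p.2) ∈ A} := by
  have hp := isProbabilityMeasure_unifSphere ι
  set V := volume (ball (0 : EuclideanSpace ℝ ι) 1) with hV
  set ν := unifSphere ι with hν
  have hsh : MeasurableSet (shellSet (univ : Set (EuclideanSpace ℝ ι)) δ) :=
    (measurableSet_coneSet MeasurableSet.univ 1).inter
      (measurableSet_le measurable_const measurable_norm)
  have hn : Measurable fun x : EuclideanSpace ℝ ι => ‖x‖⁻¹ • x := by fun_prop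
  have m1 : MeasurableSet {p : sphere (0 : EuclideanSpace ℝ ι) 1 × sphere (0 : EuclideanSpace ℝ ι) 1 |
      ((p.1 : EuclideanSpace ℝ ι), (p.2 : EuclideanSpace ℝ ι)) ∈ A} :=
    (measurable_subtype_coe.comp measurable_fst).prodMk
      (measurable_subtype_coe.comp measurable_snd) hA
  have m2 : MeasurableSet {p : sphere (0 : EuclideanSpace ℝ ι) 1 × EuclideanSpace ℝ ι |
      p.2 ∈ shellSet univ δ ∧ ((p.1 : EuclideanSpace ℝ ι), ‖p.2‖⁻¹ • p.2) ∈ A} := by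
    have q1 : MeasurableSet {p : sphere (0 : EuclideanSpace ℝ ι) 1 × EuclideanSpace ℝ ι |
      p.2 ∈ shellSet univ δ} := measurable_snd hsh
    have q2 : MeasurableSet {p : sphere (0 : EuclideanSpace ℝ ι) 1 × EuclideanSpace ℝ ι |
      ((p.1 : EuclideanSpace ℝ ι), ‖p.2‖⁻¹ • p.2) ∈ A} :=
      (measurable_subtype_coe.comp measurable_fst).prodMk (hn.comp measurable_snd) hA
    exact q1.inter q2
  have m3 : MeasurableSet {p : EuclideanSpace ℝ ι × EuclideanSpace ℝ ι |
      p.1 ∈ shellSet univ δ ∧ p.2 ∈ shellSet univ δ ∧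
          (‖p.1‖⁻¹ • p.1, ‖p.2‖⁻¹ • p.2) ∈ A} := by
    have q1 : MeasurableSet {p : EuclideanSpace ℝ ι × EuclideanSpace ℝ ι |
      p.1 ∈ shellSet univ δ} := measurable_fst hsh
    have q2 : MeasurableSet {p : EuclideanSpace ℝ ι × EuclideanSpace ℝ ι |
      p.2 ∈ shellSet univ δ} := measurable_snd hsh
    have q3 : MeasurableSet {p : EuclideanSpace ℝ ι × EuclideanSpace ℝ ι |
      (‖p.1‖⁻¹ • p.1, ‖p.2‖⁻¹ • p.2) ∈ A} :=
      (hn.comp measurable_fst).prodMk (hn.comp measurable_snd) hA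
    exact q1.inter (q2.inter q3)
  have hV0 : V ≠ ⊤ := measure_ball_lt_top.ne
  have hshell : ∀ B : Set (EuclideanSpace ℝ ι), MeasurableSet B →
      V * ν {c | (c : EuclideanSpace ℝ ι) ∈ B} ≤
        2 * volume {x | x ∈ shellSet univ δ ∧ ‖x‖⁻¹ • x ∈ B} := by
    intro B hB
    refine (volume_mul_unifSphere_le hB hδ1 hδ).trans (mul_le_mul_right (measure_mono ?_) 2)
    rintro x ⟨⟨h1, h2, h3⟩, h4⟩
    exact ⟨⟨⟨h1, h2, trivial⟩, h4⟩, h3⟩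
  have step1 : V * (ν.prod ν) {p | ((p.1 : EuclideanSpace ℝ ι), (p.2 : EuclideanSpace ℝ ι)) ∈ A} ≤
      2 * (ν.prod (volume : Measure (EuclideanSpace ℝ ι))) {p |
      p.2 ∈ shellSet univ δ ∧ ((p.1 : EuclideanSpace ℝ ι), ‖p.2‖⁻¹ • p.2) ∈ A} := by
    rw [Measure.prod_apply m1, Measure.prod_apply m2, ← lintegral_const_mul' _ _ hV0,
      ← lintegral_const_mul' _ _ (by norm_num)]
    refine lintegral_mono fun x => ?_
    exact hshell {y | ((x : EuclideanSpace ℝ ι), y) ∈ A} (measurable_prodMk_left hA)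
  have step2 : V * (ν.prod (volume : Measure (EuclideanSpace ℝ ι))) {p |
      p.2 ∈ shellSet univ δ ∧ ((p.1 : EuclideanSpace ℝ ι), ‖p.2‖⁻¹ • p.2) ∈ A} ≤
      2 * ((volume : Measure (EuclideanSpace ℝ ι)).prod volume)
        {p | p.1 ∈ shellSet univ δ ∧ p.2 ∈ shellSet univ δ ∧
          (‖p.1‖⁻¹ • p.1, ‖p.2‖⁻¹ • p.2) ∈ A} := by
    rw [Measure.prod_apply_symm m2, Measure.prod_apply_symm m3, ← lintegral_const_mul' _ _ hV0,
      ← lintegral_const_mul' _ _ (by norm_num)]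
    refine lintegral_mono fun y => ?_
    by_cases hy : y ∈ shellSet univ δ
    · have := hshell {x | (x, ‖y‖⁻¹ • y) ∈ A} (measurable_prodMk_right hA)
      refine le_trans ?_ (this.trans ?_)
      · gcongr
        intro x hx; exact hx.2
      · gcongr
        rintro x ⟨hx1, hx2⟩
        exact ⟨hx1, hy, hx2⟩
    · have : ((fun x : sphere (0 : EuclideanSpace ℝ ι) 1 => (x, y)) ⁻¹' {p |
          p.2 ∈ shellSet univ δ ∧ ((p.1 : EuclideanSpace ℝ ι), ‖p.2‖⁻¹ • p.2) ∈ A}) = ∅ := by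
        ext x; simp [hy]
      rw [this]; simp
  calc _ ≤ V * (2 * (ν.prod (volume : Measure (EuclideanSpace ℝ ι))) {p |
      p.2 ∈ shellSet univ δ ∧ ((p.1 : EuclideanSpace ℝ ι), ‖p.2‖⁻¹ • p.2) ∈ A}) := by gcongr
    _ = 2 * (V * (ν.prod (volume : Measure (EuclideanSpace ℝ ι))) {p |
      p.2 ∈ shellSet univ δ ∧ ((p.1 : EuclideanSpace ℝ ι), ‖p.2‖⁻¹ • p.2) ∈ A}) := by ring
    _ ≤ 2 * (2 * _) := by gcongr
    _ = _ := by rw [← mul_assoc]; norm_num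

theorem volume_prod_sub_add_eq {A B : Set (EuclideanSpace ℝ ι)} (hA : MeasurableSet A)
    (hB : MeasurableSet B) :
    ((volume : Measure (EuclideanSpace ℝ ι)).prod volume) {p | p.1 - p.2 ∈ A ∧ p.1 + p.2 ∈ B} =
      ENNReal.ofReal ((1 / 2) ^ Fintype.card ι) * (volume A * volume B) := by
  have m1 : MeasurableSet {p : EuclideanSpace ℝ ι × EuclideanSpace ℝ ι |
      p.1 - p.2 ∈ A ∧ p.1 + p.2 ∈ B} := by
    have q1 : MeasurableSet {p : EuclideanSpace ℝ ι × EuclideanSpace ℝ ι | p.1 - p.2 ∈ A} :=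
      (measurable_fst.sub measurable_snd) hA
    have q2 : MeasurableSet {p : EuclideanSpace ℝ ι × EuclideanSpace ℝ ι | p.1 + p.2 ∈ B} :=
      (measurable_fst.add measurable_snd) hB
    exact q1.inter q2
  have m2 : MeasurableSet {p : EuclideanSpace ℝ ι × EuclideanSpace ℝ ι |
      p.1 ∈ A ∧ p.1 + (2 : ℝ) • p.2 ∈ B} := by
    have q1 : MeasurableSet {p : EuclideanSpace ℝ ι × EuclideanSpace ℝ ι | p.1 ∈ A} :=
      measurable_fst hA
    have q2 : MeasurableSet {p : EuclideanSpace ℝ ι × EuclideanSpace ℝ ι |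
        p.1 + (2 : ℝ) • p.2 ∈ B} :=
      (measurable_fst.add (measurable_snd.const_smul (2 : ℝ))) hB
    exact q1.inter q2
  have step1 : ((volume : Measure (EuclideanSpace ℝ ι)).prod volume)
      {p | p.1 - p.2 ∈ A ∧ p.1 + p.2 ∈ B} =
      ((volume : Measure (EuclideanSpace ℝ ι)).prod volume)
      {p | p.1 ∈ A ∧ p.1 + (2 : ℝ) • p.2 ∈ B} := by
    rw [Measure.prod_apply_symm m1, Measure.prod_apply_symm m2]
    refine lintegral_congr fun y => ?_
    rw [← measure_preimage_add_right volume (-y)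
      ((fun x => (x, y)) ⁻¹' {p | p.1 ∈ A ∧ p.1 + (2 : ℝ) • p.2 ∈ B})]
    congr 1
    ext x
    simp only [mem_preimage, mem_ofPred_eq]
    rw [show x + -y + (2 : ℝ) • y = x + y by module, ← sub_eq_add_neg]
  rw [step1, Measure.prod_apply m2]
  have hin : ∀ u : EuclideanSpace ℝ ι, volume (Prod.mk u ⁻¹'
      {p : EuclideanSpace ℝ ι × EuclideanSpace ℝ ι | p.1 ∈ A ∧ p.1 + (2 : ℝ) • p.2 ∈ B}) =
      A.indicator (fun _ => ENNReal.ofReal ((1 / 2) ^ Fintype.card ι) * volume B) u := by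
    intro u
    by_cases hu : u ∈ A
    · rw [indicator_of_mem hu]
      have : (Prod.mk u ⁻¹' {p : EuclideanSpace ℝ ι × EuclideanSpace ℝ ι |
          p.1 ∈ A ∧ p.1 + (2 : ℝ) • p.2 ∈ B}) = (fun y => (2 : ℝ) • y) ⁻¹' ((fun y => u + y) ⁻¹' B) := by
        ext y; simp [hu]
      rw [this, Measure.addHaar_preimage_smul _ (by norm_num), measure_preimage_add,
        finrank_euclideanSpace]
      congr 2
      rw [abs_of_pos (by positivity)]
      simp
    · rw [indicator_of_notMem hu]
      have : (Prod.mk u ⁻¹' {p : EuclideanSpace ℝ ι × EuclideanSpace ℝ ι |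
          p.1 ∈ A ∧ p.1 + (2 : ℝ) • p.2 ∈ B}) = ∅ := by
        ext y; simp [hu]
      rw [this, measure_empty]
  rw [lintegral_congr hin, lintegral_indicator hA, lintegral_const, Measure.restrict_apply_univ]
  ring

theorem norm_normalize_sub_normalize_le {E : Type*} [NormedAddCommGroup E] [NormedSpace ℝ E]
    {u v : E} (hu : u ≠ 0) (hv : v ≠ 0) :
    ‖‖u‖⁻¹ • u - ‖v‖⁻¹ • v‖ ≤ 2 * ‖u - v‖ / ‖v‖ := by
  have hu' := norm_pos_iff.2 hu
  have hv' := norm_pos_iff.2 hv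
  have h1 : ‖u‖⁻¹ • u - ‖v‖⁻¹ • v = ‖v‖⁻¹ • ((u - v) + (‖v‖ - ‖u‖) • (‖u‖⁻¹ • u)) := by
    have : (‖v‖⁻¹ * ((‖v‖ - ‖u‖) * ‖u‖⁻¹)) = ‖u‖⁻¹ - ‖v‖⁻¹ := by field_simp
    rw [smul_add, smul_smul, smul_smul, mul_assoc, this]
    module
  rw [h1, norm_smul, norm_inv, norm_norm, inv_mul_eq_div]
  gcongr
  refine (norm_add_le _ _).trans ?_
  have h2 : ‖(‖v‖ - ‖u‖) • (‖u‖⁻¹ • u)‖ ≤ ‖u - v‖ := by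
    rw [norm_smul, norm_smul, norm_inv, norm_norm, inv_mul_cancel₀ hu'.ne', mul_one,
      Real.norm_eq_abs, norm_sub_rev]
    exact abs_norm_sub_norm_le v u
  linarith

theorem unifSphere_pair_le [Nonempty ι] {c : EuclideanSpace ℝ ι} (hc : ‖c‖ = 1)
    {k a g e w : ℝ} (hA : Adm k a g) (he0 : 0 < e) (he : 100 * e ≤ k) (hw : 4 * e / k ≤ w)
    (hn : (1 - e) ^ Fintype.card ι ≤ 1 / 2) {F F' : Set (EuclideanSpace ℝ ι)}
    (hF : MeasurableSet F) (hF' : MeasurableSet F')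
    (hFF : ∀ u v : EuclideanSpace ℝ ι, u ∈ F → ‖u - v‖ ≤ w → v ∈ F') :
    ((unifSphere ι).prod (unifSphere ι)) {p |
      |inner ℝ (p.1 : EuclideanSpace ℝ ι) c - a| ≤ e ∧
      |inner ℝ (p.2 : EuclideanSpace ℝ ι) c - a| ≤ e ∧
      |inner ℝ (p.1 : EuclideanSpace ℝ ι) (p.2 : EuclideanSpace ℝ ι) - g| ≤ e ∧
      ‖(p.1 : EuclideanSpace ℝ ι) - p.2‖⁻¹ • ((p.1 : EuclideanSpace ℝ ι) - p.2) ∈ F} ≤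
    ENNReal.ofReal (4 * (1 - 2 * a ^ 2 - g ^ 2 + 2 * a ^ 2 * g + 20 * e) ^
        ((Fintype.card ι : ℝ) / 2)) * unifSphere ι {v | (v : EuclideanSpace ℝ ι) ∈ F'} := by
  have hk := hA.pos
  have ha := hA.a_ge
  have ha1 := hA.a_le
  have hg := hA.g_ge
  have hg1 := hA.g_le
  have hk1 : k ≤ 1 := by linarith
  have he1 : e ≤ 1 / 100 := by linarith
  set V := volume (ball (0 : EuclideanSpace ℝ ι) 1) with hV
  have hV0 : V ≠ 0 := (isOpen_ball.measure_pos _ (by simp)).ne'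
  have hV1 : V ≠ ⊤ := measure_ball_lt_top.ne
  have hmA : MeasurableSet {p : EuclideanSpace ℝ ι × EuclideanSpace ℝ ι |
      |inner ℝ p.1 c - a| ≤ e ∧ |inner ℝ p.2 c - a| ≤ e ∧ |inner ℝ p.1 p.2 - g| ≤ e ∧
      ‖p.1 - p.2‖⁻¹ • (p.1 - p.2) ∈ F} := by
    have q1 : MeasurableSet {p : EuclideanSpace ℝ ι × EuclideanSpace ℝ ι |
      |inner ℝ p.1 c - a| ≤ e} := measurableSet_le (by fun_prop) measurable_const
    have q2 : MeasurableSet {p : EuclideanSpace ℝ ι × EuclideanSpace ℝ ι |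
      |inner ℝ p.2 c - a| ≤ e} := measurableSet_le (by fun_prop) measurable_const
    have q3 : MeasurableSet {p : EuclideanSpace ℝ ι × EuclideanSpace ℝ ι |
      |inner ℝ p.1 p.2 - g| ≤ e} := measurableSet_le (by fun_prop) measurable_const
    have q4 : Measurable fun p : EuclideanSpace ℝ ι × EuclideanSpace ℝ ι =>
      ‖p.1 - p.2‖⁻¹ • (p.1 - p.2) := by fun_prop
    exact q1.inter (q2.inter (q3.inter (q4 hF)))
  have hmain := volume_sq_mul_unifSphere_prod_le hmA (by linarith) hn
  obtain ⟨h, hh⟩ : ∃ h, h = 2 * a - 4 * e := ⟨_, rfl⟩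
  obtain ⟨RU, hRU⟩ : ∃ RU, RU = √(2 - 2 * g + 7 * e) := ⟨_, rfl⟩
  obtain ⟨S, hS⟩ : ∃ S, S = 2 + 2 * g + 2 * e - h ^ 2 := ⟨_, rfl⟩
  have hh0 : 0 ≤ h := by linarith
  have hdet := hA.det
  have hS1 : S ≤ 2 + 2 * g - 4 * a ^ 2 + 18 * e := by
    rw [hS, hh]
    have : a * e ≤ 1 * e := by gcongr; linarith
    linarith [sq_nonneg e]
  have hS0 : 0 ≤ S := by
    have : 0 ≤ 1 + g - 2 * a ^ 2 := by
      by_contra hcon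
      push Not at hcon
      nlinarith
    have q : 0 ≤ a * e := mul_nonneg (by linarith) he0.le
    have q2 : e ^ 2 ≤ a * e := by rw [sq]; gcongr; linarith
    rw [hS, hh]
    linarith
  have hRUpos : 0 < RU := by rw [hRU]; exact Real.sqrt_pos.2 (by linarith)
  have hsub : {p : EuclideanSpace ℝ ι × EuclideanSpace ℝ ι |
      p.1 ∈ shellSet univ e ∧ p.2 ∈ shellSet univ e ∧ (‖p.1‖⁻¹ • p.1, ‖p.2‖⁻¹ • p.2) ∈
      {p : EuclideanSpace ℝ ι × EuclideanSpace ℝ ι |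
      |inner ℝ p.1 c - a| ≤ e ∧ |inner ℝ p.2 c - a| ≤ e ∧ |inner ℝ p.1 p.2 - g| ≤ e ∧
      ‖p.1 - p.2‖⁻¹ • (p.1 - p.2) ∈ F}} ⊆
      {p | p.1 - p.2 ∈ coneSet F' RU ∧ p.1 + p.2 ∈ closedBall (h • c) (√S)} := by
    rintro ⟨x, y⟩ ⟨⟨⟨hx0, hx1, -⟩, hx2⟩, ⟨⟨hy0, hy1, -⟩, hy2⟩, h1, h2, h3, h4⟩
    simp only [mem_ofPred_eq] at hx2 hy2 h1 h2 h3 h4 hx0 hx1 hy0 hy1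
    have hxn := norm_pos_iff.2 hx0
    have hyn := norm_pos_iff.2 hy0
    obtain ⟨X, hX⟩ : ∃ X, X = ‖x‖⁻¹ • x := ⟨_, rfl⟩
    obtain ⟨Y, hY⟩ : ∃ Y, Y = ‖y‖⁻¹ • y := ⟨_, rfl⟩
    rw [← hX, ← hY] at h3 h4
    rw [← hX] at h1
    rw [← hY] at h2
    have hxX : x = ‖x‖ • X := by rw [hX, smul_smul, mul_inv_cancel₀ hxn.ne', one_smul]
    have hyY : y = ‖y‖ • Y := by rw [hY, smul_smul, mul_inv_cancel₀ hyn.ne', one_smul]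
    have hX1 : ‖X‖ = 1 := by rw [hX, norm_smul, norm_inv, norm_norm, inv_mul_cancel₀ hxn.ne']
    have hY1 : ‖Y‖ = 1 := by rw [hY, norm_smul, norm_inv, norm_norm, inv_mul_cancel₀ hyn.ne']
    obtain ⟨s, hs⟩ : ∃ s, s = ‖x‖ := ⟨_, rfl⟩
    obtain ⟨s', hs'⟩ : ∃ s', s' = ‖y‖ := ⟨_, rfl⟩
    rw [← hs] at hxX hx1 hx2 hxn
    rw [← hs'] at hyY hy1 hy2 hyn
    rw [abs_le] at h1 h2 h3
    have hss : s * s' ≤ 1 := mul_le_one₀ hx1.le hyn.le hy1.le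
    have hss2 : 1 - 2 * e ≤ s * s' := by
      have : (1 - e) * (1 - e) ≤ s * s' := by gcongr; linarith
      linarith [sq_nonneg e]
    have hxy : inner ℝ x y = s * s' * inner ℝ X Y := by
      conv_lhs => rw [hxX, hyY]
      rw [inner_smul_left, inner_smul_right]; simp; ring
    have hU2 : ‖x - y‖ ^ 2 < 2 - 2 * g + 7 * e := by
      rw [@norm_sub_sq ℝ, ← hs, ← hs']
      simp only [RCLike.re_to_real]
      rw [hxy]
      have q1 : s ^ 2 ≤ 1 := pow_le_one₀ hxn.le hx1.le
      have q2 : s' ^ 2 ≤ 1 := pow_le_one₀ hyn.le hy1.le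
      have q3 : (1 - 2 * e) * (g - e) ≤ s * s' * inner ℝ X Y := by gcongr <;> linarith
      have q4 : e * g ≤ e * 1 := by gcongr; linarith
      linarith [sq_nonneg e]
    have hV2 : ‖x + y‖ ^ 2 ≤ 2 + 2 * g + 2 * e := by
      rw [@norm_add_sq ℝ, ← hs, ← hs']
      simp only [RCLike.re_to_real]
      rw [hxy]
      have q1 : s ^ 2 ≤ 1 := pow_le_one₀ hxn.le hx1.le
      have q2 : s' ^ 2 ≤ 1 := pow_le_one₀ hyn.le hy1.le
      have q3 : s * s' * inner ℝ X Y ≤ 1 * (g + e) := by gcongr <;> linarith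
      linarith
    have hVc : h ≤ inner ℝ (x + y) c := by
      conv_rhs => rw [hxX, hyY]
      rw [inner_add_left, inner_smul_left, inner_smul_left]
      simp only [conj_trivial]
      have q1 : (1 - e) * (a - e) ≤ s * inner ℝ X c := by gcongr <;> linarith
      have q2 : (1 - e) * (a - e) ≤ s' * inner ℝ Y c := by gcongr <;> linarith
      have q3 : e * a ≤ e * 1 := by gcongr; linarith
      rw [hh]
      linarith [sq_nonneg e]
    have hXY2 : ‖X - Y‖ ^ 2 = 2 - 2 * inner ℝ X Y := by
      rw [@norm_sub_sq ℝ, hX1, hY1]; simp only [RCLike.re_to_real]; ring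
    have hXYk : k ≤ ‖X - Y‖ := by
      refine le_of_sq_le_sq ?_ (norm_nonneg _)
      rw [hXY2]
      have : k ^ 2 ≤ k := by rw [sq]; exact mul_le_of_le_one_left hk.le hk1
      linarith
    have hXY0 : X - Y ≠ 0 := by rw [← norm_pos_iff]; linarith
    have hd1 : ‖(X - Y) - (x - y)‖ ≤ 2 * e := by
      have : (X - Y) - (x - y) = (1 - s) • X - (1 - s') • Y := by
        conv_lhs => rw [hxX, hyY]
        module
      rw [this]
      refine (norm_sub_le _ _).trans ?_
      rw [norm_smul, norm_smul, hX1, hY1, Real.norm_eq_abs, Real.norm_eq_abs,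
        abs_of_nonneg (by linarith), abs_of_nonneg (by linarith)]
      linarith
    have hxy0 : x - y ≠ 0 := by
      intro hcon
      rw [hcon, sub_zero] at hd1
      linarith
    have hd2 : ‖‖X - Y‖⁻¹ • (X - Y) - ‖x - y‖⁻¹ • (x - y)‖ ≤ w := by
      rw [norm_sub_rev]
      refine (norm_normalize_sub_normalize_le hxy0 hXY0).trans (le_trans ?_ hw)
      rw [norm_sub_rev]
      rw [show 4 * e = 2 * (2 * e) by ring]
      gcongr
    refine ⟨⟨hxy0, ?_, hFF _ _ h4 hd2⟩, ?_⟩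
    · rw [hRU]
      exact Real.lt_sqrt_of_sq_lt hU2
    · rw [hS]
      exact mem_closedBall_of_inner_le hc.le hh0 hV2 hVc
  have hfin := hmain.trans (mul_le_mul_right (measure_mono hsub) 4)
  rw [volume_prod_sub_add_eq (measurableSet_coneSet hF' RU) measurableSet_closedBall,
    volume_coneSet hF' hRUpos, volume_closedBall_sqrt_le _ hS0] at hfin
  refine (ENNReal.mul_le_mul_iff_right hV0 hV1).1 ((ENNReal.mul_le_mul_iff_right hV0 hV1).1 ?_)
  refine hfin.trans ?_
  have hreal : 4 * ((1 / 2) ^ Fintype.card ι * (RU ^ Fintype.card ι *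
      S ^ ((Fintype.card ι : ℝ) / 2))) ≤ 4 * (1 - 2 * a ^ 2 - g ^ 2 + 2 * a ^ 2 * g + 20 * e) ^
        ((Fintype.card ι : ℝ) / 2) := by
    have e1 : (1 / 2 : ℝ) ^ Fintype.card ι = (1 / 4) ^ ((Fintype.card ι : ℝ) / 2) := by
      rw [show (1 / 4 : ℝ) = (1 / 2) ^ (2 : ℝ) by norm_num, ← Real.rpow_mul (by norm_num),
        ← Real.rpow_natCast]
      congr 1; ring
    have e2 : RU ^ Fintype.card ι = (2 - 2 * g + 7 * e) ^ ((Fintype.card ι : ℝ) / 2) := by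
      rw [hRU, Real.sqrt_eq_rpow, ← Real.rpow_natCast, ← Real.rpow_mul (by linarith)]
      congr 1; ring
    rw [e1, e2, ← Real.mul_rpow (by linarith) hS0,
      ← Real.mul_rpow (by norm_num) (mul_nonneg (by linarith) hS0)]
    have : 1 / 4 * ((2 - 2 * g + 7 * e) * S) ≤
        1 - 2 * a ^ 2 - g ^ 2 + 2 * a ^ 2 * g + 20 * e := by
      have q1 : (2 - 2 * g + 7 * e) * S ≤
          (2 - 2 * g + 7 * e) * (2 + 2 * g - 4 * a ^ 2 + 18 * e) := by
        gcongr; linarith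
      have q2 : e * e ≤ e * (1 / 100) := by gcongr
      have q3 : 0 ≤ e * a ^ 2 := by positivity
      have q4 : e * g ≤ e * 1 := by gcongr; linarith
      have q5 : 0 ≤ e * g := mul_nonneg he0.le (by linarith)
      linarith
    have h0 : 0 ≤ 1 / 4 * ((2 - 2 * g + 7 * e) * S) := by
      have : 0 ≤ 2 - 2 * g + 7 * e := by linarith
      positivity
    gcongr
  calc _ = ENNReal.ofReal (4 * ((1 / 2) ^ Fintype.card ι * (RU ^ Fintype.card ι *
      S ^ ((Fintype.card ι : ℝ) / 2)))) * (V * (V *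
        unifSphere ι {v | (v : EuclideanSpace ℝ ι) ∈ F'})) := by
        rw [ENNReal.ofReal_mul (by norm_num), ENNReal.ofReal_mul (by positivity),
          ENNReal.ofReal_mul (by positivity), ENNReal.ofReal_ofNat]
        ring
    _ ≤ ENNReal.ofReal (4 * (1 - 2 * a ^ 2 - g ^ 2 + 2 * a ^ 2 * g + 20 * e) ^
        ((Fintype.card ι : ℝ) / 2)) *
          (V * (V * unifSphere ι {v | (v : EuclideanSpace ℝ ι) ∈ F'})) :=
        mul_le_mul_left (ENNReal.ofReal_le_ofReal hreal) _
    _ = _ := by ring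

end Pair

/-! ### Random rotations -/

section Rotation

variable {d : ℕ}

instance : SecondCountableTopology (SO d) :=
  have : SecondCountableTopology (Matrix (Fin d) (Fin d) ℝ) :=
    inferInstanceAs (SecondCountableTopology (Fin d → Fin d → ℝ))
  TopologicalSpace.Subtype.secondCountableTopology _

/-- The action of a rotation matrix. -/
def rotVec (Q : SO d) (x : EuclideanSpace ℝ (Fin d)) : EuclideanSpace ℝ (Fin d) :=
  WithLp.toLp 2 ((Q : Matrix (Fin d) (Fin d) ℝ) *ᵥ x.ofLp)

/-- The action of the inverse of a rotation matrix. -/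
def pullVec (Q : SO d) (x : EuclideanSpace ℝ (Fin d)) : EuclideanSpace ℝ (Fin d) :=
  WithLp.toLp 2 ((Q : Matrix (Fin d) (Fin d) ℝ)ᵀ *ᵥ x.ofLp)

theorem SO.transpose_mul_self (Q : SO d) :
    (Q : Matrix (Fin d) (Fin d) ℝ)ᵀ * (Q : Matrix (Fin d) (Fin d) ℝ) = 1 :=
  (Matrix.mem_orthogonalGroup_iff' _ _).1 (Matrix.mem_specialOrthogonalGroup_iff.1 Q.2).1

theorem SO.mul_transpose_self (Q : SO d) :
    (Q : Matrix (Fin d) (Fin d) ℝ) * (Q : Matrix (Fin d) (Fin d) ℝ)ᵀ = 1 :=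
  (Matrix.mem_orthogonalGroup_iff _ _).1 (Matrix.mem_specialOrthogonalGroup_iff.1 Q.2).1

theorem pullVec_rotVec (Q : SO d) (x : EuclideanSpace ℝ (Fin d)) : pullVec Q (rotVec Q x) = x := by
  simp [pullVec, rotVec, Matrix.mulVec_mulVec, SO.transpose_mul_self]

theorem rotVec_pullVec (Q : SO d) (x : EuclideanSpace ℝ (Fin d)) : rotVec Q (pullVec Q x) = x := by
  simp [pullVec, rotVec, Matrix.mulVec_mulVec, SO.mul_transpose_self]

theorem inner_rotVec (Q : SO d) (x y : EuclideanSpace ℝ (Fin d)) :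
    inner ℝ x (rotVec Q y) = inner ℝ (pullVec Q x) y := by
  simp only [EuclideanSpace.inner_eq_star_dotProduct, rotVec, pullVec, star_trivial]
  rw [Matrix.mulVec_transpose, dotProduct_comm, dotProduct_comm y.ofLp,
    Matrix.dotProduct_mulVec]

theorem inner_pullVec_pullVec (Q : SO d) (x y : EuclideanSpace ℝ (Fin d)) :
    inner ℝ (pullVec Q x) (pullVec Q y) = inner ℝ x y := by
  rw [← inner_rotVec, rotVec_pullVec]

theorem norm_pullVec (Q : SO d) (x : EuclideanSpace ℝ (Fin d)) : ‖pullVec Q x‖ = ‖x‖ := by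
  rw [@norm_eq_sqrt_real_inner _ _ _ (pullVec Q x), inner_pullVec_pullVec,
    ← norm_eq_sqrt_real_inner]

theorem norm_rotVec (Q : SO d) (x : EuclideanSpace ℝ (Fin d)) : ‖rotVec Q x‖ = ‖x‖ := by
  rw [← norm_pullVec Q, pullVec_rotVec]

/-- The inverse of a rotation, as a linear isometry. -/
def pullIso (Q : SO d) : EuclideanSpace ℝ (Fin d) ≃ₗᵢ[ℝ] EuclideanSpace ℝ (Fin d) where
  toFun := pullVec Q
  invFun := rotVec Q
  map_add' x y := by simp [pullVec, Matrix.mulVec_add]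
  map_smul' r x := by simp [pullVec, Matrix.mulVec_smul]
  left_inv := rotVec_pullVec Q
  right_inv := pullVec_rotVec Q
  norm_map' := norm_pullVec Q

theorem continuous_pullVec :
    Continuous fun p : SO d × EuclideanSpace ℝ (Fin d) => pullVec p.1 p.2 := by
  unfold pullVec
  refine (PiLp.continuous_toLp 2 _).comp ?_
  refine Continuous.matrix_mulVec ?_ ?_
  · exact (continuous_subtype_val.comp continuous_fst).matrix_transpose
  · exact (PiLp.continuous_ofLp 2 _).comp continuous_snd

theorem pullVec_mul (g Q : SO d) (x : EuclideanSpace ℝ (Fin d)) :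
    pullVec (g * Q) x = pullVec Q (pullVec g x) := by
  simp [pullVec, Matrix.mulVec_mulVec, Matrix.transpose_mul]

theorem exists_SO_of_isometry (f : EuclideanSpace ℝ (Fin d) ≃ₗᵢ[ℝ] EuclideanSpace ℝ (Fin d))
    (hf : LinearMap.det (f.toLinearEquiv : EuclideanSpace ℝ (Fin d) →ₗ[ℝ] _) = 1) :
    ∃ g : SO d, ∀ x, rotVec g x = f x := by
  let b := EuclideanSpace.basisFun (Fin d) ℝ
  let M := LinearMap.toMatrix b.toBasis b.toBasis
    (f.toLinearEquiv : EuclideanSpace ℝ (Fin d) →ₗ[ℝ] _)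
  have hM : M ∈ Matrix.specialOrthogonalGroup (Fin d) ℝ := by
    rw [Matrix.mem_specialOrthogonalGroup_iff]
    refine ⟨f.toMatrix_mem_unitaryGroup b b, ?_⟩
    rw [← hf, LinearMap.det_toMatrix]
  refine ⟨⟨M, hM⟩, fun x => ?_⟩
  have h1 := LinearMap.toMatrix_mulVec_repr b.toBasis b.toBasis
    (f.toLinearEquiv : EuclideanSpace ℝ (Fin d) →ₗ[ℝ] _) x
  ext j
  have h2 := congrFun h1 j
  have h3 : ⇑(b.toBasis.repr x) = x.ofLp := by ext i; simp [b]
  rw [h3] at h2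
  simpa [rotVec, M, b] using h2

theorem exists_SO_map (hd : 2 ≤ d) {x y : EuclideanSpace ℝ (Fin d)} (hx : ‖x‖ = 1) (hy : ‖y‖ = 1) :
    ∃ g : SO d, rotVec g x = y := by
  by_cases hxy : x = y
  · exact ⟨1, by simp [rotVec, hxy]⟩
  have hy0 : y ≠ 0 := by rw [← norm_ne_zero_iff, hy]; norm_num
  obtain ⟨z, hz0, hzy⟩ : ∃ z : EuclideanSpace ℝ (Fin d), z ≠ 0 ∧ inner ℝ z y = 0 := by
    have h1 : (ℝ ∙ y)ᗮ ≠ ⊥ := by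
      intro h
      have h2 := Submodule.finrank_add_finrank_orthogonal (ℝ ∙ y)
      rw [h, finrank_bot, finrank_span_singleton hy0, finrank_euclideanSpace, Fintype.card_fin] at h2
      omega
    obtain ⟨z, hz, hz0⟩ := Submodule.exists_mem_ne_zero_of_ne_bot h1
    exact ⟨z, hz0, Submodule.mem_orthogonal_singleton_iff_inner_left.1 hz⟩
  have hxy0 : x - y ≠ 0 := sub_ne_zero.2 hxy
  let f := (Submodule.reflection (ℝ ∙ (x - y))ᗮ).trans (Submodule.reflection (ℝ ∙ z)ᗮ)
  obtain ⟨g, hg⟩ := exists_SO_of_isometry f (by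
    have e : ((f.toLinearEquiv : EuclideanSpace ℝ (Fin d) →ₗ[ℝ] _)) =
        (Submodule.reflection (ℝ ∙ z)ᗮ).toLinearMap ∘ₗ
          (Submodule.reflection (ℝ ∙ (x - y))ᗮ).toLinearMap := rfl
    rw [e, LinearMap.det_comp, Submodule.det_reflection, Submodule.det_reflection,
      Submodule.orthogonal_orthogonal, Submodule.orthogonal_orthogonal,
      finrank_span_singleton hz0, finrank_span_singleton hxy0]
    norm_num)
  refine ⟨g, ?_⟩
  rw [hg]
  change Submodule.reflection (ℝ ∙ z)ᗮ (Submodule.reflection (ℝ ∙ (x - y))ᗮ x) = y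
  rw [Submodule.reflection_sub (by rw [hx, hy])]
  refine Submodule.reflection_mem_subspace_eq_self ?_
  rw [Submodule.mem_orthogonal_singleton_iff_inner_left, real_inner_comm]
  exact hzy

/-- The inverse of a Haar-random rotation moves a fixed unit vector to a uniform one. -/
theorem unifSO_pullVec (hd : 2 ≤ d) {x : EuclideanSpace ℝ (Fin d)} (hx : ‖x‖ = 1)
    {A : Set (EuclideanSpace ℝ (Fin d))} (hA : MeasurableSet A) :
    unifSO d {Q | pullVec Q x ∈ A} =
      unifSphere (Fin d) {c | (c : EuclideanSpace ℝ (Fin d)) ∈ A} := by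
  have : Nonempty (Fin d) := ⟨⟨0, by omega⟩⟩
  have := isProbabilityMeasure_unifSO d
  have := isProbabilityMeasure_unifSphere (Fin d)
  have : (unifSO d).IsMulLeftInvariant := by unfold unifSO; infer_instance
  have hconst : ∀ y : EuclideanSpace ℝ (Fin d), ‖y‖ = 1 →
      unifSO d {Q | pullVec Q y ∈ A} = unifSO d {Q | pullVec Q x ∈ A} := by
    intro y hy
    obtain ⟨g, hg⟩ := exists_SO_map hd hy hx
    have hg' : pullVec g x = y := by rw [← hg, pullVec_rotVec]
    rw [← measure_preimage_mul (unifSO d) g {Q | pullVec Q x ∈ A}]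
    congr 1
    ext Q
    simp only [mem_preimage, mem_ofPred_eq]
    rw [pullVec_mul, hg']
  have hm : MeasurableSet {p : SO d × sphere (0 : EuclideanSpace ℝ (Fin d)) 1 |
      pullVec p.1 (p.2 : EuclideanSpace ℝ (Fin d)) ∈ A} := by
    have : Continuous fun p : SO d × sphere (0 : EuclideanSpace ℝ (Fin d)) 1 =>
        pullVec p.1 (p.2 : EuclideanSpace ℝ (Fin d)) :=
      continuous_pullVec.comp (continuous_fst.prodMk (continuous_subtype_val.comp continuous_snd))
    exact this.measurable hA
  have h1 := Measure.prod_apply (μ := unifSO d) (ν := unifSphere (Fin d)) hm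
  have h2 := Measure.prod_apply_symm (μ := unifSO d) (ν := unifSphere (Fin d)) hm
  have e1 : ∀ Q : SO d, unifSphere (Fin d) (Prod.mk Q ⁻¹'
      {p : SO d × sphere (0 : EuclideanSpace ℝ (Fin d)) 1 |
      pullVec p.1 (p.2 : EuclideanSpace ℝ (Fin d)) ∈ A}) =
      unifSphere (Fin d) {c | (c : EuclideanSpace ℝ (Fin d)) ∈ A} := fun Q =>
    unifSphere_map_isometry (pullIso Q) hA
  have e2 : ∀ y : sphere (0 : EuclideanSpace ℝ (Fin d)) 1, unifSO d ((fun Q => (Q, y)) ⁻¹'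
      {p : SO d × sphere (0 : EuclideanSpace ℝ (Fin d)) 1 |
      pullVec p.1 (p.2 : EuclideanSpace ℝ (Fin d)) ∈ A}) =
      unifSO d {Q | pullVec Q x ∈ A} := fun y => hconst y (by simp)
  rw [lintegral_congr e1, lintegral_const, measure_univ, mul_one] at h1
  rw [lintegral_congr e2, lintegral_const, measure_univ, mul_one, h1] at h2
  exact h2.symm

end Rotation

/-! ### Blocks of coordinates -/

section Blocks

variable {d b : ℕ}

theorem block_index_lt (hd : 0 < d) (hb : 0 < b) (j : Fin d) : j.val * b / d < b := by
  rw [Nat.div_lt_iff_lt_mul hd, mul_comm b]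
  exact Nat.mul_lt_mul_of_pos_right j.2 hb

/-- The block of a coordinate. -/
def blockIndex (hd : 0 < d) (hb : 0 < b) (j : Fin d) : Fin b :=
  ⟨j.val * b / d, block_index_lt hd hb j⟩

/-- The coordinates of a block. -/
def blockFinset (d b : ℕ) (i : Fin b) : Finset (Fin d) :=
  Finset.univ.filter fun j => j.val * b / d = i

theorem card_blockFinset (i : Fin b) : (blockFinset d b i).card = Fintype.card (Block d b i) := by
  rw [blockFinset, Fintype.card_subtype]

theorem card_block_eq (hd : 0 < d) (hb : 0 < b) (i : Fin b) :
    Fintype.card (Block d b i) = ((i + 1) * d + b - 1) / b - (i * d + b - 1) / b := by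
  rw [← Nat.card_Ico, Fintype.card_subtype]
  refine Finset.card_bij (fun j _ => j.val) ?_ (fun _ _ _ _ h => Fin.ext h) ?_
  · intro j hj
    rw [Finset.mem_filter, Nat.div_eq_iff (by omega)] at hj
    obtain ⟨-, h1, h2⟩ := hj
    rw [Finset.mem_Ico]
    constructor
    · rw [← Nat.lt_succ_iff, Nat.div_lt_iff_lt_mul hb, Nat.succ_eq_add_one, add_mul]; omega
    · rw [Nat.lt_iff_add_one_le, Nat.le_div_iff_mul_le hb, add_mul, add_mul]; omega
  · intro j hj
    rw [Finset.mem_Ico] at hj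
    obtain ⟨h1, h2⟩ := hj
    rw [← Nat.lt_succ_iff, Nat.div_lt_iff_lt_mul hb, Nat.succ_eq_add_one, add_mul] at h1
    rw [Nat.lt_iff_add_one_le, Nat.le_div_iff_mul_le hb, add_mul, add_mul] at h2
    have hjd : j < d := by
      have hi : (i : ℕ) + 1 ≤ b := i.2
      have : (i + 1) * d ≤ b * d := Nat.mul_le_mul_right d hi
      rw [add_mul] at this
      have h3 : j * b < d * b := by rw [mul_comm d b]; omega
      exact Nat.lt_of_mul_lt_mul_right h3
    refine ⟨⟨j, hjd⟩, ?_, rfl⟩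
    rw [Finset.mem_filter, Nat.div_eq_iff (by omega)]
    refine ⟨Finset.mem_univ _, ?_, ?_⟩ <;> simp only [] <;> omega

theorem card_block_le (hd : 0 < d) (hb : 0 < b) (i : Fin b) :
    (Fintype.card (Block d b i) : ℝ) ≤ d / b + 1 := by
  rw [card_block_eq hd hb]
  have hb' : (0 : ℝ) < b := by exact_mod_cast hb
  rw [div_add_one hb'.ne', le_div_iff₀ hb']
  have h1 := Nat.div_mul_le_self ((i + 1) * d + b - 1) b
  have h2 := Nat.lt_div_mul_add (a := i * d + b - 1) hb
  have : (((i + 1) * d + b - 1) / b - (i * d + b - 1) / b) * b ≤ d + b := by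
    rw [Nat.sub_mul]
    have : (i + 1) * d = i * d + d := by ring
    omega
  exact_mod_cast this

theorem le_card_block (hd : 0 < d) (hb : 0 < b) (i : Fin b) :
    (d : ℝ) / b - 1 ≤ Fintype.card (Block d b i) := by
  rw [card_block_eq hd hb]
  have hb' : (0 : ℝ) < b := by exact_mod_cast hb
  rw [sub_le_iff_le_add, div_le_iff₀ hb', add_mul, one_mul]
  have h1 := Nat.div_mul_le_self (i * d + b - 1) b
  have h2 := Nat.lt_div_mul_add (a := (i + 1) * d + b - 1) hb
  have : d ≤ (((i + 1) * d + b - 1) / b - (i * d + b - 1) / b) * b + b := by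
    rw [Nat.sub_mul]
    have : (i + 1) * d = i * d + d := by ring
    omega
  exact_mod_cast this

/-- The restriction of a vector to a block of coordinates. -/
def blk (b : ℕ) (v : EuclideanSpace ℝ (Fin d)) (i : Fin b) : EuclideanSpace ℝ (Block d b i) :=
  WithLp.toLp 2 fun j => v j.1

/-- The extension by zero of a vector on a block of coordinates. -/
def ext0 (i : Fin b) (y : EuclideanSpace ℝ (Block d b i)) : EuclideanSpace ℝ (Fin d) :=
  WithLp.toLp 2 fun j => if h : j.val * b / d = i then y ⟨j, h⟩ else 0

theorem continuous_blk (i : Fin b) :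
    Continuous fun v : EuclideanSpace ℝ (Fin d) => blk b v i := by
  unfold blk
  refine (PiLp.continuous_toLp 2 _).comp ?_
  fun_prop

theorem sum_block (hd : 0 < d) (hb : 0 < b) (f : Fin d → ℝ) :
    ∑ i : Fin b, ∑ j : Block d b i, f j.1 = ∑ j, f j := by
  rw [← Finset.sum_fiberwise Finset.univ (blockIndex hd hb) f]
  refine Finset.sum_congr rfl fun i _ => ?_
  rw [Finset.sum_subtype (p := fun j : Fin d => j.val * b / d = i)]
  intro j
  simp [blockIndex, Fin.ext_iff]

theorem inner_eq_sum_blk (hd : 0 < d) (hb : 0 < b) (v w : EuclideanSpace ℝ (Fin d)) :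
    inner ℝ v w = ∑ i : Fin b, inner ℝ (blk b v i) (blk b w i) := by
  simp only [PiLp.inner_apply, blk]
  exact (sum_block hd hb fun j => inner ℝ (v j) (w j)).symm

theorem norm_sq_eq_sum_blk (hd : 0 < d) (hb : 0 < b) (v : EuclideanSpace ℝ (Fin d)) :
    ‖v‖ ^ 2 = ∑ i : Fin b, ‖blk b v i‖ ^ 2 := by
  simp only [← real_inner_self_eq_norm_sq]
  exact inner_eq_sum_blk hd hb v v

theorem norm_blk_sq (v : EuclideanSpace ℝ (Fin d)) (i : Fin b) :
    ‖blk b v i‖ ^ 2 = ∑ j ∈ blockFinset d b i, v j ^ 2 := by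
  have e : ∑ j ∈ blockFinset d b i, v j ^ 2 = ∑ j : Block d b i, v j.1 ^ 2 :=
    Finset.sum_subtype _ (fun j => by simp [blockFinset]) _
  rw [EuclideanSpace.norm_sq_eq, e]
  simp [blk]

theorem inner_ext0 (i : Fin b) (v : EuclideanSpace ℝ (Fin d))
    (y : EuclideanSpace ℝ (Block d b i)) : inner ℝ v (ext0 i y) = inner ℝ (blk b v i) y := by
  simp only [PiLp.inner_apply, blk, ext0]
  rw [← Finset.sum_subset (Finset.subset_univ (blockFinset d b i))]
  · rw [Finset.sum_subtype (p := fun j : Fin d => j.val * b / d = i)]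
    · refine Finset.sum_congr rfl fun j _ => ?_
      rw [dif_pos j.2]
    · intro j; simp [blockFinset]
  · intro j _ hj
    rw [dif_neg]
    · simp
    · simpa [blockFinset] using hj

theorem blk_ext0 (i : Fin b) (y : EuclideanSpace ℝ (Block d b i)) : blk b (ext0 i y) i = y := by
  ext j
  simp only [blk, ext0]
  rw [dif_pos j.2]

theorem norm_ext0 (i : Fin b) (y : EuclideanSpace ℝ (Block d b i)) : ‖ext0 i y‖ = ‖y‖ := by
  rw [@norm_eq_sqrt_real_inner _ _ _ (ext0 i y), inner_ext0, blk_ext0, ← norm_eq_sqrt_real_inner]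

theorem blk_concat (u : (i : Fin b) → sphere (0 : EuclideanSpace ℝ (Block d b i)) 1) (i : Fin b) :
    blk b (concat d b u) i = (√(b : ℝ))⁻¹ • (u i : EuclideanSpace ℝ (Block d b i)) := by
  ext ⟨j, hj⟩
  have key : ∀ (n : ℕ) (hn : n < b) (hj : j.val * b / d = n),
      concat d b u j = (u ⟨n, hn⟩ : EuclideanSpace ℝ (Block d b n)) ⟨j, hj⟩ / √(b : ℝ) := by
    rintro n hn rfl
    simp only [concat]
    rw [dif_pos hn]
  simp only [blk, PiLp.smul_apply, smul_eq_mul]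
  rw [key i i.2 hj, div_eq_inv_mul]

theorem inner_concat (hd : 0 < d) (hb : 0 < b) (v : EuclideanSpace ℝ (Fin d))
    (u : (i : Fin b) → sphere (0 : EuclideanSpace ℝ (Block d b i)) 1) :
    inner ℝ v (concat d b u) =
      (b : ℝ)⁻¹ * ∑ i, √(b : ℝ) * inner ℝ (blk b v i) (u i : EuclideanSpace ℝ (Block d b i)) := by
  rw [inner_eq_sum_blk hd hb, Finset.mul_sum]
  refine Finset.sum_congr rfl fun i _ => ?_
  rw [blk_concat, inner_smul_right, ← mul_assoc]
  congr 1
  have : (0 : ℝ) < b := by exact_mod_cast hb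
  have h2 : √(b : ℝ) ^ 2 = b := Real.sq_sqrt this.le
  have h3 : 0 < √(b : ℝ) := Real.sqrt_pos.2 this
  rw [inv_eq_iff_eq_inv, mul_inv, inv_inv, ← div_eq_mul_inv, eq_div_iff h3.ne', ← sq, h2]

theorem norm_concat (hd : 0 < d) (hb : 0 < b)
    (u : (i : Fin b) → sphere (0 : EuclideanSpace ℝ (Block d b i)) 1) :
    ‖concat d b u‖ = 1 := by
  have hb' : (0 : ℝ) < b := by exact_mod_cast hb
  have h : ‖concat d b u‖ ^ 2 = 1 := by
    rw [norm_sq_eq_sum_blk hd hb]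
    have : ∀ i : Fin b, ‖blk b (concat d b u) i‖ ^ 2 = (b : ℝ)⁻¹ := by
      intro i
      rw [blk_concat, norm_smul, norm_eq_of_mem_sphere, mul_one, norm_inv, inv_pow,
        Real.norm_eq_abs, sq_abs, Real.sq_sqrt hb'.le]
    simp only [this]
    simp [hb'.ne']
  exact (pow_eq_one_iff_of_nonneg (norm_nonneg _) two_ne_zero).1 h

/-- All blocks of `v` have nearly the same norm. -/
def Balanced (b : ℕ) (τ : ℝ) (v : EuclideanSpace ℝ (Fin d)) : Prop :=
  ∀ i : Fin b, |b * ‖blk b v i‖ ^ 2 - 1| ≤ τ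

theorem measurableSet_balanced (τ : ℝ) :
    MeasurableSet {v : EuclideanSpace ℝ (Fin d) | Balanced b τ v} := by
  have : {v : EuclideanSpace ℝ (Fin d) | Balanced b τ v} =
      ⋂ i : Fin b, {v | |b * ‖blk b v i‖ ^ 2 - 1| ≤ τ} := by
    ext v; simp [Balanced]
  rw [this]
  refine MeasurableSet.iInter fun i => measurableSet_le ?_ measurable_const
  have := (continuous_blk (d := d) i).measurable
  fun_prop

theorem abs_norm_blk_sub_le (hd : 0 < d) (hb : 0 < b) (hbd : b ≤ d) {K : Type*}
    {a : K → EuclideanSpace ℝ (Fin d)} {η h : ℝ} (hη : 0 ≤ η) (hη1 : η ≤ 1) (hh : 0 ≤ h)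
    (hh1 : h ≤ 1)
    {r : EuclideanSpace ℝ (Fin d)} (hr : r ∈ typicalSet a (blockFinset d b) η h) (i : Fin b) :
    |b * ‖blk b r i‖ ^ 2 - 1| ≤ b * (2 * η + h + 2 * b / d) := by
  have hd' : (0 : ℝ) < d := by exact_mod_cast hd
  have hb' : (1 : ℝ) ≤ b := by exact_mod_cast hb
  have hbd' : (b : ℝ) / d ≤ 1 := by rw [div_le_one hd']; exact_mod_cast hbd
  obtain ⟨q, hq⟩ : ∃ q : ℝ, q = h + 2 * b / d := ⟨_, rfl⟩
  have hq0 : 0 ≤ q := by rw [hq]; positivity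
  have hup : ∀ i : Fin b, b * ‖blk b r i‖ ^ 2 ≤ 1 + q := by
    intro i
    have h1 := (hr.2.2.2 i).le
    rw [← norm_blk_sq, card_blockFinset, Fintype.card_fin] at h1
    have h2 := card_block_le hd hb i
    have h4 : (b : ℝ) * ‖blk b r i‖ ^ 2 ≤ b * ((1 + h) * (d / b + 1) / d) := by
      refine mul_le_mul_of_nonneg_left (h1.trans ?_) (by linarith)
      gcongr
    have h5 : b * ((1 + h) * (d / b + 1) / d) = (1 + h) * (1 + (b : ℝ) / d) := by field_simp
    have h6 : h * (b / d) ≤ 1 * ((b : ℝ) / d) := by gcongr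
    rw [h5] at h4
    rw [hq, mul_div_assoc]
    linarith
  have hsum := norm_sq_eq_sum_blk hd hb r
  rw [← Finset.add_sum_erase _ _ (Finset.mem_univ i)] at hsum
  have h3 : b * ∑ j ∈ Finset.univ.erase i, ‖blk b r j‖ ^ 2 ≤ (b - 1) * (1 + q) := by
    rw [Finset.mul_sum]
    refine (Finset.sum_le_sum fun j _ => hup j).trans ?_
    rw [Finset.sum_const, Finset.card_erase_of_mem (Finset.mem_univ i), Finset.card_univ,
      Fintype.card_fin, nsmul_eq_mul, Nat.cast_sub (by omega), Nat.cast_one]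
  have h4 : 1 - 2 * η ≤ ‖r‖ ^ 2 := by
    have := hr.2.1
    nlinarith [norm_nonneg r]
  have h7 : b * (1 - 2 * η) ≤ b * ‖r‖ ^ 2 := by gcongr
  have h8 : q ≤ b * q := le_mul_of_one_le_left hq0 hb'
  have h9 : 0 ≤ b * η := by positivity
  have e : b * (2 * η + h + 2 * b / d) = 2 * (b * η) + b * q := by rw [hq]; ring
  rw [e, abs_le]
  have h10 := congrArg (fun z => (b : ℝ) * z) hsum
  simp only [mul_add] at h10
  constructor
  · linarith
  · linarith [hup i]

end Blocks

/-! ### Points near a vector and near a codeword in every block -/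

section BlockWedge

variable {d b : ℕ}

/-- In every block, the component of `v` has nearly the inner product `a / b` with that of the
point of the product code. -/
def InBand (τ a : ℝ) (v : EuclideanSpace ℝ (Fin d))
    (u : (i : Fin b) → sphere (0 : EuclideanSpace ℝ (Block d b i)) 1) : Prop :=
  ∀ i, |√(b : ℝ) * inner ℝ (blk b v i) (u i : EuclideanSpace ℝ (Block d b i)) - a| ≤ τ

theorem InBand.abs_inner_sub_le (hd : 0 < d) (hb : 0 < b) {τ a : ℝ} {v : EuclideanSpace ℝ (Fin d)}
    {u : (i : Fin b) → sphere (0 : EuclideanSpace ℝ (Block d b i)) 1} (h : InBand τ a v u) :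
    |inner ℝ v (concat d b u) - a| ≤ τ := by
  have hb' : (0 : ℝ) < b := by exact_mod_cast hb
  have e : inner ℝ v (concat d b u) - a =
      (b : ℝ)⁻¹ * ∑ i, (√(b : ℝ) * inner ℝ (blk b v i) (u i : EuclideanSpace ℝ (Block d b i)) - a) := by
    rw [inner_concat hd hb, Finset.sum_sub_distrib]
    simp only [Finset.sum_const, Finset.card_univ, Fintype.card_fin, nsmul_eq_mul]
    field_simp
  rw [e, abs_mul, abs_of_pos (inv_pos.2 hb'), inv_mul_le_iff₀ hb']
  refine (Finset.abs_sum_le_sum_abs _ _).trans ((Finset.sum_le_sum fun i _ => h i).trans ?_)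
  simp

theorem measurableSet_inBand (τ a : ℝ)
    (u : (i : Fin b) → sphere (0 : EuclideanSpace ℝ (Block d b i)) 1) :
    MeasurableSet {v : EuclideanSpace ℝ (Fin d) | InBand τ a v u} := by
  have : {v : EuclideanSpace ℝ (Fin d) | InBand τ a v u} =
      ⋂ i : Fin b, {v | |√(b : ℝ) *
        inner ℝ (blk b v i) (u i : EuclideanSpace ℝ (Block d b i)) - a| ≤ τ} := by
    ext v; simp [InBand]
  rw [this]
  refine MeasurableSet.iInter fun i => measurableSet_le ?_ measurable_const
  have := (continuous_blk (d := d) i).measurable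
  fun_prop

/-- The coefficients of the shortest vector with inner products `g` and `a` with two unit vectors
whose inner product `s` is close to `a`. -/
theorem exists_wedge_coeff {k a g s τ : ℝ} (hA : Adm k a g) (hτ : 0 ≤ τ) (hτk : 12 * τ ≤ k)
    (hs : |s - a| ≤ τ) : ∃ l μ G : ℝ, |l| ≤ 2 / k ∧ |μ| ≤ 2 / k ∧ l + μ * s = g ∧ l * s + μ = a ∧
      l ^ 2 + μ ^ 2 + 2 * l * μ * s = G ∧ G ≤ gramG a g + 6 * τ / k := by
  have h1 := hA.one_sub_sq_pos
  have hk := hA.pos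
  have ha := hA.a_ge
  have ha1 := hA.a_le
  have hg := hA.g_ge
  have hg1 := hA.g_le
  have hdet := hA.det
  have hG1 := hA.one_sub_gramG
  rw [abs_le] at hs
  have hk1 : k ≤ 1 := by linarith
  have hs2 : 1 - a ^ 2 - 3 * τ ≤ 1 - s ^ 2 := by
    have : (s - a) * (s + a) ≤ τ * 3 := by gcongr <;> linarith
    linarith
  have hs3 : 1 - s ^ 2 ≤ 1 - a ^ 2 + 3 * τ := by
    have : -(s - a) * (s + a) ≤ τ * 3 := by gcongr <;> linarith
    linarith
  have hs4 : k / 2 ≤ 1 - s ^ 2 := by linarith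
  have hs0 : 0 < 1 - s ^ 2 := by linarith
  have hsle : s ≤ 1 := by nlinarith
  have hs00 : 0 ≤ s := by linarith
  have hbd : ∀ z : ℝ, |z| ≤ 1 → |z / (1 - s ^ 2)| ≤ 2 / k := by
    intro z hz
    rw [abs_div, abs_of_pos hs0, div_le_div_iff₀ hs0 hk]
    nlinarith
  refine ⟨(g - a * s) / (1 - s ^ 2), (a - g * s) / (1 - s ^ 2),
    (g ^ 2 + a ^ 2 - 2 * a * g * s) / (1 - s ^ 2), hbd _ ?_, hbd _ ?_, ?_, ?_, ?_, ?_⟩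
  · have p1 : a * s ≤ 1 * 1 := by gcongr; linarith
    have p2 : 0 ≤ a * s := mul_nonneg (by linarith) hs00
    rw [abs_le]; constructor <;> linarith
  · have p1 : g * s ≤ 1 * 1 := by gcongr; linarith
    have p2 : 0 ≤ g * s := mul_nonneg (by linarith) hs00
    rw [abs_le]; constructor <;> linarith
  · field_simp; ring
  · field_simp; ring
  · field_simp; ring
  · obtain ⟨D, hD⟩ : ∃ D, D = 1 - 2 * a ^ 2 - g ^ 2 + 2 * a ^ 2 * g := ⟨_, rfl⟩
    obtain ⟨B, hB⟩ : ∃ B, B = 1 - a ^ 2 := ⟨_, rfl⟩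
    have hDB : D ≤ B := by rw [hD, hB]; nlinarith [sq_nonneg (g - a ^ 2), sq_nonneg a]
    rw [← hD] at hdet
    have hnum : g ^ 2 + a ^ 2 - 2 * a * g * s ≤ (1 - s ^ 2) - D + 3 * τ := by
      have : (s - a) * (a + s - 2 * a * g) ≤ τ * 3 := by
        have p0 : 0 ≤ a * g := mul_nonneg (by linarith) (by linarith)
        have p1 : a * g ≤ 1 * 1 := by gcongr <;> linarith
        have p2 : |a + s - 2 * a * g| ≤ 3 := by rw [abs_le]; constructor <;> linarith
        refine (le_abs_self _).trans ?_
        rw [abs_mul]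
        gcongr
        rw [abs_le]; exact hs
      rw [hD]; linarith
    have hGe : gramG a g = 1 - D / B := by rw [hD, hB, ← hG1]; ring
    rw [hGe]
    have hB0 : 0 < B := by rw [hB]; linarith
    have hBk : k ≤ B := by rw [hB]; exact h1
    have e1 : (D - 6 * τ) / B ≤ (D - 3 * τ) / (1 - s ^ 2) := by
      rw [div_le_div_iff₀ hB0 hs0]
      rw [← hB] at hs3
      have q1 : (D - 6 * τ) * (1 - s ^ 2) ≤ (D - 6 * τ) * (B + 3 * τ) := by
        gcongr; linarith
      have q2 : τ * D ≤ τ * B := by gcongr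
      linarith [sq_nonneg τ]
    have e2 : (g ^ 2 + a ^ 2 - 2 * a * g * s) / (1 - s ^ 2) ≤ 1 - (D - 3 * τ) / (1 - s ^ 2) := by
      rw [le_sub_iff_add_le, ← add_div, div_le_one hs0]; linarith
    have e3 : 6 * τ / B ≤ 6 * τ / k := by gcongr
    rw [sub_div] at e1
    linarith

set_option maxHeartbeats 1000000 in
/-- Near a vector `v` and near a codeword that is close to `v` in every block there are many points
that are close to the codeword in every block. -/
theorem unifSphere_blockWedge_ge (hd : 0 < d) (hb : 0 < b) (hbd : b ≤ d)
    {v : EuclideanSpace ℝ (Fin d)} (hv : ‖v‖ = 1)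
    {u : (i : Fin b) → sphere (0 : EuclideanSpace ℝ (Block d b i)) 1}
    {k a g τ₀ τ η h t : ℝ} (hA : Adm k a g) (hτ0 : 0 ≤ τ₀) (hτ0k : 12 * τ₀ ≤ k ^ 2)
    (hη : 0 < η) (hη1 : η ≤ 1 / 8) (hh : 0 ≤ h) (hh1 : h ≤ 1)
    (hτ1 : τ ≤ 1)
    (hτ : 200 / k ^ 2 * (τ₀ + b * (2 * η + h + 2 * b / d)) ≤ τ)
    (ht1 : Real.exp (-(d * η ^ 2 / 2)) ≤ t)
    (ht2 : Real.exp (-((d / b - 1) * h ^ 2 / 8)) ≤ t) (ht : 8 * b * t ≤ 1 / 2)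
    (hbal : Balanced b τ₀ v) (hband : InBand τ₀ a v u) :
    ENNReal.ofReal ((√(1 - gramG a g - 6 * τ₀ / k) / (1 + 5 * η)) ^ d / 2) ≤
      unifSphere (Fin d) {y | |inner ℝ v (y : EuclideanSpace ℝ (Fin d)) - g| ≤ τ ∧
        Balanced b τ (y : EuclideanSpace ℝ (Fin d)) ∧
        InBand τ a (y : EuclideanSpace ℝ (Fin d)) u} := by
  have : Nonempty (Fin d) := ⟨⟨0, hd⟩⟩
  have hk := hA.pos
  have ha := hA.a_ge
  have ha1 := hA.a_le
  have hg := hA.g_ge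
  have hg1 := hA.g_le
  have hk1 : k ≤ 1 := by linarith
  have hkk : k ^ 2 ≤ k := by rw [sq]; exact mul_le_of_le_one_left hk.le hk1
  have hb1 : (1 : ℝ) ≤ b := by exact_mod_cast hb
  have hb0 : (0 : ℝ) < b := by linarith
  have hd0 : (0 : ℝ) < d := by exact_mod_cast hd
  have hs := hband.abs_inner_sub_le hd hb
  obtain ⟨c, hc⟩ : ∃ c, c = concat d b u := ⟨_, rfl⟩
  have hcn : ‖c‖ = 1 := by rw [hc]; exact norm_concat hd hb u
  rw [← hc] at hs
  obtain ⟨s, hsd⟩ : ∃ s, s = inner ℝ v c := ⟨_, rfl⟩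
  rw [← hsd] at hs
  obtain ⟨l, μ, G, hl, hμ, e1, e2, e3, hG⟩ := exists_wedge_coeff hA hτ0 (by linarith) hs
  have hG0 : 0 ≤ G := by
    have e4 : G = (l + μ * s) ^ 2 + μ ^ 2 * (1 - s ^ 2) := by rw [← e3]; ring
    have : s ^ 2 ≤ 1 := by
      rw [sq_le_one_iff_abs_le_one, hsd]
      calc |inner ℝ v c| ≤ ‖v‖ * ‖c‖ := abs_real_inner_le_norm v c
        _ = 1 := by rw [hv, hcn, one_mul]
    rw [e4]
    have : 0 ≤ μ ^ 2 * (1 - s ^ 2) := mul_nonneg (sq_nonneg _) (by linarith)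
    positivity
  have hGk := hA.le_one_sub_gramG
  have hτk6 : 6 * τ₀ / k ≤ k / 2 := by
    rw [div_le_iff₀ hk]; nlinarith
  have hG1 : G ≤ 1 := by linarith
  obtain ⟨w, hw⟩ : ∃ w, w = l • v + μ • c := ⟨_, rfl⟩
  have hwn : ‖w‖ ^ 2 = G := by
    rw [hw, @norm_add_sq ℝ _ _ _ _ (l • v) (μ • c), norm_smul, norm_smul, hv, hcn, inner_smul_left,
      inner_smul_right, ← hsd, ← e3]
    simp only [RCLike.re_to_real, conj_trivial, mul_one, Real.norm_eq_abs, sq_abs]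
    ring
  have hwn1 : ‖w‖ ≤ 1 := by rw [← sq_le_one_iff₀ (norm_nonneg _), hwn]; exact hG1
  obtain ⟨ρ, hρ⟩ : ∃ ρ, ρ = √(1 - G) := ⟨_, rfl⟩
  have hρ0 : 0 ≤ ρ := by rw [hρ]; exact Real.sqrt_nonneg _
  have hρsq : ρ ^ 2 = 1 - G := by rw [hρ, Real.sq_sqrt (by linarith)]
  have hρ1 : ρ ≤ 1 := by rw [hρ, Real.sqrt_le_one]; linarith
  have hblkle : ∀ i : Fin b, ‖blk b v i‖ ≤ 1 := by
    intro i
    rw [← sq_le_one_iff₀ (norm_nonneg _), ← one_pow 2, ← hv, norm_sq_eq_sum_blk hd hb v]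
    exact Finset.single_le_sum (f := fun i => ‖blk b v i‖ ^ 2) (fun i _ => sq_nonneg _)
      (Finset.mem_univ i)
  obtain ⟨av, hav⟩ : ∃ av : (Fin b ⊕ Fin b) ⊕ Unit → EuclideanSpace ℝ (Fin d), av =
    Sum.elim (Sum.elim (fun i => ext0 i (u i : EuclideanSpace ℝ (Block d b i)))
      (fun i => ext0 i (blk b v i))) (fun _ => w) := ⟨_, rfl⟩
  have hvol := volume_ball_le_two_mul_typicalSet (a := av) (I := blockFinset d b) (η := η) (h := h)
    (τ := t) (by
      rw [hav]
      rintro ((i | i) | i)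
      · simp [norm_ext0]
      · simpa [norm_ext0] using hblkle i
      · simpa using hwn1) hη.le (by linarith) hh hh1
    (by rw [Fintype.card_fin]; exact ht1)
    (by
      intro i
      refine le_trans ?_ ht2
      rw [card_blockFinset]
      have := le_card_block hd hb i
      gcongr)
    (by
      simp only [Fintype.card_sum, Fintype.card_fin, Fintype.card_unit]
      push_cast
      have t0 : 0 ≤ t := (Real.exp_pos _).le.trans ht1
      nlinarith)
  have hmeas : MeasurableSet {y : EuclideanSpace ℝ (Fin d) | |inner ℝ v y - g| ≤ τ ∧
        Balanced b τ y ∧ InBand τ a y u} := by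
    have m1 : MeasurableSet {y : EuclideanSpace ℝ (Fin d) | |inner ℝ v y - g| ≤ τ} :=
      measurableSet_le (by fun_prop) measurable_const
    exact m1.inter ((measurableSet_balanced τ).inter (measurableSet_inBand τ a u))
  have hmono : ENNReal.ofReal ((√(1 - gramG a g - 6 * τ₀ / k) / (1 + 5 * η)) ^ d / 2) ≤
      ENNReal.ofReal ((ρ / (1 + 5 * η)) ^ Fintype.card (Fin d) / 2) := by
    rw [Fintype.card_fin]
    gcongr
    rw [hρ]
    exact Real.sqrt_le_sqrt (by linarith)
  refine hmono.trans (unifSphere_ge_of_typicalSet (t := w) hmeas hvol hη hη1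
    (by rw [hwn, hρsq]; ring) hρ0 ?_ ?_)
  · intro r hr
    have := hr.2.2.1 (Sum.inr ())
    simp only [hav, Sum.elim_inr] at this
    exact this.le
  intro r hr hxx
  have ru : ∀ i : Fin b, |inner ℝ (blk b r i) (u i : EuclideanSpace ℝ (Block d b i))| ≤ η := by
    intro i
    have := hr.2.2.1 (Sum.inl (Sum.inl i))
    simp only [hav, Sum.elim_inl, inner_ext0] at this
    exact this.le
  have rv : ∀ i : Fin b, |inner ℝ (blk b r i) (blk b v i)| ≤ η := by
    intro i
    have := hr.2.2.1 (Sum.inl (Sum.inr i))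
    simp only [hav, Sum.elim_inl, Sum.elim_inr, inner_ext0] at this
    exact this.le
  have rn := abs_norm_blk_sub_le hd hb hbd hη.le (by linarith) hh hh1 hr
  obtain ⟨E, hE⟩ : ∃ E, E = b * (2 * η + h + 2 * b / d) := ⟨_, rfl⟩
  simp only [← hE] at rn
  rw [← hE] at hτ
  have hbη0 : 0 ≤ b * η := by positivity
  have hEη : 2 * (b * η) ≤ E := by
    rw [hE]
    have : 0 ≤ (b : ℝ) * (h + 2 * b / d) := by positivity
    linarith
  have hL1 : (1 : ℝ) ≤ 1 / k := by rw [le_div_iff₀ hk]; linarith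
  obtain ⟨L, hL⟩ : ∃ L, L = 1 / k := ⟨_, rfl⟩
  rw [← hL] at hL1
  have hl' : |l| ≤ 2 * L := by rw [hL]; linarith [show 2 / k = 2 * (1 / k) by ring]
  have hμ' : |μ| ≤ 2 * L := by rw [hL]; linarith [show 2 / k = 2 * (1 / k) by ring]
  have hτ' : 200 * L ^ 2 * (τ₀ + E) ≤ τ := by
    rw [hL]; calc _ = 200 / k ^ 2 * (τ₀ + E) := by ring
      _ ≤ τ := hτ
  have hLL : L ≤ L ^ 2 := by rw [sq]; exact le_mul_of_one_le_left (by linarith) hL1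
  have hE0 : 0 ≤ E := by linarith
  have hEη1 : η ≤ E := by
    have : η ≤ b * η := le_mul_of_one_le_left hη.le hb1
    linarith
  -- the three quantities before normalization
  have sqb0 : 0 ≤ √(b : ℝ) := Real.sqrt_nonneg _
  have sqbb : √(b : ℝ) ≤ b := by
    rw [Real.sqrt_le_left hb0.le]; nlinarith
  have sqb2 : √(b : ℝ) * √(b : ℝ) = b := Real.mul_self_sqrt hb0.le
  have q1 : |inner ℝ v (w + ρ • r) - g| ≤ E := by
    have : inner ℝ v (w + ρ • r) - g = ρ * ∑ i : Fin b, inner ℝ (blk b r i) (blk b v i) := by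
      rw [inner_add_right, inner_smul_right, hw, inner_add_right, inner_smul_right,
        inner_smul_right, real_inner_self_eq_norm_sq, hv, ← hsd, real_inner_comm r v,
        ← inner_eq_sum_blk hd hb]
      linear_combination e1
    rw [this, abs_mul, abs_of_nonneg hρ0]
    have h2 : |∑ i : Fin b, inner ℝ (blk b r i) (blk b v i)| ≤ b * η := by
      refine (Finset.abs_sum_le_sum_abs _ _).trans ((Finset.sum_le_sum fun i _ => rv i).trans ?_)
      simp
    calc ρ * _ ≤ 1 * (b * η) := by gcongr
      _ ≤ E := by linarith
  have xb : ∀ i : Fin b, blk b (w + ρ • r) i = l • blk b v i +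
      (μ * (√(b : ℝ))⁻¹) • (u i : EuclideanSpace ℝ (Block d b i)) + ρ • blk b r i := by
    intro i
    have h1 : blk b (w + ρ • r) i = l • blk b v i + μ • blk b c i + ρ • blk b r i := by
      rw [hw]; rfl
    rw [h1, hc, blk_concat, smul_smul]
  have sqbpos : 0 < √(b : ℝ) := Real.sqrt_pos.2 hb0
  have un : ∀ i : Fin b, ‖(u i : EuclideanSpace ℝ (Block d b i))‖ = 1 := fun i => norm_eq_of_mem_sphere _
  have q2 : ∀ i : Fin b, |√(b : ℝ) * inner ℝ (blk b (w + ρ • r) i)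
      (u i : EuclideanSpace ℝ (Block d b i)) - a| ≤ 4 * L * τ₀ + E := by
    intro i
    have h1 : √(b : ℝ) * inner ℝ (blk b (w + ρ • r) i) (u i : EuclideanSpace ℝ (Block d b i)) - a =
        l * ((√(b : ℝ) * inner ℝ (blk b v i) (u i : EuclideanSpace ℝ (Block d b i)) - a) - (s - a)) +
        ρ * (√(b : ℝ) * inner ℝ (blk b r i) (u i : EuclideanSpace ℝ (Block d b i))) := by
      rw [xb, inner_add_left, inner_add_left, inner_smul_left, inner_smul_left, inner_smul_left,
        real_inner_self_eq_norm_sq, un]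
      simp only [conj_trivial]
      have : √(b : ℝ) * (μ * (√(b : ℝ))⁻¹) = μ := by field_simp
      linear_combination this + e2
    rw [h1]
    refine (abs_add_le _ _).trans (add_le_add ?_ ?_)
    · rw [abs_mul]
      calc |l| * _ ≤ 2 * L * (τ₀ + τ₀) := by
            gcongr
            exact (abs_sub _ _).trans (add_le_add (hband i) hs)
        _ = _ := by ring
    · rw [abs_mul, abs_mul, abs_of_nonneg hρ0, abs_of_nonneg sqb0]
      calc ρ * (√(b : ℝ) * |inner ℝ (blk b r i) (u i : EuclideanSpace ℝ (Block d b i))|) ≤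
          1 * (b * η) := by
            gcongr
            exact ru i
        _ ≤ E := by linarith
  have q3 : ∀ i : Fin b, |b * ‖blk b (w + ρ • r) i‖ ^ 2 - 1| ≤ 4 * L ^ 2 * τ₀ + 16 * L ^ 2 * τ₀ + E +
      4 * L * E := by
    intro i
    have h1 : b * ‖blk b (w + ρ • r) i‖ ^ 2 - 1 = l ^ 2 * (b * ‖blk b v i‖ ^ 2 - 1) +
        2 * l * μ * ((√(b : ℝ) * inner ℝ (blk b v i) (u i : EuclideanSpace ℝ (Block d b i)) - a)
          - (s - a)) + ρ ^ 2 * (b * ‖blk b r i‖ ^ 2 - 1) +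
        (2 * ρ * l * (b * inner ℝ (blk b r i) (blk b v i)) +
        2 * ρ * μ * (√(b : ℝ) * inner ℝ (blk b r i) (u i : EuclideanSpace ℝ (Block d b i)))) := by
      rw [xb, ← real_inner_self_eq_norm_sq]
      simp only [inner_add_left, inner_add_right, inner_smul_left, inner_smul_right, conj_trivial]
      rw [real_inner_self_eq_norm_sq (blk b v i), real_inner_self_eq_norm_sq (blk b r i),
        real_inner_self_eq_norm_sq (u i : EuclideanSpace ℝ (Block d b i)), un,
        real_inner_comm (blk b r i) (blk b v i),
        real_inner_comm (blk b r i) (u i : EuclideanSpace ℝ (Block d b i)),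
        real_inner_comm (blk b v i) (u i : EuclideanSpace ℝ (Block d b i))]
      have hinv : (b : ℝ) * (√(b : ℝ))⁻¹ = √(b : ℝ) := by
        rw [← div_eq_mul_inv, div_eq_iff sqbpos.ne', sqb2]
      have hinv2 : (b : ℝ) * (√(b : ℝ))⁻¹ * (√(b : ℝ))⁻¹ = 1 := by
        rw [hinv, mul_inv_cancel₀ sqbpos.ne']
      linear_combination (2 * l * μ * inner ℝ (blk b v i) (u i : EuclideanSpace ℝ (Block d b i)) +
        2 * ρ * μ * inner ℝ (blk b r i) (u i : EuclideanSpace ℝ (Block d b i))) * hinv +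
        μ ^ 2 * hinv2 + e3 + hρsq
    have hl2 : l ^ 2 ≤ 4 * L ^ 2 := by
      rw [← sq_abs]; calc |l| ^ 2 ≤ (2 * L) ^ 2 := by gcongr
        _ = _ := by ring
    rw [h1]
    refine (abs_add_le _ _).trans (add_le_add ((abs_add_le _ _).trans (add_le_add
      ((abs_add_le _ _).trans (add_le_add ?_ ?_)) ?_)) ((abs_add_le _ _).trans ?_))
    · rw [abs_mul, abs_of_nonneg (sq_nonneg l)]
      gcongr
      exact hbal i
    · rw [abs_mul, abs_mul, abs_mul]
      calc |2| * |l| * |μ| * _ ≤ 2 * (2 * L) * (2 * L) * (τ₀ + τ₀) := by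
            gcongr
            · norm_num
            · exact (abs_sub _ _).trans (add_le_add (hband i) hs)
        _ = _ := by ring
    · rw [abs_mul, abs_of_nonneg (sq_nonneg ρ)]
      calc ρ ^ 2 * _ ≤ 1 * E := by
            gcongr
            · exact pow_le_one₀ hρ0 hρ1
            · exact rn i
        _ = E := one_mul E
    · have p1 : |2 * ρ * l * (b * inner ℝ (blk b r i) (blk b v i))| ≤ 2 * L * E := by
        rw [abs_mul, abs_mul, abs_mul, abs_mul, abs_of_nonneg hρ0, abs_of_pos hb0]
        calc |2| * ρ * |l| * (b * |inner ℝ (blk b r i) (blk b v i)|) ≤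
            2 * 1 * (2 * L) * (b * η) := by
              gcongr
              · norm_num
              · exact rv i
          _ = 2 * L * (2 * (b * η)) := by ring
          _ ≤ 2 * L * E := by gcongr
      have p2 : |2 * ρ * μ * (√(b : ℝ) *
          inner ℝ (blk b r i) (u i : EuclideanSpace ℝ (Block d b i)))| ≤ 2 * L * E := by
        rw [abs_mul, abs_mul, abs_mul, abs_mul, abs_of_nonneg hρ0, abs_of_nonneg sqb0]
        calc |2| * ρ * |μ| * (√(b : ℝ) *
            |inner ℝ (blk b r i) (u i : EuclideanSpace ℝ (Block d b i))|) ≤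
            2 * 1 * (2 * L) * (b * η) := by
              gcongr
              · norm_num
              · exact ru i
          _ = 2 * L * (2 * (b * η)) := by ring
          _ ≤ 2 * L * E := by gcongr
      linarith
  have z1 : 0 ≤ L ^ 2 * τ₀ := by positivity
  have z2 : 0 ≤ L ^ 2 * E := by positivity
  have z3 : L * E ≤ L ^ 2 * E := by gcongr
  have z4 : E ≤ L ^ 2 * E := by
    refine le_mul_of_one_le_left hE0 ?_
    linarith
  have z5 : L * τ₀ ≤ L ^ 2 * τ₀ := by gcongr
  obtain ⟨x, hx⟩ : ∃ x, x = w + ρ • r := ⟨_, rfl⟩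
  rw [← hx] at hxx q1 ⊢
  simp only [← hx] at q2 q3
  refine ⟨?_, ?_, ?_⟩
  · rw [inner_smul_right]
    have h1 : |inner ℝ v x| ≤ 2 := by rw [abs_le] at q1 ⊢; constructor <;> linarith
    have h2 := abs_inv_mul_sub_le hη.le hη1 hxx h1
    rw [abs_le] at q1 h2 ⊢
    constructor <;> linarith
  · intro i
    have h0 : blk b (‖x‖⁻¹ • x) i = ‖x‖⁻¹ • blk b x i := rfl
    have h1 : b * ‖blk b (‖x‖⁻¹ • x) i‖ ^ 2 = ‖x‖⁻¹ * (‖x‖⁻¹ * (b * ‖blk b x i‖ ^ 2)) := by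
      rw [h0, norm_smul, norm_inv, norm_norm]; ring
    have h3 := q3 i
    have h2 : |b * ‖blk b x i‖ ^ 2| ≤ 2 := by rw [abs_le] at h3 ⊢; constructor <;> linarith
    have h4 := abs_inv_mul_sub_le hη.le hη1 hxx h2
    have h5 : |‖x‖⁻¹ * (b * ‖blk b x i‖ ^ 2)| ≤ 4 := by
      rw [abs_le] at h4 h2 ⊢; constructor <;> linarith
    have h6 := abs_inv_mul_sub_le hη.le hη1 hxx h5
    rw [h1]
    rw [abs_le] at h3 h4 h6 ⊢
    constructor <;> linarith
  · intro i
    have h0 : blk b (‖x‖⁻¹ • x) i = ‖x‖⁻¹ • blk b x i := rfl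
    have h1 : √(b : ℝ) * inner ℝ (blk b (‖x‖⁻¹ • x) i) (u i : EuclideanSpace ℝ (Block d b i)) =
        ‖x‖⁻¹ * (√(b : ℝ) * inner ℝ (blk b x i) (u i : EuclideanSpace ℝ (Block d b i))) := by
      rw [h0, inner_smul_left]; simp only [conj_trivial]; ring
    have h3 := q2 i
    have h2 : |√(b : ℝ) * inner ℝ (blk b x i) (u i : EuclideanSpace ℝ (Block d b i))| ≤ 2 := by
      rw [abs_le] at h3 ⊢; constructor <;> linarith
    have h4 := abs_inv_mul_sub_le hη.le hη1 hxx h2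
    rw [h1]
    rw [abs_le] at h3 h4 ⊢
    constructor <;> linarith

end BlockWedge

/-! ### Subexponential scales -/

/-- `log₂ d`. -/
def ell (d : ℕ) : ℝ := Real.logb 2 d

/-- The factor `2^{d / log₂ d}`. -/
def Lam (d : ℕ) : ℝ := 2 ^ ((d : ℝ) / ell d)

theorem tol_eq (d : ℕ) : tol d = 1 / ell d ^ 2 := rfl

theorem tendsto_ell : Tendsto ell atTop atTop := by
  exact (Real.tendsto_logb_atTop (b := 2) (by norm_num)).comp
    (tendsto_natCast_atTop_atTop (R := ℝ))

theorem eventually_le_ell (C : ℝ) : ∀ᶠ d in atTop, C ≤ ell d := tendsto_ell.eventually_ge_atTop C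

theorem eventually_mul_ell_pow_le (C : ℝ) (n : ℕ) : ∀ᶠ d : ℕ in atTop, C * ell d ^ n ≤ d := by
  have h1 := (Real.isLittleO_pow_log_id_atTop (n := n)).comp_tendsto (tendsto_natCast_atTop_atTop (R := ℝ))
  have hl : 0 < Real.log 2 := Real.log_pos (by norm_num)
  have hc : 0 < Real.log 2 ^ n / (|C| + 1) := by positivity
  filter_upwards [h1.bound hc, eventually_le_ell 1] with d hd hd1
  simp only [Function.comp, id, Real.norm_eq_abs] at hd
  rw [abs_of_nonneg (a := (d : ℝ)) (Nat.cast_nonneg d)] at hd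
  have h2 : Real.log d = ell d * Real.log 2 := by
    unfold ell; rw [Real.logb]; field_simp
  rw [h2, abs_of_nonneg (by positivity), mul_pow] at hd
  have h3 : ell d ^ n * Real.log 2 ^ n * (|C| + 1) ≤ Real.log 2 ^ n * d := by
    calc ell d ^ n * Real.log 2 ^ n * (|C| + 1) ≤
          Real.log 2 ^ n / (|C| + 1) * d * (|C| + 1) := by gcongr
      _ = _ := by field_simp
  have h4 : ell d ^ n * (|C| + 1) ≤ d := by
    have : 0 < Real.log 2 ^ n := by positivity
    refine le_of_mul_le_mul_left ?_ this
    linarith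
  have h5 : C * ell d ^ n ≤ (|C| + 1) * ell d ^ n := by
    gcongr; linarith [le_abs_self C]
  linarith

theorem Lam_pos (d : ℕ) : 0 < Lam d := by unfold Lam; positivity

theorem Lam_eq_exp (d : ℕ) : Lam d = Real.exp (Real.log 2 * (d / ell d)) := by
  rw [Lam, Real.rpow_def_of_pos (by norm_num)]

theorem eventually_mul_exp_le_Lam (C : ℝ) {c : ℝ} (hc : 0 < c) :
    ∀ᶠ d : ℕ in atTop, C * Real.exp (C * (d / ell d ^ 2)) ≤ Lam d ^ c := by
  have hl : 0 < Real.log 2 := Real.log_pos (by norm_num)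
  filter_upwards [eventually_le_ell 1, eventually_le_ell (2 * |C| / (Real.log 2 * c)),
    eventually_mul_ell_pow_le 1 2] with d h1 h2 h3
  have h0 : 0 < ell d := by linarith
  have hq : 1 ≤ (d : ℝ) / ell d ^ 2 := by rw [le_div_iff₀ (by positivity)]; linarith
  have hC : C ≤ Real.exp (|C| * (d / ell d ^ 2)) := by
    calc C ≤ |C| * (d / ell d ^ 2) := (le_abs_self C).trans (le_mul_of_one_le_right (abs_nonneg C) hq)
      _ ≤ |C| * (d / ell d ^ 2) + 1 := by linarith
      _ ≤ _ := Real.add_one_le_exp _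
  rw [Lam_eq_exp, ← Real.exp_mul]
  calc C * Real.exp (C * (d / ell d ^ 2)) ≤
        Real.exp (|C| * (d / ell d ^ 2)) * Real.exp (|C| * (d / ell d ^ 2)) := by
        gcongr; exact le_abs_self C
    _ = Real.exp (2 * |C| * (d / ell d ^ 2)) := by rw [← Real.exp_add]; congr 1; ring
    _ ≤ _ := by
        rw [div_le_iff₀ (by positivity)] at h2
        refine Real.exp_le_exp.2 ?_
        calc 2 * |C| * (d / ell d ^ 2) ≤ (ell d * (Real.log 2 * c)) * (d / ell d ^ 2) := by gcongr
          _ = _ := by field_simp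

theorem eventually_exp_neg_le (C : ℝ) (n : ℕ) :
    ∀ᶠ d : ℕ in atTop, Real.exp (-(d / ell d ^ n)) * (C * d) ≤ 1 := by
  filter_upwards [eventually_le_ell 1, eventually_le_ell C,
    eventually_mul_ell_pow_le 2 (n + 1), eventually_ge_atTop 1] with d h1 h2 h3 h4
  have h0 : 0 < ell d := by linarith
  have hd : (0 : ℝ) < d := by exact_mod_cast h4
  have h5 : (d : ℝ) ≤ Real.exp (ell d) := by
    have : (d : ℝ) = Real.exp (ell d * Real.log 2) := by
      rw [show ell d * Real.log 2 = Real.log d by unfold ell; rw [Real.logb]; field_simp,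
        Real.exp_log hd]
    rw [this]
    gcongr
    have := Real.log_two_lt_d9
    exact mul_le_of_le_one_right h0.le (by linarith)
  have h6 : C ≤ Real.exp (ell d) := h2.trans (by linarith [Real.add_one_le_exp (ell d)])
  calc Real.exp (-(d / ell d ^ n)) * (C * d) ≤
        Real.exp (-(d / ell d ^ n)) * (Real.exp (ell d) * Real.exp (ell d)) := by gcongr
    _ = Real.exp (2 * ell d - d / ell d ^ n) := by
        rw [← Real.exp_add, ← Real.exp_add]; congr 1; ring
    _ ≤ 1 := by
        rw [Real.exp_le_one_iff, sub_nonpos, le_div_iff₀ (by positivity)]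
        calc _ = 2 * ell d ^ (n + 1) := by ring
          _ ≤ _ := h3

theorem natLog_le_ell (d : ℕ) : (Nat.log 2 d : ℝ) ≤ ell d := by
  exact_mod_cast Real.natLog_le_logb d 2

/-- Perturbing the base of a power from above. -/
theorem rpow_add_le_mul_exp {X E k n : ℝ} (hk : 0 < k) (hX : k ≤ X) (hE : 0 ≤ E) (hn : 0 ≤ n) :
    (X + E) ^ n ≤ X ^ n * Real.exp (n * E / k) := by
  have hX0 : 0 < X := hk.trans_le hX
  have h1 : X + E ≤ X * Real.exp (E / k) := by
    have h2 := Real.add_one_le_exp (E / k)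
    calc X + E ≤ X + X * (E / k) := by
          gcongr
          rw [mul_div_assoc', le_div_iff₀ hk, mul_comm]
          gcongr
      _ = X * (E / k + 1) := by ring
      _ ≤ _ := by gcongr
  calc (X + E) ^ n ≤ (X * Real.exp (E / k)) ^ n := Real.rpow_le_rpow (by linarith) h1 hn
    _ = _ := by
      rw [Real.mul_rpow hX0.le (Real.exp_pos _).le, ← Real.exp_mul]
      congr 2; ring

/-- Perturbing the base of a power from below. -/
theorem mul_exp_le_rpow_sub {X E k n : ℝ} (hk : 0 < k) (hX : k ≤ X) (hE : 0 ≤ E) (hEk : 2 * E ≤ k)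
    (hn : 0 ≤ n) :
    X ^ n * Real.exp (-(2 * n * E / k)) ≤ (X - E) ^ n := by
  have hX0 : 0 < X := hk.trans_le hX
  have hXE : 0 < X - E := by linarith
  have h1 := rpow_add_le_mul_exp (X := X - E) (E := E) (k := k / 2) (n := n) (by linarith)
    (by linarith) hE hn
  rw [sub_add_cancel] at h1
  rw [Real.exp_neg, ← div_eq_mul_inv, div_le_iff₀ (Real.exp_pos _)]
  rwa [show 2 * n * E / k = n * E / (k / 2) by field_simp]

theorem exp_le_one_add_pow_inv {η : ℝ} (hη : 0 ≤ η) (n : ℕ) :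
    Real.exp (-(5 * η * n)) ≤ ((1 + 5 * η) ^ n)⁻¹ := by
  rw [Real.exp_neg]
  gcongr
  calc (1 + 5 * η) ^ n ≤ Real.exp (5 * η) ^ n := by
        gcongr; linarith [Real.add_one_le_exp (5 * η)]
    _ = _ := by rw [← Real.exp_nat_mul]; congr 1; ring

/-! ### Product measures: integrating out single coordinates -/

section PiUpdate

open Function

variable {ι : Type*} [Fintype ι] [DecidableEq ι] {X : ι → Type*} [∀ i, MeasurableSpace (X i)]
  (μ : ∀ i, Measure (X i)) [∀ i, IsProbabilityMeasure (μ i)]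

theorem lintegral_pi_update {F : (∀ i, X i) → ℝ≥0∞} (hF : Measurable F) (i : ι) :
    ∫⁻ f, F f ∂Measure.pi μ = ∫⁻ f, ∫⁻ t, F (update f i t) ∂μ i ∂Measure.pi μ := by
  have hG : Measurable fun f => ∫⁻ t, F (update f i t) ∂μ i := by
    have := hF.lmarginal μ (s := {i})
    simpa only [lmarginal_singleton] using this
  refine lintegral_eq_of_lmarginal_eq {i} hF hG ?_
  ext f
  rw [lmarginal_singleton, lmarginal_singleton]
  simp

theorem lintegral_pi_le_of_update {F G : (∀ i, X i) → ℝ≥0∞} (hF : Measurable F) (i : ι)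
    (h : ∀ f, ∫⁻ t, F (update f i t) ∂μ i ≤ G f) :
    ∫⁻ f, F f ∂Measure.pi μ ≤ ∫⁻ f, G f ∂Measure.pi μ := by
  rw [lintegral_pi_update μ hF i]
  exact lintegral_mono h

theorem lintegral_pi_prod_le (g : (∀ i, X i) → ∀ i, X i → ℝ≥0∞) (s : Finset ι)
    (hm : ∀ i, Measurable fun f => g f i (f i)) (a : ι → ℝ≥0∞)
    (hg : ∀ f, ∀ i ∈ s, ∀ t, g (update f i t) = g f)
    (ha : ∀ f, ∀ i ∈ s, ∫⁻ t, g f i t ∂μ i ≤ a i) :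
    ∫⁻ f, ∏ i ∈ s, g f i (f i) ∂Measure.pi μ ≤ ∏ i ∈ s, a i := by
  induction s using Finset.induction_on with
  | empty => simp
  | insert i s his ih =>
    have hms : Measurable fun f => ∏ j ∈ insert i s, g f j (f j) :=
      Finset.measurable_fun_prod _ fun j _ => hm j
    have hms' : Measurable fun f => ∏ j ∈ s, g f j (f j) :=
      Finset.measurable_fun_prod _ fun j _ => hm j
    rw [Finset.prod_insert his]
    refine (lintegral_pi_le_of_update μ (G := fun f => a i * ∏ j ∈ s, g f j (f j)) hms i
      fun f => ?_).trans ?_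
    · have : ∀ t, ∏ j ∈ insert i s, g (update f i t) j (update f i t j) =
          g f i t * ∏ j ∈ s, g f j (f j) := by
        intro t
        rw [hg f i (Finset.mem_insert_self i s) t, Finset.prod_insert his, update_self]
        congr 1
        refine Finset.prod_congr rfl fun j hj => ?_
        rw [update_of_ne]
        rintro rfl; exact his hj
      simp only [this]
      rw [lintegral_mul_const'']
      · gcongr
        exact ha f i (Finset.mem_insert_self i s)
      · have h1 := (hm i).comp (measurable_update f (a := i))
        have h2 : (fun t => g (update f i t) i (update f i t i)) = g f i := by
          ext t; rw [hg f i (Finset.mem_insert_self i s) t, update_self]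
        have h3 : Measurable fun t => g (update f i t) i (update f i t i) := h1
        rw [h2] at h3
        exact h3.aemeasurable
    · rw [lintegral_const_mul _ hms']
      gcongr
      exact ih (fun f j hj => hg f j (Finset.mem_insert_of_mem hj))
        (fun f j hj => ha f j (Finset.mem_insert_of_mem hj))

theorem lintegral_pi_prod_eq (g : ∀ i, X i → ℝ≥0∞) (s : Finset ι) (hm : ∀ i, Measurable (g i)) :
    ∫⁻ f, ∏ i ∈ s, g i (f i) ∂Measure.pi μ = ∏ i ∈ s, ∫⁻ t, g i t ∂μ i := by
  induction s using Finset.induction_on with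
  | empty => simp
  | insert i s his ih =>
    have hms : Measurable fun f : ∀ i, X i => ∏ j ∈ insert i s, g j (f j) :=
      Finset.measurable_fun_prod _ fun j _ => (hm j).comp (measurable_pi_apply j)
    have hms' : Measurable fun f : ∀ i, X i => ∏ j ∈ s, g j (f j) :=
      Finset.measurable_fun_prod _ fun j _ => (hm j).comp (measurable_pi_apply j)
    rw [Finset.prod_insert his, lintegral_pi_update μ hms i, ← ih, ← lintegral_const_mul _ hms']
    refine lintegral_congr fun f => ?_
    have : ∀ t, ∏ j ∈ insert i s, g j (update f i t j) = g i t * ∏ j ∈ s, g j (f j) := by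
      intro t
      rw [Finset.prod_insert his, update_self]
      congr 1
      refine Finset.prod_congr rfl fun j hj => ?_
      rw [update_of_ne]
      rintro rfl; exact his hj
    simp only [this]
    rw [lintegral_mul_const _ (hm i)]

end PiUpdate

/-! ### Chernoff bounds -/

section Chernoff

open Function

variable {ι : Type*} [Fintype ι] [DecidableEq ι] {S : Type*} [MeasurableSpace S]
  (μ : Measure S) [IsProbabilityMeasure μ]

open Classical in
theorem pi_card_ge_le (s : Finset ι) (D : (ι → S) → Set S)
    (hD : ∀ i, MeasurableSet {f : ι → S | f i ∈ D f}) (hDm : ∀ f, MeasurableSet (D f))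
    (hDs : ∀ f, ∀ i ∈ s, ∀ t, D (update f i t) = D f)
    {p : ℝ} (hp : 0 ≤ p) (hμ : ∀ f, μ (D f) ≤ ENNReal.ofReal p) (T : ℝ) :
    Measure.pi (fun _ : ι => μ) {f | T ≤ (s.filter fun i => f i ∈ D f).card} ≤
      ENNReal.ofReal (Real.exp (s.card * p) / 2 ^ T) := by
  let g : (ι → S) → ι → S → ℝ≥0∞ := fun f _ t => 1 + (D f).indicator (1 : S → ℝ≥0∞) t
  have hm : ∀ i, Measurable fun f => g f i (f i) := by
    intro i
    have : (fun f : ι → S => g f i (f i)) =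
        fun f => 1 + {f : ι → S | f i ∈ D f}.indicator (1 : (ι → S) → ℝ≥0∞) f := by
      ext f; simp [g, indicator]
    rw [this]
    exact Measurable.add measurable_const
      ((measurable_one : Measurable (1 : (ι → S) → ℝ≥0∞)).indicator (hD i))
  have hint : ∫⁻ f, ∏ i ∈ s, g f i (f i) ∂Measure.pi (fun _ : ι => μ) ≤
      ∏ i ∈ s, ENNReal.ofReal (Real.exp p) := by
    refine lintegral_pi_prod_le (fun _ : ι => μ) g s hm _ ?_ ?_
    · intro f i hi t
      ext j x; simp only [g]; rw [hDs f i hi t]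
    · intro f i _
      simp only [g]
      rw [lintegral_add_left measurable_const, lintegral_const, measure_univ, one_mul,
        lintegral_indicator_one (hDm f)]
      calc 1 + μ (D f) ≤ ENNReal.ofReal 1 + ENNReal.ofReal p := by
            rw [ENNReal.ofReal_one]; gcongr; exact hμ f
        _ = ENNReal.ofReal (1 + p) := (ENNReal.ofReal_add zero_le_one hp).symm
        _ ≤ _ := ENNReal.ofReal_le_ofReal (by linarith [Real.add_one_le_exp p])
  have hprod : ∀ f, ∏ i ∈ s, g f i (f i) = 2 ^ (s.filter fun i => f i ∈ D f).card := by
    intro f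
    rw [← Finset.prod_const, Finset.prod_filter]
    refine Finset.prod_congr rfl fun i _ => ?_
    by_cases h : f i ∈ D f <;> simp [g, h, one_add_one_eq_two]
  have hmark := meas_ge_le_lintegral_div (μ := Measure.pi (fun _ : ι => μ))
    (f := fun f => ∏ i ∈ s, g f i (f i)) (Finset.measurable_fun_prod _ fun j _ => hm j).aemeasurable
    (ε := ENNReal.ofReal ((2 : ℝ) ^ T)) (by simp; positivity) ENNReal.ofReal_ne_top
  refine (measure_mono ?_).trans (hmark.trans ?_)
  · intro f hf
    rw [mem_ofPred_eq] at hf ⊢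
    rw [hprod, ← ENNReal.ofReal_ofNat 2, ← ENNReal.ofReal_pow (by norm_num), ← Real.rpow_natCast]
    exact ENNReal.ofReal_le_ofReal (Real.rpow_le_rpow_of_exponent_le (by norm_num) hf)
  · refine (ENNReal.div_le_div_right hint _).trans ?_
    rw [Finset.prod_const, ← ENNReal.ofReal_pow (Real.exp_pos _).le, ← Real.exp_nat_mul,
      ENNReal.ofReal_div_of_pos (by positivity)]

open Classical in
theorem pi_card_le_le {D : Set S} (hD : MeasurableSet D) {p : ℝ} (hp : 0 ≤ p)
    (hμ : ENNReal.ofReal p ≤ μ D) :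
    Measure.pi (fun _ : ι => μ)
        {f | ((Finset.univ.filter fun i => f i ∈ D).card : ℝ) ≤ Fintype.card ι * p / 4} ≤
      ENNReal.ofReal (Real.exp (-(Fintype.card ι * p / 4))) := by
  let g : ι → S → ℝ≥0∞ := fun _ t => D.indicator (fun _ => ENNReal.ofReal (1 / 2)) t +
    Dᶜ.indicator 1 t
  have hm : ∀ i, Measurable (g i) := fun i =>
    (measurable_const.indicator hD).add (measurable_one.indicator hD.compl)
  have hp1 : p ≤ 1 := by
    have := hμ.trans prob_le_one
    rwa [← ENNReal.ofReal_one, ENNReal.ofReal_le_ofReal_iff zero_le_one] at this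
  have hreal : p ≤ μ.real D := (ENNReal.ofReal_le_iff_le_toReal (measure_ne_top _ _)).1 hμ
  have hint : ∀ i, ∫⁻ t, g i t ∂μ ≤ ENNReal.ofReal (Real.exp (-p / 2)) := by
    intro i
    simp only [g]
    rw [lintegral_add_left (measurable_const.indicator hD), lintegral_indicator_const hD,
      lintegral_indicator_one hD.compl]
    rw [← ENNReal.ofReal_toReal (measure_ne_top μ D), ← ENNReal.ofReal_toReal (measure_ne_top μ Dᶜ),
      ← ENNReal.ofReal_mul (by norm_num), ← ENNReal.ofReal_add (by positivity) (by positivity)]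
    refine ENNReal.ofReal_le_ofReal ?_
    have h1 : (μ Dᶜ).toReal = 1 - μ.real D := by
      have := measureReal_compl (μ := μ) hD
      simpa [measureReal_def] using this
    rw [h1]
    have h2 : (μ D).toReal = μ.real D := rfl
    rw [h2]
    linarith [Real.add_one_le_exp (-p / 2)]
  have hprod : ∀ f : ι → S, ∏ i, g i (f i) =
      ENNReal.ofReal (1 / 2) ^ (Finset.univ.filter fun i => f i ∈ D).card := by
    intro f
    rw [← Finset.prod_const, Finset.prod_filter]
    refine Finset.prod_congr rfl fun i _ => ?_
    by_cases h : f i ∈ D <;> simp [g, h]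
  set T : ℝ := Fintype.card ι * p / 4 with hT
  have hmeas : Measurable fun f : ι → S => ∏ i, g i (f i) :=
    Finset.measurable_fun_prod _ fun j _ => (hm j).comp (measurable_pi_apply j)
  have hmark := meas_ge_le_lintegral_div (μ := Measure.pi (fun _ : ι => μ))
    (f := fun f => ∏ i, g i (f i)) hmeas.aemeasurable
    (ε := ENNReal.ofReal ((1 / 2) ^ T)) (by simp; positivity) ENNReal.ofReal_ne_top
  refine (measure_mono ?_).trans (hmark.trans ?_)
  · intro f hf
    rw [mem_ofPred_eq] at hf ⊢
    rw [hprod, ← ENNReal.ofReal_pow (by norm_num), ← Real.rpow_natCast]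
    exact ENNReal.ofReal_le_ofReal
      (Real.rpow_le_rpow_of_exponent_ge (by norm_num) (by norm_num) hf)
  · rw [lintegral_pi_prod_eq (fun _ : ι => μ) g Finset.univ hm]
    refine (ENNReal.div_le_div_right (Finset.prod_le_prod' fun i _ => hint i) _).trans ?_
    rw [Finset.prod_const, ← ENNReal.ofReal_pow (Real.exp_pos _).le, ← Real.exp_nat_mul,
      ← ENNReal.ofReal_div_of_pos (by positivity)]
    refine ENNReal.ofReal_le_ofReal ?_
    rw [div_le_iff₀ (by positivity), Finset.card_univ, one_div, Real.inv_rpow (by norm_num),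
      ← Real.rpow_neg (by norm_num)]
    have h2 : Real.exp (-T) ≤ 2 ^ (-T) := by
      have hT0 : 0 ≤ T := by positivity
      rw [Real.exp_neg, Real.rpow_neg (by norm_num)]
      gcongr
      rw [Real.rpow_def_of_pos (by norm_num)]
      gcongr
      have := Real.log_two_lt_d9
      nlinarith
    calc Real.exp (Fintype.card ι * (-p / 2)) = Real.exp (-T) * Real.exp (-T) := by
          rw [← Real.exp_add]; congr 1; rw [hT]; ring
      _ ≤ _ := by gcongr

end Chernoff

/-! ### Second moments of counts of pairs and triples of independent points -/

section Overlap

open Function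

variable {S ι : Type*} [MeasurableSpace S] [Fintype ι] [DecidableEq ι]
  (ν : Measure S) [IsProbabilityMeasure ν]

theorem update_eq_of_ne {a c : ι} (h : a ≠ c) (f : ι → S) (t : S) : update f c t a = f a :=
  update_of_ne h t f

theorem measurable_eval₂ {p : S → S → ℝ≥0∞} (hp : Measurable (uncurry p)) (a b : ι) :
    Measurable fun f : ι → S => p (f a) (f b) := by
  have ha : ∀ a : ι, Measurable fun f : ι → S => f a := fun a => measurable_pi_apply a
  exact hp.comp ((ha a).prodMk (ha b))

theorem measurable_eval₃ {q : S → S → S → ℝ≥0∞}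
    (hq : Measurable fun t : S × S × S => q t.1 t.2.1 t.2.2) (a b c : ι) :
    Measurable fun f : ι → S => q (f a) (f b) (f c) := by
  have ha : ∀ a : ι, Measurable fun f : ι → S => f a := fun a => measurable_pi_apply a
  exact hq.comp ((ha a).prodMk ((ha b).prodMk (ha c)))

theorem measurable_section_left {p : S → S → ℝ≥0∞} (hp : Measurable (uncurry p)) (x : S) :
    Measurable fun y => p x y :=
  hp.comp (measurable_const.prodMk measurable_id)

theorem measurable_section_right {p : S → S → ℝ≥0∞} (hp : Measurable (uncurry p)) (y : S) :
    Measurable fun x => p x y :=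
  hp.comp (measurable_id.prodMk measurable_const)

variable {p : S → S → ℝ≥0∞} {q : S → S → S → ℝ≥0∞} {B B' : S → ℝ≥0∞} {w w' : ℝ≥0∞}

theorem lintegral_eval₁ {g : S → ℝ≥0∞} (hg : Measurable g) (a : ι) :
    ∫⁻ f : ι → S, g (f a) ∂Measure.pi (fun _ => ν) = ∫⁻ t, g t ∂ν := by
  rw [lintegral_pi_update (fun _ : ι => ν) (F := fun f => g (f a))
    (hg.comp (measurable_pi_apply a)) a]
  simp

theorem lintegral_eval₂_le (hp : Measurable (uncurry p)) (h1 : ∀ x, ∫⁻ y, p x y ∂ν ≤ w)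
    {a b : ι} (hab : a ≠ b) :
    ∫⁻ f : ι → S, p (f a) (f b) ∂Measure.pi (fun _ => ν) ≤ w := by
  refine (lintegral_pi_le_of_update (fun _ : ι => ν) (G := fun _ => w)
    (measurable_eval₂ hp a b) b fun f => ?_).trans (by simp)
  simpa [update_eq_of_ne hab] using h1 (f a)

theorem lintegral_pair_fst_le (hp : Measurable (uncurry p)) (h1 : ∀ x, ∫⁻ y, p x y ∂ν ≤ w)
    {a a' b b' : ι} (hab : a ≠ b) (hab' : a ≠ b') (ha'b' : a' ≠ b') (hbb : b ≠ b') :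
    ∫⁻ f : ι → S, p (f a) (f b) * p (f a') (f b') ∂Measure.pi (fun _ => ν) ≤ w ^ 2 := by
  refine (lintegral_pi_le_of_update (fun _ : ι => ν) (G := fun f => p (f a) (f b) * w)
    ((measurable_eval₂ hp a b).mul (measurable_eval₂ hp a' b')) b' fun f => ?_).trans ?_
  · simp only [Pi.mul_apply, update_eq_of_ne hab', update_eq_of_ne hbb, update_eq_of_ne ha'b', update_self]
    rw [lintegral_const_mul _ (measurable_section_left hp _)]
    gcongr
    exact h1 _
  · rw [lintegral_mul_const _ (measurable_eval₂ hp a b), sq]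
    gcongr
    exact lintegral_eval₂_le ν hp h1 hab

theorem lintegral_pair_snd_le (hp : Measurable (uncurry p)) (hB : Measurable B)
    (h2 : ∀ y, ∫⁻ x, p x y ∂ν ≤ B y * w)
    {a a' b : ι} (hab : a ≠ b) (ha'b : a' ≠ b) (haa : a ≠ a') :
    ∫⁻ f : ι → S, p (f a) (f b) * p (f a') (f b) ∂Measure.pi (fun _ => ν) ≤
      (∫⁻ y, B y ^ 2 ∂ν) * w ^ 2 := by
  have hBm : Measurable fun f : ι → S => B (f b) := hB.comp (measurable_pi_apply b)
  refine (lintegral_pi_le_of_update (fun _ : ι => ν) (G := fun f => p (f a) (f b) * (B (f b) * w))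
    ((measurable_eval₂ hp a b).mul (measurable_eval₂ hp a' b)) a' fun f => ?_).trans ?_
  · simp only [Pi.mul_apply, update_eq_of_ne ha'b.symm, update_eq_of_ne haa, update_self]
    rw [lintegral_const_mul _ (measurable_section_right hp _)]
    gcongr
    exact h2 _
  refine (lintegral_pi_le_of_update (fun _ : ι => ν) (G := fun f => B (f b) ^ 2 * w ^ 2)
    ((measurable_eval₂ hp a b).mul (hBm.mul_const w)) a fun f => ?_).trans ?_
  · simp only [Pi.mul_apply, update_eq_of_ne hab.symm, update_self]
    rw [lintegral_mul_const _ (measurable_section_right hp _)]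
    calc _ ≤ B (f b) * w * (B (f b) * w) := by gcongr; exact h2 _
      _ = _ := by ring
  · rw [lintegral_mul_const _ (hBm.pow_const 2),
      lintegral_eval₁ ν (g := fun y => B y ^ 2) (hB.pow_const 2)]

theorem lintegral_mul_third_le {c : ι} (hq : Measurable fun t : S × S × S => q t.1 t.2.1 t.2.2)
    (h3 : ∀ x y, ∫⁻ z, q x y z ∂ν ≤ w') {a b : ι} (hac : a ≠ c) (hbc : b ≠ c)
    {G : (ι → S) → ℝ≥0∞} (hG : Measurable G) (hGc : ∀ f t, G (update f c t) = G f) :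
    ∫⁻ f : ι → S, G f * q (f a) (f b) (f c) ∂Measure.pi (fun _ => ν) ≤
      (∫⁻ f : ι → S, G f ∂Measure.pi (fun _ => ν)) * w' := by
  rw [← lintegral_mul_const _ hG]
  refine lintegral_pi_le_of_update (fun _ : ι => ν)
    (hG.mul (measurable_eval₃ hq a b c)) c fun f => ?_
  simp only [update_eq_of_ne hac, update_eq_of_ne hbc, update_self, hGc]
  have hqm : Measurable fun t => q (f a) (f b) t :=
    (hq.comp ((measurable_const (a := f a)).prodMk
      ((measurable_const (a := f b)).prodMk measurable_id)) :)
  rw [lintegral_const_mul _ hqm]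
  gcongr
  exact h3 _ _

theorem lintegral_mul_pair_le {a b c : ι} (hp : Measurable (uncurry p))
    (hq : Measurable fun t : S × S × S => q t.1 t.2.1 t.2.2)
    (h4 : ∀ z, ∫⁻ x, ∫⁻ y, p x y * q x y z ∂ν ∂ν ≤ B z * (w * w'))
    (hab : a ≠ b) (hac : a ≠ c) (hbc : b ≠ c)
    {G : (ι → S) → ℝ≥0∞} (hG : Measurable G) (hGa : ∀ f t, G (update f a t) = G f)
    (hGb : ∀ f t, G (update f b t) = G f) :
    ∫⁻ f : ι → S, G f * (p (f a) (f b) * q (f a) (f b) (f c)) ∂Measure.pi (fun _ => ν) ≤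
      ∫⁻ f : ι → S, G f * (B (f c) * (w * w')) ∂Measure.pi (fun _ => ν) := by
  have hpq : Measurable fun t : (S × S) × S => p t.1.1 t.2 * q t.1.1 t.2 t.1.2 :=
    (hp.comp (measurable_fst.fst.prodMk measurable_snd)).mul
      (hq.comp (measurable_fst.fst.prodMk (measurable_snd.prodMk measurable_fst.snd)))
  have hI : Measurable fun t : S × S => ∫⁻ y, p t.1 y * q t.1 y t.2 ∂ν := hpq.lintegral_prod_right'
  have ha : ∀ a : ι, Measurable fun f : ι → S => f a := fun a => measurable_pi_apply a
  have hm : Measurable fun f : ι → S => ∫⁻ y, p (f a) y * q (f a) y (f c) ∂ν :=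
    hI.comp ((ha a).prodMk (ha c))
  refine (lintegral_pi_le_of_update (fun _ : ι => ν)
    (G := fun f => G f * ∫⁻ y, p (f a) y * q (f a) y (f c) ∂ν)
    (hG.mul ((measurable_eval₂ hp a b).mul (measurable_eval₃ hq a b c))) b fun f => ?_).trans ?_
  · simp only [Pi.mul_apply, update_eq_of_ne hab, update_eq_of_ne hbc.symm, update_self, hGb]
    rw [lintegral_const_mul]
    exact hpq.comp ((measurable_const (a := (f a, f c))).prodMk measurable_id)
  refine lintegral_pi_le_of_update (fun _ : ι => ν) (hG.mul hm) a fun f => ?_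
  simp only [update_eq_of_ne hac.symm, update_self, hGa]
  have hIc : Measurable fun t => ∫⁻ y, p t y * q t y (f c) ∂ν :=
    hI.comp (measurable_id.prodMk measurable_const)
  rw [lintegral_const_mul _ hIc]
  gcongr
  exact h4 _

/-- The overlap bound: two triples of indices give nearly independent triples of points, up to a
factor `n` for every shared index. -/
theorem lintegral_triple_mul_triple_le {n : ℝ≥0∞} (hp : Measurable (uncurry p))
    (hq : Measurable fun t : S × S × S => q t.1 t.2.1 t.2.2) (hB : Measurable B)
    (hB' : Measurable B') (hp1 : ∀ x y, p x y ≤ 1) (hq1 : ∀ x y z, q x y z ≤ 1)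
    (h1 : ∀ x, ∫⁻ y, p x y ∂ν ≤ w) (h2 : ∀ y, ∫⁻ x, p x y ∂ν ≤ B y * w)
    (h3 : ∀ x y, ∫⁻ z, q x y z ∂ν ≤ w')
    (h4 : ∀ z, ∫⁻ x, ∫⁻ y, p x y * q x y z ∂ν ∂ν ≤ B' z * (w * w'))
    (hn : 1 ≤ n) (hnw : 1 ≤ n * w) (hnw' : 1 ≤ n ^ 2 * w')
    {a b c a' b' c' : ι} (hab : a ≠ b) (hac : a ≠ c) (hbc : b ≠ c) (hab' : a' ≠ b')
    (hac' : a' ≠ c') (hbc' : b' ≠ c') (xab : a ≠ b') (xac : a ≠ c') (xbc : b ≠ c')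
    (xba : a' ≠ b) (xca : a' ≠ c) (xcb : b' ≠ c) :
    ∫⁻ f : ι → S, (p (f a) (f b) * q (f a) (f b) (f c)) *
        (p (f a') (f b') * q (f a') (f b') (f c')) ∂Measure.pi (fun _ => ν) ≤
      (1 + ∫⁻ y, B y ^ 2 ∂ν + ∫⁻ z, B' z ^ 2 ∂ν) * (w * w') ^ 2 *
        ((if a = a' then n else 1) * (if b = b' then n else 1) * (if c = c' then n else 1)) := by
  set β := ∫⁻ y, B y ^ 2 ∂ν
  set β' := ∫⁻ y, B' y ^ 2 ∂ν
  have mp := fun a b => measurable_eval₂ (ι := ι) hp a b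
  have mq := fun a b c => measurable_eval₃ (ι := ι) hq a b c
  have hna : ∀ a b : ι, 1 ≤ (if a = b then n else 1) := fun a b => by split_ifs <;> simp [hn]
  have one1 : (1 : ℝ≥0∞) ≤ 1 + β + β' := by rw [add_assoc]; exact le_self_add
  have oneβ : β ≤ 1 + β + β' := by rw [add_comm 1, add_assoc]; exact le_self_add
  have oneβ' : β' ≤ 1 + β + β' := le_add_self
  by_cases hc : c = c'
  · subst hc
    by_cases hab2 : a ≠ a' ∧ b ≠ b'
    · obtain ⟨haa, hbb⟩ := hab2
      have hBm : Measurable fun f : ι → S => B' (f c) * (w * w') :=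
        (hB'.comp (measurable_pi_apply c)).mul_const _
      refine (lintegral_mul_pair_le ν hp hq h4 hab' xca xcb
        (G := fun f => p (f a) (f b) * q (f a) (f b) (f c)) ((mp a b).mul (mq a b c))
        (fun f t => by simp [update_eq_of_ne haa, update_eq_of_ne xba.symm, update_eq_of_ne xca.symm])
        (fun f t => by simp [update_eq_of_ne xab, update_eq_of_ne hbb, update_eq_of_ne xcb.symm])).trans ?_
      simp_rw [mul_comm (p _ _ * q _ _ _) (B' _ * _)]
      refine (lintegral_mul_pair_le ν hp hq h4 hab hac hbc
        (G := fun f => B' (f c) * (w * w')) hBm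
        (fun f t => by simp [update_eq_of_ne hac.symm])
        (fun f t => by simp [update_eq_of_ne hbc.symm])).trans ?_
      have e : ∀ f : ι → S, B' (f c) * (w * w') * (B' (f c) * (w * w')) =
          B' (f c) ^ 2 * (w * w') ^ 2 := fun f => by ring
      simp_rw [e]
      have hBc : Measurable fun f : ι → S => B' (f c) := hB'.comp (measurable_pi_apply c)
      rw [lintegral_mul_const _ (hBc.pow_const 2),
        lintegral_eval₁ ν (g := fun y => B' y ^ 2) (hB'.pow_const 2)]
      calc β' * (w * w') ^ 2 = β' * (w * w') ^ 2 * (1 * 1 * 1) := by ring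
        _ ≤ _ := by gcongr <;> first | apply hna | simp [hn]
    · have hdrop : ∫⁻ f : ι → S, (p (f a) (f b) * q (f a) (f b) (f c)) *
          (p (f a') (f b') * q (f a') (f b') (f c)) ∂Measure.pi (fun _ => ν) ≤
          (∫⁻ f : ι → S, p (f a) (f b) * p (f a') (f b') ∂Measure.pi (fun _ => ν)) * w' := by
        refine le_trans (lintegral_mono fun f => ?_) (lintegral_mul_third_le ν hq h3 hac hbc
          (G := fun f => p (f a) (f b) * p (f a') (f b')) ((mp a b).mul (mp a' b')) (fun f t => by
            simp [update_eq_of_ne hac, update_eq_of_ne hbc, update_eq_of_ne xca, update_eq_of_ne xcb]))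
        calc _ ≤ (p (f a) (f b) * q (f a) (f b) (f c)) * (p (f a') (f b') * 1) := by
              gcongr; exact hq1 _ _ _
          _ = _ := by ring
      refine hdrop.trans ?_
      rw [if_pos rfl]
      by_cases haa : a = a'
      · subst haa
        rw [if_pos rfl]
        by_cases hbb : b = b'
        · subst hbb
          rw [if_pos rfl]
          have h5 : ∫⁻ f : ι → S, p (f a) (f b) * p (f a) (f b) ∂Measure.pi (fun _ => ν) ≤ w := by
            refine le_trans (lintegral_mono fun f => ?_) (lintegral_eval₂_le ν hp h1 hab)
            exact mul_le_of_le_one_right' (hp1 _ _)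
          calc _ ≤ w * w' := by gcongr
            _ = 1 * (w * w') * 1 * 1 := by ring
            _ ≤ (1 + β + β') * (w * w') * (n * w) * (n ^ 2 * w') := by gcongr
            _ = _ := by ring
        · rw [if_neg hbb]
          calc _ ≤ w ^ 2 * w' := by
                gcongr; exact lintegral_pair_fst_le ν hp h1 hab xab xab hbb
            _ = 1 * (w ^ 2 * w') * 1 := by ring
            _ ≤ (1 + β + β') * (w ^ 2 * w') * (n ^ 2 * w') := by gcongr
            _ = _ := by ring
      · have hbb : b = b' := by by_contra h; exact hab2 ⟨haa, h⟩
        subst hbb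
        rw [if_neg haa, if_pos rfl]
        calc _ ≤ (β * w ^ 2) * w' := by
              gcongr; exact lintegral_pair_snd_le ν hp hB h2 hab xba haa
          _ = β * (w ^ 2 * w') * 1 := by ring
          _ ≤ (1 + β + β') * (w ^ 2 * w') * (n ^ 2 * w') := by gcongr
          _ = _ := by ring
  · have hdrop : ∫⁻ f : ι → S, (p (f a) (f b) * q (f a) (f b) (f c)) *
        (p (f a') (f b') * q (f a') (f b') (f c')) ∂Measure.pi (fun _ => ν) ≤
        (∫⁻ f : ι → S, p (f a) (f b) * p (f a') (f b') ∂Measure.pi (fun _ => ν)) * w' * w' := by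
      have e : ∀ f : ι → S, (p (f a) (f b) * q (f a) (f b) (f c)) *
          (p (f a') (f b') * q (f a') (f b') (f c')) =
          (p (f a) (f b) * p (f a') (f b') * q (f a) (f b) (f c)) * q (f a') (f b') (f c') :=
        fun f => by ring
      simp_rw [e]
      refine (lintegral_mul_third_le ν hq h3 hac' hbc'
        (G := fun f => p (f a) (f b) * p (f a') (f b') * q (f a) (f b) (f c))
        (((mp a b).mul (mp a' b')).mul (mq a b c)) (fun f t => by
          simp [update_eq_of_ne xac, update_eq_of_ne xbc, update_eq_of_ne hac', update_eq_of_ne hbc',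
            update_eq_of_ne hc])).trans ?_
      gcongr
      exact lintegral_mul_third_le ν hq h3 hac hbc
        (G := fun f => p (f a) (f b) * p (f a') (f b')) ((mp a b).mul (mp a' b')) (fun f t => by
          simp [update_eq_of_ne hac, update_eq_of_ne hbc, update_eq_of_ne xca, update_eq_of_ne xcb])
    refine hdrop.trans ?_
    rw [if_neg hc]
    by_cases hbb : b = b'
    · subst hbb
      rw [if_pos (rfl : b = b)]
      by_cases haa : a = a'
      · subst haa
        rw [if_pos rfl]
        have h5 : ∫⁻ f : ι → S, p (f a) (f b) * p (f a) (f b) ∂Measure.pi (fun _ => ν) ≤ w := by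
          refine le_trans (lintegral_mono fun f => ?_) (lintegral_eval₂_le ν hp h1 hab)
          exact mul_le_of_le_one_right' (hp1 _ _)
        calc _ ≤ w * w' * w' := by gcongr
          _ = 1 * (w * w' * w') * 1 * 1 := by ring
          _ ≤ (1 + β + β') * (w * w' * w') * (n * w) * n := by gcongr
          _ = _ := by ring
      · rw [if_neg haa]
        calc _ ≤ (β * w ^ 2) * w' * w' := by
              gcongr; exact lintegral_pair_snd_le ν hp hB h2 hab xba haa
          _ = β * (w ^ 2 * w' * w') * 1 := by ring
          _ ≤ (1 + β + β') * (w ^ 2 * w' * w') * n := by gcongr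
          _ = _ := by ring
    · rw [if_neg hbb]
      calc _ ≤ w ^ 2 * w' * w' := by
            gcongr; exact lintegral_pair_fst_le ν hp h1 hab xab hab' hbb
        _ = 1 * (w ^ 2 * w' * w') * 1 := by ring
        _ ≤ (1 + β + β') * (w ^ 2 * w' * w') * (if a = a' then n else 1) := by
            gcongr; exact hna _ _
        _ = _ := by ring

theorem le_lintegral_triple (hp : Measurable (uncurry p))
    (hq : Measurable fun t : S × S × S => q t.1 t.2.1 t.2.2)
    {a b c : ι} (hab : a ≠ b) (hac : a ≠ c) (hbc : b ≠ c) :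
    ∫⁻ f : ι → S, p (f a) (f b) * q (f a) (f b) (f c) ∂Measure.pi (fun _ => ν) =
      ∫⁻ x, ∫⁻ y, p x y * ∫⁻ z, q x y z ∂ν ∂ν ∂ν := by
  have hI : Measurable fun t : S × S => ∫⁻ z, q t.1 t.2 z ∂ν :=
    (hq.comp (measurable_fst.fst.prodMk (measurable_fst.snd.prodMk measurable_snd)) :
      Measurable fun t : (S × S) × S => q t.1.1 t.1.2 t.2).lintegral_prod_right'
  have hpI : Measurable fun t : S × S => p t.1 t.2 * ∫⁻ z, q t.1 t.2 z ∂ν := hp.mul hI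
  have ha : ∀ a : ι, Measurable fun f : ι → S => f a := fun a => measurable_pi_apply a
  have hm : Measurable fun f : ι → S => p (f a) (f b) * ∫⁻ z, q (f a) (f b) z ∂ν :=
    hpI.comp ((ha a).prodMk (ha b))
  have hJ : Measurable fun x : S => ∫⁻ y, p x y * ∫⁻ z, q x y z ∂ν ∂ν := hpI.lintegral_prod_right'
  rw [lintegral_pi_update (fun _ : ι => ν) (F := fun f => p (f a) (f b) * q (f a) (f b) (f c))
    ((measurable_eval₂ hp a b).mul (measurable_eval₃ hq a b c)) c]
  have e1 : ∀ f : ι → S, ∫⁻ t, p (update f c t a) (update f c t b) *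
      q (update f c t a) (update f c t b) (update f c t c) ∂ν =
      p (f a) (f b) * ∫⁻ z, q (f a) (f b) z ∂ν := by
    intro f
    have hqm : Measurable fun t => q (f a) (f b) t :=
      (hq.comp ((measurable_const (a := f a)).prodMk
        ((measurable_const (a := f b)).prodMk measurable_id)) :)
    simp only [update_eq_of_ne hac, update_eq_of_ne hbc, update_self]
    rw [lintegral_const_mul _ hqm]
  simp_rw [e1]
  rw [lintegral_pi_update (fun _ : ι => ν) hm b]
  simp only [update_eq_of_ne hab, update_self]
  exact lintegral_eval₁ ν hJ a

end Overlap

section SecondMoment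

open Function

variable {Ω S ι κ : Type*} [MeasurableSpace Ω] [MeasurableSpace S] [Fintype ι] [DecidableEq ι]
  [Fintype κ] [DecidableEq κ] (μ : Measure Ω) [IsProbabilityMeasure μ]
  (ν : Measure S) [IsProbabilityMeasure ν]

theorem sum_sum_ite_le (n : ℝ≥0∞) (hn : n = Fintype.card κ) :
    ∑ i : κ, ∑ j : κ, (if i = j then n else 1) ≤ 2 * n ^ 2 := by
  calc ∑ i : κ, ∑ j : κ, (if i = j then n else 1) ≤
        ∑ i : κ, ∑ j : κ, ((if i = j then n else 0) + 1) := by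
        gcongr with i _ j _; split_ifs <;> simp
    _ = 2 * n ^ 2 := by
        simp [Finset.sum_add_distrib, ← hn]; ring

theorem sq_lintegral_mul_le {α : Type*} [MeasurableSpace α] (μ : Measure α) {X : α → ℝ≥0∞}
    (hX : AEMeasurable X μ) {G : Set α} (hG : MeasurableSet G) :
    (∫⁻ t in G, X t ∂μ) ^ 2 ≤ (∫⁻ t, X t ^ 2 ∂μ) * μ G := by
  have h := ENNReal.lintegral_mul_le_Lp_mul_Lq μ (p := 2) (q := 2) (by
    constructor <;> norm_num) hX (g := G.indicator 1)
    (measurable_one.indicator hG).aemeasurable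
  have e1 : ∫⁻ t in G, X t ∂μ = ∫⁻ t, (X * G.indicator (1 : α → ℝ≥0∞)) t ∂μ := by
    rw [← lintegral_indicator hG]
    congr 1 with t
    by_cases ht : t ∈ G <;> simp [ht]
  have e2 : ∫⁻ t, G.indicator (1 : α → ℝ≥0∞) t ^ (2 : ℝ) ∂μ = μ G := by
    rw [← lintegral_indicator_one hG]
    congr 1 with t
    by_cases ht : t ∈ G <;> simp [ht]
  rw [e2] at h
  rw [e1]
  have e3 : ∀ x : ℝ≥0∞, (x ^ (1 / (2 : ℝ))) ^ 2 = x := fun x => by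
    rw [← ENNReal.rpow_natCast, ← ENNReal.rpow_mul]; norm_num
  refine (pow_le_pow_left' h 2).trans_eq ?_
  rw [mul_pow, e3, e3]
  simp

theorem sum_prod_mul_sum {κ' : Type*} [Fintype κ'] (g : κ → κ → ℝ≥0∞) (h : κ' → κ' → ℝ≥0∞) :
    ∑ x : κ × κ', ∑ y : κ × κ', g x.1 y.1 * h x.2 y.2 =
      (∑ i, ∑ j, g i j) * ∑ i, ∑ j, h i j := by
  simp only [Fintype.sum_prod_type, Finset.sum_mul_sum]

variable {P : Ω → S → S → ℝ≥0∞} {Q : Ω → S → S → S → ℝ≥0∞} {B B' : Ω → S → ℝ≥0∞}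
  {w w' l δ Λ n : ℝ≥0∞}

/-- Second moment bound for the number of triples: with probability at least a constant times
`(l / (w w'))² / Λ`, both the number of triples and the number of pairs are large. -/
theorem le_prob_triples (hP : Measurable fun t : Ω × S × S => P t.1 t.2.1 t.2.2)
    (hQ : Measurable fun t : Ω × S × S × S => Q t.1 t.2.1 t.2.2.1 t.2.2.2)
    (hB : Measurable (uncurry B)) (hB' : Measurable (uncurry B'))
    (hP1 : ∀ ω x y, P ω x y ≤ 1) (hQ1 : ∀ ω x y z, Q ω x y z ≤ 1)
    (h1 : ∀ ω x, ∫⁻ y, P ω x y ∂ν ≤ w) (h2 : ∀ ω y, ∫⁻ x, P ω x y ∂ν ≤ B ω y * w)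
    (h3 : ∀ ω x y, ∫⁻ z, Q ω x y z ∂ν ≤ w')
    (h4 : ∀ ω z, ∫⁻ x, ∫⁻ y, P ω x y * Q ω x y z ∂ν ∂ν ≤ B' ω z * (w * w'))
    (hΛ : ∫⁻ ω, ∫⁻ y, B ω y ^ 2 ∂ν ∂μ ≤ Λ) (hΛ' : ∫⁻ ω, ∫⁻ y, B' ω y ^ 2 ∂ν ∂μ ≤ Λ)
    (hnκ : n = Fintype.card κ) (hn : 1 ≤ n) (hnw : 1 ≤ n * w) (hnw' : 1 ≤ n ^ 2 * w')
    (hl : l ≤ ∫⁻ ω, ∫⁻ x, ∫⁻ y, P ω x y * ∫⁻ z, Q ω x y z ∂ν ∂ν ∂ν ∂μ) (hl1 : l ≠ ⊤)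
    (hδ : 4 * (δ * w') ≤ l) {e₁ e₂ e₃ : κ → ι} (he₁ : Injective e₁) (he₂ : Injective e₂)
    (he₃ : Injective e₃) (h12 : ∀ i j, e₁ i ≠ e₂ j) (h13 : ∀ i j, e₁ i ≠ e₃ j)
    (h23 : ∀ i j, e₂ i ≠ e₃ j) :
    l ^ 2 ≤ 32 * ((1 + Λ + Λ) * (w * w') ^ 2) * (μ.prod (Measure.pi fun _ : ι => ν))
      {t | δ * n ^ 2 ≤ ∑ i, ∑ j, P t.1 (t.2 (e₁ i)) (t.2 (e₂ j)) ∧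
        l * n ^ 3 ≤ 4 * ∑ i, ∑ j, ∑ k, P t.1 (t.2 (e₁ i)) (t.2 (e₂ j)) *
          Q t.1 (t.2 (e₁ i)) (t.2 (e₂ j)) (t.2 (e₃ k))} := by
  have ev : ∀ a : ι, Measurable fun t : Ω × (ι → S) => t.2 a :=
    fun a => (measurable_pi_apply a).comp measurable_snd
  have mP : ∀ a b : ι, Measurable fun t : Ω × (ι → S) => P t.1 (t.2 a) (t.2 b) := fun a b =>
    hP.comp (measurable_fst.prodMk ((ev a).prodMk (ev b)))
  have mQ : ∀ a b c : ι, Measurable fun t : Ω × (ι → S) => Q t.1 (t.2 a) (t.2 b) (t.2 c) :=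
    fun a b c => hQ.comp (measurable_fst.prodMk ((ev a).prodMk ((ev b).prodMk (ev c))))
  have hp : ∀ ω, Measurable (uncurry (P ω)) := fun ω =>
    hP.comp ((measurable_const (a := ω)).prodMk measurable_id)
  have hq : ∀ ω, Measurable fun t : S × S × S => Q ω t.1 t.2.1 t.2.2 := fun ω =>
    hQ.comp ((measurable_const (a := ω)).prodMk measurable_id)
  have mB : ∀ ω, Measurable (B ω) := fun ω =>
    hB.comp ((measurable_const (a := ω)).prodMk measurable_id)
  have mB' : ∀ ω, Measurable (B' ω) := fun ω =>
    hB'.comp ((measurable_const (a := ω)).prodMk measurable_id)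
  obtain ⟨X, hX⟩ : ∃ X : Ω × (ι → S) → ℝ≥0∞, X = fun t => ∑ i, ∑ j, ∑ k,
    P t.1 (t.2 (e₁ i)) (t.2 (e₂ j)) * Q t.1 (t.2 (e₁ i)) (t.2 (e₂ j)) (t.2 (e₃ k)) := ⟨_, rfl⟩
  obtain ⟨Y, hY⟩ : ∃ Y : Ω × (ι → S) → ℝ≥0∞, Y = fun t => ∑ i, ∑ j,
    P t.1 (t.2 (e₁ i)) (t.2 (e₂ j)) := ⟨_, rfl⟩
  have mX : Measurable X := by
    rw [hX]
    exact Finset.measurable_fun_sum _ fun i _ => Finset.measurable_fun_sum _ fun j _ =>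
      Finset.measurable_fun_sum _ fun k _ => (mP _ _).mul (mQ _ _ _)
  have mY : Measurable Y := by
    rw [hY]
    exact Finset.measurable_fun_sum _ fun i _ => Finset.measurable_fun_sum _ fun j _ => mP _ _
  set π := Measure.pi fun _ : ι => ν with hπ
  have hn_top : n ≠ ⊤ := by rw [hnκ]; exact ENNReal.natCast_ne_top _
  -- the first moment
  have hEX : n ^ 3 * l ≤ ∫⁻ t, X t ∂μ.prod π := by
    rw [lintegral_prod _ mX.aemeasurable]
    have : ∀ ω, ∫⁻ f, X (ω, f) ∂π =
        n ^ 3 * ∫⁻ x, ∫⁻ y, P ω x y * ∫⁻ z, Q ω x y z ∂ν ∂ν ∂ν := by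
      intro ω
      have m3 : ∀ i j k, Measurable fun f : ι → S => P ω (f (e₁ i)) (f (e₂ j)) *
          Q ω (f (e₁ i)) (f (e₂ j)) (f (e₃ k)) := fun i j k =>
        (measurable_eval₂ (hp ω) _ _).mul (measurable_eval₃ (hq ω) _ _ _)
      simp only [hX]
      rw [lintegral_finsetSum _ fun i _ => Finset.measurable_fun_sum _ fun j _ =>
        Finset.measurable_fun_sum _ fun k _ => m3 i j k]
      have : ∀ i, ∫⁻ f : ι → S, ∑ j, ∑ k, P ω (f (e₁ i)) (f (e₂ j)) *
          Q ω (f (e₁ i)) (f (e₂ j)) (f (e₃ k)) ∂π =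
          n ^ 2 * ∫⁻ x, ∫⁻ y, P ω x y * ∫⁻ z, Q ω x y z ∂ν ∂ν ∂ν := by
        intro i
        rw [lintegral_finsetSum _ fun j _ => Finset.measurable_fun_sum _ fun k _ => m3 i j k]
        have : ∀ j, ∫⁻ f : ι → S, ∑ k, P ω (f (e₁ i)) (f (e₂ j)) *
            Q ω (f (e₁ i)) (f (e₂ j)) (f (e₃ k)) ∂π =
            n * ∫⁻ x, ∫⁻ y, P ω x y * ∫⁻ z, Q ω x y z ∂ν ∂ν ∂ν := by
          intro j
          rw [lintegral_finsetSum _ fun k _ => m3 i j k]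
          simp_rw [hπ, le_lintegral_triple ν (hp ω) (hq ω) (h12 i j) (h13 i _) (h23 j _)]
          simp [hnκ]
        simp_rw [this]
        simp [← hnκ]; ring
      simp_rw [this]
      simp [← hnκ]; ring
    simp_rw [this]
    rw [lintegral_const_mul' _ _ (ENNReal.pow_ne_top hn_top)]
    gcongr
  -- the second moment
  have hEX2 : ∫⁻ t, X t ^ 2 ∂μ.prod π ≤ 8 * n ^ 6 * ((1 + Λ + Λ) * (w * w') ^ 2) := by
    rw [lintegral_prod _ (mX.pow_const 2).aemeasurable]
    have mBB : Measurable fun ω => ∫⁻ y, B ω y ^ 2 ∂ν := (hB.pow_const 2).lintegral_prod_right'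
    have mBB' : Measurable fun ω => ∫⁻ y, B' ω y ^ 2 ∂ν := (hB'.pow_const 2).lintegral_prod_right'
    have key : ∀ ω, ∫⁻ f, X (ω, f) ^ 2 ∂π ≤
        8 * n ^ 6 * ((1 + ∫⁻ y, B ω y ^ 2 ∂ν + ∫⁻ z, B' ω z ^ 2 ∂ν) * (w * w') ^ 2) := by
      intro ω
      set A := (1 + ∫⁻ y, B ω y ^ 2 ∂ν + ∫⁻ z, B' ω z ^ 2 ∂ν) * (w * w') ^ 2
      have m6 : ∀ x y : κ × κ × κ, Measurable fun f : ι → S =>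
          (P ω (f (e₁ x.1)) (f (e₂ x.2.1)) *
            Q ω (f (e₁ x.1)) (f (e₂ x.2.1)) (f (e₃ x.2.2))) *
          (P ω (f (e₁ y.1)) (f (e₂ y.2.1)) *
            Q ω (f (e₁ y.1)) (f (e₂ y.2.1)) (f (e₃ y.2.2))) := fun x y =>
        ((measurable_eval₂ (hp ω) _ _).mul (measurable_eval₃ (hq ω) _ _ _)).mul
          ((measurable_eval₂ (hp ω) _ _).mul (measurable_eval₃ (hq ω) _ _ _))
      have e : ∀ f : ι → S, X (ω, f) ^ 2 = ∑ x : κ × κ × κ, ∑ y : κ × κ × κ,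
          (P ω (f (e₁ x.1)) (f (e₂ x.2.1)) *
            Q ω (f (e₁ x.1)) (f (e₂ x.2.1)) (f (e₃ x.2.2))) *
          (P ω (f (e₁ y.1)) (f (e₂ y.2.1)) *
            Q ω (f (e₁ y.1)) (f (e₂ y.2.1)) (f (e₃ y.2.2))) := by
        intro f
        rw [← Finset.sum_mul_sum, sq]
        simp only [hX, Fintype.sum_prod_type]
      simp_rw [e]
      rw [lintegral_finsetSum _ fun x _ => Finset.measurable_fun_sum _ fun y _ => m6 x y]
      simp_rw [lintegral_finsetSum _ fun y _ => m6 _ y]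
      calc _ ≤ ∑ x : κ × κ × κ, ∑ y : κ × κ × κ, A * ((if x.1 = y.1 then n else 1) *
            (if x.2.1 = y.2.1 then n else 1) * (if x.2.2 = y.2.2 then n else 1)) := by
            gcongr with x _ y _
            refine (lintegral_triple_mul_triple_le ν (hp ω) (hq ω) (mB ω) (mB' ω) (hP1 ω) (hQ1 ω)
              (h1 ω) (h2 ω) (h3 ω) (h4 ω) hn hnw hnw' (h12 _ _) (h13 _ _) (h23 _ _) (h12 _ _)
              (h13 _ _) (h23 _ _) (h12 _ _) (h13 _ _) (h23 _ _) (h12 _ _) (h13 _ _)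
              (h23 _ _)).trans (le_of_eq ?_)
            simp only [he₁.eq_iff, he₂.eq_iff, he₃.eq_iff]
            rfl
        _ = A * ((∑ i : κ, ∑ j : κ, (if i = j then n else 1)) *
            ((∑ i : κ, ∑ j : κ, (if i = j then n else 1)) *
            (∑ i : κ, ∑ j : κ, (if i = j then n else 1)))) := by
            simp_rw [← Finset.mul_sum, mul_assoc]
            rw [sum_prod_mul_sum (fun i j : κ => if i = j then n else 1)
              (fun x y : κ × κ => (if x.1 = y.1 then n else 1) * (if x.2 = y.2 then n else 1)),
              sum_prod_mul_sum (fun i j : κ => if i = j then n else 1)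
              (fun i j : κ => if i = j then n else 1)]
        _ ≤ A * ((2 * n ^ 2) * ((2 * n ^ 2) * (2 * n ^ 2))) := by
            gcongr <;> exact sum_sum_ite_le n hnκ
        _ = _ := by ring
    refine (lintegral_mono key).trans ?_
    have mB1 : Measurable fun ω => 1 + ∫⁻ y, B ω y ^ 2 ∂ν := measurable_const.add mBB
    have mB2 : Measurable fun ω => 1 + ∫⁻ y, B ω y ^ 2 ∂ν + ∫⁻ z, B' ω z ^ 2 ∂ν := mB1.add mBB'
    rw [lintegral_const_mul _ (mB2.mul_const _), lintegral_mul_const _ mB2,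
      lintegral_add_left mB1, lintegral_add_left measurable_const]
    gcongr
    simp
  -- triples over few pairs
  have hsmall : ∫⁻ t in {t | Y t < δ * n ^ 2}, X t ∂μ.prod π ≤ δ * n ^ 2 * (n * w') := by
    have hms : MeasurableSet {t | Y t < δ * n ^ 2} := measurableSet_lt mY measurable_const
    rw [← lintegral_indicator hms,
      lintegral_prod _ (mX.indicator hms).aemeasurable]
    calc _ ≤ ∫⁻ _ω, δ * n ^ 2 * (n * w') ∂μ := lintegral_mono fun ω => ?_
      _ = _ := by simp
    have mYω : Measurable fun f => Y (ω, f) := mY.comp (measurable_const.prodMk measurable_id)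
    have hmω : MeasurableSet {f | Y (ω, f) < δ * n ^ 2} := measurableSet_lt mYω measurable_const
    have e : ∀ f, {t | Y t < δ * n ^ 2}.indicator X (ω, f) = ∑ i, ∑ j, ∑ k,
        ({f | Y (ω, f) < δ * n ^ 2}.indicator 1 f * P ω (f (e₁ i)) (f (e₂ j))) *
          Q ω (f (e₁ i)) (f (e₂ j)) (f (e₃ k)) := by
      intro f
      by_cases h : Y (ω, f) < δ * n ^ 2
      · rw [indicator_of_mem (show (ω, f) ∈ {t | Y t < δ * n ^ 2} from h)]
        simp [h, hX]
      · rw [indicator_of_notMem (show (ω, f) ∉ {t | Y t < δ * n ^ 2} from h)]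
        simp [h]
    have mI : Measurable ({f | Y (ω, f) < δ * n ^ 2}.indicator (1 : (ι → S) → ℝ≥0∞)) :=
      measurable_one.indicator hmω
    have m3 : ∀ i j k, Measurable fun f : ι → S =>
        ({f | Y (ω, f) < δ * n ^ 2}.indicator 1 f * P ω (f (e₁ i)) (f (e₂ j))) *
          Q ω (f (e₁ i)) (f (e₂ j)) (f (e₃ k)) := fun i j k =>
      (mI.mul (measurable_eval₂ (hp ω) _ _)).mul (measurable_eval₃ (hq ω) _ _ _)
    have mIP : ∀ i j, Measurable fun f : ι → S =>
        {f | Y (ω, f) < δ * n ^ 2}.indicator 1 f * P ω (f (e₁ i)) (f (e₂ j)) := fun i j =>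
      mI.mul (measurable_eval₂ (hp ω) _ _)
    have hYc : ∀ k f t, Y (ω, update f (e₃ k) t) = Y (ω, f) := by
      intro k f t
      simp only [hY, update_eq_of_ne (h13 _ k), update_eq_of_ne (h23 _ k)]
    have b1 : ∀ i j k, ∫⁻ f : ι → S,
        ({f | Y (ω, f) < δ * n ^ 2}.indicator 1 f * P ω (f (e₁ i)) (f (e₂ j))) *
          Q ω (f (e₁ i)) (f (e₂ j)) (f (e₃ k)) ∂π ≤
        (∫⁻ f : ι → S, {f | Y (ω, f) < δ * n ^ 2}.indicator 1 f *
          P ω (f (e₁ i)) (f (e₂ j)) ∂π) * w' := by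
      intro i j k
      refine lintegral_mul_third_le ν (hq ω) (h3 ω) (h13 i k) (h23 j k)
        (G := fun f => {f | Y (ω, f) < δ * n ^ 2}.indicator 1 f * P ω (f (e₁ i)) (f (e₂ j)))
        (mI.mul (measurable_eval₂ (hp ω) _ _)) fun f t => ?_
      simp only [update_eq_of_ne (h13 _ k), update_eq_of_ne (h23 _ k), indicator, mem_ofPred_eq, Pi.one_apply,
        hYc]
    simp_rw [e]
    rw [lintegral_finsetSum _ fun i _ => Finset.measurable_fun_sum _ fun j _ =>
        Finset.measurable_fun_sum _ fun k _ => m3 i j k]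
    simp_rw [lintegral_finsetSum Finset.univ fun j _ => Finset.measurable_fun_sum _ fun k _ => m3 _ j k]
    simp_rw [lintegral_finsetSum Finset.univ fun k _ => m3 _ _ k]
    calc _ ≤ ∑ i, ∑ j, ∑ _k : κ, (∫⁻ f : ι → S, {f | Y (ω, f) < δ * n ^ 2}.indicator 1 f *
          P ω (f (e₁ i)) (f (e₂ j)) ∂π) * w' := by
          gcongr with i _ j _ k _; exact b1 i j k
      _ = (∫⁻ f : ι → S, ∑ i, ∑ j, {f | Y (ω, f) < δ * n ^ 2}.indicator 1 f *
          P ω (f (e₁ i)) (f (e₂ j)) ∂π) * (n * w') := by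
          rw [lintegral_finsetSum _ fun i _ => Finset.measurable_fun_sum _ fun j _ => mIP i j]
          simp_rw [lintegral_finsetSum Finset.univ fun j _ => mIP _ j]
          simp only [Finset.sum_const, Finset.card_univ, nsmul_eq_mul, ← hnκ, Finset.sum_mul]
          refine Finset.sum_congr rfl fun i _ => Finset.sum_congr rfl fun j _ => ?_
          ring
      _ ≤ (∫⁻ _f : ι → S, δ * n ^ 2 ∂π) * (n * w') := by
          gcongr with f
          simp_rw [← Finset.mul_sum]
          by_cases h : Y (ω, f) < δ * n ^ 2
          · have h' := h.le
            simp only [hY] at h'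
            rw [indicator_of_mem (by exact h)]
            simpa using h'
          · rw [indicator_of_notMem (by exact h)]
            simp
      _ = _ := by simp [hπ]
  -- conclusion
  set G : Set (Ω × (ι → S)) := {t | δ * n ^ 2 ≤ Y t ∧ l * n ^ 3 ≤ 4 * X t} with hG
  have hGm : MeasurableSet G := by
    have g1 : MeasurableSet {t | δ * n ^ 2 ≤ Y t} := measurableSet_le measurable_const mY
    have g2 : MeasurableSet {t | l * n ^ 3 ≤ 4 * X t} :=
      measurableSet_le measurable_const (mX.const_mul 4)
    exact g1.inter g2
  have hGgoal : G = {t | δ * n ^ 2 ≤ ∑ i, ∑ j, P t.1 (t.2 (e₁ i)) (t.2 (e₂ j)) ∧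
        l * n ^ 3 ≤ 4 * ∑ i, ∑ j, ∑ k, P t.1 (t.2 (e₁ i)) (t.2 (e₂ j)) *
          Q t.1 (t.2 (e₁ i)) (t.2 (e₂ j)) (t.2 (e₃ k))} := by
    rw [hG, hX, hY]
  rw [← hGgoal]
  have hlow : ∫⁻ t in {t | 4 * X t ≤ l * n ^ 3}, 4 * X t ∂μ.prod π ≤ l * n ^ 3 := by
    have h0 : ∀ t ∈ {t | 4 * X t ≤ l * n ^ 3}, 4 * X t ≤ l * n ^ 3 := fun t ht => ht
    refine (setLIntegral_mono (g := fun _ => l * n ^ 3) measurable_const h0).trans ?_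
    rw [setLIntegral_const]
    exact mul_le_of_le_one_right' prob_le_one
  have hsplit : ∫⁻ t, X t ∂μ.prod π ≤ ∫⁻ t in {t | Y t < δ * n ^ 2}, X t ∂μ.prod π +
      ∫⁻ t in {t | 4 * X t ≤ l * n ^ 3}, X t ∂μ.prod π + ∫⁻ t in G, X t ∂μ.prod π := by
    rw [← setLIntegral_univ]
    refine (lintegral_mono_set (t := ({t | Y t < δ * n ^ 2} ∪ {t | 4 * X t ≤ l * n ^ 3}) ∪ G)
      fun t _ => ?_).trans ((lintegral_union_le _ _ _).trans ?_)
    · by_cases h1 : Y t < δ * n ^ 2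
      · exact Or.inl (Or.inl h1)
      · by_cases h2 : 4 * X t ≤ l * n ^ 3
        · exact Or.inl (Or.inr h2)
        · exact Or.inr ⟨not_lt.1 h1, (not_le.1 h2).le⟩
    · gcongr
      exact lintegral_union_le _ _ _
  have hfin : l * n ^ 3 ≠ ⊤ := ENNReal.mul_ne_top hl1 (ENNReal.pow_ne_top hn_top)
  have hmain : l * n ^ 3 ≤ 2 * ∫⁻ t in G, X t ∂μ.prod π := by
    have h5 : 4 * (l * n ^ 3) ≤ l * n ^ 3 + l * n ^ 3 + 4 * ∫⁻ t in G, X t ∂μ.prod π := by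
      calc 4 * (l * n ^ 3) = 4 * (n ^ 3 * l) := by ring
        _ ≤ 4 * (∫⁻ t in {t | Y t < δ * n ^ 2}, X t ∂μ.prod π +
            ∫⁻ t in {t | 4 * X t ≤ l * n ^ 3}, X t ∂μ.prod π + ∫⁻ t in G, X t ∂μ.prod π) := by
            exact mul_le_mul_right (hEX.trans hsplit) 4
        _ = 4 * ∫⁻ t in {t | Y t < δ * n ^ 2}, X t ∂μ.prod π +
            ∫⁻ t in {t | 4 * X t ≤ l * n ^ 3}, 4 * X t ∂μ.prod π +
            4 * ∫⁻ t in G, X t ∂μ.prod π := by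
            rw [lintegral_const_mul _ mX, mul_add, mul_add]
        _ ≤ l * n ^ 3 + l * n ^ 3 + 4 * ∫⁻ t in G, X t ∂μ.prod π := by
            refine add_le_add (add_le_add ?_ hlow) le_rfl
            calc _ ≤ 4 * (δ * n ^ 2 * (n * w')) := mul_le_mul_right hsmall 4
              _ = 4 * (δ * w') * n ^ 3 := by ring
              _ ≤ _ := by gcongr
    have h6 : l * n ^ 3 + l * n ^ 3 + 2 * (l * n ^ 3) ≤
        l * n ^ 3 + l * n ^ 3 + 2 * (2 * ∫⁻ t in G, X t ∂μ.prod π) := by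
      calc _ = 4 * (l * n ^ 3) := by ring
        _ ≤ _ := h5
        _ = _ := by ring
    have h7 := (ENNReal.add_le_add_iff_left (ENNReal.add_ne_top.2 ⟨hfin, hfin⟩)).1 h6
    exact (ENNReal.mul_le_mul_iff_right (by norm_num) (by norm_num)).1 h7
  have hn0 : n ^ 6 ≠ 0 := pow_ne_zero _ (by rintro rfl; simp at hn)
  refine (ENNReal.mul_le_mul_iff_right hn0 (ENNReal.pow_ne_top hn_top)).1 ?_
  calc n ^ 6 * l ^ 2 = (l * n ^ 3) ^ 2 := by ring
    _ ≤ (2 * ∫⁻ t in G, X t ∂μ.prod π) ^ 2 := by gcongr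
    _ = 4 * (∫⁻ t in G, X t ∂μ.prod π) ^ 2 := by ring
    _ ≤ 4 * ((8 * n ^ 6 * ((1 + Λ + Λ) * (w * w') ^ 2)) * (μ.prod π) G) := by
        gcongr
        refine (sq_lintegral_mul_le _ mX.aemeasurable hGm).trans ?_
        gcongr
    _ = _ := by ring

end SecondMoment

/-! ### Codewords -/

section Codewords

variable {d b N : ℕ} {M : ℝ}

/-- The indices of the codewords of a random product code. -/
abbrev CodeIdx (b N : ℕ) (M : ℝ) : Type := Fin N × (Fin b → Fin (blockSize b M))

/-- The codeword with a given index. -/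
def cw (σ : RPCSeed d b N M) (j : CodeIdx b N M) : EuclideanSpace ℝ (Fin d) :=
  rotVec (σ.1 j.1) (concat d b fun i => σ.2 i (j.2 i))

theorem mem_rpcCode {σ : RPCSeed d b N M} {v : EuclideanSpace ℝ (Fin d)} :
    v ∈ rpcCode σ ↔ ∃ j, v = cw σ j :=
  ⟨fun ⟨q, k, h⟩ => ⟨(q, k), h⟩, fun ⟨j, h⟩ => ⟨j.1, j.2, h⟩⟩

theorem norm_cw (hd : 0 < d) (hb : 0 < b) (σ : RPCSeed d b N M) (j : CodeIdx b N M) :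
    ‖cw σ j‖ = 1 := by
  rw [cw, norm_rotVec, norm_concat hd hb]

theorem inner_cw (σ : RPCSeed d b N M) (j : CodeIdx b N M) (x : EuclideanSpace ℝ (Fin d)) :
    inner ℝ x (cw σ j) = inner ℝ (pullVec (σ.1 j.1) x) (concat d b fun i => σ.2 i (j.2 i)) :=
  inner_rotVec _ _ _

/-- `x` is balanced in the frame of the codeword, and close to it in every block. -/
def BNear (τ a : ℝ) (σ : RPCSeed d b N M) (x : EuclideanSpace ℝ (Fin d)) (j : CodeIdx b N M) :
    Prop :=
  Balanced b τ (pullVec (σ.1 j.1) x) ∧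
    InBand τ a (pullVec (σ.1 j.1) x) fun i => σ.2 i (j.2 i)

theorem BNear.abs_inner_sub_le (hd : 0 < d) (hb : 0 < b) {τ a : ℝ} {σ : RPCSeed d b N M}
    {x : EuclideanSpace ℝ (Fin d)} {j : CodeIdx b N M} (h : BNear τ a σ x j) :
    |inner ℝ x (cw σ j) - a| ≤ τ := by
  rw [inner_cw]
  exact h.2.abs_inner_sub_le hd hb

/-- `|⟨x, c_j⟩ - a| ≤ e`. -/
def Near (e a : ℝ) (σ : RPCSeed d b N M) (x : EuclideanSpace ℝ (Fin d)) (j : CodeIdx b N M) :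
    Prop :=
  |inner ℝ x (cw σ j) - a| ≤ e

open Classical in
/-- The number of codewords near `x`, counted with their indices. -/
def cnt (e a : ℝ) (σ : RPCSeed d b N M) (x : EuclideanSpace ℝ (Fin d)) : ℝ≥0∞ :=
  ∑ j : CodeIdx b N M, if Near e a σ x j then 1 else 0

open Classical in
/-- The number of codewords of the rotation `q` near `x` in every block. -/
def bcnt (τ a : ℝ) (σ : RPCSeed d b N M) (q : Fin N) (x : EuclideanSpace ℝ (Fin d)) : ℝ≥0∞ :=
  ∑ k : Fin b → Fin (blockSize b M), if BNear τ a σ x (q, k) then 1 else 0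

theorem continuous_concat : Continuous (concat d b) := by
  unfold concat
  refine (PiLp.continuous_toLp 2 _).comp (continuous_pi fun j => ?_)
  by_cases h : j.val * b / d < b
  · simp only [h, dite_true]
    fun_prop
  · simp only [h, dite_false]
    fun_prop

theorem continuous_pullVec_seed (j : CodeIdx b N M) :
    Continuous fun p : RPCSeed d b N M × EuclideanSpace ℝ (Fin d) => pullVec (p.1.1 j.1) p.2 :=
  continuous_pullVec.comp (by fun_prop :
    Continuous fun p : RPCSeed d b N M × EuclideanSpace ℝ (Fin d) => (p.1.1 j.1, p.2))

theorem continuous_inner_cw (j : CodeIdx b N M) :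
    Continuous fun p : RPCSeed d b N M × EuclideanSpace ℝ (Fin d) => inner ℝ p.2 (cw p.1 j) := by
  simp only [inner_cw]
  refine (continuous_pullVec_seed j).inner (continuous_concat.comp ?_)
  fun_prop

theorem continuous_cw (j : CodeIdx b N M) : Continuous fun σ : RPCSeed d b N M => cw σ j := by
  unfold cw rotVec
  refine (PiLp.continuous_toLp 2 _).comp ?_
  refine Continuous.matrix_mulVec ?_ ?_
  · fun_prop
  · refine (PiLp.continuous_ofLp 2 _).comp (continuous_concat.comp ?_)
    fun_prop

theorem measurableSet_near (e a : ℝ) (j : CodeIdx b N M) :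
    MeasurableSet {p : RPCSeed d b N M × EuclideanSpace ℝ (Fin d) | Near e a p.1 p.2 j} :=
  (isClosed_le (((continuous_inner_cw j).sub continuous_const).abs)
    continuous_const).measurableSet

theorem isClosed_blockNear (τ a : ℝ) (k : Fin b → Fin (blockSize b M)) :
    IsClosed {p : EuclideanSpace ℝ (Fin d) × ((i : Fin b) → Fin (blockSize b M) →
      sphere (0 : EuclideanSpace ℝ (Block d b i)) 1) |
      Balanced b τ p.1 ∧ InBand τ a p.1 fun i => p.2 i (k i)} := by
  have h1 : IsClosed {p : EuclideanSpace ℝ (Fin d) × ((i : Fin b) → Fin (blockSize b M) →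
      sphere (0 : EuclideanSpace ℝ (Block d b i)) 1) | ∀ i : Fin b,
        |b * ‖blk b p.1 i‖ ^ 2 - 1| ≤ τ} := by
    simp only [setOf_forall]
    refine isClosed_iInter fun i => isClosed_le ?_ continuous_const
    exact ((continuous_const.mul (((continuous_blk i).comp continuous_fst).norm.pow
      2)).sub continuous_const).abs
  have h2 : IsClosed {p : EuclideanSpace ℝ (Fin d) × ((i : Fin b) → Fin (blockSize b M) →
      sphere (0 : EuclideanSpace ℝ (Block d b i)) 1) | ∀ i : Fin b,
        |√(b : ℝ) * inner ℝ (blk b p.1 i)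
          (p.2 i (k i) : EuclideanSpace ℝ (Block d b i)) - a| ≤ τ} := by
    simp only [setOf_forall]
    refine isClosed_iInter fun i => isClosed_le ?_ continuous_const
    refine ((continuous_const.mul (((continuous_blk i).comp continuous_fst).inner
      ?_)).sub continuous_const).abs
    fun_prop
  exact h1.inter h2

theorem measurableSet_bnear (τ a : ℝ) (j : CodeIdx b N M) :
    MeasurableSet {p : RPCSeed d b N M × EuclideanSpace ℝ (Fin d) | BNear τ a p.1 p.2 j} :=
  ((isClosed_blockNear τ a j.2).preimage
    ((continuous_pullVec_seed j).prodMk (continuous_snd.comp continuous_fst))).measurableSet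

open Classical in
theorem measurable_cnt (e a : ℝ) :
    Measurable fun p : RPCSeed d b N M × EuclideanSpace ℝ (Fin d) => cnt e a p.1 p.2 :=
  Finset.measurable_fun_sum _ fun j _ =>
    Measurable.ite (measurableSet_near e a j) measurable_const measurable_const

open Classical in
theorem measurable_bcnt (τ a : ℝ) (q : Fin N) :
    Measurable fun p : RPCSeed d b N M × EuclideanSpace ℝ (Fin d) => bcnt τ a p.1 q p.2 :=
  Finset.measurable_fun_sum _ fun k _ =>
    Measurable.ite (measurableSet_bnear τ a (q, k)) measurable_const measurable_const

theorem nonempty_block (hd : 0 < d) (hb : 0 < b) (hbd : b < d) (i : Fin b) :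
    Nonempty (Block d b i) := by
  rw [← Fintype.card_pos_iff]
  have h := le_card_block hd hb i
  have hb' : (0 : ℝ) < b := by exact_mod_cast hb
  have h1 : 1 < (d : ℝ) / b := by rw [one_lt_div hb']; exact_mod_cast hbd
  have : (0 : ℝ) < Fintype.card (Block d b i) := by linarith
  exact_mod_cast this

theorem isProbabilityMeasure_rpcLaw (hd : 0 < d) (hb : 0 < b) (hbd : b < d) :
    IsProbabilityMeasure (rpcLaw d b N M) := by
  have := isProbabilityMeasure_unifSO d
  have : ∀ i : Fin b, IsProbabilityMeasure (unifSphere (Block d b i)) := fun i =>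
    have := nonempty_block hd hb hbd i
    isProbabilityMeasure_unifSphere _
  unfold rpcLaw
  infer_instance

/-- A rotated unit vector is uniform: averages over the seed of a function of the vector in the
frame of rotation `q` and the points of the blocks. -/
theorem lintegral_rpcLaw_pullVec (hd : 2 ≤ d) (hb : 0 < b) (hbd : b < d)
    {x : EuclideanSpace ℝ (Fin d)} (hx : ‖x‖ = 1) (q : Fin N)
    {F : EuclideanSpace ℝ (Fin d) → ((i : Fin b) → Fin (blockSize b M) →
      sphere (0 : EuclideanSpace ℝ (Block d b i)) 1) → ℝ≥0∞}
    (hF : Measurable (Function.uncurry F)) :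
    ∫⁻ σ, F (pullVec (σ.1 q) x) σ.2 ∂rpcLaw d b N M =
      ∫⁻ v, ∫⁻ u, F (v : EuclideanSpace ℝ (Fin d)) u
        ∂(Measure.pi fun i : Fin b => Measure.pi fun _ => unifSphere (Block d b i))
        ∂unifSphere (Fin d) := by
  have := isProbabilityMeasure_unifSO d
  have : ∀ i : Fin b, IsProbabilityMeasure (unifSphere (Block d b i)) := fun i =>
    have := nonempty_block (by omega) hb hbd i
    isProbabilityMeasure_unifSphere _
  have hpm : Measurable fun Q : SO d => pullVec Q x :=
    (continuous_pullVec.comp (Continuous.prodMk_left x)).measurable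
  have hm : Measurable fun σ : RPCSeed d b N M => F (pullVec (σ.1 q) x) σ.2 := by
    refine hF.comp ((hpm.comp ?_).prodMk measurable_snd)
    exact (measurable_pi_apply q).comp measurable_fst
  have hI : Measurable fun v : EuclideanSpace ℝ (Fin d) => ∫⁻ u, F v u
      ∂(Measure.pi fun i : Fin b => Measure.pi fun _ => unifSphere (Block d b i)) :=
    hF.lintegral_prod_right'
  rw [rpcLaw, lintegral_prod _ hm.aemeasurable]
  rw [lintegral_eval₁ (unifSO d) (g := fun Q => ∫⁻ u, F (pullVec Q x) u
      ∂(Measure.pi fun i : Fin b => Measure.pi fun _ => unifSphere (Block d b i)))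
    (hI.comp hpm) q]
  have hlaw : (unifSO d).map (fun Q => pullVec Q x) =
      (unifSphere (Fin d)).map Subtype.val := by
    ext A hA
    rw [Measure.map_apply hpm hA, Measure.map_apply measurable_subtype_coe hA]
    exact unifSO_pullVec hd hx hA
  rw [← lintegral_map hI hpm, hlaw, lintegral_map hI measurable_subtype_coe]

end Codewords

/-! ### Points near a random product code -/

section Blocks

variable {ι : Type} [Fintype ι] [Nonempty ι]

/-- The band of a block vector of nearly unit length is at least as large as a slightly thinner
band of a unit vector. -/
theorem unifSphere_band_scaled_ge {v : EuclideanSpace ℝ ι} {s a τ' τ η : ℝ} (hs : 0 ≤ s)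
    (hv : |s ^ 2 * ‖v‖ ^ 2 - 1| ≤ τ') (hτ' : τ' < 1) (ha0 : 0 ≤ a) (ha1 : a ≤ 1) (hη : 0 < η)
    (hη8 : η ≤ 1 / 8) (hτ : 20 * η + τ' ≤ τ)
    (hn : Real.exp (-(Fintype.card ι * η ^ 2 / 2)) ≤ 1 / 6) :
    ENNReal.ofReal ((√(1 - a ^ 2) / (1 + 5 * η)) ^ Fintype.card ι / 2) ≤
      unifSphere ι {x | |s * inner ℝ v (x : EuclideanSpace ℝ ι) - a| ≤ τ} := by
  have hv' := abs_le.1 hv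
  have hv0 : v ≠ 0 := by
    rintro rfl
    rw [norm_zero] at hv'
    linarith
  have hn0 : 0 < ‖v‖ := norm_pos_iff.2 hv0
  have hc : ‖‖v‖⁻¹ • v‖ = 1 := norm_smul_inv_norm hv0
  refine (unifSphere_band_ge hc ha0 ha1 hη hη8 le_rfl hn).trans (measure_mono fun x hx => ?_)
  rw [mem_ofPred_eq] at hx ⊢
  have hx1 : ‖(x : EuclideanSpace ℝ ι)‖ = 1 := norm_eq_of_mem_sphere x
  obtain ⟨y, hy⟩ : ∃ y, y = inner ℝ (x : EuclideanSpace ℝ ι) (‖v‖⁻¹ • v) := ⟨_, rfl⟩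
  have hy1 : |y| ≤ 1 := by
    rw [hy]
    refine (abs_real_inner_le_norm _ _).trans ?_
    rw [hx1, hc, one_mul]
  have e : s * inner ℝ v (x : EuclideanSpace ℝ ι) = (s * ‖v‖) * y := by
    rw [hy, inner_smul_right, real_inner_comm]
    field_simp
  rw [← hy] at hx
  have ht : |s * ‖v‖ - 1| ≤ τ' := by
    have ht0 : 0 ≤ s * ‖v‖ := by positivity
    have : |s * ‖v‖ - 1| * 1 ≤ |s * ‖v‖ - 1| * |s * ‖v‖ + 1| := by
      gcongr
      rw [abs_of_nonneg (by linarith)]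
      linarith
    rw [← abs_mul, mul_one, show (s * ‖v‖ - 1) * (s * ‖v‖ + 1) = s ^ 2 * ‖v‖ ^ 2 - 1 by ring] at this
    exact this.trans hv
  rw [e]
  calc |s * ‖v‖ * y - a| = |(s * ‖v‖ - 1) * y + (y - a)| := by congr 1; ring
    _ ≤ |s * ‖v‖ - 1| * |y| + |y - a| := by rw [← abs_mul]; exact abs_add_le _ _
    _ ≤ τ' * 1 + 20 * η := by gcongr; exact (abs_nonneg _).trans ht
    _ ≤ τ := by linarith

/-- The band of a block vector of nearly unit length is contained in a cap of a unit vector. -/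
theorem unifSphere_band_scaled_le {v : EuclideanSpace ℝ ι} {s a τ δ : ℝ} (hs : 0 ≤ s)
    (hv : |s ^ 2 * ‖v‖ ^ 2 - 1| ≤ τ) (hτ0 : 0 ≤ τ) (hτ : τ < 1) (hτa : τ ≤ a) (ha : a ≤ 1)
    (hδ : 0 ≤ δ) (hδ1 : δ < 1) (hn : (1 - δ) ^ Fintype.card ι ≤ 1 / 2) :
    unifSphere ι {x | |s * inner ℝ v (x : EuclideanSpace ℝ ι) - a| ≤ τ} ≤
      ENNReal.ofReal (2 * (1 - a ^ 2 + 6 * τ + 2 * δ) ^ ((Fintype.card ι : ℝ) / 2)) := by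
  have hv' := abs_le.1 hv
  have hv0 : v ≠ 0 := by
    rintro rfl
    rw [norm_zero] at hv'
    linarith
  have hn0 : 0 < ‖v‖ := norm_pos_iff.2 hv0
  have hc : ‖‖v‖⁻¹ • v‖ = 1 := norm_smul_inv_norm hv0
  have hsv : s * ‖v‖ ≤ 1 + τ := by
    have h1 : (s * ‖v‖) ^ 2 ≤ (1 + τ) ^ 2 := by
      rw [mul_pow]; nlinarith
    exact le_of_sq_le_sq h1 (by linarith)
  obtain ⟨h, hh⟩ : ∃ h, h = (a - τ) * (1 - τ) := ⟨_, rfl⟩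
  have hh0 : 0 ≤ h := by rw [hh]; exact mul_nonneg (by linarith) (by linarith)
  have hh1 : h ≤ 1 := by rw [hh]; exact mul_le_one₀ (by linarith) (by linarith) (by linarith)
  refine (measure_mono fun x hx => ?_).trans
    ((unifSphere_cap_le hc.le hh0 hh1 hδ hδ1 hn).trans (ENNReal.ofReal_le_ofReal ?_))
  · rw [mem_ofPred_eq] at hx ⊢
    have e : s * inner ℝ v (x : EuclideanSpace ℝ ι) =
        (s * ‖v‖) * inner ℝ (x : EuclideanSpace ℝ ι) (‖v‖⁻¹ • v) := by
      rw [inner_smul_right, real_inner_comm]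
      field_simp
    have h1 := (abs_le.1 hx).1
    rw [e] at h1
    obtain ⟨y, hy⟩ : ∃ y, y = inner ℝ (x : EuclideanSpace ℝ ι) (‖v‖⁻¹ • v) := ⟨_, rfl⟩
    rw [← hy] at h1 ⊢
    have hy0 : 0 ≤ y := by
      by_contra hneg
      have : s * ‖v‖ * y ≤ 0 := mul_nonpos_of_nonneg_of_nonpos (by positivity) (by linarith)
      by_cases h0 : a - τ = 0
      · have hs0 : s * ‖v‖ * y < 0 := by
          refine mul_neg_of_pos_of_neg ?_ (by linarith)
          refine lt_of_le_of_ne (by positivity) fun h => ?_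
          rw [← mul_pow, ← h] at hv'
          linarith
        linarith
      · have : 0 < a - τ := lt_of_le_of_ne (by linarith) (Ne.symm h0)
        linarith
    have h2 : a - τ ≤ (1 + τ) * y := by
      have := mul_le_mul_of_nonneg_right hsv hy0
      linarith
    rw [hh]
    calc (a - τ) * (1 - τ) ≤ ((1 + τ) * y) * (1 - τ) := by gcongr
      _ = y * (1 - τ ^ 2) := by ring
      _ ≤ y * 1 := by gcongr; linarith [sq_nonneg τ]
      _ = y := mul_one y
  · have hX : 0 ≤ 1 - (h * (1 - δ)) ^ 2 := by
      have h1 : h * (1 - δ) ≤ 1 := mul_le_one₀ hh1 (by linarith) (by linarith)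
      have h2 : 0 ≤ h * (1 - δ) := mul_nonneg hh0 (by linarith)
      have := pow_le_one₀ (n := 2) h2 h1
      linarith
    gcongr
    have h1 : a - 2 * τ ≤ h := by
      rw [hh]
      have : a * τ ≤ 1 * τ := by gcongr
      linarith [sq_nonneg τ]
    have h3 : h - δ ≤ h * (1 - δ) := by
      have : h * δ ≤ 1 * δ := by gcongr
      linarith
    have h4 : a - 2 * τ - δ ≤ h * (1 - δ) := by linarith
    have h5 : 0 ≤ h * (1 - δ) := mul_nonneg hh0 (by linarith)
    obtain ⟨y, hy⟩ : ∃ y, y = h * (1 - δ) := ⟨_, rfl⟩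
    rw [← hy] at h4 h5 ⊢
    have ha0 : 0 ≤ a := by linarith
    have h6 : a * (a - 2 * τ - δ) ≤ a * y := by gcongr
    have h7 : a * (2 * τ + δ) ≤ 1 * (2 * τ + δ) := by gcongr
    nlinarith [sq_nonneg (a - y)]

end Blocks

section Independent

variable {S : Type*} [MeasurableSpace S] (μ : Measure S) [IsProbabilityMeasure μ]

/-- Among `K` independent points, one lies in a set of measure at least `p` with probability at
least `min (1, K p) / 2`. -/
theorem pi_exists_mem_ge {A : Set S} (hA : MeasurableSet A) {K : ℕ} {p t : ℝ}
    (hμ : ENNReal.ofReal p ≤ μ A) (ht0 : 0 ≤ t) (ht1 : t ≤ 1) (ht : t ≤ K * p) :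
    ENNReal.ofReal (t / 2) ≤ Measure.pi (fun _ : Fin K => μ) {f | ∃ κ, f κ ∈ A} := by
  have e : {f : Fin K → S | ∃ κ, f κ ∈ A} = (Set.pi univ fun _ => Aᶜ)ᶜ := by
    ext f; simp [Set.mem_pi]
  have hm : MeasurableSet (Set.pi univ fun _ : Fin K => Aᶜ) :=
    MeasurableSet.univ_pi fun _ => hA.compl
  have hreal : p ≤ μ.real A := (ENNReal.ofReal_le_iff_le_toReal (measure_ne_top _ _)).1 hμ
  rw [e, ENNReal.ofReal_le_iff_le_toReal (measure_ne_top _ _)]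
  change t / 2 ≤ (Measure.pi (fun _ : Fin K => μ)).real _
  rw [probReal_compl_eq_one_sub hm, measureReal_def, Measure.pi_pi]
  simp only [Finset.prod_const, Finset.card_univ, Fintype.card_fin, ENNReal.toReal_pow]
  have h1 : (μ Aᶜ).toReal = 1 - μ.real A := by
    have := probReal_compl_eq_one_sub (μ := μ) hA
    simpa [measureReal_def] using this
  rw [h1]
  have hA1 : μ.real A ≤ 1 := measureReal_le_one
  have h2 : (1 - μ.real A) ^ K ≤ Real.exp (-t) := by
    calc (1 - μ.real A) ^ K ≤ Real.exp (-p) ^ K := by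
          refine pow_le_pow_left₀ (by linarith) ?_ K
          linarith [Real.add_one_le_exp (-p)]
      _ = Real.exp (K * (-p)) := (Real.exp_nat_mul _ _).symm
      _ ≤ _ := by gcongr; linarith
  have h3 : Real.exp (-t) ≤ 1 - t / 2 := by
    have h4 : Real.exp (-t) ≤ (1 + t)⁻¹ := by
      rw [Real.exp_neg]
      gcongr
      linarith [Real.add_one_le_exp t]
    refine h4.trans ?_
    rw [inv_le_iff_one_le_mul₀ (by linarith)]
    nlinarith
  linarith

open Classical in
/-- The second moment of the number of `K` independent points in a set. -/
theorem lintegral_pi_count_sq_le {A : Set S} (hA : MeasurableSet A) (K : ℕ) :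
    ∫⁻ f, (∑ κ, if f κ ∈ A then 1 else 0) ^ 2 ∂Measure.pi (fun _ : Fin K => μ) ≤
      K * μ A + (K * μ A) ^ 2 := by
  have hm : ∀ κ : Fin K, Measurable fun f : Fin K → S => if f κ ∈ A then (1 : ℝ≥0∞) else 0 :=
    fun κ => Measurable.ite (measurable_pi_apply κ hA) measurable_const measurable_const
  have hg : Measurable fun t : S => if t ∈ A then (1 : ℝ≥0∞) else 0 :=
    Measurable.ite hA measurable_const measurable_const
  have hint : ∫⁻ t, (if t ∈ A then (1 : ℝ≥0∞) else 0) ∂μ = μ A := by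
    rw [← lintegral_indicator_one hA]
    rfl
  have hm2 : ∀ i j : Fin K, Measurable fun f : Fin K → S =>
      (if f i ∈ A then (1 : ℝ≥0∞) else 0) * if f j ∈ A then 1 else 0 :=
    fun i j => (hm i).mul (hm j)
  simp_rw [sq, Finset.sum_mul_sum]
  rw [lintegral_finsetSum _ fun i _ => Finset.measurable_fun_sum _ fun j _ => hm2 i j]
  simp_rw [lintegral_finsetSum Finset.univ fun j _ => hm2 _ j]
  have hterm : ∀ i j : Fin K, ∫⁻ f : Fin K → S, (if f i ∈ A then (1 : ℝ≥0∞) else 0) *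
      (if f j ∈ A then 1 else 0) ∂Measure.pi (fun _ : Fin K => μ) ≤
      (if i = j then μ A else 0) + μ A * μ A := by
    intro i j
    by_cases hij : i = j
    · subst hij
      rw [if_pos rfl]
      refine le_add_right ?_
      have : ∀ f : Fin K → S, (if f i ∈ A then (1 : ℝ≥0∞) else 0) * (if f i ∈ A then 1 else 0) =
          if f i ∈ A then 1 else 0 := fun f => by split_ifs <;> simp
      simp_rw [this]
      rw [lintegral_eval₁ μ hg i, hint]
    · rw [if_neg hij, zero_add]
      refine (lintegral_pi_le_of_update (fun _ : Fin K => μ) (G := fun f =>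
        (if f i ∈ A then (1 : ℝ≥0∞) else 0) * μ A) ((hm i).mul (hm j)) j fun f => ?_).trans ?_
      · simp only [Pi.mul_apply, update_eq_of_ne hij, Function.update_self]
        rw [lintegral_const_mul _ hg, hint]
      · rw [lintegral_mul_const _ (hm i), lintegral_eval₁ μ hg i, hint]
  calc _ ≤ ∑ i : Fin K, ∑ j : Fin K, ((if i = j then μ A else 0) + μ A * μ A) := by
        gcongr with i _ j _; exact hterm i j
    _ = _ := by simp [Finset.sum_add_distrib]; ring

end Independent

/-! ### Hitting probabilities and moments of random product codes -/

/-- `(1 - a²)^{d/2}`. -/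
def pa (d : ℕ) (a : ℝ) : ℝ := (1 - a ^ 2) ^ ((d : ℝ) / 2)

theorem capP_eq_pa (d : ℕ) (θ : ℝ) : capP d θ = pa d (Real.cos θ) := rfl

section BlockSize

variable {d b : ℕ} {a k : ℝ}

theorem rpow_inv_pa (hX : 0 < 1 - a ^ 2) :
    (1 / pa d a) ^ (1 / (b : ℝ)) = ((1 - a ^ 2) ^ ((d : ℝ) / (2 * b)))⁻¹ := by
  rw [pa, one_div, Real.inv_rpow (by positivity), ← Real.rpow_mul hX.le]
  congr 2
  field_simp

theorem one_le_blockSize_mul (hX : 0 < 1 - a ^ 2) :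
    1 ≤ blockSize b (1 / pa d a) * (1 - a ^ 2) ^ ((d : ℝ) / (2 * b)) := by
  have h := Nat.le_ceil ((1 / pa d a) ^ (1 / (b : ℝ)))
  rw [rpow_inv_pa hX] at h
  have h0 : 0 < (1 - a ^ 2) ^ ((d : ℝ) / (2 * b)) := by positivity
  calc (1 : ℝ) = ((1 - a ^ 2) ^ ((d : ℝ) / (2 * b)))⁻¹ * (1 - a ^ 2) ^ ((d : ℝ) / (2 * b)) := by
        field_simp
    _ ≤ _ := by
        gcongr
        rw [blockSize, rpow_inv_pa hX]
        exact h

theorem blockSize_mul_le (hX : 0 < 1 - a ^ 2) :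
    blockSize b (1 / pa d a) * (1 - a ^ 2) ^ ((d : ℝ) / (2 * b)) ≤ 2 := by
  have h0 : 0 < (1 - a ^ 2) ^ ((d : ℝ) / (2 * b)) := by positivity
  have h := Nat.ceil_lt_add_one (a := (1 / pa d a) ^ (1 / (b : ℝ))) (by
    rw [rpow_inv_pa hX]; positivity)
  rw [rpow_inv_pa hX] at h
  have h1 : (1 - a ^ 2) ^ ((d : ℝ) / (2 * b)) ≤ 1 :=
    Real.rpow_le_one hX.le (by linarith [sq_nonneg a]) (by positivity)
  calc (blockSize b (1 / pa d a) : ℝ) * (1 - a ^ 2) ^ ((d : ℝ) / (2 * b)) ≤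
        (((1 - a ^ 2) ^ ((d : ℝ) / (2 * b)))⁻¹ + 1) * (1 - a ^ 2) ^ ((d : ℝ) / (2 * b)) := by
        gcongr
        rw [blockSize, rpow_inv_pa hX]
        exact h.le
    _ = 1 + (1 - a ^ 2) ^ ((d : ℝ) / (2 * b)) := by field_simp
    _ ≤ 2 := by linarith

theorem blockSize_pow_mul_le (hb : 0 < b) (hX : 0 < 1 - a ^ 2) :
    (blockSize b (1 / pa d a) : ℝ) ^ b * pa d a ≤ 2 ^ b := by
  have e : pa d a = ((1 - a ^ 2) ^ ((d : ℝ) / (2 * b))) ^ b := by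
    rw [← Real.rpow_natCast, ← Real.rpow_mul hX.le, pa]
    congr 1
    have : (b : ℝ) ≠ 0 := by exact_mod_cast hb.ne'
    field_simp
  have h := blockSize_mul_le (d := d) (b := b) hX
  obtain ⟨K, hK⟩ : ∃ K : ℝ, K = blockSize b (1 / pa d a) := ⟨_, rfl⟩
  have hK0 : 0 ≤ K := by rw [hK]; exact Nat.cast_nonneg _
  rw [← hK] at h ⊢
  rw [e, ← mul_pow]
  exact pow_le_pow_left₀ (mul_nonneg hK0 (Real.rpow_nonneg hX.le _)) h b

end BlockSize

section Hit

variable {d b N : ℕ}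

theorem unifSphere_balanced_ge (hd : 0 < d) (hb : 0 < b) (hbd : b ≤ d) {η τ t : ℝ}
    (hη : 0 < η) (hη8 : η ≤ 1 / 8) (hτ : b * (2 * η + η + 2 * b / d) + 48 * η ≤ τ) (hτ1 : τ ≤ 1)
    (ht1 : Real.exp (-(d * η ^ 2 / 2)) ≤ t) (ht2 : Real.exp (-((d / b - 1) * η ^ 2 / 8)) ≤ t)
    (ht : (1 + b) * t ≤ 1 / 2) :
    ENNReal.ofReal ((1 / (1 + 5 * η)) ^ d / 2) ≤
      unifSphere (Fin d) {y | Balanced b τ (y : EuclideanSpace ℝ (Fin d))} := by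
  have : Nonempty (Fin d) := ⟨⟨0, hd⟩⟩
  have hvol := volume_ball_le_two_mul_typicalSet (ι := Fin d) (K := Empty) (a := fun _ => 0)
    (by simp) (blockFinset d b) (η := η) (h := η) (τ := t) hη.le (by linarith) hη.le (by linarith)
    (by simpa using ht1) (fun i => by
      refine le_trans ?_ ht2
      rw [card_blockFinset]
      gcongr
      exact le_card_block hd hb i) (by simpa using ht)
  have h := unifSphere_ge_of_typicalSet (t := 0) (ρ := 1) (measurableSet_balanced (d := d) (b := b) τ)
    hvol hη hη8 (by simp) (by norm_num) (fun r _ => by simpa using hη.le) (fun r hr hr1 => by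
      simp only [zero_add, one_smul] at hr1 ⊢
      intro i
      have hE := abs_norm_blk_sub_le hd hb hbd hη.le (by linarith) hη.le (by linarith) hr i
      obtain ⟨E, hEE⟩ : ∃ E, E = (b : ℝ) * (2 * η + η + 2 * b / d) := ⟨_, rfl⟩
      rw [← hEE] at hE hτ
      obtain ⟨s, hs⟩ : ∃ s, s = ‖r‖ := ⟨_, rfl⟩
      obtain ⟨y, hy⟩ : ∃ y, y = b * ‖blk b r i‖ ^ 2 := ⟨_, rfl⟩
      have e : (b : ℝ) * ‖blk b (‖r‖⁻¹ • r) i‖ ^ 2 = s⁻¹ * (s⁻¹ * y) := by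
        have : blk b (‖r‖⁻¹ • r) i = ‖r‖⁻¹ • blk b r i := by ext j; simp [blk]
        rw [this, norm_smul, norm_inv, norm_norm, hy, hs]
        ring
      rw [e]
      rw [← hy] at hE
      rw [← hs] at hr1
      have hE1 : E ≤ 1 := by linarith
      have hy2 : |y| ≤ 2 := by
        have := abs_le.1 hE
        rw [abs_le]; constructor <;> linarith
      have h1 := abs_inv_mul_sub_le hη.le hη8 hr1 hy2
      have hy4 : |s⁻¹ * y| ≤ 4 := by
        have h2 := abs_le.1 h1
        have h3 := abs_le.1 hy2
        rw [abs_le]; constructor <;> linarith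
      have h2 := abs_inv_mul_sub_le hη.le hη8 hr1 hy4
      have h3 := abs_le.1 h1
      have h4 := abs_le.1 h2
      have h5 := abs_le.1 hE
      rw [abs_le]; constructor <;> linarith)
  simpa using h

theorem pi_exists_inBand_ge (hd : 0 < d) (hb : 0 < b) (hbd : b < d) {k a η τ' τ : ℝ} (hk : 0 < k)
    (hk1 : k ≤ 1) (hX : k ≤ 1 - a ^ 2) (ha0 : 0 ≤ a) (hη : 0 < η) (hη8 : η ≤ 1 / 8) (hτ' : τ' < 1)
    (hτ : 20 * η + τ' ≤ τ) (hn : Real.exp (-((d / b - 1) * η ^ 2 / 2)) ≤ 1 / 6)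
    {v : EuclideanSpace ℝ (Fin d)} (hv : Balanced b τ' v) :
    ENNReal.ofReal ((√k / 4 * Real.exp (-(5 * η * (d / b + 1)))) ^ b) ≤
      (Measure.pi fun i : Fin b => Measure.pi fun _ : Fin (blockSize b (1 / pa d a)) =>
        unifSphere (Block d b i)) {u | ∃ k : Fin b → Fin (blockSize b (1 / pa d a)), InBand τ a v fun i => u i (k i)} := by
  have hne := nonempty_block hd hb hbd
  have hpr : ∀ i : Fin b, IsProbabilityMeasure (unifSphere (Block d b i)) := fun i =>
    isProbabilityMeasure_unifSphere _
  have hb' : (0 : ℝ) < b := by exact_mod_cast hb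
  have hX0 : 0 < 1 - a ^ 2 := hk.trans_le hX
  have ha1 : a ≤ 1 := by nlinarith
  let A : (i : Fin b) → Set (sphere (0 : EuclideanSpace ℝ (Block d b i)) 1) := fun i =>
    {y | |√(b : ℝ) * inner ℝ (blk b v i) (y : EuclideanSpace ℝ (Block d b i)) - a| ≤ τ}
  have hA : ∀ i, MeasurableSet (A i) := fun i =>
    measurableSet_le (by fun_prop) measurable_const
  obtain ⟨t, ht⟩ : ∃ t, t = √k / 2 * Real.exp (-(5 * η * (d / b + 1))) := ⟨_, rfl⟩
  have ht0 : 0 ≤ t := by rw [ht]; positivity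
  have hsk : √k ≤ 1 := Real.sqrt_le_one.2 hk1
  have ht1 : t ≤ 1 := by
    rw [ht]
    refine mul_le_one₀ (by linarith) (Real.exp_pos _).le (Real.exp_le_one_iff.2 ?_)
    have : 0 ≤ 5 * η * (d / b + 1) := by positivity
    linarith
  have hblock : ∀ i : Fin b, ENNReal.ofReal (t / 2) ≤
      Measure.pi (fun _ : Fin (blockSize b (1 / pa d a)) => unifSphere (Block d b i))
        {f | ∃ κ, f κ ∈ A i} := by
    intro i
    have hcard := card_block_le hd hb i
    have hcard' := le_card_block hd hb i
    obtain ⟨n, hnn⟩ : ∃ n : ℕ, n = Fintype.card (Block d b i) := ⟨_, rfl⟩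
    have hne := hne i
    have hpi := hpr i
    have hμ := unifSphere_band_scaled_ge (v := blk b v i) (s := √(b : ℝ)) (τ' := τ') (τ := τ) (η := η)
      (Real.sqrt_nonneg _) (by rw [Real.sq_sqrt hb'.le]; exact hv i) hτ' ha0 ha1 hη hη8 hτ
      (by
        refine le_trans ?_ hn
        gcongr)
    refine pi_exists_mem_ge (unifSphere (Block d b i)) (hA i) hμ ht0 ht1 ?_
    rw [← hnn] at hcard ⊢
    have hXn : (1 - a ^ 2) ^ ((d : ℝ) / (2 * b)) * √k ≤ √(1 - a ^ 2) ^ n := by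
      calc (1 - a ^ 2) ^ ((d : ℝ) / (2 * b)) * √k ≤
            (1 - a ^ 2) ^ ((d : ℝ) / (2 * b)) * √(1 - a ^ 2) := by gcongr
        _ = (1 - a ^ 2) ^ (((d : ℝ) / b + 1) / 2) := by
            rw [Real.sqrt_eq_rpow, ← Real.rpow_add hX0]
            congr 1; field_simp
        _ ≤ (1 - a ^ 2) ^ ((n : ℝ) / 2) := by
            refine Real.rpow_le_rpow_of_exponent_ge hX0 (by linarith [sq_nonneg a]) ?_
            linarith
        _ = _ := by
            rw [Real.sqrt_eq_rpow, ← Real.rpow_natCast ((1 - a ^ 2) ^ (1 / 2 : ℝ)) n,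
              ← Real.rpow_mul hX0.le]
            congr 1; ring
    have hexp : Real.exp (-(5 * η * (d / b + 1))) ≤ ((1 + 5 * η) ^ n)⁻¹ := by
      refine le_trans ?_ (exp_le_one_add_pow_inv hη.le n)
      gcongr
    have hK := one_le_blockSize_mul (d := d) (b := b) hX0
    rw [ht, div_pow, div_eq_mul_inv (√(1 - a ^ 2) ^ n)]
    calc √k / 2 * Real.exp (-(5 * η * (d / b + 1))) ≤
          1 * (√k / 2) * ((1 + 5 * η) ^ n)⁻¹ := by rw [one_mul]; gcongr
      _ ≤ (blockSize b (1 / pa d a) * (1 - a ^ 2) ^ ((d : ℝ) / (2 * b))) * (√k / 2) *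
          ((1 + 5 * η) ^ n)⁻¹ := by gcongr
      _ = blockSize b (1 / pa d a) * (((1 - a ^ 2) ^ ((d : ℝ) / (2 * b)) * √k) *
          ((1 + 5 * η) ^ n)⁻¹ / 2) := by ring
      _ ≤ _ := by gcongr
  have hsub : Set.pi univ (fun i : Fin b => {f : Fin (blockSize b (1 / pa d a)) →
      sphere (0 : EuclideanSpace ℝ (Block d b i)) 1 | ∃ κ, f κ ∈ A i}) ⊆
      {u | ∃ k : (Fin b → Fin (blockSize b (1 / pa d a))), InBand τ a v fun i => u i (k i)} := by
    intro u hu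
    have : ∀ i, ∃ κ, u i κ ∈ A i := fun i => hu i (mem_univ i)
    choose κ hκ using this
    exact ⟨κ, hκ⟩
  refine le_trans ?_ (measure_mono hsub)
  rw [Measure.pi_pi]
  calc ENNReal.ofReal ((√k / 4 * Real.exp (-(5 * η * (d / b + 1)))) ^ b) =
        ∏ _i : Fin b, ENNReal.ofReal (t / 2) := by
        rw [Finset.prod_const, Finset.card_univ, Fintype.card_fin,
          ← ENNReal.ofReal_pow (by positivity), ht]
        congr 2; ring
    _ ≤ _ := Finset.prod_le_prod' fun i _ => hblock i

theorem rpcLaw_exists_bnear_ge (hd : 2 ≤ d) (hb : 0 < b) (hbd : b < d) {k a η τ' τ t : ℝ}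
    (hk : 0 < k)
    (hk1 : k ≤ 1) (hX : k ≤ 1 - a ^ 2) (ha0 : 0 ≤ a) (hη : 0 < η) (hη8 : η ≤ 1 / 8) (hτ' : τ' < 1)
    (hτ : 20 * η + τ' ≤ τ) (hn : Real.exp (-((d / b - 1) * η ^ 2 / 2)) ≤ 1 / 6)
    (hτ'' : b * (2 * η + η + 2 * b / d) + 48 * η ≤ τ')
    (ht1 : Real.exp (-(d * η ^ 2 / 2)) ≤ t) (ht2 : Real.exp (-((d / b - 1) * η ^ 2 / 8)) ≤ t)
    (ht : (1 + b) * t ≤ 1 / 2) {x : EuclideanSpace ℝ (Fin d)} (hx : ‖x‖ = 1) (q : Fin N) :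
    ENNReal.ofReal ((√k / 4) ^ b * Real.exp (-(15 * η * d)) / 2) ≤
      rpcLaw d b N (1 / pa d a) {σ | ∃ k, BNear τ a σ x (q, k)} := by
  have hb' : (0 : ℝ) < b := by exact_mod_cast hb
  have hm : MeasurableSet {p : EuclideanSpace ℝ (Fin d) × ((i : Fin b) →
      Fin (blockSize b (1 / pa d a)) → sphere (0 : EuclideanSpace ℝ (Block d b i)) 1) |
      ∃ k : (Fin b → Fin (blockSize b (1 / pa d a))),
        Balanced b τ p.1 ∧ InBand τ a p.1 fun i => p.2 i (k i)} := by
    have e : {p : EuclideanSpace ℝ (Fin d) × ((i : Fin b) →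
      Fin (blockSize b (1 / pa d a)) → sphere (0 : EuclideanSpace ℝ (Block d b i)) 1) |
      ∃ k : (Fin b → Fin (blockSize b (1 / pa d a))),
        Balanced b τ p.1 ∧ InBand τ a p.1 fun i => p.2 i (k i)} = ⋃ k : Fin b → Fin (blockSize b (1 / pa d a)),
        {p | Balanced b τ p.1 ∧ InBand τ a p.1 fun i => p.2 i (k i)} := by
      ext p; simp
    rw [e]
    exact MeasurableSet.iUnion fun k => (isClosed_blockNear τ a k).measurableSet
  have hme : MeasurableSet {σ : RPCSeed d b N (1 / pa d a) | ∃ k, BNear τ a σ x (q, k)} := by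
    have e : {σ : RPCSeed d b N (1 / pa d a) | ∃ k, BNear τ a σ x (q, k)} =
        ⋃ k, (fun σ => (σ, x)) ⁻¹' {p | BNear τ a p.1 p.2 (q, k)} := by
      ext σ; simp
    rw [e]
    exact MeasurableSet.iUnion fun k =>
      (measurable_id.prodMk measurable_const) (measurableSet_bnear τ a (q, k))
  have key := lintegral_rpcLaw_pullVec (M := 1 / pa d a) hd hb hbd hx q
    (F := fun v u => {p : EuclideanSpace ℝ (Fin d) × ((i : Fin b) →
      Fin (blockSize b (1 / pa d a)) → sphere (0 : EuclideanSpace ℝ (Block d b i)) 1) |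
      ∃ k : (Fin b → Fin (blockSize b (1 / pa d a))),
        Balanced b τ p.1 ∧ InBand τ a p.1 fun i => p.2 i (k i)}.indicator 1 (v, u))
    (measurable_one.indicator hm)
  have e1 : rpcLaw d b N (1 / pa d a) {σ | ∃ k, BNear τ a σ x (q, k)} =
      ∫⁻ σ, {p : EuclideanSpace ℝ (Fin d) × ((i : Fin b) →
      Fin (blockSize b (1 / pa d a)) → sphere (0 : EuclideanSpace ℝ (Block d b i)) 1) |
      ∃ k : (Fin b → Fin (blockSize b (1 / pa d a))),
        Balanced b τ p.1 ∧ InBand τ a p.1 fun i => p.2 i (k i)}.indicator 1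
          (pullVec (σ.1 q) x, σ.2) ∂rpcLaw d b N (1 / pa d a) := by
    rw [← lintegral_indicator_one hme]
    rfl
  rw [e1, key]
  have hmb : MeasurableSet {v : sphere (0 : EuclideanSpace ℝ (Fin d)) 1 |
      Balanced b τ' (v : EuclideanSpace ℝ (Fin d))} :=
    measurable_subtype_coe (measurableSet_balanced τ')
  have hbal := unifSphere_balanced_ge (by omega) hb hbd.le hη hη8 hτ'' hτ'.le ht1 ht2 ht
  calc ENNReal.ofReal ((√k / 4) ^ b * Real.exp (-(15 * η * d)) / 2) ≤
        ENNReal.ofReal ((√k / 4 * Real.exp (-(5 * η * (d / b + 1)))) ^ b) *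
          ENNReal.ofReal ((1 / (1 + 5 * η)) ^ d / 2) := by
        rw [← ENNReal.ofReal_mul (by positivity)]
        refine ENNReal.ofReal_le_ofReal ?_
        have h1 := exp_le_one_add_pow_inv hη.le d
        have hbd' : (b : ℝ) ≤ d := by exact_mod_cast hbd.le
        rw [mul_pow, ← Real.exp_nat_mul, div_pow 1, one_pow, one_div]
        calc (√k / 4) ^ b * Real.exp (-(15 * η * d)) / 2 =
              (√k / 4) ^ b * (Real.exp (-(10 * η * d)) * (Real.exp (-(5 * η * d)) / 2)) := by
              rw [show -(15 * η * d) = -(10 * η * d) + -(5 * η * d) by ring, Real.exp_add]; ring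
          _ ≤ (√k / 4) ^ b * (Real.exp (b * -(5 * η * (d / b + 1))) *
              (((1 + 5 * η) ^ d)⁻¹ / 2)) := by
              gcongr
              have : b * -(5 * η * (d / b + 1)) = -(5 * η * (d + b)) := by field_simp
              rw [this]
              have : 5 * η * b ≤ 5 * η * d := by gcongr
              linarith
          _ = _ := by ring
    _ ≤ ENNReal.ofReal ((√k / 4 * Real.exp (-(5 * η * (d / b + 1)))) ^ b) *
          unifSphere (Fin d) {y | Balanced b τ' (y : EuclideanSpace ℝ (Fin d))} := by gcongr
    _ = ∫⁻ v in {y | Balanced b τ' (y : EuclideanSpace ℝ (Fin d))},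
          ENNReal.ofReal ((√k / 4 * Real.exp (-(5 * η * (d / b + 1)))) ^ b)
          ∂unifSphere (Fin d) := (setLIntegral_const _ _).symm
    _ ≤ ∫⁻ v in {y | Balanced b τ' (y : EuclideanSpace ℝ (Fin d))}, _ ∂unifSphere (Fin d) :=
        setLIntegral_mono' hmb fun v hv => ?_
    _ ≤ _ := setLIntegral_le_lintegral _ _
  refine (pi_exists_inBand_ge (τ := τ) (by omega) hb hbd hk hk1 hX ha0 hη hη8 hτ' hτ hn
    (v := v) hv).trans ?_
  rw [← setLIntegral_one]
  refine (setLIntegral_mono' ?_ fun u hu => ?_).trans (setLIntegral_le_lintegral _ _)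
  · have e : {u : (i : Fin b) → Fin (blockSize b (1 / pa d a)) →
        sphere (0 : EuclideanSpace ℝ (Block d b i)) 1 |
        ∃ k : (Fin b → Fin (blockSize b (1 / pa d a))),
          InBand τ a (v : EuclideanSpace ℝ (Fin d)) fun i => u i (k i)} =
        ⋃ k : Fin b → Fin (blockSize b (1 / pa d a)), {u | ∀ i, u i (k i) ∈
          {y | |√(b : ℝ) * inner ℝ (blk b (v : EuclideanSpace ℝ (Fin d)) i)
            (y : EuclideanSpace ℝ (Block d b i)) - a| ≤ τ}} := by
      ext u; simp [InBand]
    rw [e]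
    refine MeasurableSet.iUnion fun k => ?_
    simp only [ofPred_forall]
    refine MeasurableSet.iInter fun i => ?_
    have hA : MeasurableSet {y : sphere (0 : EuclideanSpace ℝ (Block d b i)) 1 |
        |√(b : ℝ) * inner ℝ (blk b (v : EuclideanSpace ℝ (Fin d)) i)
            (y : EuclideanSpace ℝ (Block d b i)) - a| ≤ τ} :=
      measurableSet_le (by fun_prop) measurable_const
    have h1 : Measurable fun u : (i : Fin b) → Fin (blockSize b (1 / pa d a)) →
        sphere (0 : EuclideanSpace ℝ (Block d b i)) 1 => u i (k i) :=
      (measurable_pi_apply (k i)).comp (measurable_pi_apply i)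
    exact h1 hA
  · obtain ⟨k, hk⟩ := hu
    rw [indicator_of_mem]
    · simp
    · exact ⟨k, fun i => (hv i).trans (by linarith), hk⟩

end Hit

section Moments

variable {d b N : ℕ}

open Classical in
theorem lintegral_bcnt_sq_le (hd : 2 ≤ d) (hb : 0 < b) (hbd : b < d) {k a τ δ : ℝ}
    (hk : 0 < k) (hk1 : k ≤ 1) (hX : k ≤ 1 - a ^ 2) (hτ0 : 0 ≤ τ) (hτ : τ < 1) (hτa : τ ≤ a)
    (ha : a ≤ 1) (hδ : 0 ≤ δ) (hδ1 : δ < 1) (hE : 6 * τ + 2 * δ ≤ a ^ 2)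
    (hδn : (1 - δ) ^ ((d : ℝ) / b - 1) ≤ 1 / 2)
    {x : EuclideanSpace ℝ (Fin d)} (hx : ‖x‖ = 1) (q : Fin N) :
    ∫⁻ σ, bcnt τ a σ q x ^ 2 ∂rpcLaw d b N (1 / pa d a) ≤
      ENNReal.ofReal ((32 / k) ^ b * Real.exp (d * (6 * τ + 2 * δ) / k)) := by
  have hd0 : 0 < d := by omega
  have hne := nonempty_block hd0 hb hbd
  have hpr : ∀ i : Fin b, IsProbabilityMeasure (unifSphere (Block d b i)) := fun i =>
    isProbabilityMeasure_unifSphere _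
  have hb' : (0 : ℝ) < b := by exact_mod_cast hb
  have hX0 : 0 < 1 - a ^ 2 := hk.trans_le hX
  obtain ⟨E, hEE⟩ : ∃ E, E = 6 * τ + 2 * δ := ⟨_, rfl⟩
  have hE0 : 0 ≤ E := by rw [hEE]; positivity
  obtain ⟨K, hK⟩ : ∃ K, K = blockSize b (1 / pa d a) := ⟨_, rfl⟩
  have hFm : Measurable (Function.uncurry fun (v : EuclideanSpace ℝ (Fin d))
      (u : (i : Fin b) → Fin (blockSize b (1 / pa d a)) →
        sphere (0 : EuclideanSpace ℝ (Block d b i)) 1) =>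
      (∑ k : Fin b → Fin (blockSize b (1 / pa d a)),
        if Balanced b τ v ∧ InBand τ a v (fun i => u i (k i)) then (1 : ℝ≥0∞) else 0) ^ 2) :=
    (Finset.measurable_fun_sum _ fun k _ => Measurable.ite (isClosed_blockNear τ a k).measurableSet
      measurable_const measurable_const).pow_const 2
  have key := lintegral_rpcLaw_pullVec (N := N) hd hb hbd hx q hFm
  have e0 : ∀ σ : RPCSeed d b N (1 / pa d a), bcnt τ a σ q x =
      ∑ k : Fin b → Fin (blockSize b (1 / pa d a)),
        if Balanced b τ (pullVec (σ.1 q) x) ∧ InBand τ a (pullVec (σ.1 q) x)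
          (fun i => σ.2 i (k i)) then (1 : ℝ≥0∞) else 0 := fun σ =>
    Finset.sum_congr rfl fun k _ => if_congr Iff.rfl rfl rfl
  simp_rw [e0]
  refine (key.le).trans ?_
  have : Nonempty (Fin d) := ⟨⟨0, hd0⟩⟩
  have hprob := isProbabilityMeasure_unifSphere (Fin d)
  refine (lintegral_mono (g := fun _ => ENNReal.ofReal ((32 / k) ^ b * Real.exp (d * E / k)))
    fun v => ?_).trans (by simp [hEE])
  by_cases hv : Balanced b τ (v : EuclideanSpace ℝ (Fin d))
  swap
  · refine le_of_eq_of_le (lintegral_congr (g := fun _ => 0) fun u => ?_) ?_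
    · simp only [hv, false_and, if_false, Finset.sum_const_zero]
      exact zero_pow two_ne_zero
    · rw [lintegral_zero]
      exact zero_le
  let A : (i : Fin b) → Set (sphere (0 : EuclideanSpace ℝ (Block d b i)) 1) := fun i =>
    {y | |√(b : ℝ) * inner ℝ (blk b (v : EuclideanSpace ℝ (Fin d)) i)
      (y : EuclideanSpace ℝ (Block d b i)) - a| ≤ τ}
  have hA : ∀ i, MeasurableSet (A i) := fun i =>
    measurableSet_le (by fun_prop) measurable_const
  have e : ∀ u : (i : Fin b) → Fin (blockSize b (1 / pa d a)) →
        sphere (0 : EuclideanSpace ℝ (Block d b i)) 1,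
      (∑ k : Fin b → Fin (blockSize b (1 / pa d a)),
        if Balanced b τ (v : EuclideanSpace ℝ (Fin d)) ∧ InBand τ a (v : EuclideanSpace ℝ (Fin d))
          (fun i => u i (k i)) then (1 : ℝ≥0∞) else 0) ^ 2 =
      ∏ i, (∑ κ, if u i κ ∈ A i then (1 : ℝ≥0∞) else 0) ^ 2 := by
    intro u
    rw [Finset.prod_pow, Finset.prod_univ_sum, Fintype.piFinset_univ]
    congr 1
    refine Finset.sum_congr rfl fun k _ => ?_
    rw [Finset.prod_ite_zero]
    simp [hv, InBand, A]
  simp_rw [e]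
  have hgm : ∀ i : Fin b, Measurable fun f : Fin (blockSize b (1 / pa d a)) →
      sphere (0 : EuclideanSpace ℝ (Block d b i)) 1 =>
      (∑ κ, if f κ ∈ A i then (1 : ℝ≥0∞) else 0) ^ 2 := fun i =>
    (Finset.measurable_fun_sum _ fun κ _ => Measurable.ite (measurable_pi_apply κ (hA i))
      measurable_const measurable_const).pow_const 2
  rw [lintegral_pi_prod_eq (fun i : Fin b => Measure.pi fun _ : Fin (blockSize b (1 / pa d a)) =>
    unifSphere (Block d b i)) (fun i f => (∑ κ, if f κ ∈ A i then (1 : ℝ≥0∞) else 0) ^ 2)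
    Finset.univ hgm]
  obtain ⟨T, hT⟩ : ∃ T, T = 4 / √k * Real.exp (d / (2 * b) * E / k) := ⟨_, rfl⟩
  have hsk : √k ≤ 1 := Real.sqrt_le_one.2 hk1
  have hsk0 : 0 < √k := Real.sqrt_pos.2 hk
  have hT1 : 1 ≤ T := by
    rw [hT]
    have h1 : 1 ≤ 4 / √k := by rw [le_div_iff₀ hsk0]; linarith
    have h2 : 1 ≤ Real.exp (d / (2 * b) * E / k) := Real.one_le_exp (by positivity)
    calc (1 : ℝ) = 1 * 1 := by ring
      _ ≤ _ := by gcongr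
  have hblock : ∀ i : Fin b, ∫⁻ f, (∑ κ, if f κ ∈ A i then (1 : ℝ≥0∞) else 0) ^ 2
      ∂(Measure.pi fun _ : Fin (blockSize b (1 / pa d a)) => unifSphere (Block d b i)) ≤
      ENNReal.ofReal (2 * T ^ 2) := by
    intro i
    have hne := hne i
    have hpi := hpr i
    have hcard' := le_card_block hd0 hb i
    obtain ⟨n, hnn⟩ : ∃ n : ℕ, n = Fintype.card (Block d b i) := ⟨_, rfl⟩
    have hP := unifSphere_band_scaled_le (v := blk b (v : EuclideanSpace ℝ (Fin d)) i)
      (s := √(b : ℝ)) (Real.sqrt_nonneg _) (by rw [Real.sq_sqrt hb'.le]; exact hv i) hτ0 hτ hτa ha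
      hδ hδ1 (by
        refine le_trans ?_ hδn
        rw [← Real.rpow_natCast]
        exact Real.rpow_le_rpow_of_exponent_ge (by linarith) (by linarith) hcard')
    rw [← hnn] at hcard' hP
    have hKP : (blockSize b (1 / pa d a) : ℝ≥0∞) * unifSphere (Block d b i) (A i) ≤
        ENNReal.ofReal T := by
      calc _ ≤ ENNReal.ofReal (blockSize b (1 / pa d a)) *
            ENNReal.ofReal (2 * (1 - a ^ 2 + 6 * τ + 2 * δ) ^ ((n : ℝ) / 2)) := by
            rw [ENNReal.ofReal_natCast]; gcongr
        _ = ENNReal.ofReal (blockSize b (1 / pa d a) * (2 * (1 - a ^ 2 + E) ^ ((n : ℝ) / 2))) := by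
            rw [hEE, ← add_assoc, ENNReal.ofReal_mul (Nat.cast_nonneg _)]
        _ ≤ _ := by
            refine ENNReal.ofReal_le_ofReal ?_
            have hY0 : 0 < 1 - a ^ 2 + E := by linarith
            have hY1 : 1 - a ^ 2 + E ≤ 1 := by linarith
            have h1 : (1 - a ^ 2 + E) ^ ((n : ℝ) / 2) ≤
                (1 - a ^ 2 + E) ^ ((d : ℝ) / (2 * b)) * (√k)⁻¹ := by
              calc (1 - a ^ 2 + E) ^ ((n : ℝ) / 2) ≤
                    (1 - a ^ 2 + E) ^ ((d : ℝ) / (2 * b) + -(1 / 2)) := by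
                    refine Real.rpow_le_rpow_of_exponent_ge hY0 hY1 ?_
                    have : (d : ℝ) / (2 * b) + -(1 / 2) = (d / b - 1) / 2 := by field_simp; ring
                    rw [this]; linarith
                _ = (1 - a ^ 2 + E) ^ ((d : ℝ) / (2 * b)) * (√(1 - a ^ 2 + E))⁻¹ := by
                    rw [Real.rpow_add hY0, Real.rpow_neg hY0.le, ← Real.sqrt_eq_rpow]
                _ ≤ _ := by gcongr; linarith
            have h2 := rpow_add_le_mul_exp (n := (d : ℝ) / (2 * b)) hk hX hE0 (by positivity)
            have h3 := blockSize_mul_le (d := d) (b := b) hX0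
            calc blockSize b (1 / pa d a) * (2 * (1 - a ^ 2 + E) ^ ((n : ℝ) / 2)) ≤
                  blockSize b (1 / pa d a) * (2 * (((1 - a ^ 2) ^ ((d : ℝ) / (2 * b)) *
                    Real.exp (d / (2 * b) * E / k)) * (√k)⁻¹)) := by
                  gcongr
                  exact h1.trans (by gcongr)
              _ = (blockSize b (1 / pa d a) * (1 - a ^ 2) ^ ((d : ℝ) / (2 * b))) *
                  (2 * (√k)⁻¹ * Real.exp (d / (2 * b) * E / k)) := by ring
              _ ≤ 2 * (2 * (√k)⁻¹ * Real.exp (d / (2 * b) * E / k)) := by gcongr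
              _ = T := by rw [hT]; ring
    refine (lintegral_pi_count_sq_le (unifSphere (Block d b i)) (hA i) _).trans ?_
    calc _ ≤ ENNReal.ofReal T + ENNReal.ofReal T ^ 2 := by gcongr
      _ = ENNReal.ofReal (T + T ^ 2) := by
          rw [ENNReal.ofReal_add (by linarith) (by positivity), ENNReal.ofReal_pow (by linarith)]
      _ ≤ _ := by
          refine ENNReal.ofReal_le_ofReal ?_
          nlinarith
  refine (Finset.prod_le_prod' fun i _ => hblock i).trans ?_
  rw [Finset.prod_const, Finset.card_univ, Fintype.card_fin, ← ENNReal.ofReal_pow (by positivity)]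
  refine ENNReal.ofReal_le_ofReal (le_of_eq ?_)
  have e2 : 2 * T ^ 2 = 32 / k * Real.exp (d / b * E / k) := by
    rw [hT, mul_pow, div_pow, Real.sq_sqrt hk.le, ← Real.exp_nat_mul]
    have : ((2 : ℕ) : ℝ) * (d / (2 * b) * E / k) = d / b * E / k := by
      push_cast; field_simp
    rw [this]; ring
  rw [e2, mul_pow, ← Real.exp_nat_mul]
  congr 2
  field_simp

theorem rpcLaw_near_le (hd : 2 ≤ d) (hb : 0 < b) (hbd : b < d) {M e a : ℝ} {p : ℝ≥0∞}
    (hp : ∀ c : EuclideanSpace ℝ (Fin d), ‖c‖ = 1 →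
      unifSphere (Fin d) {x | |inner ℝ (x : EuclideanSpace ℝ (Fin d)) c - a| ≤ e} ≤ p)
    {x : EuclideanSpace ℝ (Fin d)} (hx : ‖x‖ = 1) (j : CodeIdx b N M) :
    rpcLaw d b N M {σ | Near e a σ x j} ≤ p := by
  have hd0 : 0 < d := by omega
  have hne := nonempty_block hd0 hb hbd
  have hpr : ∀ i : Fin b, IsProbabilityMeasure (unifSphere (Block d b i)) := fun i =>
    isProbabilityMeasure_unifSphere _
  have : Nonempty (Fin d) := ⟨⟨0, hd0⟩⟩
  have hprob := isProbabilityMeasure_unifSphere (Fin d)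
  have hcl : IsClosed {t : EuclideanSpace ℝ (Fin d) × ((i : Fin b) → Fin (blockSize b M) →
      sphere (0 : EuclideanSpace ℝ (Block d b i)) 1) |
      |inner ℝ t.1 (concat d b fun i => t.2 i (j.2 i)) - a| ≤ e} := by
    refine isClosed_le ?_ continuous_const
    refine ((continuous_fst.inner (continuous_concat.comp ?_)).sub continuous_const).abs
    fun_prop
  have hmN : MeasurableSet {σ : RPCSeed d b N M | Near e a σ x j} :=
    (measurable_id.prodMk measurable_const) (measurableSet_near e a j)
  have key := lintegral_rpcLaw_pullVec (M := M) hd hb hbd hx j.1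
    (F := fun v u => {t : EuclideanSpace ℝ (Fin d) × ((i : Fin b) → Fin (blockSize b M) →
      sphere (0 : EuclideanSpace ℝ (Block d b i)) 1) |
      |inner ℝ t.1 (concat d b fun i => t.2 i (j.2 i)) - a| ≤ e}.indicator 1 (v, u))
    (measurable_one.indicator hcl.measurableSet)
  have e1 : rpcLaw d b N M {σ | Near e a σ x j} = ∫⁻ σ, {t : EuclideanSpace ℝ (Fin d) ×
      ((i : Fin b) → Fin (blockSize b M) → sphere (0 : EuclideanSpace ℝ (Block d b i)) 1) |
      |inner ℝ t.1 (concat d b fun i => t.2 i (j.2 i)) - a| ≤ e}.indicator 1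
        (pullVec (σ.1 j.1) x, σ.2) ∂rpcLaw d b N M := by
    rw [← lintegral_indicator_one hmN]
    refine lintegral_congr fun σ => ?_
    simp only [indicator, mem_ofPred_eq, Near, inner_cw, Pi.one_apply]
  rw [e1, key, lintegral_lintegral_swap]
  · refine (lintegral_mono (g := fun _ => p) fun u => ?_).trans (by
      rw [lintegral_const, measure_univ, mul_one])
    refine le_trans (le_of_eq ?_) (hp (concat d b fun i => u i (j.2 i)) (norm_concat hd0 hb _))
    rw [← lintegral_indicator_one]
    · rfl
    · exact measurableSet_le (by fun_prop) measurable_const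
  · exact ((measurable_one.indicator hcl.measurableSet).comp
      ((measurable_subtype_coe.comp measurable_fst).prodMk measurable_snd)).aemeasurable

end Moments

/-! ### Asymptotic estimates -/

/-- The model `(1 - γ²)^{d/2}` for the wedge ratio. -/
def wa (d : ℕ) (a g : ℝ) : ℝ := (1 - gramG a g) ^ ((d : ℝ) / 2)

/-- The exponent `d / log₂² d` of the error factors. -/
def err (d : ℕ) : ℝ := d / ell d ^ 2

/-- The numerical facts about a large dimension that the estimates use. -/
structure Scale (k : ℝ) (d : ℕ) : Prop where
  two_le : 2 ≤ d
  b_pos : 0 < Nat.log 2 d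
  b_lt : Nat.log 2 d < d
  ell_ge : 100 ≤ ell d
  ell_ge' : 1000 / k ^ 2 ≤ ell d
  pow_le : ell d ^ 30 ≤ d
  exp_le : Real.exp (-(d / ell d ^ 18)) * (32 * d) ≤ 1

theorem eventually_scale (k : ℝ) : ∀ᶠ d : ℕ in atTop, Scale k d := by
  filter_upwards [eventually_ge_atTop 2, eventually_le_ell 100, eventually_le_ell (1000 / k ^ 2),
    eventually_mul_ell_pow_le 1 30, eventually_exp_neg_le 32 18] with d h1 h2 h3 h4 h5
  exact ⟨h1, Nat.log_pos (by norm_num) h1, Nat.log_lt_self 2 (by omega), h2, h3, by simpa using h4, h5⟩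

namespace Scale

variable {k : ℝ} {d : ℕ} (h : Scale k d)
include h

theorem ell_pos : 0 < ell d := by linarith [h.ell_ge]

theorem d_pos : (0 : ℝ) < d := by exact_mod_cast (show 0 < d by linarith [h.two_le])

theorem pow_le_of_le {n : ℕ} (hn : n ≤ 30) : ell d ^ n ≤ d :=
  (pow_le_pow_right₀ (by linarith [h.ell_ge]) hn).trans h.pow_le

theorem one_le_err : 1 ≤ err d := by
  have := h.ell_pos
  rw [err, le_div_iff₀ (by positivity), one_mul]
  exact h.pow_le_of_le (by norm_num)

theorem b_le_err : (Nat.log 2 d : ℝ) ≤ err d := by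
  have := h.ell_pos
  refine (natLog_le_ell d).trans ?_
  rw [err, le_div_iff₀ (by positivity), ← pow_succ']
  exact h.pow_le_of_le (by norm_num)

theorem div_b_ge : (d : ℝ) / (2 * ell d) ≤ d / Nat.log 2 d - 1 := by
  have h0 := h.ell_pos
  have hb : (0 : ℝ) < Nat.log 2 d := by exact_mod_cast h.b_pos
  have h1 : (d : ℝ) / ell d ≤ d / Nat.log 2 d := by
    gcongr
    exact natLog_le_ell d
  have h2 : 2 ≤ (d : ℝ) / ell d := by
    rw [le_div_iff₀ h0]
    have := h.pow_le_of_le (n := 2) (by norm_num)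
    nlinarith [h.ell_ge]
  have h3 : (d : ℝ) / (2 * ell d) = d / ell d / 2 := by field_simp
  linarith

theorem exp_le' : Real.exp (-(d / ell d ^ 18)) ≤ 1 / (32 * d) := by
  have := h.d_pos
  rw [le_div_iff₀ (by positivity)]
  exact h.exp_le

theorem exp_block_le {n : ℝ} (hn : (d : ℝ) / (2 * ell d) ≤ n) :
    Real.exp (-(n * (1 / ell d ^ 8) ^ 2 / 8)) ≤ 1 / (32 * d) := by
  have h0 := h.ell_pos
  refine le_trans (Real.exp_le_exp.2 (neg_le_neg ?_)) h.exp_le'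
  have : (d : ℝ) / ell d ^ 18 ≤ d / (2 * ell d) * (1 / ell d ^ 8) ^ 2 / 8 := by
    have e : (d : ℝ) / (2 * ell d) * (1 / ell d ^ 8) ^ 2 / 8 = d / (16 * ell d ^ 17) := by
      field_simp; ring
    rw [e]
    gcongr
    calc 16 * ell d ^ 17 ≤ ell d * ell d ^ 17 := by gcongr; linarith [h.ell_ge]
      _ = _ := by ring
  refine this.trans ?_
  gcongr

theorem inv_pow_le {m n : ℕ} (hmn : m ≤ n) : 1 / ell d ^ n ≤ 1 / ell d ^ m := by
  have h0 := h.ell_pos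
  gcongr
  linarith [h.ell_ge]

theorem mul_inv_pow_le {C : ℝ} (hC : C ≤ ell d) (n : ℕ) : C * (1 / ell d ^ (n + 1)) ≤ 1 / ell d ^ n := by
  have h0 := h.ell_pos
  calc C * (1 / ell d ^ (n + 1)) ≤ ell d * (1 / ell d ^ (n + 1)) := by gcongr
    _ = _ := by rw [pow_succ]; field_simp

theorem b_mul_le : (Nat.log 2 d : ℝ) * (2 * (1 / ell d ^ 8) + 1 / ell d ^ 8 +
    2 * Nat.log 2 d / d) + 48 * (1 / ell d ^ 8) ≤ 1 / ell d ^ 6 := by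
  have h0 := h.ell_pos
  have hb := natLog_le_ell d
  have h1 : 2 * (Nat.log 2 d : ℝ) / d ≤ 2 * (1 / ell d ^ 8) := by
    rw [mul_div_assoc]
    refine mul_le_mul_of_nonneg_left ?_ (by norm_num)
    rw [div_le_div_iff₀ h.d_pos (by positivity), one_mul]
    calc (Nat.log 2 d : ℝ) * ell d ^ 8 ≤ ell d * ell d ^ 8 := by gcongr
      _ = ell d ^ 9 := by ring
      _ ≤ d := h.pow_le_of_le (by norm_num)
  have h2 := h.mul_inv_pow_le (C := 100) h.ell_ge 6
  have h3 := h.inv_pow_le (show 7 ≤ 8 by norm_num)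
  have h4 : ell d * (1 / ell d ^ 8) = 1 / ell d ^ 7 := by field_simp
  calc _ ≤ ell d * (2 * (1 / ell d ^ 8) + 1 / ell d ^ 8 + 2 * (1 / ell d ^ 8)) +
        48 * (1 / ell d ^ 7) := by gcongr
    _ = 53 * (1 / ell d ^ 7) := by rw [← h4]; ring
    _ ≤ 100 * (1 / ell d ^ 7) := by gcongr; norm_num
    _ ≤ _ := h2

theorem five_mul_le_err : 5 * (1 / ell d ^ 8) * d ≤ 5 * err d := by
  have h0 := h.ell_pos
  have hd := h.d_pos
  have := h.inv_pow_le (show 2 ≤ 8 by norm_num)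
  calc 5 * (1 / ell d ^ 8) * d ≤ 5 * (1 / ell d ^ 2) * d := by gcongr
    _ = _ := by rw [err]; ring

theorem tol_le : tol d ≤ 1 / 100 := by
  rw [tol_eq]
  have h1 := h.inv_pow_le (show 1 ≤ 2 by norm_num)
  have h2 := h.ell_ge
  have : 1 / ell d ^ 1 ≤ 1 / 100 := by rw [pow_one]; gcongr
  linarith

theorem tol_pos : 0 < tol d := by
  have := h.ell_pos
  rw [tol_eq]; positivity

theorem tol_le_k (hk : 0 < k) : 1000 * tol d ≤ k ^ 2 := by
  have h0 := h.ell_pos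
  have h1 := h.ell_ge'
  rw [div_le_iff₀ (by positivity)] at h1
  rw [tol_eq, mul_one_div, div_le_iff₀ (by positivity)]
  nlinarith [h.ell_ge, mul_pos h0 (pow_pos hk 2)]

theorem one_sub_tol_pow_le {c : ℝ} (hc : 1 ≤ c) (hc1 : c * tol d ≤ 1) : (1 - c * tol d) ^ d ≤ 1 / 2 := by
  have h0 := h.ell_pos
  have h3 : Real.exp (-1) ≤ 1 / 2 := by
    rw [Real.exp_neg, one_div]
    gcongr
    have := Real.add_one_le_exp 1
    linarith
  calc (1 - c * tol d) ^ d ≤ Real.exp (-(c * tol d)) ^ d := by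
        refine pow_le_pow_left₀ (by linarith) ?_ d
        linarith [Real.add_one_le_exp (-(c * tol d))]
    _ = Real.exp (d * -(c * tol d)) := (Real.exp_nat_mul _ _).symm
    _ ≤ Real.exp (-1) := by
        gcongr
        have h4 : (1 : ℝ) ≤ d * tol d := by
          have := h.one_le_err
          rw [err] at this
          rw [tol_eq, mul_one_div]; exact this
        nlinarith
    _ ≤ 1 / 2 := h3

end Scale

/-- `exp (C d / log₂² d)` is eventually below any fixed power of `2^{d / log₂ d}`. -/
theorem eventually_exp_err_le (C : ℝ) {c : ℝ} (hc : 0 < c) :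
    ∀ᶠ d : ℕ in atTop, Real.exp (C * err d) ≤ Lam d ^ c := by
  filter_upwards [eventually_mul_exp_le_Lam (max 1 C) hc, eventually_scale 1] with d hd h
  refine le_trans ?_ hd
  have h1 := h.one_le_err
  calc Real.exp (C * err d) ≤ 1 * Real.exp (max 1 C * err d) := by
        rw [one_mul]; gcongr; exact le_max_right _ _
    _ ≤ _ := by
        rw [err]
        gcongr
        exact le_max_left _ _

theorem const_mul_le_exp_err {k C : ℝ} (hC : 0 ≤ C) {d : ℕ} (h : Scale k d) :
    C ≤ Real.exp (C * err d) := by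
  have h1 := h.one_le_err
  calc C ≤ C * err d := le_mul_of_one_le_right hC h1
    _ ≤ C * err d + 1 := by linarith
    _ ≤ _ := Real.add_one_le_exp _

theorem exp_err_le_half {k : ℝ} {d : ℕ} (h : Scale k d) : Real.exp (-err d) ≤ 1 / 2 := by
  have h1 := h.one_le_err
  rw [Real.exp_neg, one_div]
  gcongr
  linarith [Real.add_one_le_exp (err d)]

section Estimates

variable {k : ℝ} (hk : 0 < k)
include hk

theorem cap_upper {D : ℝ} (hD : 1 ≤ D) : ∃ C : ℝ, ∀ d : ℕ, Scale k d →
    16 * (D * tol d) ≤ k ^ 2 → ∀ a : ℝ, k ≤ a → a ≤ 1 - k →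
    ∀ c : EuclideanSpace ℝ (Fin d), ‖c‖ = 1 →
    unifSphere (Fin d) {x | |inner ℝ (x : EuclideanSpace ℝ (Fin d)) c - a| ≤ D * tol d} ≤
      ENNReal.ofReal (Real.exp (C * err d) * pa d a) := by
  refine ⟨2 + 2 * D / k, fun d h hDk a ha ha1 c hc => ?_⟩
  have : Nonempty (Fin d) := ⟨⟨0, by linarith [h.two_le]⟩⟩
  have ht := h.tol_pos
  have ht1 := h.tol_le
  have hk1 : k ≤ 1 := by linarith
  have hkk : k ^ 2 ≤ k := by rw [sq]; exact mul_le_of_le_one_left hk.le hk1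
  have hX : k ≤ 1 - a ^ 2 := by nlinarith
  obtain ⟨e, he⟩ : ∃ e, e = D * tol d := ⟨_, rfl⟩
  have hte : tol d ≤ e := by rw [he]; exact le_mul_of_one_le_left ht.le hD
  rw [← he] at hDk ⊢
  refine (measure_mono fun x hx => ?_).trans ((unifSphere_cap_le (u := c) (h := a - e)
    (δ := tol d) hc.le (by linarith) (by linarith) ht.le (by linarith)
    (by simpa using h.one_sub_tol_pow_le (c := 1) le_rfl (by linarith))).trans
    (ENNReal.ofReal_le_ofReal ?_))
  · rw [mem_ofPred_eq] at hx ⊢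
    linarith [(abs_le.1 hx).1]
  · rw [Fintype.card_fin]
    have h1 : 1 - ((a - e) * (1 - tol d)) ^ 2 ≤ (1 - a ^ 2) + 4 * e := by
      have h2 : a - 2 * e ≤ (a - e) * (1 - tol d) := by nlinarith
      have h3 : (a - 2 * e) ^ 2 ≤ ((a - e) * (1 - tol d)) ^ 2 := by
        refine pow_le_pow_left₀ (by linarith) h2 2
      nlinarith
    have h0 : 0 ≤ 1 - ((a - e) * (1 - tol d)) ^ 2 := by
      have h2 : (a - e) * (1 - tol d) ≤ 1 :=
        mul_le_one₀ (by linarith) (by linarith) (by linarith)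
      have h3 : 0 ≤ (a - e) * (1 - tol d) := mul_nonneg (by linarith) (by linarith)
      have := pow_le_one₀ (n := 2) h3 h2
      linarith
    have h4 := rpow_add_le_mul_exp (E := 4 * e) (n := (d : ℝ) / 2) hk hX (by linarith)
      (by positivity)
    have h5 := const_mul_le_exp_err (C := 2) (by norm_num) h
    calc 2 * (1 - ((a - e) * (1 - tol d)) ^ 2) ^ ((d : ℝ) / 2) ≤
          Real.exp (2 * err d) * (pa d a * Real.exp ((d : ℝ) / 2 * (4 * e) / k)) := by
          refine mul_le_mul h5 ?_ (by positivity) (Real.exp_pos _).le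
          exact (Real.rpow_le_rpow h0 h1 (by positivity)).trans h4
      _ = _ := by
          have : (d : ℝ) / 2 * (4 * e) / k = 2 * D / k * err d := by
            rw [he, tol_eq, err]; field_simp; ring
          rw [this, add_mul, Real.exp_add]; ring

theorem cap_lower : ∃ C : ℝ, ∀ d : ℕ, Scale k d → ∀ a : ℝ, k ≤ a → a ≤ 1 - k →
    ∀ c : EuclideanSpace ℝ (Fin d), ‖c‖ = 1 →
    ENNReal.ofReal (Real.exp (-(C * err d)) * pa d a) ≤
      unifSphere (Fin d) {x | |inner ℝ (x : EuclideanSpace ℝ (Fin d)) c - a| ≤ tol d} := by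
  refine ⟨6, fun d h a ha ha1 c hc => ?_⟩
  have : Nonempty (Fin d) := ⟨⟨0, by linarith [h.two_le]⟩⟩
  have h0 := h.ell_pos
  have hd := h.d_pos
  have hX : k ≤ 1 - a ^ 2 := by nlinarith
  have hη8 : 1 / ell d ^ 8 ≤ 1 / 8 := by
    have h1 := h.inv_pow_le (show 2 ≤ 8 by norm_num)
    have h2 := h.tol_le
    rw [tol_eq] at h2
    linarith
  refine le_trans (ENNReal.ofReal_le_ofReal ?_) (unifSphere_band_ge (η := 1 / ell d ^ 8) hc
    (by linarith) (by linarith) (by positivity) hη8 ?_ ?_)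
  · rw [Fintype.card_fin, div_pow, div_eq_mul_inv (√(1 - a ^ 2) ^ d)]
    have h1 := exp_le_one_add_pow_inv (η := 1 / ell d ^ 8) (by positivity) d
    have h2 : √(1 - a ^ 2) ^ d = pa d a := by
      rw [pa, Real.sqrt_eq_rpow, ← Real.rpow_natCast ((1 - a ^ 2) ^ (1 / 2 : ℝ)) d,
        ← Real.rpow_mul (by linarith)]
      congr 1; ring
    have h3 := exp_err_le_half h
    have hpa : 0 ≤ pa d a := Real.rpow_nonneg (by linarith) _
    rw [h2]
    calc Real.exp (-(6 * err d)) * pa d a =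
          pa d a * Real.exp (-(5 * err d)) * Real.exp (-err d) := by
          rw [show -(6 * err d) = -(5 * err d) + -err d by ring, Real.exp_add]; ring
      _ ≤ pa d a * Real.exp (-(5 * (1 / ell d ^ 8) * d)) * (1 / 2) := by
          have h6 := Real.exp_le_exp.2 (neg_le_neg h.five_mul_le_err)
          exact mul_le_mul (mul_le_mul_of_nonneg_left h6 hpa) h3 (Real.exp_pos _).le
            (mul_nonneg hpa (Real.exp_pos _).le)
      _ ≤ pa d a * ((1 + 5 * (1 / ell d ^ 8)) ^ d)⁻¹ * (1 / 2) := by gcongr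
      _ = _ := by ring
  · rw [tol_eq]
    have h1 := h.mul_inv_pow_le (C := 20) (by linarith [h.ell_ge]) 7
    have h2 := h.inv_pow_le (show 2 ≤ 7 by norm_num)
    linarith
  · rw [Fintype.card_fin]
    have h2 : Real.exp (-((d : ℝ) * (1 / ell d ^ 8) ^ 2 / 2)) ≤
        Real.exp (-((d : ℝ) * (1 / ell d ^ 8) ^ 2 / 8)) := by
      gcongr; norm_num
    have h3 := h.exp_block_le (n := d) (by
      rw [div_le_iff₀ (by positivity)]
      have := h.ell_ge
      nlinarith)
    have h4 : 1 / (32 * (d : ℝ)) ≤ 1 / 6 := by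
      have : (2 : ℝ) ≤ d := by exact_mod_cast h.two_le
      gcongr; linarith
    linarith

theorem wedge_upper {D : ℝ} (hD : 1 ≤ D) : ∃ C : ℝ, ∀ d : ℕ, Scale k d → 16 * (D * tol d) ≤ k ^ 2 →
    ∀ a g : ℝ, Adm k a g → ∀ x c : EuclideanSpace ℝ (Fin d), ‖x‖ = 1 → ‖c‖ = 1 →
    |inner ℝ x c - a| ≤ D * tol d →
    unifSphere (Fin d) {y | g - D * tol d ≤ inner ℝ x (y : EuclideanSpace ℝ (Fin d)) ∧
      a - D * tol d ≤ inner ℝ (y : EuclideanSpace ℝ (Fin d)) c} ≤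
      ENNReal.ofReal (Real.exp (C * err d) * wa d a g) := by
  refine ⟨2 + 4 * D / k, fun d h hDk a g hA x c hx hc hxc => ?_⟩
  have : Nonempty (Fin d) := ⟨⟨0, by linarith [h.two_le]⟩⟩
  have ht := h.tol_pos
  have hk1 : k ≤ 1 := by linarith [hA.a_ge, hA.a_le]
  have hkk : k ^ 2 ≤ 1 := pow_le_one₀ hk.le hk1
  refine (unifSphere_wedge_le hx hc hA (by positivity) hDk
    (by simpa using h.one_sub_tol_pow_le hD (by linarith)) hxc).trans (ENNReal.ofReal_le_ofReal ?_)
  rw [Fintype.card_fin]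
  have h4 := rpow_add_le_mul_exp (E := 8 * (D * tol d)) (n := (d : ℝ) / 2) hk hA.le_one_sub_gramG
    (by positivity) (by positivity)
  have h5 := const_mul_le_exp_err (C := 2) (by norm_num) h
  have hw : 0 ≤ wa d a g := Real.rpow_nonneg (by linarith [hA.le_one_sub_gramG]) _
  calc _ ≤ Real.exp (2 * err d) * (wa d a g * Real.exp ((d : ℝ) / 2 * (8 * (D * tol d)) / k)) := by
        refine mul_le_mul h5 h4 (Real.rpow_nonneg ?_ _) (Real.exp_pos _).le
        have := hA.le_one_sub_gramG
        have : 0 ≤ 8 * (D * tol d) := by positivity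
        linarith
    _ = _ := by
        have : (d : ℝ) / 2 * (8 * (D * tol d)) / k = 4 * D / k * err d := by
          rw [tol_eq, err]; field_simp; ring
        rw [this, add_mul, Real.exp_add]; ring

theorem wedge_lower : ∃ C : ℝ, ∀ d : ℕ, Scale k d →
    ∀ a g : ℝ, Adm k a g → ∀ x c : EuclideanSpace ℝ (Fin d), ‖x‖ = 1 → ‖c‖ = 1 →
    inner ℝ x c = a →
    ENNReal.ofReal (Real.exp (-(C * err d)) * wa d a g) ≤
    unifSphere (Fin d) {y | g ≤ inner ℝ x (y : EuclideanSpace ℝ (Fin d)) ∧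
      a ≤ inner ℝ c (y : EuclideanSpace ℝ (Fin d))} := by
  refine ⟨6 + 3 / k, fun d h a g hA x c hx hc hxc => ?_⟩
  have : Nonempty (Fin d) := ⟨⟨0, by linarith [h.two_le]⟩⟩
  have ht := h.tol_pos
  have h0 := h.ell_pos
  have hd := h.d_pos
  have htk := h.tol_le_k hk
  have hk1 : k ≤ 1 := by linarith [hA.a_ge, hA.a_le]
  have hkk : k ^ 2 ≤ k := by rw [sq]; exact mul_le_of_le_one_left hk.le hk1
  have hη8 : 1 / ell d ^ 8 ≤ 1 / 8 := by
    have h1 := h.inv_pow_le (show 2 ≤ 8 by norm_num)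
    have h2 := h.tol_le
    rw [tol_eq] at h2
    linarith
  have hG := hA.le_one_sub_gramG
  refine le_trans (ENNReal.ofReal_le_ofReal ?_) (unifSphere_wedge_ge (β := tol d)
    (η := 1 / ell d ^ 8) hx hc hA (by linarith) (by positivity) hη8 ?_ ?_ hxc)
  · rw [Fintype.card_fin, div_pow, div_eq_mul_inv (√(1 - gramG a g - 3 * tol d) ^ d)]
    have h1 := exp_le_one_add_pow_inv (η := 1 / ell d ^ 8) (by positivity) d
    have h4 := mul_exp_le_rpow_sub (X := 1 - gramG a g) (E := 3 * tol d) (n := (d : ℝ) / 2) hk hG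
      (by positivity) (by linarith) (by positivity)
    have h7 : 0 ≤ (1 - gramG a g - 3 * tol d) ^ ((d : ℝ) / 2) :=
      Real.rpow_nonneg (by linarith) _
    have e : 2 * ((d : ℝ) / 2) * (3 * tol d) / k = 3 / k * err d := by
      rw [tol_eq, err]; field_simp
    rw [e] at h4
    have h2 : √(1 - gramG a g - 3 * tol d) ^ d = (1 - gramG a g - 3 * tol d) ^ ((d : ℝ) / 2) := by
      rw [Real.sqrt_eq_rpow,
        ← Real.rpow_natCast ((1 - gramG a g - 3 * tol d) ^ (1 / 2 : ℝ)) d,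
        ← Real.rpow_mul (by linarith)]
      congr 1; ring
    have h3 := exp_err_le_half h
    have hw : 0 ≤ wa d a g := Real.rpow_nonneg (by linarith) _
    rw [h2]
    calc Real.exp (-((6 + 3 / k) * err d)) * wa d a g =
          (wa d a g * Real.exp (-(3 / k * err d))) * Real.exp (-(5 * err d)) *
            Real.exp (-err d) := by
          rw [show -((6 + 3 / k) * err d) = -(3 / k * err d) + -(5 * err d) + -err d by ring,
            Real.exp_add, Real.exp_add]
          ring
      _ ≤ (1 - gramG a g - 3 * tol d) ^ ((d : ℝ) / 2) * Real.exp (-(5 * (1 / ell d ^ 8) * d)) *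
          (1 / 2) := by
          have h6 := Real.exp_le_exp.2 (neg_le_neg h.five_mul_le_err)
          exact mul_le_mul (mul_le_mul h4 h6 (Real.exp_pos _).le h7) h3 (Real.exp_pos _).le
            (mul_nonneg h7 (Real.exp_pos _).le)
      _ ≤ (1 - gramG a g - 3 * tol d) ^ ((d : ℝ) / 2) * ((1 + 5 * (1 / ell d ^ 8)) ^ d)⁻¹ *
          (1 / 2) := by gcongr
      _ = _ := by ring
  · rw [tol_eq]
    have hkl : 20 ≤ k * ell d := by
      have h1 := h.ell_ge'
      rw [div_le_iff₀ (by positivity)] at h1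
      nlinarith
    have h2 := h.inv_pow_le (show 3 ≤ 8 by norm_num)
    have e : 1 / ell d ^ 2 * k = (k * ell d) * (1 / ell d ^ 3) := by field_simp
    rw [e]
    gcongr
  · rw [Fintype.card_fin]
    have h2 : Real.exp (-((d : ℝ) * (1 / ell d ^ 8) ^ 2 / 2)) ≤
        Real.exp (-((d : ℝ) * (1 / ell d ^ 8) ^ 2 / 8)) := by
      gcongr; norm_num
    have h3 := h.exp_block_le (n := d) (by
      rw [div_le_iff₀ (by positivity)]
      have := h.ell_ge
      nlinarith)
    have h4 : 1 / (32 * (d : ℝ)) ≤ 1 / 14 := by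
      have : (2 : ℝ) ≤ d := by exact_mod_cast h.two_le
      gcongr; linarith
    linarith

end Estimates

/-! ### Asymptotic estimates for random product codes -/

section CodeEstimates

variable {k : ℝ} (hk : 0 < k)
include hk

theorem code_hit : ∃ C : ℝ, ∀ d : ℕ, Scale k d → ∀ a : ℝ, k ≤ a → a ≤ 1 - k →
    ∀ (N : ℕ) (q : Fin N) (x : EuclideanSpace ℝ (Fin d)), ‖x‖ = 1 →
    ENNReal.ofReal (Real.exp (-(C * err d))) ≤
      rpcLaw d (Nat.log 2 d) N (1 / pa d a) {σ | ∃ κ, BNear (1 / ell d ^ 4) a σ x (q, κ)} := by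
  refine ⟨4 / √k + 16, fun d h a ha ha1 N q x hx => ?_⟩
  have h0 := h.ell_pos
  have hd := h.d_pos
  have hk1 : k ≤ 1 := by linarith
  have hX : k ≤ 1 - a ^ 2 := by nlinarith
  have hsk0 : 0 < √k := Real.sqrt_pos.2 hk
  have hη8 : 1 / ell d ^ 8 ≤ 1 / 8 := by
    have h1 := h.inv_pow_le (show 2 ≤ 8 by norm_num)
    have h2 := h.tol_le
    rw [tol_eq] at h2
    linarith
  have h6 : 1 / ell d ^ 6 < 1 := by
    have h1 := h.inv_pow_le (show 2 ≤ 6 by norm_num)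
    have h2 := h.tol_le
    rw [tol_eq] at h2
    linarith
  have hd2 : (2 : ℝ) ≤ d := by exact_mod_cast h.two_le
  have hbd : (Nat.log 2 d : ℝ) ≤ d := by exact_mod_cast h.b_lt.le
  have hdd : (d : ℝ) / (2 * ell d) ≤ d := by
    rw [div_le_iff₀ (by positivity)]
    have := h.ell_ge
    nlinarith
  have e1 := h.exp_block_le h.div_b_ge
  have e2 := h.exp_block_le hdd
  refine le_trans (ENNReal.ofReal_le_ofReal ?_) (rpcLaw_exists_bnear_ge (k := k)
    (η := 1 / ell d ^ 8) (τ' := 1 / ell d ^ 6) (t := 1 / (32 * d)) h.two_le h.b_pos h.b_lt hk hk1 hX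
    (by linarith) (by positivity) hη8 h6 ?_ ?_ h.b_mul_le ?_ e1 ?_ hx q)
  · have h1 : Real.exp (-(4 / √k * err d)) ≤ (√k / 4) ^ Nat.log 2 d := by
      calc Real.exp (-(4 / √k * err d)) ≤ Real.exp (Nat.log 2 d * -(4 / √k)) := by
            refine Real.exp_le_exp.2 ?_
            have : 4 / √k * Nat.log 2 d ≤ 4 / √k * err d := by
              gcongr
              exact h.b_le_err
            linarith
        _ = Real.exp (-(4 / √k)) ^ Nat.log 2 d := Real.exp_nat_mul _ _
        _ ≤ _ := by
            gcongr
            rw [Real.exp_neg, inv_le_comm₀ (Real.exp_pos _) (by positivity), inv_div]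
            linarith [Real.add_one_le_exp (4 / √k)]
    have h2 : Real.exp (-(15 * err d)) ≤ Real.exp (-(15 * (1 / ell d ^ 8) * d)) := by
      refine Real.exp_le_exp.2 ?_
      have := h.five_mul_le_err
      linarith
    have h3 := exp_err_le_half h
    calc Real.exp (-((4 / √k + 16) * err d)) =
          Real.exp (-(4 / √k * err d)) * Real.exp (-(15 * err d)) * Real.exp (-err d) := by
          rw [← Real.exp_add, ← Real.exp_add]; congr 1; ring
      _ ≤ (√k / 4) ^ Nat.log 2 d * Real.exp (-(15 * (1 / ell d ^ 8) * d)) * (1 / 2) := by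
          exact mul_le_mul (mul_le_mul h1 h2 (Real.exp_pos _).le (by positivity)) h3
            (Real.exp_pos _).le (by positivity)
      _ = _ := by ring
  · have h1 := h.mul_inv_pow_le (C := 20) (by linarith [h.ell_ge]) 7
    have h2 := h.inv_pow_le (show 6 ≤ 7 by norm_num)
    have h3 := h.mul_inv_pow_le (C := 2) (by linarith [h.ell_ge]) 5
    have h4 := h.inv_pow_le (show 4 ≤ 5 by norm_num)
    linarith
  · have e3 : Real.exp (-(((d : ℝ) / Nat.log 2 d - 1) * (1 / ell d ^ 8) ^ 2 / 2)) ≤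
        Real.exp (-(((d : ℝ) / Nat.log 2 d - 1) * (1 / ell d ^ 8) ^ 2 / 8)) := by
      have := h.div_b_ge
      have h5 : 0 ≤ (d : ℝ) / Nat.log 2 d - 1 := le_trans (by positivity) this
      gcongr
      norm_num
    have h4 : 1 / (32 * (d : ℝ)) ≤ 1 / 6 := by gcongr; linarith
    linarith
  · refine le_trans (Real.exp_le_exp.2 (neg_le_neg ?_)) e2
    gcongr
    norm_num
  · rw [mul_one_div, div_le_iff₀ (by positivity)]
    linarith

theorem code_moment : ∃ C : ℝ, ∀ d : ℕ, Scale k d → ∀ a : ℝ, k ≤ a → a ≤ 1 - k →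
    ∀ (N : ℕ) (q : Fin N) (x : EuclideanSpace ℝ (Fin d)), ‖x‖ = 1 →
    ∫⁻ σ, bcnt (tol d) a σ q x ^ 2 ∂rpcLaw d (Nat.log 2 d) N (1 / pa d a) ≤
      ENNReal.ofReal (Real.exp (C * err d)) := by
  refine ⟨32 / k + 8 / k, fun d h a ha ha1 N q x hx => ?_⟩
  have h0 := h.ell_pos
  have hd := h.d_pos
  have ht := h.tol_pos
  have ht1 := h.tol_le
  have htk := h.tol_le_k hk
  have hk1 : k ≤ 1 := by linarith
  have hkk : k ^ 2 ≤ k := by rw [sq]; exact mul_le_of_le_one_left hk.le hk1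
  have hX : k ≤ 1 - a ^ 2 := by nlinarith
  have hka : k ^ 2 ≤ a ^ 2 := by gcongr
  refine (lintegral_bcnt_sq_le (k := k) (δ := tol d) h.two_le h.b_pos h.b_lt hk hk1 hX ht.le
    (by linarith) (by linarith) (by linarith) ht.le (by linarith) (by linarith) ?_ hx q).trans
    (ENNReal.ofReal_le_ofReal ?_)
  · have hn := h.div_b_ge
    have h1 : 1 ≤ tol d * ((d : ℝ) / Nat.log 2 d - 1) := by
      calc (1 : ℝ) ≤ tol d * (d / (2 * ell d)) := by
            rw [tol_eq, div_mul_div_comm, le_div_iff₀ (by positivity), one_mul, one_mul]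
            calc ell d ^ 2 * (2 * ell d) = 2 * ell d ^ 3 := by ring
              _ ≤ ell d * ell d ^ 3 := by gcongr; linarith [h.ell_ge]
              _ = ell d ^ 4 := by ring
              _ ≤ d := h.pow_le_of_le (by norm_num)
        _ ≤ _ := by gcongr
    have h3 : Real.exp (-1) ≤ 1 / 2 := by
      rw [Real.exp_neg, one_div]
      gcongr
      have := Real.add_one_le_exp 1
      linarith
    have h5 : 0 ≤ (d : ℝ) / Nat.log 2 d - 1 := le_trans (by positivity) hn
    calc (1 - tol d) ^ ((d : ℝ) / Nat.log 2 d - 1) ≤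
          Real.exp (-tol d) ^ ((d : ℝ) / Nat.log 2 d - 1) := by
          refine Real.rpow_le_rpow (by linarith) ?_ h5
          linarith [Real.add_one_le_exp (-tol d)]
      _ = Real.exp (-tol d * ((d : ℝ) / Nat.log 2 d - 1)) := (Real.exp_mul _ _).symm
      _ ≤ Real.exp (-1) := Real.exp_le_exp.2 (by linarith)
      _ ≤ _ := h3
  · rw [add_mul, Real.exp_add]
    have h1 : (32 / k) ^ Nat.log 2 d ≤ Real.exp (32 / k * err d) := by
      calc (32 / k) ^ Nat.log 2 d ≤ Real.exp (32 / k) ^ Nat.log 2 d := by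
            gcongr; linarith [Real.add_one_le_exp (32 / k)]
        _ = Real.exp (Nat.log 2 d * (32 / k)) := (Real.exp_nat_mul _ _).symm
        _ ≤ _ := by
            refine Real.exp_le_exp.2 ?_
            rw [mul_comm]
            exact mul_le_mul_of_nonneg_left h.b_le_err (by positivity)
    have h2 : (d : ℝ) * (6 * tol d + 2 * tol d) / k = 8 / k * err d := by
      rw [tol_eq, err]; field_simp; ring
    rw [h2]
    gcongr

theorem code_wedge : ∃ C : ℝ, ∀ d : ℕ, Scale k d → ∀ a g : ℝ, Adm k a g →
    ∀ (N : ℕ) (M : ℝ) (σ : RPCSeed d (Nat.log 2 d) N M) (j : CodeIdx (Nat.log 2 d) N M)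
    (x : EuclideanSpace ℝ (Fin d)), ‖x‖ = 1 → BNear (1 / ell d ^ 4) a σ x j →
    ENNReal.ofReal (Real.exp (-(C * err d)) * wa d a g) ≤
      unifSphere (Fin d) {y | |inner ℝ x (y : EuclideanSpace ℝ (Fin d)) - g| ≤ tol d ∧
        BNear (tol d) a σ (y : EuclideanSpace ℝ (Fin d)) j} := by
  refine ⟨6 / k ^ 2 + 6, fun d h a g hA N M σ j x hx hj => ?_⟩
  have : Nonempty (Fin d) := ⟨⟨0, by linarith [h.two_le]⟩⟩
  have h0 := h.ell_pos
  have hd := h.d_pos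
  have ht := h.tol_pos
  have ht1 := h.tol_le
  have htk := h.tol_le_k hk
  have hk1 : k ≤ 1 := by linarith [hA.a_ge, hA.a_le]
  have hkk : k ^ 2 ≤ k := by rw [sq]; exact mul_le_of_le_one_left hk.le hk1
  have hG := hA.le_one_sub_gramG
  have h4t : 1 / ell d ^ 4 ≤ tol d := h.inv_pow_le (show 2 ≤ 4 by norm_num)
  have h4t' : 1 / ell d ^ 4 ≤ tol d * (k ^ 2 / 1000) := by
    have h1 := h.tol_le_k hk
    have e : 1 / ell d ^ 4 = tol d * tol d := by rw [tol_eq]; field_simp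
    rw [e]
    gcongr
    linarith
  have hη8 : 1 / ell d ^ 8 ≤ 1 / 8 := by
    have h1 := h.inv_pow_le (show 2 ≤ 8 by norm_num)
    rw [tol_eq] at ht1
    linarith
  have hd2 : (2 : ℝ) ≤ d := by exact_mod_cast h.two_le
  have hbd : (Nat.log 2 d : ℝ) ≤ d := by exact_mod_cast h.b_lt.le
  have hdd : (d : ℝ) / (2 * ell d) ≤ d := by
    rw [div_le_iff₀ (by positivity)]
    have := h.ell_ge
    nlinarith
  have e1 := h.exp_block_le h.div_b_ge
  have e2 := h.exp_block_le hdd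
  have hw := unifSphere_blockWedge_ge (k := k) (g := g) (τ₀ := 1 / ell d ^ 4) (τ := tol d)
    (η := 1 / ell d ^ 8) (h := 1 / ell d ^ 8) (t := 1 / (32 * d)) (by linarith [h.two_le]) h.b_pos
    h.b_lt.le (v := pullVec (σ.1 j.1) x) (by rw [norm_pullVec, hx]) hA (by positivity)
    (by linarith) (by positivity) hη8 (by positivity) (by linarith) (by linarith)
    (by
      have h1 := h.b_mul_le
      have h2 := h.inv_pow_le (show 4 ≤ 6 by norm_num)
      have h3 : 0 ≤ 48 * (1 / ell d ^ 8) := by positivity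
      calc _ ≤ 200 / k ^ 2 * (1 / ell d ^ 4 + 1 / ell d ^ 4) := by gcongr; linarith
        _ ≤ 200 / k ^ 2 * (tol d * (k ^ 2 / 1000) + tol d * (k ^ 2 / 1000)) := by gcongr
        _ = 2 / 5 * tol d := by field_simp; ring
        _ ≤ _ := by linarith)
    (by
      refine le_trans (Real.exp_le_exp.2 (neg_le_neg ?_)) e2
      gcongr
      norm_num) e1
    (by
      rw [mul_one_div, div_le_iff₀ (by positivity)]
      linarith) hj.1 hj.2
  have hset : {y : sphere (0 : EuclideanSpace ℝ (Fin d)) 1 |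
      |inner ℝ x (y : EuclideanSpace ℝ (Fin d)) - g| ≤ tol d ∧
        BNear (tol d) a σ (y : EuclideanSpace ℝ (Fin d)) j} =
      {c : sphere (0 : EuclideanSpace ℝ (Fin d)) 1 |
        pullIso (σ.1 j.1) (c : EuclideanSpace ℝ (Fin d)) ∈ {y : EuclideanSpace ℝ (Fin d) |
        |inner ℝ (pullVec (σ.1 j.1) x) y - g| ≤ tol d ∧
        (Balanced (Nat.log 2 d) (tol d) y ∧
          InBand (tol d) a y fun i => σ.2 i (j.2 i))}} := by
    ext y
    have e : pullIso (σ.1 j.1) (y : EuclideanSpace ℝ (Fin d)) = pullVec (σ.1 j.1) y := rfl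
    simp only [mem_ofPred_eq, BNear, e, inner_pullVec_pullVec]
  have hmeas : MeasurableSet {y : EuclideanSpace ℝ (Fin d) |
        |inner ℝ (pullVec (σ.1 j.1) x) y - g| ≤ tol d ∧
        (Balanced (Nat.log 2 d) (tol d) y ∧
          InBand (tol d) a y fun i => σ.2 i (j.2 i))} := by
    have m1 : MeasurableSet {y : EuclideanSpace ℝ (Fin d) |
        |inner ℝ (pullVec (σ.1 j.1) x) y - g| ≤ tol d} :=
      measurableSet_le (by fun_prop) measurable_const
    exact m1.inter ((measurableSet_balanced _).inter (measurableSet_inBand _ _ _))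
  rw [hset, unifSphere_map_isometry (pullIso (σ.1 j.1)) hmeas]
  refine le_trans (ENNReal.ofReal_le_ofReal ?_) hw
  rw [div_pow, div_eq_mul_inv (√(1 - gramG a g - _) ^ d)]
  have hE : 6 * (1 / ell d ^ 4) / k ≤ 3 * tol d / k := by
    refine div_le_div_of_nonneg_right ?_ hk.le
    have : tol d * (k ^ 2 / 1000) ≤ tol d * (1 / 1000) := by gcongr; linarith
    linarith
  have htk2 : 6 * tol d / k ≤ k := by
    rw [div_le_iff₀ hk]; linarith
  have h1 := exp_le_one_add_pow_inv (η := 1 / ell d ^ 8) (by positivity) d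
  have h4 := mul_exp_le_rpow_sub (X := 1 - gramG a g) (E := 6 * (1 / ell d ^ 4) / k)
    (n := (d : ℝ) / 2) hk hG (by positivity) (by
      have : 3 * tol d / k * 2 = 6 * tol d / k := by ring
      linarith) (by positivity)
  have hpos : 0 ≤ 1 - gramG a g - 6 * (1 / ell d ^ 4) / k := by
    have : 3 * tol d / k * 2 = 6 * tol d / k := by ring
    linarith
  have h7 : 0 ≤ (1 - gramG a g - 6 * (1 / ell d ^ 4) / k) ^ ((d : ℝ) / 2) :=
    Real.rpow_nonneg hpos _
  have h2 : √(1 - gramG a g - 6 * (1 / ell d ^ 4) / k) ^ d =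
      (1 - gramG a g - 6 * (1 / ell d ^ 4) / k) ^ ((d : ℝ) / 2) := by
    rw [Real.sqrt_eq_rpow,
      ← Real.rpow_natCast ((1 - gramG a g - 6 * (1 / ell d ^ 4) / k) ^ (1 / 2 : ℝ)) d,
      ← Real.rpow_mul hpos]
    congr 1; ring
  have h3 := exp_err_le_half h
  have hwa : 0 ≤ wa d a g := Real.rpow_nonneg (by linarith) _
  have h5 : wa d a g * Real.exp (-(6 / k ^ 2 * err d)) ≤
      (1 - gramG a g - 6 * (1 / ell d ^ 4) / k) ^ ((d : ℝ) / 2) := by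
    refine le_trans (mul_le_mul_of_nonneg_left (Real.exp_le_exp.2 (neg_le_neg ?_)) hwa) h4
    have e : 6 / k ^ 2 * err d = 2 * ((d : ℝ) / 2) * (6 * (1 / ell d ^ 2) / k) / k := by
      rw [err]; field_simp
    rw [e]
    have := h.inv_pow_le (show 2 ≤ 4 by norm_num)
    gcongr
  rw [h2]
  have h6 := Real.exp_le_exp.2 (neg_le_neg h.five_mul_le_err)
  calc Real.exp (-((6 / k ^ 2 + 6) * err d)) * wa d a g =
        (wa d a g * Real.exp (-(6 / k ^ 2 * err d))) * Real.exp (-(5 * err d)) *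
          Real.exp (-err d) := by
        rw [show -((6 / k ^ 2 + 6) * err d) = -(6 / k ^ 2 * err d) + -(5 * err d) + -err d by ring,
          Real.exp_add, Real.exp_add]
        ring
    _ ≤ (1 - gramG a g - 6 * (1 / ell d ^ 4) / k) ^ ((d : ℝ) / 2) *
        Real.exp (-(5 * (1 / ell d ^ 8) * d)) * (1 / 2) :=
        mul_le_mul (mul_le_mul h5 h6 (Real.exp_pos _).le h7) h3 (Real.exp_pos _).le
          (mul_nonneg h7 (Real.exp_pos _).le)
    _ ≤ (1 - gramG a g - 6 * (1 / ell d ^ 4) / k) ^ ((d : ℝ) / 2) *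
        ((1 + 5 * (1 / ell d ^ 8)) ^ d)⁻¹ * (1 / 2) := by gcongr
    _ = _ := by ring

theorem pair_upper : ∃ C : ℝ, ∀ d : ℕ, Scale k d →
    ∀ a g : ℝ, Adm k a g → ∀ c : EuclideanSpace ℝ (Fin d), ‖c‖ = 1 →
    ∀ F F' : Set (EuclideanSpace ℝ (Fin d)), MeasurableSet F → MeasurableSet F' →
    (∀ u v : EuclideanSpace ℝ (Fin d), u ∈ F → ‖u - v‖ ≤ 4 / k * tol d → v ∈ F') →
    ((unifSphere (Fin d)).prod (unifSphere (Fin d))) {p |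
      |inner ℝ (p.1 : EuclideanSpace ℝ (Fin d)) c - a| ≤ tol d ∧
      |inner ℝ (p.2 : EuclideanSpace ℝ (Fin d)) c - a| ≤ tol d ∧
      |inner ℝ (p.1 : EuclideanSpace ℝ (Fin d)) (p.2 : EuclideanSpace ℝ (Fin d)) - g| ≤ tol d ∧
      dir (p.1 : EuclideanSpace ℝ (Fin d)) p.2 ∈ F} ≤
    ENNReal.ofReal (Real.exp (C * err d) * (pa d a * wa d a g)) *
      unifSphere (Fin d) {v | (v : EuclideanSpace ℝ (Fin d)) ∈ F'} := by
  refine ⟨4 + 10 / k, fun d h a g hA c hc F F' hF hF' hFF => ?_⟩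
  have : Nonempty (Fin d) := ⟨⟨0, by linarith [h.two_le]⟩⟩
  have ht := h.tol_pos
  have ht1 := h.tol_le
  have htk := h.tol_le_k hk
  have hk1 : k ≤ 1 := by linarith [hA.a_ge, hA.a_le]
  have hkk : k ^ 2 ≤ k := by rw [sq]; exact mul_le_of_le_one_left hk.le hk1
  have hX := hA.one_sub_sq_pos
  refine (unifSphere_pair_le (w := 4 / k * tol d) hc hA ht (by linarith)
    (le_of_eq (by ring)) (by simpa using h.one_sub_tol_pow_le (c := 1) le_rfl (by linarith))
    hF hF' hFF).trans (mul_le_mul_left (ENNReal.ofReal_le_ofReal ?_) _)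
  rw [Fintype.card_fin]
  have h4 := rpow_add_le_mul_exp (E := 20 * tol d) (n := (d : ℝ) / 2) hk hA.det (by positivity)
    (by positivity)
  have h5 := const_mul_le_exp_err (C := 4) (by norm_num) h
  have hG := hA.le_one_sub_gramG
  have e1 : (1 - 2 * a ^ 2 - g ^ 2 + 2 * a ^ 2 * g) ^ ((d : ℝ) / 2) = pa d a * wa d a g := by
    rw [pa, wa, ← Real.mul_rpow (by linarith) (by linarith), hA.one_sub_gramG]
    congr 1
    have : 1 - a ^ 2 ≠ 0 := by linarith
    field_simp
  have hp : 0 ≤ pa d a * wa d a g :=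
    mul_nonneg (Real.rpow_nonneg (by linarith) _) (Real.rpow_nonneg (by linarith) _)
  rw [e1] at h4
  calc _ ≤ Real.exp (4 * err d) * ((pa d a * wa d a g) *
        Real.exp ((d : ℝ) / 2 * (20 * tol d) / k)) := by
        refine mul_le_mul h5 h4 (Real.rpow_nonneg ?_ _) (Real.exp_pos _).le
        have := hA.det
        linarith
    _ = _ := by
        have : (d : ℝ) / 2 * (20 * tol d) / k = 10 / k * err d := by
          rw [tol_eq, err]; field_simp; ring
        rw [this, add_mul, Real.exp_add]; ring

end CodeEstimates

/-! ### All estimates in a fixed dimension -/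

/-- The estimates in a fixed large dimension, up to factors `2^{d / log₂ d}`. -/
structure DimFacts (k : ℝ) (d N : ℕ) : Prop where
  scale : Scale k d
  two_le_Lam : 256 ≤ Lam d
  codeSize : ∀ a, k ≤ a → a ≤ 1 - k →
    (Fintype.card (CodeIdx (Nat.log 2 d) N (1 / pa d a)) : ℝ) * pa d a ≤ Lam d
  cap_le : ∀ a, k ≤ a → a ≤ 1 - k → ∀ c : EuclideanSpace ℝ (Fin d), ‖c‖ = 1 →
    unifSphere (Fin d) {x | |inner ℝ (x : EuclideanSpace ℝ (Fin d)) c - a| ≤ tol d} ≤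
      ENNReal.ofReal (Lam d * pa d a)
  cap_ge : ∀ a, k ≤ a → a ≤ 1 - k → ∀ c : EuclideanSpace ℝ (Fin d), ‖c‖ = 1 →
    ENNReal.ofReal ((Lam d)⁻¹ * pa d a) ≤
      unifSphere (Fin d) {x | |inner ℝ (x : EuclideanSpace ℝ (Fin d)) c - a| ≤ tol d}
  wedge_le : ∀ a g, Adm k a g → ∀ x c : EuclideanSpace ℝ (Fin d), ‖x‖ = 1 → ‖c‖ = 1 →
    |inner ℝ x c - a| ≤ tol d →
    unifSphere (Fin d) {y | g - tol d ≤ inner ℝ x (y : EuclideanSpace ℝ (Fin d)) ∧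
      a - tol d ≤ inner ℝ (y : EuclideanSpace ℝ (Fin d)) c} ≤ ENNReal.ofReal (Lam d * wa d a g)
  wedge_ge : ∀ a g, Adm k a g → ∀ x c : EuclideanSpace ℝ (Fin d), ‖x‖ = 1 → ‖c‖ = 1 →
    inner ℝ x c = a →
    ENNReal.ofReal ((Lam d)⁻¹ * wa d a g) ≤
      unifSphere (Fin d) {y | g ≤ inner ℝ x (y : EuclideanSpace ℝ (Fin d)) ∧
        a ≤ inner ℝ c (y : EuclideanSpace ℝ (Fin d))}
  hit : ∀ a, k ≤ a → a ≤ 1 - k → ∀ q : Fin N, ∀ x : EuclideanSpace ℝ (Fin d), ‖x‖ = 1 →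
    ENNReal.ofReal (Lam d)⁻¹ ≤ rpcLaw d (Nat.log 2 d) N (1 / pa d a)
      {σ | cnt (tol d) a σ x ≤ ENNReal.ofReal (Lam d) ∧
        ∃ κ, BNear (1 / ell d ^ 4) a σ x (q, κ)}
  moment : ∀ a, k ≤ a → a ≤ 1 - k → ∀ q : Fin N, ∀ x : EuclideanSpace ℝ (Fin d), ‖x‖ = 1 →
    ∫⁻ σ, bcnt (tol d) a σ q x ^ 2 ∂rpcLaw d (Nat.log 2 d) N (1 / pa d a) ≤
      ENNReal.ofReal (Lam d)
  code_wedge : ∀ a g, Adm k a g → ∀ (σ : RPCSeed d (Nat.log 2 d) N (1 / pa d a))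
    (j : CodeIdx (Nat.log 2 d) N (1 / pa d a)) (x : EuclideanSpace ℝ (Fin d)), ‖x‖ = 1 →
    BNear (1 / ell d ^ 4) a σ x j →
    ENNReal.ofReal ((Lam d)⁻¹ * wa d a g) ≤
      unifSphere (Fin d) {y | |inner ℝ x (y : EuclideanSpace ℝ (Fin d)) - g| ≤ tol d ∧
        BNear (tol d) a σ (y : EuclideanSpace ℝ (Fin d)) j}
  pair_wedge : ∀ a g a' g', Adm k a g → Adm k a' g' → ∀ c c' z : EuclideanSpace ℝ (Fin d),
    ‖c‖ = 1 → ‖c'‖ = 1 → ‖z‖ = 1 → |inner ℝ z c' - a'| ≤ tol d →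
    ((unifSphere (Fin d)).prod (unifSphere (Fin d))) {p |
      |inner ℝ (p.1 : EuclideanSpace ℝ (Fin d)) c - a| ≤ tol d ∧
      |inner ℝ (p.2 : EuclideanSpace ℝ (Fin d)) c - a| ≤ tol d ∧
      |inner ℝ (p.1 : EuclideanSpace ℝ (Fin d)) (p.2 : EuclideanSpace ℝ (Fin d)) - g| ≤ tol d ∧
      |inner ℝ (dir (p.1 : EuclideanSpace ℝ (Fin d)) p.2) z - g'| ≤ tol d ∧
      |inner ℝ (dir (p.1 : EuclideanSpace ℝ (Fin d)) p.2) c' - a'| ≤ tol d} ≤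
    ENNReal.ofReal (Lam d * (pa d a * wa d a g * wa d a' g'))
  pair_cap : ∀ a g a', Adm k a g → k ≤ a' → a' ≤ 1 - k → ∀ c c' : EuclideanSpace ℝ (Fin d),
    ‖c‖ = 1 → ‖c'‖ = 1 →
    ((unifSphere (Fin d)).prod (unifSphere (Fin d))) {p |
      |inner ℝ (p.1 : EuclideanSpace ℝ (Fin d)) c - a| ≤ tol d ∧
      |inner ℝ (p.2 : EuclideanSpace ℝ (Fin d)) c - a| ≤ tol d ∧
      |inner ℝ (p.1 : EuclideanSpace ℝ (Fin d)) (p.2 : EuclideanSpace ℝ (Fin d)) - g| ≤ tol d ∧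
      |inner ℝ (dir (p.1 : EuclideanSpace ℝ (Fin d)) p.2) c' - a'| ≤ tol d} ≤
    ENNReal.ofReal (Lam d * (pa d a * wa d a g * pa d a'))

theorem card_codeIdx (b N : ℕ) (M : ℝ) :
    Fintype.card (CodeIdx b N M) = N * blockSize b M ^ b := by
  simp [CodeIdx]

theorem codeSize_le {k : ℝ} (hk : 0 < k) {d N : ℕ} (h : Scale k d) {a : ℝ} (ha : k ≤ a)
    (ha1 : a ≤ 1 - k) :
    (Fintype.card (CodeIdx (Nat.log 2 d) N (1 / pa d a)) : ℝ) * pa d a ≤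
      N * Real.exp (2 * err d) := by
  have hX : 0 < 1 - a ^ 2 := by nlinarith
  rw [card_codeIdx]
  push_cast
  rw [mul_assoc]
  gcongr
  refine (blockSize_pow_mul_le h.b_pos hX).trans ?_
  calc (2 : ℝ) ^ Nat.log 2 d ≤ Real.exp 2 ^ Nat.log 2 d := by
        gcongr; linarith [Real.add_one_le_exp 2]
    _ = Real.exp (Nat.log 2 d * 2) := (Real.exp_nat_mul _ _).symm
    _ ≤ _ := by
        rw [mul_comm]
        have := h.b_le_err
        gcongr

theorem pa_pos {k : ℝ} (hk : 0 < k) {a : ℝ} (ha : k ≤ a) (ha1 : a ≤ 1 - k) (d : ℕ) :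
    0 < pa d a := Real.rpow_pos_of_pos (by nlinarith) _

theorem Adm.wa_pos {k a g : ℝ} (h : Adm k a g) (d : ℕ) : 0 < wa d a g :=
  Real.rpow_pos_of_pos (by linarith [h.le_one_sub_gramG, h.pos]) _

theorem lintegral_cnt_le {d b N : ℕ} {M e a : ℝ} (hd : 2 ≤ d) (hb : 0 < b) (hbd : b < d) {p : ℝ≥0∞}
    (hp : ∀ c : EuclideanSpace ℝ (Fin d), ‖c‖ = 1 →
      unifSphere (Fin d) {x | |inner ℝ (x : EuclideanSpace ℝ (Fin d)) c - a| ≤ e} ≤ p)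
    {x : EuclideanSpace ℝ (Fin d)} (hx : ‖x‖ = 1) :
    ∫⁻ σ, cnt e a σ x ∂rpcLaw d b N M ≤ Fintype.card (CodeIdx b N M) * p := by
  classical
  have hm : ∀ j : CodeIdx b N M, MeasurableSet {σ : RPCSeed d b N M | Near e a σ x j} := fun j =>
    (measurable_id.prodMk measurable_const) (measurableSet_near e a j)
  have e1 : ∀ σ : RPCSeed d b N M, cnt e a σ x =
      ∑ j, {σ : RPCSeed d b N M | Near e a σ x j}.indicator 1 σ := fun σ =>
    Finset.sum_congr rfl fun j _ => by simp only [indicator, mem_ofPred_eq, Pi.one_apply]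
  simp_rw [e1]
  rw [lintegral_finsetSum _ fun j _ => measurable_one.indicator (hm j)]
  refine (Finset.sum_le_sum (g := fun _ => p) fun j _ => ?_).trans (by simp)
  rw [lintegral_indicator_one (hm j)]
  exact rpcLaw_near_le hd hb hbd hp hx j

/-- Eventually, all estimates hold. -/
theorem eventually_dimFacts {k : ℝ} (hk : 0 < k) {N : ℕ → ℕ} (hN_pos : ∀ᶠ d in atTop, 1 ≤ N d)
    (hN : (fun d : ℕ => Real.logb 2 (N d)) =o[atTop] fun d : ℕ => (d : ℝ) / Real.logb 2 d) :
    ∀ᶠ d in atTop, DimFacts k d (N d) := by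
  have hD : 1 ≤ 1 + 4 / k := by
    have : 0 < 4 / k := by positivity
    linarith
  obtain ⟨C₁, h₁⟩ := cap_upper hk le_rfl
  obtain ⟨C₂, h₂⟩ := cap_lower hk
  obtain ⟨C₃, h₃⟩ := wedge_upper hk le_rfl
  obtain ⟨C₄, h₄⟩ := wedge_lower hk
  obtain ⟨C₅, h₅⟩ := code_hit hk
  obtain ⟨C₆, h₆⟩ := code_moment hk
  obtain ⟨C₇, h₇⟩ := code_wedge hk
  obtain ⟨C₈, h₈⟩ := pair_upper hk
  obtain ⟨C₉, h₉⟩ := cap_upper hk hD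
  obtain ⟨C₀, h₀⟩ := wedge_upper hk hD
  have hc : (0 : ℝ) < 1 / 8 := by norm_num
  have hDe : ∀ᶠ d : ℕ in atTop, 16 * ((1 + 4 / k) * tol d) ≤ k ^ 2 := by
    filter_upwards [eventually_le_ell 1, eventually_le_ell (16 * (1 + 4 / k) / k ^ 2)] with d h1 h2
    rw [div_le_iff₀ (by positivity)] at h2
    rw [tol_eq, mul_one_div, ← mul_div_assoc, div_le_iff₀ (by positivity)]
    nlinarith [pow_pos hk 2]
  filter_upwards [hN_pos, hN.bound hc, eventually_scale k, hDe, eventually_exp_err_le C₁ hc,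
    eventually_exp_err_le C₂ hc, eventually_exp_err_le C₃ hc, eventually_exp_err_le C₄ hc,
    eventually_exp_err_le C₅ hc, eventually_exp_err_le C₆ hc, eventually_exp_err_le C₇ hc,
    eventually_exp_err_le (C₈ + C₉) hc, eventually_exp_err_le (C₈ + C₀) hc,
    eventually_exp_err_le 8 hc] with d hN1 hNd hs hDd e1 e2 e3 e4 e5 e6 e7 e89 e80 e8
  have hL0 := Lam_pos d
  have hLbig : (256 : ℝ) ≤ Lam d := by
    have h1 := const_mul_le_exp_err (C := 8) (by norm_num) hs
    have h2 : (8 : ℝ) ≤ Lam d ^ (1 / 8 : ℝ) := h1.trans e8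
    calc (256 : ℝ) ≤ 8 ^ 8 := by norm_num
      _ ≤ (Lam d ^ (1 / 8 : ℝ)) ^ 8 := by gcongr
      _ = Lam d := by
          rw [← Real.rpow_natCast, ← Real.rpow_mul hL0.le]; norm_num
  have hL1 : 1 ≤ Lam d := by linarith
  have hpow : ∀ c : ℝ, c ≤ 1 → Lam d ^ c ≤ Lam d := fun c hc => by
    calc Lam d ^ c ≤ Lam d ^ (1 : ℝ) := Real.rpow_le_rpow_of_exponent_le hL1 hc
      _ = _ := Real.rpow_one _
  have hle : ∀ {x : ℝ}, x ≤ Lam d ^ (1 / 8 : ℝ) → x ≤ Lam d := fun h =>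
    h.trans (hpow _ (by norm_num))
  have hge8 : ∀ {C : ℝ}, Real.exp (C * err d) ≤ Lam d ^ (1 / 8 : ℝ) →
      (Lam d ^ (1 / 8 : ℝ))⁻¹ ≤ Real.exp (-(C * err d)) := fun h => by
    rw [Real.exp_neg]
    exact inv_anti₀ (Real.exp_pos _) h
  have hge : ∀ {C : ℝ}, Real.exp (C * err d) ≤ Lam d ^ (1 / 8 : ℝ) →
      (Lam d)⁻¹ ≤ Real.exp (-(C * err d)) := fun h =>
    (inv_anti₀ (by positivity) (hpow _ (by norm_num))).trans (hge8 h)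
  have hNL : (N d : ℝ) ≤ Lam d ^ (1 / 8 : ℝ) := by
    have hN0 : (0 : ℝ) < N d := by exact_mod_cast hN1
    have hell := hs.ell_pos
    rw [Lam, ← Real.rpow_mul (by norm_num)]
    rw [← Real.logb_le_iff_le_rpow (by norm_num) hN0]
    refine (le_abs_self _).trans ?_
    have h1 : ‖(d : ℝ) / Real.logb 2 d‖ = d / ell d := by
      rw [Real.norm_of_nonneg]
      · rfl
      · have : 0 ≤ (d : ℝ) / ell d := by positivity
        exact this
    rw [h1] at hNd
    calc _ ≤ _ := hNd
      _ = _ := by ring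
  have hsize : ∀ a, k ≤ a → a ≤ 1 - k →
      (Fintype.card (CodeIdx (Nat.log 2 d) (N d) (1 / pa d a)) : ℝ) * pa d a ≤
        Lam d ^ (1 / 4 : ℝ) := fun a ha ha1 => by
    calc _ ≤ (N d : ℝ) * Real.exp (2 * err d) := codeSize_le hk hs ha ha1
      _ ≤ Lam d ^ (1 / 8 : ℝ) * Lam d ^ (1 / 8 : ℝ) := by
          gcongr
          refine le_trans ?_ e8
          have := hs.one_le_err
          gcongr
          norm_num
      _ = _ := by rw [← Real.rpow_add hL0]; norm_num
  have htk := hs.tol_le_k hk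
  have ht := hs.tol_pos
  have h16 : 16 * (1 * tol d) ≤ k ^ 2 := by linarith
  have hcap : ∀ a, k ≤ a → a ≤ 1 - k → ∀ c : EuclideanSpace ℝ (Fin d), ‖c‖ = 1 →
      unifSphere (Fin d) {x | |inner ℝ (x : EuclideanSpace ℝ (Fin d)) c - a| ≤ tol d} ≤
      ENNReal.ofReal (Real.exp (C₁ * err d) * pa d a) := fun a ha ha1 c hc => by
    have := h₁ d hs h16 a ha ha1 c hc
    simpa only [one_mul] using this
  refine ⟨hs, hLbig, fun a ha ha1 => (hsize a ha ha1).trans (hpow _ (by norm_num)),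
    fun a ha ha1 c hc => ?_, fun a ha ha1 c hc => ?_, fun a g hA x c hx hc hxc => ?_,
    fun a g hA x c hx hc hxc => ?_, fun a ha ha1 q x hx => ?_, fun a ha ha1 q x hx => ?_,
    fun a g hA σ j x hx hj => ?_, fun a g a' g' hA hA' c c' z hc hc' hz hzc => ?_,
    fun a g a' hA ha' ha1' c c' hc hc' => ?_⟩
  · have hp := (pa_pos hk ha ha1 d).le
    refine (hcap a ha ha1 c hc).trans (ENNReal.ofReal_le_ofReal ?_)
    exact mul_le_mul_of_nonneg_right (hle e1) hp
  · have hp := (pa_pos hk ha ha1 d).le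
    refine le_trans (ENNReal.ofReal_le_ofReal ?_) (h₂ d hs a ha ha1 c hc)
    exact mul_le_mul_of_nonneg_right (hge e2) hp
  · have := h₃ d hs h16 a g hA x c hx hc (by simpa only [one_mul] using hxc)
    simp only [one_mul] at this
    refine this.trans (ENNReal.ofReal_le_ofReal ?_)
    exact mul_le_mul_of_nonneg_right (hle e3) (hA.wa_pos d).le
  · refine le_trans (ENNReal.ofReal_le_ofReal ?_) (h₄ d hs a g hA x c hx hc hxc)
    exact mul_le_mul_of_nonneg_right (hge e4) (hA.wa_pos d).le
  · have hp := pa_pos hk ha ha1 d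
    obtain ⟨y, hy⟩ : ∃ y, y = Lam d ^ (1 / 8 : ℝ) := ⟨_, rfl⟩
    have hyL : Lam d = y ^ 8 := by
      rw [hy, ← Real.rpow_natCast, ← Real.rpow_mul hL0.le]; norm_num
    have hy2 : 2 ≤ y := by
      by_contra hlt
      push Not at hlt
      have hy0 : 0 ≤ y := by rw [hy]; positivity
      have : y ^ 8 < 2 ^ 8 := pow_lt_pow_left₀ hlt hy0 (by norm_num)
      rw [← hyL] at this
      norm_num at this
      linarith
    have hy0 : 0 < y := by linarith
    have hhit := h₅ d hs a ha ha1 (N d) q x hx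
    have hcnt := lintegral_cnt_le (N := N d) (M := 1 / pa d a) hs.two_le hs.b_pos hs.b_lt
      (hcap a ha ha1) hx
    have hmark := meas_ge_le_lintegral_div (μ := rpcLaw d (Nat.log 2 d) (N d) (1 / pa d a))
      (f := fun σ => cnt (tol d) a σ x)
      ((measurable_cnt (tol d) a).comp (measurable_id.prodMk measurable_const)).aemeasurable
      (ε := ENNReal.ofReal (Lam d)) (by simpa using hL0) ENNReal.ofReal_ne_top
    have hbad : rpcLaw d (Nat.log 2 d) (N d) (1 / pa d a)
        {σ | ENNReal.ofReal (Lam d) ≤ cnt (tol d) a σ x} ≤ ENNReal.ofReal (y⁻¹ / 2) := by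
      refine hmark.trans ((ENNReal.div_le_div_right hcnt _).trans ?_)
      rw [← ENNReal.ofReal_natCast, ← ENNReal.ofReal_mul (by positivity),
        ← ENNReal.ofReal_div_of_pos hL0]
      refine ENNReal.ofReal_le_ofReal ?_
      rw [div_le_iff₀ hL0, hyL]
      have h4 : Lam d ^ (1 / 4 : ℝ) = y ^ 2 := by
        rw [hy, ← Real.rpow_natCast, ← Real.rpow_mul hL0.le]; norm_num
      have h5 := hsize a ha ha1
      rw [h4] at h5
      rw [← hy] at e1
      calc (Fintype.card (CodeIdx (Nat.log 2 d) (N d) (1 / pa d a)) : ℝ) *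
            (Real.exp (C₁ * err d) * pa d a) =
            (Fintype.card (CodeIdx (Nat.log 2 d) (N d) (1 / pa d a)) : ℝ) * pa d a *
              Real.exp (C₁ * err d) := by ring
        _ ≤ y ^ 2 * y := by gcongr
        _ ≤ y ^ 3 * (y ^ 4 / 2) := by
            have : 2 ^ 4 ≤ y ^ 4 := by gcongr
            have h6 : 1 ≤ y ^ 4 / 2 := by linarith
            calc y ^ 2 * y = y ^ 3 * 1 := by ring
              _ ≤ _ := by gcongr
        _ = y⁻¹ / 2 * y ^ 8 := by field_simp
    have hsum : ENNReal.ofReal (y⁻¹ / 2) + ENNReal.ofReal (y⁻¹ / 2) ≤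
        rpcLaw d (Nat.log 2 d) (N d) (1 / pa d a)
        {σ | cnt (tol d) a σ x ≤ ENNReal.ofReal (Lam d) ∧
          ∃ κ, BNear (1 / ell d ^ 4) a σ x (q, κ)} + ENNReal.ofReal (y⁻¹ / 2) := by
      rw [← ENNReal.ofReal_add (by positivity) (by positivity)]
      have h7 := hge8 e5
      rw [← hy] at h7
      calc ENNReal.ofReal (y⁻¹ / 2 + y⁻¹ / 2) ≤ ENNReal.ofReal (Real.exp (-(C₅ * err d))) :=
            ENNReal.ofReal_le_ofReal (by linarith)
        _ ≤ _ := hhit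
        _ ≤ rpcLaw d (Nat.log 2 d) (N d) (1 / pa d a)
            ({σ | cnt (tol d) a σ x ≤ ENNReal.ofReal (Lam d) ∧
              ∃ κ, BNear (1 / ell d ^ 4) a σ x (q, κ)} ∪
            {σ | ENNReal.ofReal (Lam d) ≤ cnt (tol d) a σ x}) := by
            refine measure_mono fun σ hσ => ?_
            rcases le_total (cnt (tol d) a σ x) (ENNReal.ofReal (Lam d)) with h | h
            · exact Or.inl ⟨h, hσ⟩
            · exact Or.inr h
        _ ≤ _ := (measure_union_le _ _).trans (by gcongr)
    refine le_trans (ENNReal.ofReal_le_ofReal ?_)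
      ((ENNReal.add_le_add_iff_right ENNReal.ofReal_ne_top).1 hsum)
    rw [hyL, inv_le_comm₀ (by positivity) (by positivity)]
    rw [inv_div, div_inv_eq_mul]
    calc 2 * y ≤ y * y := by gcongr
      _ = y ^ 2 := by ring
      _ ≤ y ^ 8 := pow_le_pow_right₀ (by linarith) (by norm_num)
  · exact (h₆ d hs a ha ha1 (N d) q x hx).trans (ENNReal.ofReal_le_ofReal (hle e6))
  · refine le_trans (ENNReal.ofReal_le_ofReal ?_) (h₇ d hs a g hA (N d) _ σ j x hx hj)
    exact mul_le_mul_of_nonneg_right (hge e7) (hA.wa_pos d).le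
  · have hzero : ∀ u v w : EuclideanSpace ℝ (Fin d), ‖w‖ = 1 → ∀ s, |inner ℝ u w - s| ≤ tol d →
        ‖u - v‖ ≤ 4 / k * tol d → |inner ℝ v w - s| ≤ (1 + 4 / k) * tol d := by
      intro u v w hw s h1 h2
      have h3 : |inner ℝ (v - u) w| ≤ 4 / k * tol d := by
        refine (abs_real_inner_le_norm _ _).trans ?_
        rwa [hw, mul_one, norm_sub_rev]
      rw [inner_sub_left] at h3
      calc |inner ℝ v w - s| = |(inner ℝ v w - inner ℝ u w) + (inner ℝ u w - s)| := by
            congr 1; ring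
        _ ≤ 4 / k * tol d + tol d := (abs_add_le _ _).trans (add_le_add h3 h1)
        _ = _ := by ring
    have hm : ∀ r : ℝ, MeasurableSet {v : EuclideanSpace ℝ (Fin d) |
        |inner ℝ v z - g'| ≤ r ∧ |inner ℝ v c' - a'| ≤ r} := fun r => by
      have m1 : MeasurableSet {v : EuclideanSpace ℝ (Fin d) | |inner ℝ v z - g'| ≤ r} :=
        measurableSet_le (by fun_prop) measurable_const
      have m2 : MeasurableSet {v : EuclideanSpace ℝ (Fin d) | |inner ℝ v c' - a'| ≤ r} :=
        measurableSet_le (by fun_prop) measurable_const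
      exact m1.inter m2
    have hp := h₈ d hs a g hA c hc _ _ (hm (tol d)) (hm ((1 + 4 / k) * tol d))
      fun u v hu huv => ⟨hzero u v z hz g' hu.1 huv, hzero u v c' hc' a' hu.2 huv⟩
    have hw := h₀ d hs hDd a' g' hA' z c' hz hc' (hzc.trans (by
      calc tol d = 1 * tol d := (one_mul _).symm
        _ ≤ _ := by gcongr))
    refine hp.trans ?_
    refine (mul_le_mul_right ((measure_mono fun v hv => ?_).trans hw) _).trans ?_
    · have h1 := (abs_le.1 hv.1).1
      have h2 := (abs_le.1 hv.2).1
      rw [real_inner_comm] at h1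
      exact ⟨by linarith, by linarith⟩
    · have hpp := (pa_pos hk hA.a_ge hA.a_le d).le
      have hw1 := (hA.wa_pos d).le
      have hw2 := (hA'.wa_pos d).le
      rw [← ENNReal.ofReal_mul (by positivity)]
      refine ENNReal.ofReal_le_ofReal ?_
      calc _ = Real.exp ((C₈ + C₀) * err d) * (pa d a * wa d a g * wa d a' g') := by
            rw [add_mul, Real.exp_add]; ring
        _ ≤ _ := mul_le_mul_of_nonneg_right (hle e80) (by positivity)
  · have hm : ∀ r : ℝ, MeasurableSet {v : EuclideanSpace ℝ (Fin d) |
        |inner ℝ v c' - a'| ≤ r} := fun r => measurableSet_le (by fun_prop) measurable_const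
    have hp := h₈ d hs a g hA c hc _ _ (hm (tol d)) (hm ((1 + 4 / k) * tol d))
      fun u v (hu : |inner ℝ u c' - a'| ≤ tol d) huv => by
        have h3 : |inner ℝ (v - u) c'| ≤ 4 / k * tol d := by
          refine (abs_real_inner_le_norm _ _).trans ?_
          rwa [hc', mul_one, norm_sub_rev]
        rw [inner_sub_left] at h3
        calc |inner ℝ v c' - a'| = |(inner ℝ v c' - inner ℝ u c') + (inner ℝ u c' - a')| := by
              congr 1; ring
          _ ≤ 4 / k * tol d + tol d := (abs_add_le _ _).trans (add_le_add h3 hu)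
          _ = _ := by ring
    have hw := h₉ d hs hDd a' ha' ha1' c' hc'
    refine hp.trans ?_
    refine (mul_le_mul_right hw _).trans ?_
    have hpp := (pa_pos hk hA.a_ge hA.a_le d).le
    have hw1 := (hA.wa_pos d).le
    have hw2 := (pa_pos hk ha' ha1' d).le
    rw [← ENNReal.ofReal_mul (by positivity)]
    refine ENNReal.ofReal_le_ofReal ?_
    calc _ = Real.exp ((C₈ + C₉) * err d) * (pa d a * wa d a g * pa d a') := by
          rw [add_mul, Real.exp_add]; ring
      _ ≤ _ := mul_le_mul_of_nonneg_right (hle e89) (by positivity)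

/-! ### Linked pairs -/

section Link

variable {d b N : ℕ} {M : ℝ}

/-- `y` is reached from `v` through a codeword of the rotation `q`, and `v` has few close
codewords. -/
def Link (a g : ℝ) (q : Fin N) (σ : RPCSeed d b N M) (v y : EuclideanSpace ℝ (Fin d)) : Prop :=
  |inner ℝ v y - g| ≤ tol d ∧ cnt (tol d) a σ v ≤ ENNReal.ofReal (Lam d) ∧
    ∃ κ : Fin b → Fin (blockSize b M), BNear (tol d) a σ y (q, κ) ∧ Near (tol d) a σ v (q, κ)

theorem measurableSet_link (a g : ℝ) (q : Fin N) :
    MeasurableSet {p : RPCSeed d b N M × EuclideanSpace ℝ (Fin d) × EuclideanSpace ℝ (Fin d) |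
      Link a g q p.1 p.2.1 p.2.2} := by
  have f1 : Measurable fun p : RPCSeed d b N M × EuclideanSpace ℝ (Fin d) ×
      EuclideanSpace ℝ (Fin d) => (p.1, p.2.1) :=
    measurable_fst.prodMk (measurable_fst.comp measurable_snd)
  have f2 : Measurable fun p : RPCSeed d b N M × EuclideanSpace ℝ (Fin d) ×
      EuclideanSpace ℝ (Fin d) => (p.1, p.2.2) :=
    measurable_fst.prodMk (measurable_snd.comp measurable_snd)
  have m0 : MeasurableSet {p : EuclideanSpace ℝ (Fin d) × EuclideanSpace ℝ (Fin d) |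
      |inner ℝ p.1 p.2 - g| ≤ tol d} := measurableSet_le (by fun_prop) measurable_const
  have m1 := (measurable_snd : Measurable fun p : RPCSeed d b N M × EuclideanSpace ℝ (Fin d) ×
      EuclideanSpace ℝ (Fin d) => p.2) m0
  have m2 := f1 (measurableSet_le (measurable_cnt (tol d) a)
    (measurable_const (a := ENNReal.ofReal (Lam d))))
  have m3 := fun j : CodeIdx b N M => (f2 (measurableSet_bnear (tol d) a j)).inter
    (f1 (measurableSet_near (tol d) a j))
  have m4 := m1.inter (m2.inter (MeasurableSet.iUnion fun κ => m3 (q, κ)))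
  refine (congrArg MeasurableSet ?_).mp m4
  ext p
  simp only [Link, mem_inter_iff, mem_iUnion, mem_preimage, mem_ofPred_eq]

theorem Measurable.link {T : Type*} [MeasurableSpace T] {σ : T → RPCSeed d b N M}
    {v y : T → EuclideanSpace ℝ (Fin d)} (hσ : Measurable σ) (hv : Measurable v)
    (hy : Measurable y) (a g : ℝ) (q : Fin N) :
    MeasurableSet {t | Link a g q (σ t) (v t) (y t)} :=
  hσ.prodMk (hv.prodMk hy) (measurableSet_link a g q)

theorem measurable_link_measure [Nonempty (Fin d)] (a g : ℝ) (q : Fin N)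
    (v : EuclideanSpace ℝ (Fin d)) :
    Measurable fun σ : RPCSeed d b N M =>
      unifSphere (Fin d) {y | Link a g q σ v (y : EuclideanSpace ℝ (Fin d))} := by
  have := isProbabilityMeasure_unifSphere (Fin d)
  have f : Measurable fun p : RPCSeed d b N M × sphere (0 : EuclideanSpace ℝ (Fin d)) 1 =>
      (p.1, v, (p.2 : EuclideanSpace ℝ (Fin d))) :=
    measurable_fst.prodMk (measurable_const.prodMk (measurable_subtype_coe.comp measurable_snd))
  exact measurable_measure_prodMk_left (f (measurableSet_link a g q))

open Classical in
theorem cnt_eq_card (e a : ℝ) (σ : RPCSeed d b N M) (x : EuclideanSpace ℝ (Fin d)) :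
    cnt e a σ x = ((Finset.univ.filter fun j => Near e a σ x j).card : ℝ≥0∞) := by
  rw [cnt, Finset.sum_boole]

open Classical in
theorem bcnt_eq_card (e a : ℝ) (σ : RPCSeed d b N M) (q : Fin N) (x : EuclideanSpace ℝ (Fin d)) :
    bcnt e a σ q x = ((Finset.univ.filter fun κ => BNear e a σ x (q, κ)).card : ℝ≥0∞) := by
  rw [bcnt, Finset.sum_boole]

end Link

section Bounds

variable {k : ℝ} {d N : ℕ} (h : DimFacts k d N)
include h

theorem DimFacts.one_le_Lam : 1 ≤ Lam d := by linarith [h.two_le_Lam]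

theorem DimFacts.nonempty : Nonempty (Fin d) := ⟨⟨0, by linarith [h.scale.two_le]⟩⟩

theorem DimFacts.norm_cw {M : ℝ} (σ : RPCSeed d (Nat.log 2 d) N M)
    (j : CodeIdx (Nat.log 2 d) N M) : ‖cw σ j‖ = 1 :=
  GoodRPC.norm_cw (by linarith [h.scale.two_le]) h.scale.b_pos σ j

theorem DimFacts.le_sq {w : ℝ} (hw : 0 ≤ w) : Lam d * w ≤ Lam d ^ 2 * w := by
  have := h.one_le_Lam
  have : Lam d ≤ Lam d ^ 2 := le_self_pow₀ this (by norm_num)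
  gcongr

theorem link_fst_le {a g : ℝ} (hA : Adm k a g) {M : ℝ} (q : Fin N)
    (σ : RPCSeed d (Nat.log 2 d) N M) {v : EuclideanSpace ℝ (Fin d)} (hv : ‖v‖ = 1) :
    unifSphere (Fin d) {y | Link a g q σ v (y : EuclideanSpace ℝ (Fin d))} ≤
      ENNReal.ofReal (Lam d ^ 2 * wa d a g) := by
  classical
  have hL := Lam_pos d
  by_cases hc : cnt (tol d) a σ v ≤ ENNReal.ofReal (Lam d)
  · have hnear : ∀ j, Near (tol d) a σ v j → |inner ℝ v (cw σ j) - a| ≤ tol d := fun _ hj => hj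
    have hsub : {y : sphere (0 : EuclideanSpace ℝ (Fin d)) 1 |
        Link a g q σ v (y : EuclideanSpace ℝ (Fin d))} ⊆
        ⋃ j ∈ Finset.univ.filter (fun j => Near (tol d) a σ v j),
          {y | g - tol d ≤ inner ℝ v (y : EuclideanSpace ℝ (Fin d)) ∧
            a - tol d ≤ inner ℝ (y : EuclideanSpace ℝ (Fin d)) (cw σ j)} := by
      rintro y ⟨h1, -, κ, h2, h3⟩
      simp only [mem_iUnion]
      refine ⟨(q, κ), by simpa using h3, by linarith [(abs_le.1 h1).1], ?_⟩
      have := h2.abs_inner_sub_le (by linarith [h.scale.two_le]) h.scale.b_pos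
      linarith [(abs_le.1 this).1]
    refine (measure_mono hsub).trans ((measure_biUnion_finset_le _ _).trans ?_)
    refine (Finset.sum_le_sum (g := fun _ => ENNReal.ofReal (Lam d * wa d a g))
      fun j hj => h.wedge_le a g hA v _ hv (h.norm_cw σ j) (hnear j (Finset.mem_filter.1 hj).2)).trans ?_
    rw [Finset.sum_const, nsmul_eq_mul, ← cnt_eq_card]
    refine (mul_le_mul_left hc _).trans ?_
    rw [← ENNReal.ofReal_mul hL.le, sq, mul_assoc]
  · have : {y : sphere (0 : EuclideanSpace ℝ (Fin d)) 1 |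
        Link a g q σ v (y : EuclideanSpace ℝ (Fin d))} = ∅ :=
      eq_empty_of_forall_notMem fun y hy => hc hy.2.1
    rw [this, measure_empty]
    exact zero_le

theorem link_dir_le {a g : ℝ} (hA : Adm k a g) {M : ℝ} (q : Fin N)
    (σ : RPCSeed d (Nat.log 2 d) N M) (x y : EuclideanSpace ℝ (Fin d)) :
    unifSphere (Fin d) {z | Link a g q σ (dir x y) (z : EuclideanSpace ℝ (Fin d))} ≤
      ENNReal.ofReal (Lam d ^ 2 * wa d a g) := by
  by_cases hxy : x = y
  · have : {z : sphere (0 : EuclideanSpace ℝ (Fin d)) 1 |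
        Link a g q σ (dir x y) (z : EuclideanSpace ℝ (Fin d))} = ∅ := by
      refine eq_empty_of_forall_notMem fun z hz => ?_
      have h1 := hz.1
      rw [hxy, dir, sub_self, smul_zero, inner_zero_left] at h1
      have h2 := h.scale.tol_le_k hA.pos
      have h3 := (abs_le.1 h1).1
      have h4 := h.scale.tol_pos
      nlinarith [hA.g_ge, hA.g_le, hA.pos]
    rw [this, measure_empty]
    exact zero_le
  · exact link_fst_le h hA q σ (norm_smul_inv_norm (sub_ne_zero.2 hxy))

theorem link_snd_le {a g : ℝ} (hA : Adm k a g) {M : ℝ} (q : Fin N)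
    (σ : RPCSeed d (Nat.log 2 d) N M) {y : EuclideanSpace ℝ (Fin d)} (hy : ‖y‖ = 1) :
    unifSphere (Fin d) {x | Link a g q σ (x : EuclideanSpace ℝ (Fin d)) y} ≤
      bcnt (tol d) a σ q y * ENNReal.ofReal (Lam d ^ 2 * wa d a g) := by
  classical
  have hsub : {x : sphere (0 : EuclideanSpace ℝ (Fin d)) 1 |
      Link a g q σ (x : EuclideanSpace ℝ (Fin d)) y} ⊆
      ⋃ κ ∈ Finset.univ.filter (fun κ => BNear (tol d) a σ y (q, κ)),
        {x | g - tol d ≤ inner ℝ y (x : EuclideanSpace ℝ (Fin d)) ∧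
          a - tol d ≤ inner ℝ (x : EuclideanSpace ℝ (Fin d)) (cw σ (q, κ))} := by
    rintro x ⟨h1, -, κ, h2, h3⟩
    simp only [mem_iUnion]
    rw [real_inner_comm] at h1
    exact ⟨κ, by simpa using h2, by linarith [(abs_le.1 h1).1], by linarith [(abs_le.1 h3).1]⟩
  refine (measure_mono hsub).trans ((measure_biUnion_finset_le _ _).trans ?_)
  refine (Finset.sum_le_sum (g := fun _ => ENNReal.ofReal (Lam d * wa d a g))
    fun κ hκ => h.wedge_le a g hA y _ hy (h.norm_cw σ _)
      ((Finset.mem_filter.1 hκ).2.abs_inner_sub_le (by linarith [h.scale.two_le])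
        h.scale.b_pos)).trans ?_
  rw [Finset.sum_const, nsmul_eq_mul, ← bcnt_eq_card]
  exact mul_le_mul_right (ENNReal.ofReal_le_ofReal (h.le_sq (hA.wa_pos d).le)) _

theorem blockSize_pow_mul_pa_le (q : Fin N) {a : ℝ} (ha : k ≤ a) (ha1 : a ≤ 1 - k) (hk : 0 < k) :
    (Fintype.card (Fin (Nat.log 2 d) → Fin (blockSize (Nat.log 2 d) (1 / pa d a))) : ℝ) * pa d a ≤
      Lam d := by
  refine le_trans ?_ (h.codeSize a ha ha1)
  have hp := (pa_pos hk ha ha1 d).le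
  refine mul_le_mul_of_nonneg_right ?_ hp
  have hN : (1 : ℝ) ≤ N := by exact_mod_cast q.pos
  rw [Fintype.card_prod, Fintype.card_fin]
  push_cast
  exact le_mul_of_one_le_left (by positivity) hN

theorem link_pair_le {a g a' g' : ℝ} (hA : Adm k a g) (hA' : Adm k a' g') (q : Fin N) {M : ℝ}
    (σ : RPCSeed d (Nat.log 2 d) N (1 / pa d a)) (σ' : RPCSeed d (Nat.log 2 d) N M)
    {z : EuclideanSpace ℝ (Fin d)} (hz : ‖z‖ = 1) :
    ((unifSphere (Fin d)).prod (unifSphere (Fin d))) {p |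
      Link a g q σ (p.1 : EuclideanSpace ℝ (Fin d)) (p.2 : EuclideanSpace ℝ (Fin d)) ∧
      Link a' g' q σ' (dir (p.1 : EuclideanSpace ℝ (Fin d)) p.2) z} ≤
      bcnt (tol d) a' σ' q z * (ENNReal.ofReal (Lam d ^ 2 * wa d a g) *
        ENNReal.ofReal (Lam d ^ 2 * wa d a' g')) := by
  classical
  have hL := Lam_pos d
  have hw := (hA.wa_pos d).le
  have hw' := (hA'.wa_pos d).le
  have hp := (pa_pos hA.pos hA.a_ge hA.a_le d).le
  have hd : 0 < d := by linarith [h.scale.two_le]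
  have hsub : {p : sphere (0 : EuclideanSpace ℝ (Fin d)) 1 × sphere (0 : EuclideanSpace ℝ (Fin d)) 1
      | Link a g q σ (p.1 : EuclideanSpace ℝ (Fin d)) (p.2 : EuclideanSpace ℝ (Fin d)) ∧
      Link a' g' q σ' (dir (p.1 : EuclideanSpace ℝ (Fin d)) p.2) z} ⊆
      ⋃ t ∈ (Finset.univ : Finset (Fin (Nat.log 2 d) →
        Fin (blockSize (Nat.log 2 d) (1 / pa d a)))) ×ˢ
          Finset.univ.filter (fun κ => BNear (tol d) a' σ' z (q, κ)),
        {p | |inner ℝ (p.1 : EuclideanSpace ℝ (Fin d)) (cw σ (q, t.1)) - a| ≤ tol d ∧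
        |inner ℝ (p.2 : EuclideanSpace ℝ (Fin d)) (cw σ (q, t.1)) - a| ≤ tol d ∧
        |inner ℝ (p.1 : EuclideanSpace ℝ (Fin d)) (p.2 : EuclideanSpace ℝ (Fin d)) - g| ≤ tol d ∧
        |inner ℝ (dir (p.1 : EuclideanSpace ℝ (Fin d)) p.2) z - g'| ≤ tol d ∧
        |inner ℝ (dir (p.1 : EuclideanSpace ℝ (Fin d)) p.2) (cw σ' (q, t.2)) - a'| ≤ tol d} := by
    rintro p ⟨⟨h1, -, κ, h2, h3⟩, h4, -, κ', h5, h6⟩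
    simp only [mem_iUnion]
    exact ⟨(κ, κ'), by simpa using h5, h3, h2.abs_inner_sub_le hd h.scale.b_pos, h1, h4, h6⟩
  refine (measure_mono hsub).trans ((measure_biUnion_finset_le _ _).trans ?_)
  refine (Finset.sum_le_sum
    (g := fun _ => ENNReal.ofReal (Lam d * (pa d a * wa d a g * wa d a' g')))
    fun t ht => h.pair_wedge a g a' g' hA hA' _ _ z (h.norm_cw σ _) (h.norm_cw σ' _) hz
      ((Finset.mem_filter.1 (Finset.mem_product.1 ht).2).2.abs_inner_sub_le hd
        h.scale.b_pos)).trans ?_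
  rw [Finset.sum_const, nsmul_eq_mul, Finset.card_product, Nat.cast_mul, ← bcnt_eq_card,
    mul_comm ((Finset.card _ : ℕ) : ℝ≥0∞), mul_assoc]
  refine mul_le_mul_right ?_ _
  rw [Finset.card_univ, ← ENNReal.ofReal_natCast, ← ENNReal.ofReal_mul (by positivity),
    ← ENNReal.ofReal_mul (by positivity)]
  refine ENNReal.ofReal_le_ofReal ?_
  have h1 := blockSize_pow_mul_pa_le h q hA.a_ge hA.a_le hA.pos
  have hL1 := h.one_le_Lam
  calc _ = ((Fintype.card (Fin (Nat.log 2 d) → Fin (blockSize (Nat.log 2 d) (1 / pa d a))) : ℝ) *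
        pa d a) * Lam d * (wa d a g * wa d a' g') := by ring
    _ ≤ Lam d * Lam d * (wa d a g * wa d a' g') := by gcongr
    _ = Lam d ^ 2 * (wa d a g * wa d a' g') := by ring
    _ ≤ Lam d ^ 4 * (wa d a g * wa d a' g') :=
        mul_le_mul_of_nonneg_right (pow_le_pow_right₀ hL1 (by norm_num)) (by positivity)
    _ = _ := by ring

theorem le_lintegral_link {a g : ℝ} (hA : Adm k a g) (q : Fin N)
    {v : EuclideanSpace ℝ (Fin d)} (hv : ‖v‖ = 1) :
    ENNReal.ofReal ((Lam d ^ 2)⁻¹ * wa d a g) ≤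
      ∫⁻ σ, unifSphere (Fin d) {y | Link a g q σ v (y : EuclideanSpace ℝ (Fin d))}
        ∂rpcLaw d (Nat.log 2 d) N (1 / pa d a) := by
  have hL := Lam_pos d
  have hw := (hA.wa_pos d).le
  have := h.nonempty
  have h1 := h.hit a hA.a_ge hA.a_le q v hv
  calc ENNReal.ofReal ((Lam d ^ 2)⁻¹ * wa d a g) =
      ENNReal.ofReal ((Lam d)⁻¹ * wa d a g) * ENNReal.ofReal (Lam d)⁻¹ := by
        rw [← ENNReal.ofReal_mul (by positivity)]
        congr 1
        field_simp
    _ ≤ ENNReal.ofReal ((Lam d)⁻¹ * wa d a g) *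
        rpcLaw d (Nat.log 2 d) N (1 / pa d a) {σ | cnt (tol d) a σ v ≤ ENNReal.ofReal (Lam d) ∧
          ∃ κ, BNear (1 / ell d ^ 4) a σ v (q, κ)} := mul_le_mul_right h1 _
    _ ≤ ENNReal.ofReal ((Lam d)⁻¹ * wa d a g) *
        rpcLaw d (Nat.log 2 d) N (1 / pa d a) {σ | ENNReal.ofReal ((Lam d)⁻¹ * wa d a g) ≤
          unifSphere (Fin d) {y | Link a g q σ v (y : EuclideanSpace ℝ (Fin d))}} := by
        refine mul_le_mul_right (measure_mono ?_) _
        rintro σ ⟨hc, κ, hκ⟩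
        refine (h.code_wedge a g hA σ (q, κ) v hv hκ).trans (measure_mono ?_)
        rintro y ⟨hy1, hy2⟩
        refine ⟨hy1, hc, κ, hy2, ?_⟩
        exact (hκ.abs_inner_sub_le (by linarith [h.scale.two_le]) h.scale.b_pos).trans
          (h.scale.inv_pow_le (show 2 ≤ 4 by norm_num))
    _ ≤ _ := by
        exact mul_meas_ge_le_lintegral₀ (measurable_link_measure a g q v).aemeasurable _

end Bounds

/-! ### Lower bounds for counts of linked pairs and triples -/

open Classical in
/-- The number of elements of a finite type with a given property. -/
def count {I : Type*} [Fintype I] (p : I → Prop) : ℕ := (Finset.univ.filter p).card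

theorem count_eq {I : Type*} [Fintype I] (p : I → Prop) [DecidablePred p] :
    count p = (Finset.univ.filter p).card := by
  unfold count; congr

section Abstract

variable {Ω Ω' S : Type*} [MeasurableSpace Ω] [MeasurableSpace Ω'] [MeasurableSpace S]
  {μ : Measure Ω} {μ' : Measure Ω'} {ν : Measure S} [IsProbabilityMeasure μ]
  [IsProbabilityMeasure μ'] [IsProbabilityMeasure ν]

open Classical in
theorem lintegral_ite_eq {T : Type*} [MeasurableSpace T] (ρ : Measure T) {p : T → Prop}
    (hp : MeasurableSet {t | p t}) : ∫⁻ t, (if p t then (1 : ℝ≥0∞) else 0) ∂ρ = ρ {t | p t} := by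
  rw [← lintegral_indicator_one hp]
  exact lintegral_congr fun t => by simp only [indicator, mem_ofPred_eq, Pi.one_apply]

theorem le_lintegral_triples {p : Ω → S → S → ℝ≥0∞} {q : Ω' → S → S → S → ℝ≥0∞}
    (hp : Measurable fun t : Ω × S × S => p t.1 t.2.1 t.2.2)
    (hq : Measurable fun t : Ω' × S × S × S => q t.1 t.2.1 t.2.2.1 t.2.2.2) {l l' : ℝ≥0∞}
    (hl : ∀ x, l ≤ ∫⁻ ω, ∫⁻ y, p ω x y ∂ν ∂μ)
    (hl' : ∀ ω x y, p ω x y ≠ 0 → l' ≤ ∫⁻ ω, ∫⁻ z, q ω x y z ∂ν ∂μ') :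
    l * l' ≤ ∫⁻ t : Ω × Ω', ∫⁻ x, ∫⁻ y, p t.1 x y * ∫⁻ z, q t.2 x y z ∂ν ∂ν ∂ν ∂μ.prod μ' := by
  have hI : Measurable fun t : Ω' × S × S => ∫⁻ z, q t.1 t.2.1 t.2.2 z ∂ν :=
    (hq.comp (((measurable_fst.comp measurable_fst).prodMk
      (((measurable_fst.comp measurable_snd).comp measurable_fst).prodMk
      (((measurable_snd.comp measurable_snd).comp measurable_fst).prodMk measurable_snd)))) :
      Measurable fun t : (Ω' × S × S) × S => q t.1.1 t.1.2.1 t.1.2.2 t.2).lintegral_prod_right'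
  have f1 : Measurable fun t : (Ω × Ω') × S × S => (t.1.1, t.2) :=
    (measurable_fst.comp measurable_fst).prodMk measurable_snd
  have f2 : Measurable fun t : (Ω × Ω') × S × S => (t.1.2, t.2) :=
    (measurable_snd.comp measurable_fst).prodMk measurable_snd
  have hF : Measurable fun t : (Ω × Ω') × S × S =>
      p t.1.1 t.2.1 t.2.2 * ∫⁻ z, q t.1.2 t.2.1 t.2.2 z ∂ν := (hp.comp f1).mul (hI.comp f2)
  have e1 : ∀ t : Ω × Ω', ∫⁻ x, ∫⁻ y, p t.1 x y * ∫⁻ z, q t.2 x y z ∂ν ∂ν ∂ν =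
      ∫⁻ s : S × S, p t.1 s.1 s.2 * ∫⁻ z, q t.2 s.1 s.2 z ∂ν ∂ν.prod ν := fun t => by
    have m : Measurable fun s : S × S => p t.1 s.1 s.2 * ∫⁻ z, q t.2 s.1 s.2 z ∂ν :=
      hF.comp ((measurable_const (a := t)).prodMk measurable_id)
    rw [lintegral_prod _ m.aemeasurable]
  simp only [e1]
  rw [lintegral_lintegral_swap hF.aemeasurable]
  have hpω : ∀ s : S × S, Measurable fun ω => p ω s.1 s.2 := fun s =>
    hp.comp (measurable_id.prodMk measurable_const)
  have e2 : ∀ s : S × S, ∫⁻ ω, p ω s.1 s.2 * l' ∂μ ≤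
      ∫⁻ t : Ω × Ω', p t.1 s.1 s.2 * ∫⁻ z, q t.2 s.1 s.2 z ∂ν ∂μ.prod μ' := fun s => by
    have m : Measurable fun ω => ∫⁻ z, q ω s.1 s.2 z ∂ν :=
      hI.comp (measurable_id.prodMk (measurable_const (a := s)))
    rw [lintegral_prod_mul (hpω s).aemeasurable m.aemeasurable, ← lintegral_mul_const _ (hpω s)]
    refine lintegral_mono fun ω => ?_
    by_cases h0 : p ω s.1 s.2 = 0
    · simp [h0]
    · exact mul_le_mul_right (hl' ω _ _ h0) _
  refine le_trans ?_ (lintegral_mono e2)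
  have e3 : ∀ s : S × S, ∫⁻ ω, p ω s.1 s.2 * l' ∂μ = (∫⁻ ω, p ω s.1 s.2 ∂μ) * l' := fun s =>
    lintegral_mul_const _ (hpω s)
  have m3 : Measurable fun s : S × S => ∫⁻ ω, p ω s.1 s.2 ∂μ :=
    (hp.comp measurable_swap : Measurable fun t : (S × S) × Ω =>
      p t.2 t.1.1 t.1.2).lintegral_prod_right'
  simp only [e3]
  rw [lintegral_mul_const _ m3, lintegral_prod _ m3.aemeasurable]
  refine mul_le_mul_left ?_ _
  calc l = ∫⁻ _ : S, l ∂ν := by rw [lintegral_const, measure_univ, mul_one]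
    _ ≤ ∫⁻ x, ∫⁻ ω, ∫⁻ y, p ω x y ∂ν ∂μ ∂ν := lintegral_mono hl
    _ = _ := by
      refine lintegral_congr fun x => ?_
      rw [lintegral_lintegral_swap]
      exact (hp.comp (measurable_fst.prodMk
        (measurable_const.prodMk measurable_snd))).aemeasurable

omit [IsProbabilityMeasure μ] in
theorem lintegral_moment_fst_le [SFinite μ] {f : Ω → S → ℝ≥0∞}
    (hf : Measurable fun t : Ω × S => f t.1 t.2) {c : ℝ≥0∞} (h : ∀ y, ∫⁻ ω, f ω y ^ 2 ∂μ ≤ c) :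
    ∫⁻ t : Ω × Ω', ∫⁻ y, f t.1 y ^ 2 ∂ν ∂μ.prod μ' ≤ c := by
  have m := hf.pow_const 2
  rw [lintegral_prod (fun t : Ω × Ω' => ∫⁻ y, f t.1 y ^ 2 ∂ν)
    (m.lintegral_prod_right'.comp measurable_fst).aemeasurable]
  have e : ∀ ω, ∫⁻ _ : Ω', ∫⁻ y, f ω y ^ 2 ∂ν ∂μ' = ∫⁻ y, f ω y ^ 2 ∂ν := fun ω => by
    rw [lintegral_const, measure_univ, mul_one]
  simp only [e]
  rw [lintegral_lintegral_swap m.aemeasurable]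
  refine (lintegral_mono h).trans ?_
  rw [lintegral_const, measure_univ, mul_one]

omit [IsProbabilityMeasure μ'] in
theorem lintegral_moment_snd_le [SFinite μ'] {f : Ω' → S → ℝ≥0∞}
    (hf : Measurable fun t : Ω' × S => f t.1 t.2) {c : ℝ≥0∞} (h : ∀ y, ∫⁻ ω, f ω y ^ 2 ∂μ' ≤ c) :
    ∫⁻ t : Ω × Ω', ∫⁻ y, f t.2 y ^ 2 ∂ν ∂μ.prod μ' ≤ c := by
  have m := (hf.pow_const 2).lintegral_prod_right' (ν := ν)
  have := lintegral_map (μ := μ.prod μ') (f := fun t : Ω' × Ω => ∫⁻ y, f t.1 y ^ 2 ∂ν)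
    (m.comp measurable_fst) measurable_swap
  rw [Measure.prod_swap] at this
  exact this.symm.trans_le (lintegral_moment_fst_le hf h)

open Classical in
/-- Many linked pairs and triples of indices, with not too small probability. -/
theorem le_prob_linked_triples {P : Ω → S → S → Prop} {Q : Ω' → S → S → S → Prop}
    {B : Ω → S → ℝ≥0∞} {B' : Ω' → S → ℝ≥0∞} {u u' L : ℝ} (hu : 0 < u) (hu' : 0 < u')
    (hL : 256 ≤ L) (hP : MeasurableSet {t : Ω × S × S | P t.1 t.2.1 t.2.2})
    (hQ : MeasurableSet {t : Ω' × S × S × S | Q t.1 t.2.1 t.2.2.1 t.2.2.2})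
    (hB : Measurable fun t : Ω × S => B t.1 t.2) (hB' : Measurable fun t : Ω' × S => B' t.1 t.2)
    (h1 : ∀ ω x, ν {y | P ω x y} ≤ ENNReal.ofReal (L ^ 2 * u))
    (h2 : ∀ ω y, ν {x | P ω x y} ≤ B ω y * ENNReal.ofReal (L ^ 2 * u))
    (h3 : ∀ ω x y, ν {z | Q ω x y z} ≤ ENNReal.ofReal (L ^ 2 * u'))
    (h4 : ∀ ω ω' z, (ν.prod ν) {s | P ω s.1 s.2 ∧ Q ω' s.1 s.2 z} ≤
      B' ω' z * (ENNReal.ofReal (L ^ 2 * u) * ENNReal.ofReal (L ^ 2 * u')))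
    (hΛ : ∀ y, ∫⁻ ω, B ω y ^ 2 ∂μ ≤ ENNReal.ofReal L)
    (hΛ' : ∀ y, ∫⁻ ω, B' ω y ^ 2 ∂μ' ≤ ENNReal.ofReal L)
    (hl : ∀ x, ENNReal.ofReal ((L ^ 2)⁻¹ * u) ≤ ∫⁻ ω, ν {y | P ω x y} ∂μ)
    (hl' : ∀ ω x y, P ω x y → ENNReal.ofReal ((L ^ 2)⁻¹ * u') ≤ ∫⁻ ω, ν {z | Q ω x y z} ∂μ')
    {m n : ℕ} (hn : 1 ≤ n) (hnm : 3 * n ≤ m) (hnu : 1 ≤ n * u) (hnu' : 1 ≤ (n : ℝ) ^ 2 * u') :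
    ENNReal.ofReal (L ^ 18)⁻¹ ≤ ((Measure.pi fun _ : Fin m => ν).prod (μ.prod μ')) {t |
      (L ^ 7)⁻¹ * u * n ^ 2 ≤ (count fun p : Fin m × Fin m => P t.2.1 (t.1 p.1) (t.1 p.2)) ∧
      (L ^ 4)⁻¹ * (u * u') * n ^ 3 ≤ 4 * ((count fun p : Fin m × Fin m × Fin m =>
        (p.1 ≠ p.2.1 ∧ p.1 ≠ p.2.2 ∧ p.2.1 ≠ p.2.2) ∧
        P t.2.1 (t.1 p.1) (t.1 p.2.1) ∧ Q t.2.2 (t.1 p.1) (t.1 p.2.1) (t.1 p.2.2) : ℕ) : ℝ)} := by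
  rw [← Measure.prod_swap]
  refine le_trans ?_ (MeasurableEquiv.prodComm.map_apply _).ge
  have hL0 : 0 < L := by linarith
  have hL1 : 1 ≤ L := by linarith
  let p : Ω → S → S → ℝ≥0∞ := fun ω x y => if P ω x y then 1 else 0
  let q : Ω' → S → S → S → ℝ≥0∞ := fun ω x y z => if Q ω x y z then 1 else 0
  have mp : Measurable fun t : Ω × S × S => p t.1 t.2.1 t.2.2 :=
    Measurable.ite hP measurable_const measurable_const
  have mq : Measurable fun t : Ω' × S × S × S => q t.1 t.2.1 t.2.2.1 t.2.2.2 :=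
    Measurable.ite hQ measurable_const measurable_const
  have ep : ∀ ω x, ∫⁻ y, p ω x y ∂ν = ν {y | P ω x y} := fun ω x => lintegral_ite_eq ν
    ((measurable_const.prodMk (measurable_const.prodMk measurable_id) :
      Measurable fun y : S => (ω, x, y)) hP)
  have ep' : ∀ ω y, ∫⁻ x, p ω x y ∂ν = ν {x | P ω x y} := fun ω y => lintegral_ite_eq ν
    ((measurable_const.prodMk (measurable_id.prodMk measurable_const) :
      Measurable fun x : S => (ω, x, y)) hP)
  have eq : ∀ ω x y, ∫⁻ z, q ω x y z ∂ν = ν {z | Q ω x y z} := fun ω x y => lintegral_ite_eq ν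
    ((measurable_const.prodMk (measurable_const.prodMk (measurable_const.prodMk measurable_id)) :
      Measurable fun z : S => (ω, x, y, z)) hQ)
  have epq : ∀ ω ω' z, ∫⁻ x, ∫⁻ y, p ω x y * q ω' x y z ∂ν ∂ν =
      (ν.prod ν) {s | P ω s.1 s.2 ∧ Q ω' s.1 s.2 z} := fun ω ω' z => by
    have m1 : MeasurableSet {s : S × S | P ω s.1 s.2} :=
      (measurable_const.prodMk measurable_id : Measurable fun s : S × S => (ω, s)) hP
    have m2 : MeasurableSet {s : S × S | Q ω' s.1 s.2 z} :=
      (measurable_const.prodMk (measurable_fst.prodMk (measurable_snd.prodMk measurable_const)) :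
        Measurable fun s : S × S => (ω', s.1, s.2, z)) hQ
    have m3 : MeasurableSet {s : S × S | P ω s.1 s.2 ∧ Q ω' s.1 s.2 z} := m1.inter m2
    have m4 : Measurable fun s : S × S => p ω s.1 s.2 * q ω' s.1 s.2 z :=
      (Measurable.ite m1 measurable_const measurable_const).mul
        (Measurable.ite m2 measurable_const measurable_const)
    rw [← lintegral_indicator_one m3, ← lintegral_prod _ m4.aemeasurable]
    refine lintegral_congr fun s => ?_
    by_cases c1 : P ω s.1 s.2 <;> by_cases c2 : Q ω' s.1 s.2 z <;> simp [p, q, c1, c2]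
  let e : Fin 3 → Fin n → Fin m := fun s i => ⟨s * n + i, by
    have h1 := s.2
    have h2 := i.2
    have h3 : (s : ℕ) ≤ 2 := by omega
    have h4 : (s : ℕ) * n ≤ 2 * n := Nat.mul_le_mul_right n h3
    omega⟩
  have he : ∀ s, Function.Injective (e s) := fun s i j hij => by
    have := congrArg Fin.val hij
    simp only [e] at this
    exact Fin.ext (by omega)
  have hne : ∀ s s' : Fin 3, s < s' → ∀ i j, e s i ≠ e s' j := fun s s' hs i j hij => by
    have := congrArg Fin.val hij
    simp only [e] at this
    have h1 : (s : ℕ) + 1 ≤ s' := hs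
    have h2 : ((s : ℕ) + 1) * n ≤ s' * n := Nat.mul_le_mul_right n h1
    rw [add_mul, one_mul] at h2
    have := i.2
    omega
  have hite : ∀ p : Prop, (if p then (1 : ℝ≥0∞) else 0) ≤ 1 := fun p => by split_ifs <;> simp
  have key := le_prob_triples (μ := μ.prod μ') (ν := ν) (κ := Fin n) (ι := Fin m)
    (P := fun t => p t.1) (Q := fun t => q t.2) (B := fun t => B t.1) (B' := fun t => B' t.2)
    (w := ENNReal.ofReal (L ^ 2 * u)) (w' := ENNReal.ofReal (L ^ 2 * u'))
    (l := ENNReal.ofReal ((L ^ 2)⁻¹ * u) * ENNReal.ofReal ((L ^ 2)⁻¹ * u'))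
    (δ := ENNReal.ofReal ((L ^ 7)⁻¹ * u)) (Λ := ENNReal.ofReal L) (n := (n : ℝ≥0∞))
    (mp.comp ((measurable_fst.comp measurable_fst).prodMk measurable_snd))
    (mq.comp ((measurable_snd.comp measurable_fst).prodMk measurable_snd))
    (hB.comp ((measurable_fst.comp measurable_fst).prodMk measurable_snd))
    (hB'.comp ((measurable_snd.comp measurable_fst).prodMk measurable_snd))
    (fun _ _ _ => hite _) (fun _ _ _ _ => hite _) (fun t x => (ep _ _).trans_le (h1 _ _))
    (fun t y => (ep' _ _).trans_le (h2 _ _)) (fun t x y => (eq _ _ _).trans_le (h3 _ _ _))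
    (fun t z => (epq _ _ _).trans_le (h4 _ _ _))
    (lintegral_moment_fst_le hB hΛ) (lintegral_moment_snd_le hB' hΛ') (by simp)
    (by exact_mod_cast hn)
    (by
      rw [← ENNReal.ofReal_natCast, ← ENNReal.ofReal_mul (by positivity), ENNReal.one_le_ofReal]
      have : 1 ≤ L ^ 2 := one_le_pow₀ hL1
      calc 1 ≤ n * u := hnu
        _ = 1 * (n * u) := (one_mul _).symm
        _ ≤ L ^ 2 * (n * u) := by gcongr
        _ = _ := by ring)
    (by
      rw [← ENNReal.ofReal_natCast, ← ENNReal.ofReal_pow (by positivity),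
        ← ENNReal.ofReal_mul (by positivity), ENNReal.one_le_ofReal]
      have : 1 ≤ L ^ 2 := one_le_pow₀ hL1
      calc 1 ≤ (n : ℝ) ^ 2 * u' := hnu'
        _ = 1 * ((n : ℝ) ^ 2 * u') := (one_mul _).symm
        _ ≤ L ^ 2 * ((n : ℝ) ^ 2 * u') := by gcongr
        _ = _ := by ring)
    (le_lintegral_triples mp mq (fun x => by simpa only [ep] using hl x) fun ω x y hxy => by
      simp only [eq]
      exact hl' ω x y (by by_contra hc; exact hxy (if_neg hc)))
    (ENNReal.mul_ne_top ENNReal.ofReal_ne_top ENNReal.ofReal_ne_top)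
    (by
      rw [← ENNReal.ofReal_mul (by positivity), ← ENNReal.ofReal_mul (by positivity),
        show (4 : ℝ≥0∞) = ENNReal.ofReal 4 by simp, ← ENNReal.ofReal_mul (by positivity)]
      refine ENNReal.ofReal_le_ofReal ?_
      calc 4 * ((L ^ 7)⁻¹ * u * (L ^ 2 * u')) = 4 * (L⁻¹ * ((L ^ 4)⁻¹ * (u * u'))) := by
            field_simp
        _ = 4 * L⁻¹ * ((L ^ 4)⁻¹ * (u * u')) := by ring
        _ ≤ 1 * ((L ^ 4)⁻¹ * (u * u')) := by
            refine mul_le_mul_of_nonneg_right ?_ (by positivity)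
            rw [← div_eq_mul_inv, div_le_one hL0]; linarith
        _ = _ := by field_simp)
    (he 0) (he 1) (he 2) (hne 0 1 (by decide)) (hne 0 2 (by decide)) (hne 1 2 (by decide))
  have hC : 0 < L ^ 10 * (u * u') ^ 2 := by positivity
  refine (ENNReal.mul_le_mul_iff_right (a := ENNReal.ofReal (L ^ 10 * (u * u') ^ 2))
    (by simpa using hC) ENNReal.ofReal_ne_top).1 ?_
  calc ENNReal.ofReal (L ^ 10 * (u * u') ^ 2) * ENNReal.ofReal (L ^ 18)⁻¹ =
      (ENNReal.ofReal ((L ^ 2)⁻¹ * u) * ENNReal.ofReal ((L ^ 2)⁻¹ * u')) ^ 2 := by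
        rw [← ENNReal.ofReal_mul (by positivity), ← ENNReal.ofReal_mul (by positivity),
          ← ENNReal.ofReal_pow (by positivity)]
        congr 1
        field_simp
    _ ≤ _ := key
    _ ≤ _ := by
      refine mul_le_mul' ?_ (measure_mono fun t ht => ⟨?_, ?_⟩)
      · rw [← ENNReal.ofReal_mul (by positivity), ← ENNReal.ofReal_one,
          ← ENNReal.ofReal_add (by positivity) (by positivity),
          ← ENNReal.ofReal_add (by positivity) (by positivity),
          ← ENNReal.ofReal_pow (by positivity), ← ENNReal.ofReal_mul (by positivity),
          show (32 : ℝ≥0∞) = ENNReal.ofReal 32 by simp, ← ENNReal.ofReal_mul (by positivity)]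
        refine ENNReal.ofReal_le_ofReal ?_
        calc 32 * ((1 + L + L) * (L ^ 2 * u * (L ^ 2 * u')) ^ 2) =
            32 * (1 + L + L) * (L ^ 8 * (u * u') ^ 2) := by ring
          _ ≤ L ^ 2 * (L ^ 8 * (u * u') ^ 2) :=
            mul_le_mul_of_nonneg_right (by nlinarith) (by positivity)
          _ = _ := by ring
      · have h := ht.1
        rw [← Fintype.sum_prod_type' (f := fun i j => p t.1.1 (t.2 (e 0 i)) (t.2 (e 1 j))),
          Finset.sum_boole, ← ENNReal.ofReal_natCast, ← ENNReal.ofReal_pow (by positivity),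
          ← ENNReal.ofReal_mul (by positivity), ENNReal.ofReal_le_natCast] at h
        refine h.trans (Nat.cast_le.2 ?_)
        rw [count_eq]
        refine Finset.card_le_card_of_injOn (fun x => (e 0 x.1, e 1 x.2)) (fun x hx => ?_)
          fun x _ y _ hxy => ?_
        · exact Finset.mem_filter.2 ⟨Finset.mem_univ _, (Finset.mem_filter.1 hx).2⟩
        · exact Prod.ext (he 0 (congrArg Prod.fst hxy)) (he 1 (congrArg Prod.snd hxy))
      · have h := ht.2
        have e3 : ∑ i, ∑ j, ∑ k, p t.1.1 (t.2 (e 0 i)) (t.2 (e 1 j)) *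
            q t.1.2 (t.2 (e 0 i)) (t.2 (e 1 j)) (t.2 (e 2 k)) =
            ∑ x : Fin n × Fin n × Fin n, if P t.1.1 (t.2 (e 0 x.1)) (t.2 (e 1 x.2.1)) ∧
              Q t.1.2 (t.2 (e 0 x.1)) (t.2 (e 1 x.2.1)) (t.2 (e 2 x.2.2)) then 1 else 0 := by
          simp only [Fintype.sum_prod_type, p, q, ite_and, ite_mul, one_mul, zero_mul]
        rw [e3, Finset.sum_boole, ← ENNReal.ofReal_natCast, ← ENNReal.ofReal_pow (by positivity),
          ← ENNReal.ofReal_mul (by positivity), ← ENNReal.ofReal_mul (by positivity),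
          show (4 : ℝ≥0∞) = (4 : ℕ) by simp, ← Nat.cast_mul, ENNReal.ofReal_le_natCast] at h
        calc _ = (L ^ 2)⁻¹ * u * ((L ^ 2)⁻¹ * u') * (n : ℝ) ^ 3 := by field_simp
          _ ≤ _ := h
          _ ≤ _ := by
            push_cast
            refine mul_le_mul_of_nonneg_left (Nat.cast_le.2 ?_) (by norm_num)
            rw [count_eq]
            refine Finset.card_le_card_of_injOn (fun x => (e 0 x.1, e 1 x.2.1, e 2 x.2.2))
              (fun x hx => ?_) fun x _ y _ hxy => ?_
            · have hx' := (Finset.mem_filter.1 hx).2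
              exact Finset.mem_filter.2 ⟨Finset.mem_univ _, ⟨hne 0 1 (by decide) _ _,
                hne 0 2 (by decide) _ _, hne 1 2 (by decide) _ _⟩, hx'⟩
            · exact Prod.ext (he 0 (congrArg Prod.fst hxy)) (Prod.ext
                (he 1 (congrArg (fun z => z.2.1) hxy)) (he 2 (congrArg (fun z => z.2.2) hxy)))

end Abstract

/-! ### Upper bounds for counts by Markov's inequality -/

section Counting

variable {T I : Type*} [MeasurableSpace T] [Fintype I]

open Classical in
theorem measurable_card_filter {A : I → T → Prop} (hA : ∀ i, MeasurableSet {x | A i x}) :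
    Measurable fun x => (count fun i => A i x : ℝ) := by
  have : (fun x => (count fun i => A i x : ℝ)) =
      fun x => ∑ i, if A i x then (1 : ℝ) else 0 := by
    ext x; rw [Finset.sum_boole, count_eq]
  rw [this]
  exact Finset.measurable_fun_sum _ fun i _ => Measurable.ite (hA i) measurable_const
    measurable_const

open Classical in
/-- Markov's inequality for the number of events that occur. -/
theorem measure_card_ge_le [Nonempty I] (ρ : Measure T) {A : I → T → Prop}
    (hA : ∀ i, MeasurableSet {x | A i x}) {p t : ℝ} (hp : 0 < p) (ht : 0 < t)
    (h : ∀ i, ρ {x | A i x} ≤ ENNReal.ofReal p) :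
    ρ {x | Fintype.card I * p * t ≤ (count fun i => A i x)} ≤
      ENNReal.ofReal t⁻¹ := by
  have hI : (0 : ℝ) < Fintype.card I := by exact_mod_cast Fintype.card_pos
  have hm : Measurable fun x => ∑ i, if A i x then (1 : ℝ≥0∞) else 0 :=
    Finset.measurable_fun_sum _ fun i _ => Measurable.ite (hA i) measurable_const measurable_const
  have h1 := mul_meas_ge_le_lintegral (μ := ρ) hm (ENNReal.ofReal (Fintype.card I * p * t))
  have h2 : ∫⁻ x, ∑ i, (if A i x then (1 : ℝ≥0∞) else 0) ∂ρ ≤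
      ENNReal.ofReal (Fintype.card I * p) := by
    rw [lintegral_finsetSum _ fun i _ => Measurable.ite (hA i) measurable_const measurable_const]
    simp only [lintegral_ite_eq ρ (hA _)]
    refine (Finset.sum_le_sum fun i _ => h i).trans_eq ?_
    rw [Finset.sum_const, nsmul_eq_mul, ENNReal.ofReal_mul (by positivity),
      ENNReal.ofReal_natCast, Finset.card_univ]
  have h3 : {x | ENNReal.ofReal (Fintype.card I * p * t) ≤
      ∑ i, if A i x then (1 : ℝ≥0∞) else 0} =
      {x | Fintype.card I * p * t ≤ (count fun i => A i x)} := by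
    ext x
    rw [mem_ofPred_eq, mem_ofPred_eq, count_eq, Finset.sum_boole, ENNReal.ofReal_le_natCast]
  rw [h3] at h1
  have hc : 0 < Fintype.card I * p * t := by positivity
  refine (ENNReal.mul_le_mul_iff_right (a := ENNReal.ofReal (Fintype.card I * p * t))
    (by simpa using hc) ENNReal.ofReal_ne_top).1 ((h1.trans h2).trans_eq ?_)
  rw [← ENNReal.ofReal_mul (by positivity)]
  congr 1
  field_simp

theorem prod_le_of_section_le {T' : Type*} [MeasurableSpace T'] {ρ : Measure T} {ρ' : Measure T'}
    [SFinite ρ] [IsProbabilityMeasure ρ'] {s : Set (T × T')} (hs : MeasurableSet s) {c : ℝ≥0∞}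
    (h : ∀ y, ρ {x | (x, y) ∈ s} ≤ c) : ρ.prod ρ' s ≤ c := by
  rw [Measure.prod_apply_symm hs]
  refine (lintegral_mono fun y => h y).trans ?_
  rw [lintegral_const, measure_univ, mul_one]

end Counting

section Product

variable {S ι : Type*} [MeasurableSpace S] [Fintype ι] [DecidableEq ι] {ν : Measure S}
  [IsProbabilityMeasure ν]

theorem pi_pair_le {A : Set S} (hA : MeasurableSet A) {D : S → S → Prop}
    (hD : MeasurableSet {p : S × S | D p.1 p.2}) {c c' : ℝ≥0∞} (hc : ν A ≤ c)
    (hc' : ∀ x ∈ A, ν {y | D x y} ≤ c') {a b : ι} (hab : a ≠ b) :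
    Measure.pi (fun _ : ι => ν) {f | f a ∈ A ∧ D (f a) (f b)} ≤ c * c' := by
  classical
  have ha : ∀ a : ι, Measurable fun f : ι → S => f a := fun a => measurable_pi_apply a
  have hm : MeasurableSet {f : ι → S | f a ∈ A ∧ D (f a) (f b)} :=
    (ha a hA).inter (((ha a).prodMk (ha b)) hD)
  rw [← lintegral_ite_eq _ hm]
  refine (lintegral_pi_le_of_update (fun _ : ι => ν) (G := fun f => A.indicator 1 (f a) * c')
    (Measurable.ite hm measurable_const measurable_const) b fun f => ?_).trans ?_
  · simp only [update_eq_of_ne hab, Function.update_self]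
    by_cases h : f a ∈ A
    · simp only [h, true_and, indicator_of_mem, Pi.one_apply, one_mul]
      have hs : MeasurableSet {y | D (f a) y} :=
        (measurable_const.prodMk measurable_id : Measurable fun y : S => (f a, y)) hD
      rw [lintegral_ite_eq _ hs]
      exact hc' _ h
    · simp [h]
  · have m : Measurable fun f : ι → S => A.indicator (1 : S → ℝ≥0∞) (f a) :=
      (measurable_one.indicator hA).comp (ha a)
    rw [lintegral_mul_const _ m,
      lintegral_eval₁ ν (measurable_one.indicator hA) a, lintegral_indicator_one hA]
    exact mul_le_mul_left hc _

theorem pi_triple_le {A : Set (S × S)} (hA : MeasurableSet A) {D : S → S → S → Prop}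
    (hD : MeasurableSet {p : S × S × S | D p.1 p.2.1 p.2.2}) {c c' : ℝ≥0∞} (hc : (ν.prod ν) A ≤ c)
    (hc' : ∀ x y, (x, y) ∈ A → ν {z | D x y z} ≤ c') {i j k : ι} (hij : i ≠ j) (hik : i ≠ k)
    (hjk : j ≠ k) :
    Measure.pi (fun _ : ι => ν) {f | (f i, f j) ∈ A ∧ D (f i) (f j) (f k)} ≤ c * c' := by
  classical
  have ha : ∀ a : ι, Measurable fun f : ι → S => f a := fun a => measurable_pi_apply a
  have hm : MeasurableSet {f : ι → S | (f i, f j) ∈ A ∧ D (f i) (f j) (f k)} :=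
    (((ha i).prodMk (ha j)) hA).inter (((ha i).prodMk ((ha j).prodMk (ha k))) hD)
  have hp : Measurable (Function.uncurry fun x y : S => A.indicator (1 : S × S → ℝ≥0∞) (x, y)) :=
    measurable_one.indicator hA
  have hq : Measurable fun t : S × S × S => if D t.1 t.2.1 t.2.2 then (1 : ℝ≥0∞) else 0 :=
    Measurable.ite hD measurable_const measurable_const
  have key := le_lintegral_triple (ν := ν) (q := fun x y z => if D x y z then 1 else 0)
    hp hq hij hik hjk
  rw [← lintegral_indicator_one hm]
  have e2 : ∀ f : ι → S, ({f : ι → S | (f i, f j) ∈ A ∧ D (f i) (f j) (f k)} : Set _).indicator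
      (1 : (ι → S) → ℝ≥0∞) f =
      A.indicator (1 : S × S → ℝ≥0∞) (f i, f j) * if D (f i) (f j) (f k) then 1 else 0 := by
    intro f
    by_cases h1 : (f i, f j) ∈ A <;> by_cases h2 : D (f i) (f j) (f k) <;> simp [h1, h2]
  simp only [e2]
  rw [key]
  calc _ ≤ ∫⁻ x, ∫⁻ y, A.indicator (1 : S × S → ℝ≥0∞) (x, y) * c' ∂ν ∂ν := by
        refine lintegral_mono fun x => lintegral_mono fun y => ?_
        by_cases h : (x, y) ∈ A
        · have hs : MeasurableSet {z | D x y z} :=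
            (measurable_const.prodMk (measurable_const.prodMk measurable_id) :
              Measurable fun z : S => (x, y, z)) hD
          rw [lintegral_ite_eq _ hs]
          exact mul_le_mul_right (hc' x y h) _
        · simp [h]
    _ = (ν.prod ν) A * c' := by
        have m : Measurable fun s : S × S => A.indicator (1 : S × S → ℝ≥0∞) s * c' :=
          (measurable_one.indicator hA).mul_const c'
        rw [← lintegral_prod (fun s : S × S => A.indicator (1 : S × S → ℝ≥0∞) s * c')
          m.aemeasurable, lintegral_mul_const _ (measurable_one.indicator hA),
          lintegral_indicator_one hA]
    _ ≤ c * c' := mul_le_mul_left hc _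

end Product

section Meet

variable {d b N : ℕ} {M : ℝ}

/-- `⟨v, y⟩` is close to `g`, and a codeword is close to both `v` and `y`. -/
def Meet (a g : ℝ) (σ : RPCSeed d b N M) (v y : EuclideanSpace ℝ (Fin d)) : Prop :=
  |inner ℝ v y - g| ≤ tol d ∧ ∃ j, Near (tol d) a σ v j ∧ Near (tol d) a σ y j

theorem measurableSet_meet (a g : ℝ) :
    MeasurableSet {p : RPCSeed d b N M × EuclideanSpace ℝ (Fin d) × EuclideanSpace ℝ (Fin d) |
      Meet a g p.1 p.2.1 p.2.2} := by
  have f1 : Measurable fun p : RPCSeed d b N M × EuclideanSpace ℝ (Fin d) ×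
      EuclideanSpace ℝ (Fin d) => (p.1, p.2.1) :=
    measurable_fst.prodMk (measurable_fst.comp measurable_snd)
  have f2 : Measurable fun p : RPCSeed d b N M × EuclideanSpace ℝ (Fin d) ×
      EuclideanSpace ℝ (Fin d) => (p.1, p.2.2) :=
    measurable_fst.prodMk (measurable_snd.comp measurable_snd)
  have m0 : MeasurableSet {p : EuclideanSpace ℝ (Fin d) × EuclideanSpace ℝ (Fin d) |
      |inner ℝ p.1 p.2 - g| ≤ tol d} := measurableSet_le (by fun_prop) measurable_const
  have m1 := (measurable_snd : Measurable fun p : RPCSeed d b N M × EuclideanSpace ℝ (Fin d) ×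
      EuclideanSpace ℝ (Fin d) => p.2) m0
  have m3 := fun j : CodeIdx b N M => (f1 (measurableSet_near (tol d) a j)).inter
    (f2 (measurableSet_near (tol d) a j))
  refine (congrArg MeasurableSet ?_).mp (m1.inter (MeasurableSet.iUnion m3))
  ext p
  simp only [Meet, mem_inter_iff, mem_iUnion, mem_preimage, mem_ofPred_eq]

theorem Measurable.meet {T : Type*} [MeasurableSpace T] {σ : T → RPCSeed d b N M}
    {v y : T → EuclideanSpace ℝ (Fin d)} (hσ : Measurable σ) (hv : Measurable v)
    (hy : Measurable y) (a g : ℝ) : MeasurableSet {t | Meet a g (σ t) (v t) (y t)} :=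
  hσ.prodMk (hv.prodMk hy) (measurableSet_meet a g)

theorem Measurable.bcnt {T : Type*} [MeasurableSpace T] {σ : T → RPCSeed d b N M}
    {y : T → EuclideanSpace ℝ (Fin d)} (hσ : Measurable σ) (hy : Measurable y) (e a : ℝ)
    (q : Fin N) : Measurable fun t => GoodRPC.bcnt e a (σ t) q (y t) := by
  have h := (measurable_bcnt e a q).comp (hσ.prodMk hy)
  exact h

theorem Link.meet (hd : 0 < d) (hb : 0 < b) {a g : ℝ} {q : Fin N} {σ : RPCSeed d b N M}
    {v y : EuclideanSpace ℝ (Fin d)} (h : Link a g q σ v y) : Meet a g σ v y := by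
  obtain ⟨h1, -, κ, h2, h3⟩ := h
  exact ⟨h1, (q, κ), h3, h2.abs_inner_sub_le hd hb⟩

theorem measurable_dir {S : Type*} [MeasurableSpace S] {f g : S → EuclideanSpace ℝ (Fin d)}
    (hf : Measurable f) (hg : Measurable g) : Measurable fun x => dir (f x) (g x) := by
  unfold dir; fun_prop

end Meet

/-! ### Upper bounds for pairs and triples that meet -/

theorem norm_dir {d : ℕ} {x y : EuclideanSpace ℝ (Fin d)} (h : x ≠ y) : ‖dir x y‖ = 1 :=
  norm_smul_inv_norm (sub_ne_zero.2 h)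

theorem dir_self {d : ℕ} (x : EuclideanSpace ℝ (Fin d)) : dir x x = 0 := by
  rw [dir, sub_self, smul_zero]

theorem measurableSet_and {T : Type*} [MeasurableSpace T] {p q : T → Prop}
    (hp : MeasurableSet {x | p x}) (hq : MeasurableSet {x | q x}) :
    MeasurableSet {x | p x ∧ q x} := hp.inter hq

theorem exp_div_two_rpow_le {x : ℝ} (hx : 0 ≤ x) :
    Real.exp x / 2 ^ (4 * x) ≤ Real.exp (-x) := by
  have h2 : (1 : ℝ) / 2 ≤ Real.log 2 := by linarith [Real.log_two_gt_d9]
  rw [Real.rpow_def_of_pos (by norm_num), ← Real.exp_sub]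
  exact Real.exp_le_exp.2 (by nlinarith)

/-- The number of indices of points in a cap. -/
def bucketCount {d m : ℕ} (a : ℝ) (f : Fin m → sphere (0 : EuclideanSpace ℝ (Fin d)) 1)
    (c : EuclideanSpace ℝ (Fin d)) : ℝ :=
  (count fun i => |inner ℝ (f i : EuclideanSpace ℝ (Fin d)) c - a| ≤ tol d : ℕ)

section Upper

variable {k : ℝ} {d N : ℕ} (h : DimFacts k d N)
include h

theorem DimFacts.tol_lt (hk : 0 < k) (hk1 : k ≤ 1) : tol d < k := by
  have h2 := h.scale.tol_le_k hk
  have h4 := h.scale.tol_pos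
  nlinarith

/-- A vector with a positive inner product with something is not `dir x x`. -/
theorem DimFacts.ne_of_inner_dir (hk : 0 < k) {a : ℝ} (ha : k ≤ a) (ha1 : a ≤ 1 - k)
    {x y c : EuclideanSpace ℝ (Fin d)} (hc : |inner ℝ (dir x y) c - a| ≤ tol d) : x ≠ y := by
  rintro rfl
  rw [dir_self, inner_zero_left] at hc
  linarith [(abs_le.1 hc).1, h.tol_lt hk (by linarith)]

theorem DimFacts.not_meet_self {a g : ℝ} (hA : Adm k a g) {M : ℝ}
    (σ : RPCSeed d (Nat.log 2 d) N M) {x : EuclideanSpace ℝ (Fin d)} (hx : ‖x‖ = 1) :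
    ¬ Meet a g σ x x := by
  rintro ⟨h1, -⟩
  rw [real_inner_self_eq_norm_sq, hx] at h1
  linarith [(abs_le.1 h1).2, h.tol_lt hA.pos (by linarith [hA.g_ge, hA.g_le]), hA.g_le]

theorem pi_meet_le {a g : ℝ} (hA : Adm k a g) (σ : RPCSeed d (Nat.log 2 d) N (1 / pa d a))
    {m : ℕ} {i j : Fin m} (hij : i ≠ j) :
    Measure.pi (fun _ : Fin m => unifSphere (Fin d))
      {f | Meet a g σ (f i : EuclideanSpace ℝ (Fin d)) (f j)} ≤
      ENNReal.ofReal (Lam d ^ 3 * wa d a g) := by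
  have := h.nonempty
  have := isProbabilityMeasure_unifSphere (Fin d)
  have hL := Lam_pos d
  have hw := (hA.wa_pos d).le
  have hp := (pa_pos hA.pos hA.a_ge hA.a_le d).le
  have hb : ∀ c : EuclideanSpace ℝ (Fin d), ‖c‖ = 1 →
      Measure.pi (fun _ : Fin m => unifSphere (Fin d))
        {f | f i ∈ {x : sphere (0 : EuclideanSpace ℝ (Fin d)) 1 |
            |inner ℝ (x : EuclideanSpace ℝ (Fin d)) c - a| ≤ tol d} ∧
          (g - tol d ≤ inner ℝ (f i : EuclideanSpace ℝ (Fin d)) (f j) ∧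
            a - tol d ≤ inner ℝ (f j : EuclideanSpace ℝ (Fin d)) c)} ≤
        ENNReal.ofReal (Lam d * pa d a) * ENNReal.ofReal (Lam d * wa d a g) := fun c hc => by
    have m1 : MeasurableSet {p : sphere (0 : EuclideanSpace ℝ (Fin d)) 1 ×
        sphere (0 : EuclideanSpace ℝ (Fin d)) 1 |
        g - tol d ≤ inner ℝ (p.1 : EuclideanSpace ℝ (Fin d)) p.2 ∧
        a - tol d ≤ inner ℝ (p.2 : EuclideanSpace ℝ (Fin d)) c} :=
      measurableSet_and (measurableSet_le measurable_const (by fun_prop))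
        (measurableSet_le measurable_const (by fun_prop))
    exact pi_pair_le (measurableSet_le (by fun_prop) measurable_const) m1
      (h.cap_le a hA.a_ge hA.a_le c hc)
      (fun x hx => h.wedge_le a g hA x c (by simp) hc hx) hij
  have hsub : {f : Fin m → sphere (0 : EuclideanSpace ℝ (Fin d)) 1 |
      Meet a g σ (f i : EuclideanSpace ℝ (Fin d)) (f j)} ⊆
      ⋃ κ ∈ (Finset.univ : Finset (CodeIdx (Nat.log 2 d) N (1 / pa d a))),
        {f | f i ∈ {x : sphere (0 : EuclideanSpace ℝ (Fin d)) 1 |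
            |inner ℝ (x : EuclideanSpace ℝ (Fin d)) (cw σ κ) - a| ≤ tol d} ∧
          (g - tol d ≤ inner ℝ (f i : EuclideanSpace ℝ (Fin d)) (f j) ∧
            a - tol d ≤ inner ℝ (f j : EuclideanSpace ℝ (Fin d)) (cw σ κ))} := by
    rintro f ⟨h1, κ, h2, h3⟩
    simp only [mem_iUnion]
    exact ⟨κ, Finset.mem_univ _, h2, by linarith [(abs_le.1 h1).1], by linarith [(abs_le.1 h3).1]⟩
  refine (measure_mono hsub).trans ((measure_biUnion_finset_le _ _).trans ?_)
  refine (Finset.sum_le_sum fun κ _ => hb _ (h.norm_cw σ κ)).trans ?_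
  rw [Finset.sum_const, nsmul_eq_mul, Finset.card_univ, ← ENNReal.ofReal_natCast,
    ← ENNReal.ofReal_mul (by positivity), ← ENNReal.ofReal_mul (by positivity)]
  refine ENNReal.ofReal_le_ofReal ?_
  have h1 := h.codeSize a hA.a_ge hA.a_le
  calc _ = ((Fintype.card (CodeIdx (Nat.log 2 d) N (1 / pa d a)) : ℝ) * pa d a) *
        (Lam d ^ 2 * wa d a g) := by ring
    _ ≤ Lam d * (Lam d ^ 2 * wa d a g) := mul_le_mul_of_nonneg_right h1 (by positivity)
    _ = _ := by ring

theorem pi_pairCap_wedge_le {a g a' g' : ℝ} (hA : Adm k a g) (hA' : Adm k a' g')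
    {c c' : EuclideanSpace ℝ (Fin d)} (hc : ‖c‖ = 1) (hc' : ‖c'‖ = 1)
    {m : ℕ} {i j l : Fin m} (hij : i ≠ j) (hil : i ≠ l) (hjl : j ≠ l) :
    Measure.pi (fun _ : Fin m => unifSphere (Fin d)) {f |
      (|inner ℝ (f i : EuclideanSpace ℝ (Fin d)) c - a| ≤ tol d ∧
      |inner ℝ (f j : EuclideanSpace ℝ (Fin d)) c - a| ≤ tol d ∧
      |inner ℝ (f i : EuclideanSpace ℝ (Fin d)) (f j : EuclideanSpace ℝ (Fin d)) - g| ≤ tol d ∧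
      |inner ℝ (dir (f i : EuclideanSpace ℝ (Fin d)) (f j)) c' - a'| ≤ tol d) ∧
      (g' - tol d ≤ inner ℝ (dir (f i : EuclideanSpace ℝ (Fin d)) (f j)) (f l) ∧
        a' - tol d ≤ inner ℝ (f l : EuclideanSpace ℝ (Fin d)) c')} ≤
      ENNReal.ofReal (Lam d * (pa d a * wa d a g * pa d a')) *
        ENNReal.ofReal (Lam d * wa d a' g') := by
  have := h.nonempty
  have := isProbabilityMeasure_unifSphere (Fin d)
  have cS : Measurable fun x : sphere (0 : EuclideanSpace ℝ (Fin d)) 1 =>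
    (x : EuclideanSpace ℝ (Fin d)) := measurable_subtype_coe
  have md : Measurable fun p : sphere (0 : EuclideanSpace ℝ (Fin d)) 1 ×
      sphere (0 : EuclideanSpace ℝ (Fin d)) 1 => dir (p.1 : EuclideanSpace ℝ (Fin d)) p.2 :=
    measurable_dir (cS.comp measurable_fst) (cS.comp measurable_snd)
  have mA : MeasurableSet {p : sphere (0 : EuclideanSpace ℝ (Fin d)) 1 ×
      sphere (0 : EuclideanSpace ℝ (Fin d)) 1 |
      |inner ℝ (p.1 : EuclideanSpace ℝ (Fin d)) c - a| ≤ tol d ∧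
      |inner ℝ (p.2 : EuclideanSpace ℝ (Fin d)) c - a| ≤ tol d ∧
      |inner ℝ (p.1 : EuclideanSpace ℝ (Fin d)) (p.2 : EuclideanSpace ℝ (Fin d)) - g| ≤ tol d ∧
      |inner ℝ (dir (p.1 : EuclideanSpace ℝ (Fin d)) p.2) c' - a'| ≤ tol d} :=
    measurableSet_and (measurableSet_le (by fun_prop) measurable_const)
      (measurableSet_and (measurableSet_le (by fun_prop) measurable_const)
      (measurableSet_and (measurableSet_le (by fun_prop) measurable_const)
      (measurableSet_le (by fun_prop) measurable_const)))
  have md3 : Measurable fun p : sphere (0 : EuclideanSpace ℝ (Fin d)) 1 ×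
      sphere (0 : EuclideanSpace ℝ (Fin d)) 1 × sphere (0 : EuclideanSpace ℝ (Fin d)) 1 =>
      dir (p.1 : EuclideanSpace ℝ (Fin d)) p.2.1 :=
    measurable_dir (cS.comp measurable_fst) (cS.comp (measurable_fst.comp measurable_snd))
  have m1 : MeasurableSet {p : sphere (0 : EuclideanSpace ℝ (Fin d)) 1 ×
      sphere (0 : EuclideanSpace ℝ (Fin d)) 1 × sphere (0 : EuclideanSpace ℝ (Fin d)) 1 |
      g' - tol d ≤ inner ℝ (dir (p.1 : EuclideanSpace ℝ (Fin d)) p.2.1) p.2.2 ∧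
      a' - tol d ≤ inner ℝ (p.2.2 : EuclideanSpace ℝ (Fin d)) c'} :=
    measurableSet_and (measurableSet_le measurable_const (by fun_prop))
      (measurableSet_le measurable_const (by fun_prop))
  exact pi_triple_le mA (D := fun x y z =>
    g' - tol d ≤ inner ℝ (dir (x : EuclideanSpace ℝ (Fin d)) y) z ∧
      a' - tol d ≤ inner ℝ (z : EuclideanSpace ℝ (Fin d)) c') m1
    (h.pair_cap a g a' hA hA'.a_ge hA'.a_le c c' hc hc')
    (fun x y hxy => h.wedge_le a' g' hA' _ c'
      (norm_dir (h.ne_of_inner_dir hA.pos hA'.a_ge hA'.a_le hxy.2.2.2)) hc' hxy.2.2.2) hij hil hjl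

theorem pi_meet_meet_le {a g a' g' : ℝ} (hA : Adm k a g) (hA' : Adm k a' g')
    (σ : RPCSeed d (Nat.log 2 d) N (1 / pa d a)) (σ' : RPCSeed d (Nat.log 2 d) N (1 / pa d a'))
    {m : ℕ} {i j l : Fin m} (hij : i ≠ j) (hil : i ≠ l) (hjl : j ≠ l) :
    Measure.pi (fun _ : Fin m => unifSphere (Fin d))
      {f | Meet a g σ (f i : EuclideanSpace ℝ (Fin d)) (f j) ∧
        Meet a' g' σ' (dir (f i : EuclideanSpace ℝ (Fin d)) (f j)) (f l)} ≤
      ENNReal.ofReal (Lam d ^ 4 * (wa d a g * wa d a' g')) := by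
  have hL := Lam_pos d
  have hw := (hA.wa_pos d).le
  have hw' := (hA'.wa_pos d).le
  have hp := (pa_pos hA.pos hA.a_ge hA.a_le d).le
  have hp' := (pa_pos hA'.pos hA'.a_ge hA'.a_le d).le
  refine (measure_mono (fun f hf => ?_)).trans ((measure_biUnion_finset_le
    ((Finset.univ : Finset (CodeIdx (Nat.log 2 d) N (1 / pa d a))) ×ˢ
      (Finset.univ : Finset (CodeIdx (Nat.log 2 d) N (1 / pa d a')))) _).trans
    ((Finset.sum_le_sum fun κ _ => pi_pairCap_wedge_le h hA hA' (h.norm_cw σ κ.1)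
      (h.norm_cw σ' κ.2) hij hil hjl).trans ?_))
  · obtain ⟨⟨h1, κ, h2, h3⟩, h4, κ', h5, h6⟩ := hf
    refine mem_biUnion (x := (κ, κ')) (Finset.mem_product.2
      ⟨Finset.mem_univ _, Finset.mem_univ _⟩) ?_
    exact ⟨⟨h2, h3, h1, h5⟩, by linarith [(abs_le.1 h4).1], by linarith [(abs_le.1 h6).1]⟩
  have h1 := h.codeSize a hA.a_ge hA.a_le
  have h2 := h.codeSize a' hA'.a_ge hA'.a_le
  rw [Finset.sum_const, nsmul_eq_mul, Finset.card_product, Finset.card_univ, Finset.card_univ]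
  generalize Fintype.card (CodeIdx (Nat.log 2 d) N (1 / pa d a)) = n₁ at h1 ⊢
  generalize Fintype.card (CodeIdx (Nat.log 2 d) N (1 / pa d a')) = n₂ at h2 ⊢
  rw [← ENNReal.ofReal_natCast, ← ENNReal.ofReal_mul (by positivity),
    ← ENNReal.ofReal_mul (by positivity)]
  refine ENNReal.ofReal_le_ofReal ?_
  push_cast
  calc _ = ((n₁ * pa d a) * (n₂ * pa d a')) * (Lam d ^ 2 * (wa d a g * wa d a' g')) := by ring
    _ ≤ (Lam d * Lam d) * (Lam d ^ 2 * (wa d a g * wa d a' g')) := by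
        refine mul_le_mul_of_nonneg_right ?_ (by positivity)
        exact mul_le_mul h1 h2 (by positivity) hL.le
    _ = _ := by ring

open Classical in
/-- The number of points in a cap is within a factor `4 Λ` of its expectation. -/
theorem pi_bucket_le {a : ℝ} (hk : 0 < k) (ha : k ≤ a) (ha1 : a ≤ 1 - k) (m : ℕ)
    {c : EuclideanSpace ℝ (Fin d)} (hc : ‖c‖ = 1) :
    Measure.pi (fun _ : Fin m => unifSphere (Fin d)) {f |
      bucketCount a f c ≤ m * ((Lam d)⁻¹ * pa d a) / 4 ∨
      4 * (m * (Lam d * pa d a)) ≤ bucketCount a f c} ≤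
      ENNReal.ofReal (2 * Real.exp (-(m * ((Lam d)⁻¹ * pa d a) / 4))) := by
  have := h.nonempty
  have := isProbabilityMeasure_unifSphere (Fin d)
  have hL := Lam_pos d
  have hL1 := h.one_le_Lam
  have hp := (pa_pos hk ha ha1 d).le
  obtain ⟨D, hD⟩ : ∃ D : Set (sphere (0 : EuclideanSpace ℝ (Fin d)) 1),
    D = {x : sphere (0 : EuclideanSpace ℝ (Fin d)) 1 |
      |inner ℝ (x : EuclideanSpace ℝ (Fin d)) c - a| ≤ tol d} := ⟨_, rfl⟩
  have hDm : MeasurableSet D := by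
    rw [hD]; exact measurableSet_le (by fun_prop) measurable_const
  have e : ∀ f : Fin m → sphere (0 : EuclideanSpace ℝ (Fin d)) 1, bucketCount a f c =
      (Finset.univ.filter fun i => f i ∈ D).card := fun f => by
    rw [bucketCount, count_eq]; simp only [hD, mem_ofPred_eq]
  have h1 := pi_card_le_le (ι := Fin m) (μ := unifSphere (Fin d)) hDm
    (p := (Lam d)⁻¹ * pa d a) (by positivity) (by rw [hD]; exact h.cap_ge a ha ha1 c hc)
  have h2 := pi_card_ge_le (μ := unifSphere (Fin d)) (Finset.univ : Finset (Fin m))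
    (fun _ => D) (fun i => (measurable_pi_apply i) hDm) (fun _ => hDm) (fun _ _ _ _ => rfl)
    (p := Lam d * pa d a) (by positivity) (fun _ => by rw [hD]; exact h.cap_le a ha ha1 c hc)
    (4 * (m * (Lam d * pa d a)))
  rw [Fintype.card_fin] at h1
  rw [Finset.card_univ, Fintype.card_fin] at h2
  simp only [e]
  refine (measure_union_le _ _).trans ((add_le_add h1 h2).trans ?_)
  rw [← ENNReal.ofReal_add (by positivity) (by positivity)]
  refine ENNReal.ofReal_le_ofReal ?_
  have h3 := exp_div_two_rpow_le (x := m * (Lam d * pa d a)) (by positivity)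
  have h4 : Real.exp (-(m * (Lam d * pa d a))) ≤ Real.exp (-(m * ((Lam d)⁻¹ * pa d a) / 4)) := by
    refine Real.exp_le_exp.2 (neg_le_neg ?_)
    have : (Lam d)⁻¹ ≤ Lam d := (inv_le_one_of_one_le₀ hL1).trans hL1
    have h5 : m * ((Lam d)⁻¹ * pa d a) ≤ m * (Lam d * pa d a) := by gcongr
    have h6 : 0 ≤ m * ((Lam d)⁻¹ * pa d a) := by positivity
    linarith
  linarith

open Classical in
theorem pi_third_le {g : ℝ} (hk : 0 < k) (hg : k ≤ g) (hg1 : g ≤ 1 - k) {m : ℕ} (i j : Fin m)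
    {Y : ℝ} (hY : m * (Lam d * pa d g) ≤ Y) :
    Measure.pi (fun _ : Fin m => unifSphere (Fin d)) {f |
      4 * Y ≤ (count fun l => (l ≠ i ∧ l ≠ j) ∧
        |inner ℝ (dir (f i : EuclideanSpace ℝ (Fin d)) (f j)) (f l) - g| ≤ tol d)} ≤
      ENNReal.ofReal (Real.exp (-Y)) := by
  have := h.nonempty
  have := isProbabilityMeasure_unifSphere (Fin d)
  have hL := Lam_pos d
  have hp := (pa_pos hk hg hg1 d).le
  have cS : Measurable fun x : sphere (0 : EuclideanSpace ℝ (Fin d)) 1 =>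
    (x : EuclideanSpace ℝ (Fin d)) := measurable_subtype_coe
  have ha : ∀ a : Fin m, Measurable fun f : Fin m → sphere (0 : EuclideanSpace ℝ (Fin d)) 1 =>
    (f a : EuclideanSpace ℝ (Fin d)) := fun a => cS.comp (measurable_pi_apply a)
  have md := measurable_dir (ha i) (ha j)
  have h2 := pi_card_ge_le (μ := unifSphere (Fin d))
    (Finset.univ.filter fun l : Fin m => l ≠ i ∧ l ≠ j)
    (fun f => {z | |inner ℝ (dir (f i : EuclideanSpace ℝ (Fin d)) (f j))
      (z : EuclideanSpace ℝ (Fin d)) - g| ≤ tol d})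
    (fun l => measurableSet_le (((md.inner (ha l)).sub_const g).abs) measurable_const)
    (fun f => measurableSet_le (by fun_prop) measurable_const)
    (fun f l hl t => by
      have hl' := (Finset.mem_filter.1 hl).2
      rw [update_eq_of_ne hl'.1.symm, update_eq_of_ne hl'.2.symm])
    (p := Lam d * pa d g) (by positivity) (fun f => ?_) (4 * Y)
  · simp only [Finset.filter_filter] at h2
    simp only [count_eq]
    refine h2.trans (ENNReal.ofReal_le_ofReal ?_)
    refine le_trans ?_ (exp_div_two_rpow_le (le_trans (by positivity) hY))
    refine div_le_div_of_nonneg_right (Real.exp_le_exp.2 (le_trans ?_ hY)) (by positivity)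
    have hc : (Finset.univ.filter fun l : Fin m => l ≠ i ∧ l ≠ j).card ≤ m := by
      simpa using Finset.card_le_univ (Finset.univ.filter fun l : Fin m => l ≠ i ∧ l ≠ j)
    exact mul_le_mul_of_nonneg_right (by exact_mod_cast hc) (by positivity)
  · by_cases hij : (f i : EuclideanSpace ℝ (Fin d)) = f j
    · rw [show {z : sphere (0 : EuclideanSpace ℝ (Fin d)) 1 |
          |inner ℝ (dir (f i : EuclideanSpace ℝ (Fin d)) (f j))
            (z : EuclideanSpace ℝ (Fin d)) - g| ≤ tol d} = ∅ from
          eq_empty_of_forall_notMem fun z hz => h.ne_of_inner_dir hk hg hg1 hz hij, measure_empty]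
      exact zero_le
    · refine (measure_mono fun z hz => ?_).trans (h.cap_le g hg hg1 _ (norm_dir hij))
      rw [mem_ofPred_eq, real_inner_comm]
      exact hz

omit h in
theorem pi_not_injective {d : ℕ} (hd : 2 ≤ d) (m : ℕ) :
    Measure.pi (fun _ : Fin m => unifSphere (Fin d)) {f | ¬ Function.Injective f} = 0 := by
  have : Nontrivial (Fin d) := Fin.nontrivial_iff_two_le.2 hd
  have := isProbabilityMeasure_unifSphere (Fin d)
  have hp : ∀ i j : Fin m, i ≠ j →
      Measure.pi (fun _ : Fin m => unifSphere (Fin d)) {f | f i = f j} = 0 := fun i j hij => by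
    have h1 := pi_pair_le (ν := unifSphere (Fin d)) (A := univ) MeasurableSet.univ
      (D := fun x y => (y : EuclideanSpace ℝ (Fin d)) = x)
      (measurableSet_eq_fun (by fun_prop) (by fun_prop)) (c := 1) (c' := 0) prob_le_one
      (fun x _ => (unifSphere_singleton _).le) hij
    rw [mul_zero] at h1
    refine measure_mono_null (fun f (hf : f i = f j) => ?_) (nonpos_iff_eq_zero.1 h1)
    exact ⟨mem_univ _, by rw [hf]⟩
  refine measure_mono_null (t := ⋃ i : Fin m, ⋃ j : Fin m, ⋃ _ : i ≠ j, {f | f i = f j}) ?_ ?_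
  · intro f hf
    simp only [mem_ofPred_eq, Function.Injective] at hf
    push Not at hf
    obtain ⟨i, j, h1, h2⟩ := hf
    simp only [mem_iUnion]
    exact ⟨i, j, h2, h1⟩
  · simp only [measure_iUnion_null_iff]
    exact hp

end Upper

/-! ### Typical outcomes -/

section Generic

variable {Ω S : Type*} [MeasurableSpace Ω] [MeasurableSpace S] {μ : Measure Ω} {ν : Measure S}
  [IsProbabilityMeasure μ] [IsProbabilityMeasure ν] {m : ℕ}

theorem measurable_prod_eval (i : Fin m) : Measurable fun ω : (Fin m → S) × Ω => ω.1 i :=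
  (measurable_pi_apply i).comp measurable_fst

theorem prob_pairs_ge_le [NeZero m] {P : Ω → S → S → Prop}
    (hP : MeasurableSet {t : Ω × S × S | P t.1 t.2.1 t.2.2}) {p t : ℝ} (hp : 0 < p) (ht : 0 < t)
    (h : ∀ ω, ∀ i j : Fin m, i ≠ j →
      Measure.pi (fun _ : Fin m => ν) {f | P ω (f i) (f j)} ≤ ENNReal.ofReal p) :
    ((Measure.pi fun _ : Fin m => ν).prod μ) {ω | (m : ℝ) ^ 2 * p * t ≤
      (count fun x : Fin m × Fin m => x.1 ≠ x.2 ∧ P ω.2 (ω.1 x.1) (ω.1 x.2))} ≤ ENNReal.ofReal t⁻¹ := by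
  have hA : ∀ x : Fin m × Fin m, MeasurableSet {ω : (Fin m → S) × Ω |
      x.1 ≠ x.2 ∧ P ω.2 (ω.1 x.1) (ω.1 x.2)} := fun x =>
    measurableSet_and (MeasurableSet.const _) ((measurable_snd.prodMk
      ((measurable_prod_eval x.1).prodMk (measurable_prod_eval x.2))) hP)
  have key := measure_card_ge_le ((Measure.pi fun _ : Fin m => ν).prod μ) hA hp ht fun x =>
    prod_le_of_section_le (hA x) fun ω => by
      by_cases hx : x.1 = x.2
      · simp [hx]
      · simpa [hx] using h ω _ _ hx
  rw [show (m : ℝ) ^ 2 = Fintype.card (Fin m × Fin m) by simp [sq]]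
  exact key

theorem prob_triples_ge_le [NeZero m] {P : Ω → S → S → S → Prop}
    (hP : MeasurableSet {t : Ω × S × S × S | P t.1 t.2.1 t.2.2.1 t.2.2.2}) {p t : ℝ} (hp : 0 < p)
    (ht : 0 < t) (h : ∀ ω, ∀ i j l : Fin m, i ≠ j → i ≠ l → j ≠ l →
      Measure.pi (fun _ : Fin m => ν) {f | P ω (f i) (f j) (f l)} ≤ ENNReal.ofReal p) :
    ((Measure.pi fun _ : Fin m => ν).prod μ) {ω | (m : ℝ) ^ 3 * p * t ≤
      (count fun x : Fin m × Fin m × Fin m => (x.1 ≠ x.2.1 ∧ x.1 ≠ x.2.2 ∧ x.2.1 ≠ x.2.2) ∧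
        P ω.2 (ω.1 x.1) (ω.1 x.2.1) (ω.1 x.2.2))} ≤ ENNReal.ofReal t⁻¹ := by
  have hA : ∀ x : Fin m × Fin m × Fin m, MeasurableSet {ω : (Fin m → S) × Ω |
      (x.1 ≠ x.2.1 ∧ x.1 ≠ x.2.2 ∧ x.2.1 ≠ x.2.2) ∧
        P ω.2 (ω.1 x.1) (ω.1 x.2.1) (ω.1 x.2.2)} := fun x =>
    measurableSet_and (MeasurableSet.const _) ((measurable_snd.prodMk
      ((measurable_prod_eval x.1).prodMk
        ((measurable_prod_eval x.2.1).prodMk (measurable_prod_eval x.2.2)))) hP)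
  have key := measure_card_ge_le ((Measure.pi fun _ : Fin m => ν).prod μ) hA hp ht fun x =>
    prod_le_of_section_le (hA x) fun ω => by
      by_cases hx : x.1 ≠ x.2.1 ∧ x.1 ≠ x.2.2 ∧ x.2.1 ≠ x.2.2
      · refine (measure_mono fun f hf => ?_).trans (h ω _ _ _ hx.1 hx.2.1 hx.2.2)
        exact hf.2
      · refine (measure_mono (t := ∅) fun f hf => hx hf.1).trans (by simp)
  have e : (m : ℝ) ^ 3 = Fintype.card (Fin m × Fin m × Fin m) := by
    simp only [Fintype.card_prod, Fintype.card_fin, Nat.cast_mul]; ring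
  rw [e]
  exact key

omit [IsProbabilityMeasure ν] in
theorem prob_fst_eq {s : Set (Fin m → S)} :
    ((Measure.pi fun _ : Fin m => ν).prod μ) {ω | ω.1 ∈ s} = Measure.pi (fun _ : Fin m => ν) s := by
  have : {ω : (Fin m → S) × Ω | ω.1 ∈ s} = s ×ˢ univ := by ext; simp
  rw [this, Measure.prod_prod, measure_univ, mul_one]

end Generic

section Typical

variable {k : ℝ} {d N : ℕ}

theorem prob_bucket_le (h : DimFacts k d N) (hk : 0 < k) {a : ℝ} (ha : k ≤ a) (ha1 : a ≤ 1 - k)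
    (m : ℕ) {Ω : Type*} [MeasurableSpace Ω] {μ : Measure Ω} [IsProbabilityMeasure μ]
    {J : Type*} [Fintype J] {c : J → Ω → EuclideanSpace ℝ (Fin d)} (hc : ∀ j, Measurable (c j))
    (hc1 : ∀ j ω, ‖c j ω‖ = 1) :
    ((Measure.pi fun _ : Fin m => unifSphere (Fin d)).prod μ) {ω | ∃ j,
      (bucketCount a ω.1 (c j ω.2) ≤ m * ((Lam d)⁻¹ * pa d a) / 4 ∨
      4 * (m * (Lam d * pa d a)) ≤ bucketCount a ω.1 (c j ω.2))} ≤
      ENNReal.ofReal (Fintype.card J * (2 * Real.exp (-(m * ((Lam d)⁻¹ * pa d a) / 4)))) := by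
  classical
  have := h.nonempty
  have := isProbabilityMeasure_unifSphere (Fin d)
  rw [ENNReal.ofReal_mul (by positivity), ENNReal.ofReal_natCast]
  rw [show {ω : (Fin m → sphere (0 : EuclideanSpace ℝ (Fin d)) 1) × Ω | ∃ j,
      (bucketCount a ω.1 (c j ω.2) ≤ m * ((Lam d)⁻¹ * pa d a) / 4 ∨
      4 * (m * (Lam d * pa d a)) ≤ bucketCount a ω.1 (c j ω.2))} = ⋃ j,
      {ω | bucketCount a ω.1 (c j ω.2) ≤ m * ((Lam d)⁻¹ * pa d a) / 4 ∨
      4 * (m * (Lam d * pa d a)) ≤ bucketCount a ω.1 (c j ω.2)} by ext; simp]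
  refine (measure_iUnion_fintype_le _ _).trans ((Finset.sum_le_sum fun j _ =>
    prod_le_of_section_le ?_ fun ω => pi_bucket_le h hk ha ha1 m (hc1 j ω)).trans ?_)
  · have hm : Measurable fun ω : (Fin m → sphere (0 : EuclideanSpace ℝ (Fin d)) 1) × Ω =>
        bucketCount a ω.1 (c j ω.2) := by
      refine measurable_card_filter fun i => measurableSet_le ?_ measurable_const
      exact (((measurable_subtype_coe.comp (measurable_prod_eval i)).inner
        ((hc j).comp measurable_snd)).sub_const a).abs
    exact (measurableSet_le hm measurable_const).union (measurableSet_le measurable_const hm)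
  · rw [Finset.sum_const, nsmul_eq_mul, Finset.card_univ]

/-- The counts of indices that make a triple good. -/
structure Typical {m : ℕ} {M M' : ℝ} (a g a' g' Y : ℝ) (q : Fin N)
    (ω : (Fin m → sphere (0 : EuclideanSpace ℝ (Fin d)) 1) ×
      RPCSeed d (Nat.log 2 d) N M × RPCSeed d (Nat.log 2 d) N M') : Prop where
  inj : Function.Injective ω.1
  bucket : ∀ j, m * ((Lam d)⁻¹ * pa d a) / 4 ≤ bucketCount a ω.1 (cw ω.2.1 j) ∧
    bucketCount a ω.1 (cw ω.2.1 j) ≤ 4 * (m * (Lam d * pa d a))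
  bucket' : ∀ j, m * ((Lam d)⁻¹ * pa d a') / 4 ≤ bucketCount a' ω.1 (cw ω.2.2 j) ∧
    bucketCount a' ω.1 (cw ω.2.2 j) ≤ 4 * (m * (Lam d * pa d a'))
  third : ∀ i j, (count fun l => (l ≠ i ∧ l ≠ j) ∧
    |inner ℝ (dir (ω.1 i : EuclideanSpace ℝ (Fin d)) (ω.1 j)) (ω.1 l) - g'| ≤ tol d) ≤ 4 * Y
  pairs_le : ((count fun x : Fin m × Fin m => x.1 ≠ x.2 ∧
    Meet a g ω.2.1 (ω.1 x.1 : EuclideanSpace ℝ (Fin d)) (ω.1 x.2) : ℕ) : ℝ) ≤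
    (m : ℝ) ^ 2 * (Lam d ^ 3 * wa d a g) * Lam d ^ 19
  triples_le : ((count fun x : Fin m × Fin m × Fin m =>
    (x.1 ≠ x.2.1 ∧ x.1 ≠ x.2.2 ∧ x.2.1 ≠ x.2.2) ∧
    Meet a g ω.2.1 (ω.1 x.1 : EuclideanSpace ℝ (Fin d)) (ω.1 x.2.1) ∧
    Meet a' g' ω.2.2 (dir (ω.1 x.1 : EuclideanSpace ℝ (Fin d)) (ω.1 x.2.1)) (ω.1 x.2.2) : ℕ) : ℝ) ≤
    (m : ℝ) ^ 3 * (Lam d ^ 4 * (wa d a g * wa d a' g')) * Lam d ^ 19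
  pairs_ge : (Lam d ^ 7)⁻¹ * wa d a g * (m / 3 : ℕ) ^ 2 ≤
    ((count fun x : Fin m × Fin m =>
      Link a g q ω.2.1 (ω.1 x.1 : EuclideanSpace ℝ (Fin d)) (ω.1 x.2) : ℕ) : ℝ)
  triples_ge : (Lam d ^ 4)⁻¹ * (wa d a g * wa d a' g') * (m / 3 : ℕ) ^ 3 ≤
    4 * ((count fun x : Fin m × Fin m × Fin m =>
      (x.1 ≠ x.2.1 ∧ x.1 ≠ x.2.2 ∧ x.2.1 ≠ x.2.2) ∧
      Link a g q ω.2.1 (ω.1 x.1 : EuclideanSpace ℝ (Fin d)) (ω.1 x.2.1) ∧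
      Link a' g' q ω.2.2 (dir (ω.1 x.1 : EuclideanSpace ℝ (Fin d)) (ω.1 x.2.1))
        (ω.1 x.2.2) : ℕ) : ℝ)

variable (h : DimFacts k d N)
include h

theorem prob_linked_ge {a g a' g' : ℝ} (hA : Adm k a g) (hA' : Adm k a' g') (q : Fin N) {m : ℕ}
    (hm : 1 ≤ m / 3) (hw : 1 ≤ (m / 3 : ℕ) * wa d a g)
    (hw' : 1 ≤ ((m / 3 : ℕ) : ℝ) ^ 2 * wa d a' g') :
    ENNReal.ofReal (Lam d ^ 18)⁻¹ ≤ ((Measure.pi fun _ : Fin m => unifSphere (Fin d)).prod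
      ((rpcLaw d (Nat.log 2 d) N (1 / pa d a)).prod (rpcLaw d (Nat.log 2 d) N (1 / pa d a')))) {ω |
      (Lam d ^ 7)⁻¹ * wa d a g * (m / 3 : ℕ) ^ 2 ≤
        ((count fun x : Fin m × Fin m =>
          Link a g q ω.2.1 (ω.1 x.1 : EuclideanSpace ℝ (Fin d)) (ω.1 x.2) : ℕ) : ℝ) ∧
      (Lam d ^ 4)⁻¹ * (wa d a g * wa d a' g') * (m / 3 : ℕ) ^ 3 ≤
        4 * ((count fun x : Fin m × Fin m × Fin m =>
          (x.1 ≠ x.2.1 ∧ x.1 ≠ x.2.2 ∧ x.2.1 ≠ x.2.2) ∧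
          Link a g q ω.2.1 (ω.1 x.1 : EuclideanSpace ℝ (Fin d)) (ω.1 x.2.1) ∧
          Link a' g' q ω.2.2 (dir (ω.1 x.1 : EuclideanSpace ℝ (Fin d)) (ω.1 x.2.1))
            (ω.1 x.2.2) : ℕ) : ℝ)} := by
  have := h.nonempty
  have := isProbabilityMeasure_unifSphere (Fin d)
  have hPr : ∀ M, IsProbabilityMeasure (rpcLaw d (Nat.log 2 d) N M) := fun M =>
    isProbabilityMeasure_rpcLaw (by linarith [h.scale.two_le]) h.scale.b_pos h.scale.b_lt
  have cS : Measurable fun x : sphere (0 : EuclideanSpace ℝ (Fin d)) 1 =>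
    (x : EuclideanSpace ℝ (Fin d)) := measurable_subtype_coe
  have hd := norm_eq_of_mem_sphere (E := EuclideanSpace ℝ (Fin d)) (r := 1)
  refine le_prob_linked_triples (S := sphere (0 : EuclideanSpace ℝ (Fin d)) 1) (hA.wa_pos d) (hA'.wa_pos d) h.two_le_Lam
    (P := fun σ x y => Link a g q σ (x : EuclideanSpace ℝ (Fin d)) y)
    (Q := fun σ x y z => Link a' g' q σ (dir (x : EuclideanSpace ℝ (Fin d)) y) z)
    (B := fun σ y => bcnt (tol d) a σ q (y : EuclideanSpace ℝ (Fin d)))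
    (B' := fun σ y => bcnt (tol d) a' σ q (y : EuclideanSpace ℝ (Fin d)))
    (Measurable.link measurable_fst (cS.comp (measurable_fst.comp measurable_snd))
      (cS.comp (measurable_snd.comp measurable_snd)) a g q)
    (Measurable.link measurable_fst (measurable_dir (cS.comp (measurable_fst.comp measurable_snd))
      (cS.comp (measurable_fst.comp (measurable_snd.comp measurable_snd))))
      (cS.comp (measurable_snd.comp (measurable_snd.comp measurable_snd))) a' g' q)
    ?_ ?_
    (fun σ x => link_fst_le h hA q σ (hd x)) (fun σ y => link_snd_le h hA q σ (hd y))
    (fun σ x y => link_dir_le h hA' q σ x y) (fun σ σ' z => link_pair_le h hA hA' q σ σ' (hd z))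
    (fun y => h.moment a hA.a_ge hA.a_le q y (hd y))
    (fun y => h.moment a' hA'.a_ge hA'.a_le q y (hd y))
    (fun x => le_lintegral_link h hA q (hd x))
    (fun σ x y hxy => le_lintegral_link h hA' q (norm_dir fun hc => ?_))
    hm (Nat.mul_div_le m 3) hw hw'
  · exact Measurable.bcnt measurable_fst (cS.comp measurable_snd) _ _ _
  · exact Measurable.bcnt measurable_fst (cS.comp measurable_snd) _ _ _
  · have hxy' := hxy.meet (by linarith [h.scale.two_le]) h.scale.b_pos
    rw [← hc] at hxy'
    exact h.not_meet_self hA σ (hd x) hxy'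

end Typical

/-! ### The probability of a typical outcome -/

section ProbTypical

variable {k : ℝ} {d N : ℕ} (h : DimFacts k d N)
include h

theorem prob_third_le {g : ℝ} (hk : 0 < k) (hg : k ≤ g) (hg1 : g ≤ 1 - k) {m : ℕ} {Ω : Type*}
    [MeasurableSpace Ω] {μ : Measure Ω} [IsProbabilityMeasure μ] {Y : ℝ}
    (hY : m * (Lam d * pa d g) ≤ Y) :
    ((Measure.pi fun _ : Fin m => unifSphere (Fin d)).prod μ) {ω | ∃ i j : Fin m,
      4 * Y ≤ (count fun l => (l ≠ i ∧ l ≠ j) ∧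
        |inner ℝ (dir (ω.1 i : EuclideanSpace ℝ (Fin d)) (ω.1 j)) (ω.1 l) - g| ≤ tol d)} ≤
      ENNReal.ofReal ((m : ℝ) ^ 2 * Real.exp (-Y)) := by
  have := h.nonempty
  have := isProbabilityMeasure_unifSphere (Fin d)
  refine (prob_fst_eq (S := sphere (0 : EuclideanSpace ℝ (Fin d)) 1) (s := {f | ∃ i j : Fin m,
      4 * Y ≤ (count fun l => (l ≠ i ∧ l ≠ j) ∧
        |inner ℝ (dir (f i : EuclideanSpace ℝ (Fin d)) (f j)) (f l) - g| ≤ tol d)})).le.trans ?_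
  refine (measure_mono fun f (hf : ∃ i j : Fin m, _) => ?_).trans ((measure_biUnion_finset_le
    (Finset.univ : Finset (Fin m × Fin m)) fun x : Fin m × Fin m =>
      {f : Fin m → sphere (0 : EuclideanSpace ℝ (Fin d)) 1 |
        4 * Y ≤ (count fun l => (l ≠ x.1 ∧ l ≠ x.2) ∧
        |inner ℝ (dir (f x.1 : EuclideanSpace ℝ (Fin d)) (f x.2)) (f l) - g| ≤ tol d)}).trans
    ((Finset.sum_le_sum fun x _ => pi_third_le h hk hg hg1 x.1 x.2 hY).trans_eq ?_))
  · obtain ⟨i, j, hij⟩ := hf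
    exact mem_biUnion (x := (i, j)) (Finset.mem_coe.2 (Finset.mem_univ _)) hij
  · rw [Finset.sum_const, nsmul_eq_mul, ENNReal.ofReal_mul (by positivity)]
    simp [sq, ENNReal.ofReal_mul]

/-- The typical event has not too small a probability, up to small errors. -/
theorem le_prob_typical {a g a' g' : ℝ} (hA : Adm k a g) (hA' : Adm k a' g') (q : Fin N) {m : ℕ}
    (hm : 1 ≤ m / 3) (hw : 1 ≤ (m / 3 : ℕ) * wa d a g)
    (hw' : 1 ≤ ((m / 3 : ℕ) : ℝ) ^ 2 * wa d a' g') {Y : ℝ} (hY : m * (Lam d * pa d g') ≤ Y) :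
    ENNReal.ofReal (Lam d ^ 18)⁻¹ ≤ ((Measure.pi fun _ : Fin m => unifSphere (Fin d)).prod
      ((rpcLaw d (Nat.log 2 d) N (1 / pa d a)).prod (rpcLaw d (Nat.log 2 d) N (1 / pa d a'))))
        {ω | Typical a g a' g' Y q ω} +
      (ENNReal.ofReal (Fintype.card (CodeIdx (Nat.log 2 d) N (1 / pa d a)) *
          (2 * Real.exp (-(m * ((Lam d)⁻¹ * pa d a) / 4)))) +
        ENNReal.ofReal (Fintype.card (CodeIdx (Nat.log 2 d) N (1 / pa d a')) *
          (2 * Real.exp (-(m * ((Lam d)⁻¹ * pa d a') / 4)))) +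
        ENNReal.ofReal ((m : ℝ) ^ 2 * Real.exp (-Y)) + ENNReal.ofReal (Lam d ^ 19)⁻¹ +
        ENNReal.ofReal (Lam d ^ 19)⁻¹) := by
  have := h.nonempty
  have := isProbabilityMeasure_unifSphere (Fin d)
  have hPr : ∀ M, IsProbabilityMeasure (rpcLaw d (Nat.log 2 d) N M) := fun M =>
    isProbabilityMeasure_rpcLaw (by linarith [h.scale.two_le]) h.scale.b_pos h.scale.b_lt
  have hL := Lam_pos d
  have hu := hA.wa_pos d
  have hu' := hA'.wa_pos d
  have : NeZero m := ⟨by omega⟩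
  have cS : Measurable fun x : sphere (0 : EuclideanSpace ℝ (Fin d)) 1 =>
    (x : EuclideanSpace ℝ (Fin d)) := measurable_subtype_coe
  set μ := (rpcLaw d (Nat.log 2 d) N (1 / pa d a)).prod (rpcLaw d (Nat.log 2 d) N (1 / pa d a'))
    with hμ
  set ρ := (Measure.pi fun _ : Fin m => unifSphere (Fin d)).prod μ with hρ
  have b0 : ρ {ω | ω.1 ∈ {f | ¬ Function.Injective f}} = 0 :=
    prob_fst_eq.trans (pi_not_injective h.scale.two_le m)
  have b1 := prob_bucket_le h hA.pos hA.a_ge hA.a_le m (μ := μ) (c := fun j σ => cw σ.1 j)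
    (fun j => (continuous_cw j).measurable.comp measurable_fst) (fun j σ => h.norm_cw σ.1 j)
  have b2 := prob_bucket_le h hA'.pos hA'.a_ge hA'.a_le m (μ := μ) (c := fun j σ => cw σ.2 j)
    (fun j => (continuous_cw j).measurable.comp measurable_snd) (fun j σ => h.norm_cw σ.2 j)
  have b3 := prob_third_le h hA'.pos hA'.g_ge hA'.g_le (μ := μ) hY
  have b4 := prob_pairs_ge_le (S := sphere (0 : EuclideanSpace ℝ (Fin d)) 1) (μ := μ) (ν := unifSphere (Fin d)) (m := m)
    (P := fun σ x y => Meet a g σ.1 (x : EuclideanSpace ℝ (Fin d)) y)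
    (Measurable.meet (measurable_fst.comp measurable_fst)
      (cS.comp (measurable_fst.comp measurable_snd))
      (cS.comp (measurable_snd.comp measurable_snd)) a g) (p := Lam d ^ 3 * wa d a g)
    (t := Lam d ^ 19) (by positivity) (by positivity) fun σ i j hij => pi_meet_le h hA σ.1 hij
  have b5 := prob_triples_ge_le (S := sphere (0 : EuclideanSpace ℝ (Fin d)) 1) (μ := μ) (ν := unifSphere (Fin d)) (m := m)
    (P := fun σ x y z => Meet a g σ.1 (x : EuclideanSpace ℝ (Fin d)) y ∧
      Meet a' g' σ.2 (dir (x : EuclideanSpace ℝ (Fin d)) y) z)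
    (measurableSet_and (Measurable.meet (measurable_fst.comp measurable_fst)
      (cS.comp (measurable_fst.comp measurable_snd))
      (cS.comp (measurable_fst.comp (measurable_snd.comp measurable_snd))) a g)
      (Measurable.meet (measurable_snd.comp measurable_fst)
      (measurable_dir (cS.comp (measurable_fst.comp measurable_snd))
        (cS.comp (measurable_fst.comp (measurable_snd.comp measurable_snd))))
      (cS.comp (measurable_snd.comp (measurable_snd.comp measurable_snd))) a' g'))
    (p := Lam d ^ 4 * (wa d a g * wa d a' g')) (t := Lam d ^ 19) (by positivity) (by positivity)
    fun σ i j l hij hil hjl => pi_meet_meet_le h hA hA' σ.1 σ.2 hij hil hjl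
  have key := prob_linked_ge h hA hA' q hm hw hw'
  refine key.trans ?_
  have hT := add_le_add (add_le_add (add_le_add (add_le_add b1 b2) b3) b4) b5
  refine le_trans ?_ (add_le_add (le_refl (ρ {ω | Typical a g a' g' Y q ω})) hT)
  rw [← add_zero (ρ {ω | Typical a g a' g' Y q ω}), ← b0]
  refine le_trans (measure_mono ?_) ((measure_union_le _ _).trans (add_le_add
    (measure_union_le _ _) ((measure_union_le _ _).trans (add_le_add ((measure_union_le _ _).trans
    (add_le_add ((measure_union_le _ _).trans (add_le_add (measure_union_le _ _) le_rfl)) le_rfl))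
    le_rfl))))
  intro ω hω
  by_contra hc
  simp only [mem_union, mem_ofPred_eq, not_or, not_exists, not_le] at hc
  obtain ⟨⟨c0, c1⟩, ⟨⟨⟨⟨c2, c3⟩, c4⟩, c5⟩, c6⟩⟩ := hc
  exact c0 ⟨not_not.1 c1, fun j => ⟨(c2 j).1.le, (c2 j).2.le⟩, fun j => ⟨(c3 j).1.le, (c3 j).2.le⟩,
    fun i j => (c4 i j).le, c5.le, c6.le, hω.1, hω.2⟩

end ProbTypical

/-! ### Typical outcomes are good -/

theorem ncard_setOf_eq_count {I : Type*} [Fintype I] (p : I → Prop) :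
    ({i | p i} : Set I).ncard = count p := by
  classical
  rw [count_eq, Set.ncard_eq_toFinset_card', Set.toFinset_ofPred]

theorem ncard_le_count {I T : Type*} [Fintype I] (G : I → T) {A : Set T} {p : I → Prop}
    (h : ∀ t ∈ A, ∃ i, p i ∧ G i = t) : A.ncard ≤ count p := by
  rw [← ncard_setOf_eq_count]
  exact (Set.ncard_le_ncard (t := G '' {i | p i}) h (toFinite _)).trans (ncard_image_le (toFinite _))

theorem count_le_ncard {I T : Type*} [Fintype I] {G : I → T} (hG : Function.Injective G) {A : Set T}
    (hA : A.Finite) {p : I → Prop} (h : ∀ i, p i → G i ∈ A) : count p ≤ A.ncard := by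
  rw [← ncard_setOf_eq_count, ← ncard_image_of_injective _ hG]
  exact Set.ncard_le_ncard (image_subset_iff.2 h) hA

section Sets

variable {d b N : ℕ} {M : ℝ}

theorem nbr_inter_nonempty {σ : RPCSeed d b N M} {α : ℝ} {x y : EuclideanSpace ℝ (Fin d)} :
    (nbr (rpcCode σ) α x ∩ nbr (rpcCode σ) α y).Nonempty ↔
      ∃ j, Near (tol d) (Real.cos α) σ x j ∧ Near (tol d) (Real.cos α) σ y j := by
  constructor
  · rintro ⟨c, ⟨hc, h1⟩, -, h2⟩
    obtain ⟨j, rfl⟩ := mem_rpcCode.1 hc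
    exact ⟨j, h1, h2⟩
  · rintro ⟨j, h1, h2⟩
    exact ⟨cw σ j, ⟨mem_rpcCode.2 ⟨j, rfl⟩, h1⟩, mem_rpcCode.2 ⟨j, rfl⟩, h2⟩

theorem small_nbr {σ : RPCSeed d b N M} {α : ℝ} {x : EuclideanSpace ℝ (Fin d)}
    (h : cnt (tol d) (Real.cos α) σ x ≤ ENNReal.ofReal (Lam d)) : Small (nbr (rpcCode σ) α x) := by
  classical
  have h1 : (nbr (rpcCode σ) α x).ncard ≤ count fun j => Near (tol d) (Real.cos α) σ x j := by
    refine ncard_le_count (cw σ) ?_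
    rintro c ⟨hc, h1⟩
    obtain ⟨j, rfl⟩ := mem_rpcCode.1 hc
    exact ⟨j, h1, rfl⟩
  rw [cnt_eq_card, ← count_eq, ← ENNReal.ofReal_natCast,
    ENNReal.ofReal_le_ofReal_iff (Lam_pos d).le] at h
  exact (Nat.cast_le.2 h1).trans h

end Sets

theorem eqUpTo_of {s L x y : ℝ} {i j : ℕ} (hi : L ^ i ≤ 2 ^ s)
    (hj : L ^ j ≤ 2 ^ s) (hx : 0 ≤ x) (hy : 0 ≤ y) (h1 : y ≤ L ^ i * x) (h2 : x ≤ L ^ j * y) :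
    EqUpTo s x y := by
  have h2s : (0 : ℝ) < 2 ^ s := by positivity
  refine ⟨?_, h2.trans (mul_le_mul_of_nonneg_right hj hy)⟩
  rw [Real.rpow_neg (by norm_num), inv_mul_le_iff₀ h2s]
  exact h1.trans (mul_le_mul_of_nonneg_right hi hx)

section Good

variable {k : ℝ} {d N : ℕ} (h : DimFacts k d N)
include h

omit h in
theorem bucket_ncard {m : ℕ} {f : Fin m → sphere (0 : EuclideanSpace ℝ (Fin d)) 1}
    (hf : Function.Injective f) (α : ℝ) (c : EuclideanSpace ℝ (Fin d)) :
    ((bucket (range fun i => (f i : EuclideanSpace ℝ (Fin d))) α c).ncard : ℝ) =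
      bucketCount (Real.cos α) f c := by
  rw [bucketCount, Nat.cast_inj]
  refine le_antisymm (ncard_le_count (fun i => (f i : EuclideanSpace ℝ (Fin d))) ?_)
    (count_le_ncard (Subtype.val_injective.comp hf) ((finite_range _).subset fun x hx => hx.1)
      fun i hi => ⟨⟨i, rfl⟩, hi⟩)
  rintro x ⟨⟨i, rfl⟩, hi⟩
  exact ⟨i, hi, rfl⟩

theorem bucket_eqUpTo {s : ℝ} (hs : Lam d ^ 2 ≤ 2 ^ s) {m : ℕ}
    {f : Fin m → sphere (0 : EuclideanSpace ℝ (Fin d)) 1} (hf : Function.Injective f) {α : ℝ}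
    (hp : 0 ≤ pa d (Real.cos α)) {c : EuclideanSpace ℝ (Fin d)}
    (h1 : m * ((Lam d)⁻¹ * pa d (Real.cos α)) / 4 ≤ bucketCount (Real.cos α) f c)
    (h2 : bucketCount (Real.cos α) f c ≤ 4 * (m * (Lam d * pa d (Real.cos α)))) :
    EqUpTo s (bucket (range fun i => (f i : EuclideanSpace ℝ (Fin d))) α c).ncard
      (m * capP d α) := by
  have hL := Lam_pos d
  have h4 : 4 * Lam d ≤ Lam d ^ 2 := by nlinarith [h.two_le_Lam]
  rw [bucket_ncard hf, capP_eq_pa]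
  have hb0 : 0 ≤ bucketCount (Real.cos α) f c := Nat.cast_nonneg _
  refine eqUpTo_of (L := Lam d) (i := 2) (j := 2) hs hs hb0 (by positivity) ?_ ?_
  · calc m * pa d (Real.cos α) = 4 * Lam d * (m * ((Lam d)⁻¹ * pa d (Real.cos α)) / 4) := by
          field_simp
      _ ≤ 4 * Lam d * bucketCount (Real.cos α) f c := by gcongr
      _ ≤ _ := mul_le_mul_of_nonneg_right h4 hb0
  · calc _ ≤ _ := h2
      _ = 4 * Lam d * (m * pa d (Real.cos α)) := by ring
      _ ≤ _ := mul_le_mul_of_nonneg_right h4 (by positivity)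

theorem Typical.good {θ θ' α α' : ℝ} (hA : Adm k (Real.cos α) (Real.cos θ))
    (hA' : Adm k (Real.cos α') (Real.cos θ')) {q : Fin N} {m : ℕ} (hm : 4 ≤ m) {s Y : ℝ}
    (hs : Lam d ^ 40 ≤ 2 ^ s) (hY : 2 + 4 * Y ≤ 2 ^ s)
    (hW : (Lam d)⁻¹ * wa d (Real.cos α) (Real.cos θ) ≤ wedge d θ α α)
    (hW1 : wedge d θ α α ≤ Lam d * wa d (Real.cos α) (Real.cos θ))
    (hW' : (Lam d)⁻¹ * wa d (Real.cos α') (Real.cos θ') ≤ wedge d θ' α' α')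
    (hW1' : wedge d θ' α' α' ≤ Lam d * wa d (Real.cos α') (Real.cos θ'))
    {ω : (Fin m → sphere (0 : EuclideanSpace ℝ (Fin d)) 1) ×
      RPCSeed d (Nat.log 2 d) N (1 / capP d α) × RPCSeed d (Nat.log 2 d) N (1 / capP d α')}
    (hω : Typical (Real.cos α) (Real.cos θ) (Real.cos α') (Real.cos θ') Y q ω) :
    Good s θ θ' α α' (range fun i => (ω.1 i : EuclideanSpace ℝ (Fin d)))
      (rpcCode ω.2.1) (rpcCode ω.2.2) := by
  obtain ⟨f, σ, σ'⟩ := ω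
  obtain ⟨hinj, hb, hb', hthird, hpl, htl, hpg, htg⟩ := hω
  dsimp only at *
  have hd0 : 0 < d := by linarith [h.scale.two_le]
  have hL := Lam_pos d
  have hL1 := h.one_le_Lam
  have hL256 := h.two_le_Lam
  have h36 : 36 ≤ Lam d := by linarith
  have h864 : 864 ≤ Lam d ^ 2 := by nlinarith
  have hu := hA.wa_pos d
  have hu' := hA'.wa_pos d
  have hm0 : (0 : ℝ) < m := by exact_mod_cast (by omega : 0 < m)
  have hF : Function.Injective fun i => (f i : EuclideanSpace ℝ (Fin d)) :=
    Subtype.val_injective.comp hinj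
  set F : Fin m → EuclideanSpace ℝ (Fin d) := fun i => (f i : EuclideanSpace ℝ (Fin d)) with hFdef
  have hcard : (range F).ncard = m := by
    rw [← image_univ, ncard_image_of_injective _ hF, ncard_univ, Nat.card_fin]
  have hfin : (range F).Finite := finite_range _
  have hnorm : ∀ i, ‖F i‖ = 1 := fun i => norm_eq_of_mem_sphere (f i)
  have hpow : ∀ i ≤ 40, Lam d ^ i ≤ 2 ^ s := fun i hi => (pow_le_pow_right₀ hL1 hi).trans hs
  have hn : (m : ℝ) ≤ 6 * (m / 3 : ℕ) := by exact_mod_cast (by omega : m ≤ 6 * (m / 3))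
  -- pairs
  have e1 : (M1 θ α (range F) (rpcCode σ)).ncard ≤ count fun x : Fin m × Fin m => x.1 ≠ x.2 ∧
      Meet (Real.cos α) (Real.cos θ) σ (F x.1) (F x.2) := by
    refine ncard_le_count (Prod.map F F) ?_
    rintro ⟨x, y⟩ ⟨⟨i, rfl⟩, ⟨j, rfl⟩, h1, h2⟩
    have hM : Meet (Real.cos α) (Real.cos θ) σ (F i) (F j) := ⟨h1, nbr_inter_nonempty.1 h2⟩
    refine ⟨(i, j), ⟨?_, hM⟩, rfl⟩
    intro (hij : i = j)
    subst hij
    exact h.not_meet_self hA σ (hnorm i) hM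
  have f1 : (M1 θ α (range F) (rpcCode σ)).Finite :=
    (hfin.prod hfin).subset fun x hx => ⟨hx.1, hx.2.1⟩
  have e2 : (count fun x : Fin m × Fin m => Link (Real.cos α) (Real.cos θ) q σ (F x.1) (F x.2)) ≤
      (M1s θ α (range F) (rpcCode σ)).ncard := by
    refine count_le_ncard (hF.prodMap hF) (f1.subset fun x hx => hx.1) ?_
    rintro ⟨i, j⟩ hij
    have hM := hij.meet hd0 h.scale.b_pos
    exact ⟨⟨⟨i, rfl⟩, ⟨j, rfl⟩, hM.1, nbr_inter_nonempty.2 hM.2⟩, small_nbr hij.2.1⟩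
  have e3 : (M1s θ α (range F) (rpcCode σ)).ncard ≤ (M1 θ α (range F) (rpcCode σ)).ncard :=
    Set.ncard_le_ncard (fun x hx => hx.1) f1
  -- triples
  have hG : Function.Injective (Prod.map F (Prod.map F F)) := hF.prodMap (hF.prodMap hF)
  have e4 : (TR θ θ' α α' (range F) (rpcCode σ) (rpcCode σ')).ncard ≤
      count fun x : Fin m × Fin m × Fin m => (x.1 ≠ x.2.1 ∧ x.1 ≠ x.2.2 ∧ x.2.1 ≠ x.2.2) ∧
      Meet (Real.cos α) (Real.cos θ) σ (F x.1) (F x.2.1) ∧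
      Meet (Real.cos α') (Real.cos θ') σ' (dir (F x.1) (F x.2.1)) (F x.2.2) := by
    refine ncard_le_count (Prod.map F (Prod.map F F)) ?_
    rintro ⟨x, y, z⟩ ⟨⟨⟨i, rfl⟩, ⟨j, rfl⟩, ⟨l, rfl⟩, h1, h2, h3, h4, h5⟩, h6, h7⟩
    exact ⟨(i, j, l), ⟨⟨fun hc => h1 (congrArg F hc), fun hc => h2 (congrArg F hc),
      fun hc => h3 (congrArg F hc)⟩, ⟨h4, nbr_inter_nonempty.1 h6⟩, h5, nbr_inter_nonempty.1 h7⟩,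
      rfl⟩
  have f4 : (TR θ θ' α α' (range F) (rpcCode σ) (rpcCode σ')).Finite :=
    (hfin.prod (hfin.prod hfin)).subset fun x hx => ⟨hx.1.1, hx.1.2.1, hx.1.2.2.1⟩
  have e5 : (count fun x : Fin m × Fin m × Fin m =>
      (x.1 ≠ x.2.1 ∧ x.1 ≠ x.2.2 ∧ x.2.1 ≠ x.2.2) ∧
      Link (Real.cos α) (Real.cos θ) q σ (F x.1) (F x.2.1) ∧
      Link (Real.cos α') (Real.cos θ') q σ' (dir (F x.1) (F x.2.1)) (F x.2.2)) ≤
      (TRs θ θ' α α' (range F) (rpcCode σ) (rpcCode σ')).ncard := by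
    refine count_le_ncard hG (f4.subset fun x hx => hx.1) ?_
    rintro ⟨i, j, l⟩ ⟨⟨h1, h2, h3⟩, h4, h5⟩
    have hM := h4.meet hd0 h.scale.b_pos
    have hM' := h5.meet hd0 h.scale.b_pos
    exact ⟨⟨⟨⟨i, rfl⟩, ⟨j, rfl⟩, ⟨l, rfl⟩, hF.ne h1, hF.ne h2, hF.ne h3, hM.1, hM'.1⟩,
      nbr_inter_nonempty.2 hM.2, nbr_inter_nonempty.2 hM'.2⟩, small_nbr h4.2.1, small_nbr h5.2.1⟩
  have e6 : (TRs θ θ' α α' (range F) (rpcCode σ) (rpcCode σ')).ncard ≤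
      (TR θ θ' α α' (range F) (rpcCode σ) (rpcCode σ')).ncard :=
    Set.ncard_le_ncard (fun x hx => hx.1) f4
  have hW0 : 0 ≤ wedge d θ α α := measureReal_nonneg
  have hW0' : 0 ≤ wedge d θ' α' α' := measureReal_nonneg
  have hWL : wa d (Real.cos α) (Real.cos θ) ≤ Lam d * wedge d θ α α := by
    rwa [inv_mul_le_iff₀ hL] at hW
  have hWL' : wa d (Real.cos α') (Real.cos θ') ≤ Lam d * wedge d θ' α' α' := by
    rwa [inv_mul_le_iff₀ hL] at hW'
  generalize wa d (Real.cos α) (Real.cos θ) = u at *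
  generalize wa d (Real.cos α') (Real.cos θ') = u' at *
  have t1 := (Nat.cast_le (α := ℝ).2 e1).trans hpl
  have t2 := hpg.trans (Nat.cast_le (α := ℝ).2 e2)
  have t3 := Nat.cast_le (α := ℝ).2 e3
  have t4 := (Nat.cast_le (α := ℝ).2 e4).trans htl
  have t5 := htg.trans (mul_le_mul_of_nonneg_left (Nat.cast_le (α := ℝ).2 e5) (by norm_num))
  have t6 := Nat.cast_le (α := ℝ).2 e6
  have z1 : (0 : ℝ) ≤ (M1 θ α (range F) (rpcCode σ)).ncard := Nat.cast_nonneg _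
  have z2 : (0 : ℝ) ≤ (M1s θ α (range F) (rpcCode σ)).ncard := Nat.cast_nonneg _
  have z4 : (0 : ℝ) ≤ (TR θ θ' α α' (range F) (rpcCode σ) (rpcCode σ')).ncard := Nat.cast_nonneg _
  have z5 : (0 : ℝ) ≤ (TRs θ θ' α α' (range F) (rpcCode σ) (rpcCode σ')).ncard := Nat.cast_nonneg _
  have p1 : (m : ℝ) ^ 2 * u ≤ Lam d ^ 8 * (M1s θ α (range F) (rpcCode σ)).ncard := by
    rw [mul_assoc, inv_mul_le_iff₀ (by positivity)] at t2
    calc (m : ℝ) ^ 2 * u ≤ (6 * (m / 3 : ℕ)) ^ 2 * u := by gcongr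
      _ = 36 * (u * (m / 3 : ℕ) ^ 2) := by ring
      _ ≤ Lam d * (Lam d ^ 7 * (M1s θ α (range F) (rpcCode σ)).ncard) :=
        mul_le_mul h36 t2 (by positivity) hL.le
      _ = _ := by ring
  have p3 : (m : ℝ) ^ 3 * (u * u') ≤
      Lam d ^ 6 * (TRs θ θ' α α' (range F) (rpcCode σ) (rpcCode σ')).ncard := by
    rw [mul_assoc, inv_mul_le_iff₀ (by positivity)] at t5
    calc (m : ℝ) ^ 3 * (u * u') ≤ (6 * (m / 3 : ℕ)) ^ 3 * (u * u') := by gcongr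
      _ = 216 * (u * u' * (m / 3 : ℕ) ^ 3) := by ring
      _ ≤ 216 * (Lam d ^ 4 * (4 * (TRs θ θ' α α' (range F) (rpcCode σ) (rpcCode σ')).ncard)) := by
        gcongr
      _ = 864 * (Lam d ^ 4 * (TRs θ θ' α α' (range F) (rpcCode σ) (rpcCode σ')).ncard) := by ring
      _ ≤ Lam d ^ 2 * (Lam d ^ 4 * (TRs θ θ' α α' (range F) (rpcCode σ) (rpcCode σ')).ncard) :=
        mul_le_mul_of_nonneg_right h864 (by positivity)
      _ = _ := by ring
  refine ⟨?_, ?_, ?_, ?_, ?_, ?_, ?_⟩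
  · intro c hc
    obtain ⟨j, rfl⟩ := mem_rpcCode.1 hc
    rw [hcard]
    exact bucket_eqUpTo h (hpow 2 (by norm_num)) hinj (pa_pos hA.pos hA.a_ge hA.a_le d).le
      (hb j).1 (hb j).2
  · intro c hc
    obtain ⟨j, rfl⟩ := mem_rpcCode.1 hc
    rw [hcard]
    exact bucket_eqUpTo h (hpow 2 (by norm_num)) hinj (pa_pos hA'.pos hA'.a_ge hA'.a_le d).le
      (hb' j).1 (hb' j).2
  · rintro _ ⟨i, rfl⟩ _ ⟨j, rfl⟩
    have hsub : {z ∈ range F | Approx d (inner ℝ (dir (F i) (F j)) z) (Real.cos θ') ∧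
        (nbr (rpcCode σ') α' (dir (F i) (F j)) ∩ nbr (rpcCode σ') α' z).Nonempty} ⊆
        {F i, F j} ∪ F '' {l | (l ≠ i ∧ l ≠ j) ∧
          |inner ℝ (dir (F i) (F j)) (F l) - Real.cos θ'| ≤ tol d} := by
      rintro _ ⟨⟨l, rfl⟩, h1, -⟩
      by_cases hi : l = i
      · left; left; rw [hi]
      by_cases hj : l = j
      · left; right; rw [hj]; rfl
      · exact Or.inr ⟨l, ⟨⟨hi, hj⟩, h1⟩, rfl⟩
    have h2 : ({F i, F j} : Set (EuclideanSpace ℝ (Fin d))).ncard ≤ 2 := by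
      have := ncard_insert_le (F i) {F j}
      rwa [ncard_singleton] at this
    have h3 := (Set.ncard_le_ncard hsub ((toFinite _).union ((toFinite _).image F))).trans
      ((ncard_union_le _ _).trans (add_le_add h2 (ncard_image_le (toFinite _))))
    rw [ncard_setOf_eq_count fun l => (l ≠ i ∧ l ≠ j) ∧
      |inner ℝ (dir (F i) (F j)) (F l) - Real.cos θ'| ≤ tol d] at h3
    have h4 := Nat.cast_le (α := ℝ).2 h3
    push_cast at h4
    have h5 := h4.trans (add_le_add_right (hthird i j) 2)
    have h2s : (0 : ℝ) < 2 ^ s := by positivity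
    calc _ ≤ 2 + 4 * Y := h5
      _ ≤ 2 ^ s * 1 := by rwa [mul_one]
      _ ≤ _ := by gcongr; exact le_max_left _ _
  · refine eqUpTo_of (L := Lam d) (i := 0) (j := 30) (hpow _ (by norm_num)) (hpow _ (by norm_num))
      z1 z2 (by simpa using t3) ?_
    calc _ ≤ _ := t1
      _ = Lam d ^ 22 * ((m : ℝ) ^ 2 * u) := by ring
      _ ≤ Lam d ^ 22 * _ := mul_le_mul_of_nonneg_left p1 (by positivity)
      _ = _ := by ring
  · rw [hcard]
    refine eqUpTo_of (L := Lam d) (i := 9) (j := 23) (hpow _ (by norm_num)) (hpow _ (by norm_num))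
      z2 (by positivity) ?_ ?_
    · calc (m : ℝ) ^ 2 * wedge d θ α α ≤ m ^ 2 * (Lam d * u) := by gcongr
        _ = Lam d * ((m : ℝ) ^ 2 * u) := by ring
        _ ≤ Lam d * _ := mul_le_mul_of_nonneg_left p1 hL.le
        _ = _ := by ring
    · calc _ ≤ _ := t3.trans t1
        _ = Lam d ^ 22 * ((m : ℝ) ^ 2 * u) := by ring
        _ ≤ Lam d ^ 22 * ((m : ℝ) ^ 2 * (Lam d * wedge d θ α α)) := by gcongr
        _ = _ := by ring
  · refine eqUpTo_of (L := Lam d) (i := 0) (j := 29) (hpow _ (by norm_num)) (hpow _ (by norm_num))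
      z4 z5 (by simpa using t6) ?_
    calc _ ≤ _ := t4
      _ = Lam d ^ 23 * ((m : ℝ) ^ 3 * (u * u')) := by ring
      _ ≤ Lam d ^ 23 * _ := mul_le_mul_of_nonneg_left p3 (by positivity)
      _ = _ := by ring
  · rw [hcard]
    refine eqUpTo_of (L := Lam d) (i := 8) (j := 25) (hpow _ (by norm_num)) (hpow _ (by norm_num))
      z5 (by positivity) ?_ ?_
    · calc (m : ℝ) ^ 3 * wedge d θ α α * wedge d θ' α' α' ≤
            m ^ 3 * (Lam d * u) * (Lam d * u') := by gcongr
        _ = Lam d ^ 2 * ((m : ℝ) ^ 3 * (u * u')) := by ring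
        _ ≤ Lam d ^ 2 * _ := mul_le_mul_of_nonneg_left p3 (by positivity)
        _ = _ := by ring
    · calc _ ≤ _ := t6.trans t4
        _ = Lam d ^ 23 * ((m : ℝ) ^ 3 * (u * u')) := by ring
        _ ≤ Lam d ^ 23 * ((m : ℝ) ^ 3 * ((Lam d * wedge d θ α α) * (Lam d * wedge d θ' α' α'))) := by
          gcongr
        _ = _ := by ring

end Good

/-! ### The probability of a good outcome -/

section WedgeBounds

variable {k : ℝ} {d N : ℕ} (h : DimFacts k d N)
include h

theorem DimFacts.norm_planeVec (θ : ℝ) : ‖planeVec d θ‖ = 1 := by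
  have := inner_planeVec d h.scale.two_le θ θ
  rw [sub_self, Real.cos_zero, real_inner_self_eq_norm_sq] at this
  nlinarith [norm_nonneg (planeVec d θ)]

theorem wedge_bounds {α θ : ℝ} (hA : Adm k (Real.cos α) (Real.cos θ)) :
    (Lam d)⁻¹ * wa d (Real.cos α) (Real.cos θ) ≤ wedge d θ α α ∧
      wedge d θ α α ≤ Lam d * wa d (Real.cos α) (Real.cos θ) := by
  have := h.nonempty
  have := isProbabilityMeasure_unifSphere (Fin d)
  have hL := Lam_pos d
  have ht := h.scale.tol_pos
  have hi : inner ℝ (planeVec d 0) (planeVec d α) = Real.cos α := by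
    rw [inner_planeVec d h.scale.two_le, sub_zero]
  constructor
  · exact (ENNReal.ofReal_le_iff_le_toReal (measure_ne_top _ _)).1
      (h.wedge_ge _ _ hA _ _ (h.norm_planeVec 0) (h.norm_planeVec α) hi)
  · refine ENNReal.toReal_le_of_le_ofReal (mul_nonneg hL.le (hA.wa_pos d).le)
      ((measure_mono fun c hc => ?_).trans (h.wedge_le _ _ hA _ _ (h.norm_planeVec 0)
        (h.norm_planeVec α) (by rw [hi, sub_self, abs_zero]; exact ht.le)))
    refine ⟨by linarith [hc.1], ?_⟩
    rw [real_inner_comm]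
    linarith [hc.2]

/-- The probability that the triple is good, in a fixed large dimension. -/
theorem le_prob_good {α θ α' θ' : ℝ} (hA : Adm k (Real.cos α) (Real.cos θ))
    (hA' : Adm k (Real.cos α') (Real.cos θ')) (q : Fin N) {m : ℕ} {R X Z s : ℝ}
    (hR : 36 * Lam d ^ 2 ≤ R) (h1 : R ≤ m * capP d α) (h2 : R ≤ m * capP d α')
    (h3 : R ≤ m * wedge d θ α α) (h4 : R ≤ (m : ℝ) ^ 2 * wedge d θ' α' α') (hmX : m ≤ X)
    (hX : 2 * Lam d ^ 20 * X ^ 2 ≤ Real.exp (Lam d)) (hZ : 1 ≤ Z) (hmZ : m * capP d θ' ≤ Z)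
    (hs : 2 ^ s = Lam d ^ 40 * Z) :
    ENNReal.ofReal (2 ^ (-s)) ≤ jointLaw d m N α α' {ω | Good s θ θ' α α'
      (range fun i => (ω.1 i : EuclideanSpace ℝ (Fin d))) (rpcCode ω.2.1) (rpcCode ω.2.2)} := by
  have hL := Lam_pos d
  have hL1 := h.one_le_Lam
  have hL256 := h.two_le_Lam
  obtain ⟨w1, w2⟩ := wedge_bounds h hA
  obtain ⟨w3, w4⟩ := wedge_bounds h hA'
  rw [capP_eq_pa] at h1 h2 hmZ
  have hp := pa_pos hA.pos hA.a_ge hA.a_le d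
  have hp' := pa_pos hA'.pos hA'.a_ge hA'.a_le d
  have hpa1 : pa d (Real.cos α) ≤ 1 := Real.rpow_le_one
    (by nlinarith [Real.abs_cos_le_one α, sq_abs (Real.cos α), abs_nonneg (Real.cos α)])
    (by nlinarith [sq_nonneg (Real.cos α)]) (by positivity)
  have hLL : Lam d ≤ Lam d ^ 2 := le_self_pow₀ hL1 (by norm_num)
  have hR1 : 1 ≤ R := by linarith
  have hR4 : 4 * Lam d ^ 2 ≤ R := by linarith
  have hW0 : 0 ≤ wedge d θ α α := measureReal_nonneg
  have hW0' : 0 ≤ wedge d θ' α' α' := measureReal_nonneg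
  have hm0 : (0 : ℝ) ≤ m := Nat.cast_nonneg _
  have hRm : R ≤ m := h1.trans (mul_le_of_le_one_right hm0 hpa1)
  have hm4 : 4 ≤ m := by
    have : (4 : ℝ) ≤ m := by linarith
    exact_mod_cast this
  have hn : (m : ℝ) ≤ 6 * (m / 3 : ℕ) := by exact_mod_cast (by omega : m ≤ 6 * (m / 3))
  have hn0 : (0 : ℝ) ≤ (m / 3 : ℕ) := Nat.cast_nonneg _
  have hu := hA.wa_pos d
  have hu' := hA'.wa_pos d
  have hnw : 1 ≤ (m / 3 : ℕ) * wa d (Real.cos α) (Real.cos θ) := by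
    have e : 36 * Lam d * Lam d ≤ 6 * Lam d * ((m / 3 : ℕ) * wa d (Real.cos α) (Real.cos θ)) := by
      calc 36 * Lam d * Lam d = 36 * Lam d ^ 2 := by ring
        _ ≤ m * wedge d θ α α := hR.trans h3
        _ ≤ (6 * (m / 3 : ℕ)) * (Lam d * wa d (Real.cos α) (Real.cos θ)) :=
          mul_le_mul hn w2 hW0 (by positivity)
        _ = _ := by ring
    have e' : 36 * Lam d * Lam d = 6 * Lam d * (6 * Lam d) := by ring
    rw [e'] at e
    have := le_of_mul_le_mul_left e (by positivity)
    linarith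
  have hnw' : 1 ≤ ((m / 3 : ℕ) : ℝ) ^ 2 * wa d (Real.cos α') (Real.cos θ') := by
    have e : 36 * Lam d * Lam d ≤
        36 * Lam d * (((m / 3 : ℕ) : ℝ) ^ 2 * wa d (Real.cos α') (Real.cos θ')) := by
      calc 36 * Lam d * Lam d = 36 * Lam d ^ 2 := by ring
        _ ≤ (m : ℝ) ^ 2 * wedge d θ' α' α' := hR.trans h4
        _ ≤ (6 * (m / 3 : ℕ)) ^ 2 * (Lam d * wa d (Real.cos α') (Real.cos θ')) :=
          mul_le_mul (pow_le_pow_left₀ hm0 hn 2) w4 hW0' (by positivity)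
        _ = _ := by ring
    exact hL1.trans (le_of_mul_le_mul_left e (by positivity))
  have hY : m * (Lam d * pa d (Real.cos θ')) ≤ Lam d * Z := by
    calc _ = Lam d * (m * pa d (Real.cos θ')) := by ring
      _ ≤ _ := by gcongr
  have hX0 : 0 ≤ X := hm0.trans hmX
  have hX1 : 1 ≤ X := hR1.trans (hRm.trans hmX)
  have hXX : X ≤ X ^ 2 := le_self_pow₀ hX1 (by norm_num)
  have key := le_prob_typical h hA hA' q (by omega) hnw hnw' hY
  have hexp : Lam d * X ^ 2 * (2 * Real.exp (-Lam d)) ≤ (Lam d ^ 19)⁻¹ := by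
    rw [Real.exp_neg, ← div_eq_mul_inv, ← mul_div_assoc, div_le_iff₀ (Real.exp_pos _),
      le_inv_mul_iff₀ (by positivity)]
    calc _ = 2 * Lam d ^ 20 * X ^ 2 := by ring
      _ ≤ _ := hX
  have bad : ∀ t, k ≤ t → t ≤ 1 - k → R ≤ m * pa d t →
      (Fintype.card (CodeIdx (Nat.log 2 d) N (1 / pa d t)) : ℝ) *
        (2 * Real.exp (-(m * ((Lam d)⁻¹ * pa d t) / 4))) ≤ (Lam d ^ 19)⁻¹ := by
    intro t ht ht1 hRt
    have hpt := pa_pos hA.pos ht ht1 d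
    refine le_trans ?_ hexp
    have hc := h.codeSize t ht ht1
    have i1 : (Fintype.card (CodeIdx (Nat.log 2 d) N (1 / pa d t)) : ℝ) ≤ Lam d * X ^ 2 := by
      have h5 : 1 ≤ m * pa d t := hR1.trans hRt
      calc (Fintype.card (CodeIdx (Nat.log 2 d) N (1 / pa d t)) : ℝ) ≤
            (Fintype.card (CodeIdx (Nat.log 2 d) N (1 / pa d t)) : ℝ) * (m * pa d t) :=
            le_mul_of_one_le_right (Nat.cast_nonneg _) h5
        _ = m * ((Fintype.card (CodeIdx (Nat.log 2 d) N (1 / pa d t)) : ℝ) * pa d t) := by ring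
        _ ≤ X * Lam d := mul_le_mul hmX hc (by positivity) hX0
        _ ≤ X ^ 2 * Lam d := by gcongr
        _ = _ := by ring
    refine mul_le_mul i1 ?_ (by positivity) (by positivity)
    refine mul_le_mul_of_nonneg_left (Real.exp_le_exp.2 (neg_le_neg ?_)) (by norm_num)
    rw [le_div_iff₀ (by norm_num)]
    calc Lam d * 4 = (Lam d)⁻¹ * (4 * Lam d ^ 2) := by field_simp
      _ ≤ (Lam d)⁻¹ * (m * pa d t) := by
          exact mul_le_mul_of_nonneg_left (hR4.trans hRt) (by positivity)
      _ = _ := by ring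
  have bad3 : (m : ℝ) ^ 2 * Real.exp (-(Lam d * Z)) ≤ (Lam d ^ 19)⁻¹ := by
    refine le_trans ?_ hexp
    calc (m : ℝ) ^ 2 * Real.exp (-(Lam d * Z)) ≤ X ^ 2 * Real.exp (-Lam d) := by
          gcongr
          exact le_mul_of_one_le_right hL.le hZ
      _ ≤ Lam d * 2 * (X ^ 2 * Real.exp (-Lam d)) :=
          le_mul_of_one_le_left (by positivity) (by linarith)
      _ = _ := by ring
  have tot : ENNReal.ofReal (Lam d ^ 19)⁻¹ + ENNReal.ofReal (5 * (Lam d ^ 19)⁻¹) ≤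
      jointLaw d m N α α' {ω | Typical (Real.cos α) (Real.cos θ) (Real.cos α') (Real.cos θ')
        (Lam d * Z) q ω} + ENNReal.ofReal (5 * (Lam d ^ 19)⁻¹) := by
    rw [← ENNReal.ofReal_add (by positivity) (by positivity)]
    refine le_trans (ENNReal.ofReal_le_ofReal ?_) (key.trans (add_le_add le_rfl ?_))
    · calc (Lam d ^ 19)⁻¹ + 5 * (Lam d ^ 19)⁻¹ = 6 * (Lam d ^ 19)⁻¹ := by ring
        _ ≤ Lam d * (Lam d ^ 19)⁻¹ := by gcongr; linarith
        _ = _ := by field_simp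
    · have e : 5 * (Lam d ^ 19)⁻¹ = (Lam d ^ 19)⁻¹ + (Lam d ^ 19)⁻¹ + (Lam d ^ 19)⁻¹ +
          (Lam d ^ 19)⁻¹ + (Lam d ^ 19)⁻¹ := by ring
      have hi : 0 ≤ (Lam d ^ 19)⁻¹ := by positivity
      rw [e, ENNReal.ofReal_add (by positivity) hi, ENNReal.ofReal_add (by positivity) hi,
        ENNReal.ofReal_add (by positivity) hi, ENNReal.ofReal_add hi hi]
      exact add_le_add (add_le_add (add_le_add (add_le_add
        (ENNReal.ofReal_le_ofReal (bad _ hA.a_ge hA.a_le h1))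
        (ENNReal.ofReal_le_ofReal (bad _ hA'.a_ge hA'.a_le h2)))
        (ENNReal.ofReal_le_ofReal bad3)) le_rfl) le_rfl
  refine le_trans ?_ (((ENNReal.add_le_add_iff_right ENNReal.ofReal_ne_top).1 tot).trans
    (measure_mono fun ω hω => Typical.good h hA hA' hm4 ?_ ?_ w1 w2 w3 w4 hω))
  · refine ENNReal.ofReal_le_ofReal ?_
    rw [Real.rpow_neg (by norm_num), hs]
    refine inv_anti₀ (by positivity) ?_
    calc Lam d ^ 19 ≤ Lam d ^ 40 := pow_le_pow_right₀ hL1 (by norm_num)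
      _ ≤ _ := le_mul_of_one_le_right (by positivity) hZ
  · rw [hs]
    exact le_mul_of_one_le_right (by positivity) hZ
  · rw [hs]
    calc 2 + 4 * (Lam d * Z) ≤ 6 * (Lam d * Z) := by nlinarith
      _ ≤ Lam d * (Lam d * Z) := by gcongr; linarith
      _ = Lam d ^ 2 * Z := by ring
      _ ≤ _ := by gcongr; norm_num

end WedgeBounds

theorem Adm.of_angles {κ κ' k θ α : ℝ} (hκ : κ ∈ Ioo 0 (Real.pi / 4)) (hk : 0 < k)
    (hk1 : k ≤ Real.sin κ) (hk2 : k ≤ (1 - Real.cos κ) ^ 2) (hk3 : k ≤ κ' * Real.sin κ ^ 2)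
    (hκ' : 0 < κ') (hθ : θ ∈ Icc κ (Real.pi / 2 - κ)) (hα : α ∈ Icc κ (Real.pi / 2 - κ))
    (hc : Real.cos α ^ 2 ≤ Real.cos θ)
    (hW : (α ≠ 0 ∧
      κ' ≤ (Real.cos θ ^ 2 + Real.cos α ^ 2 - 2 * Real.cos θ * Real.cos α * Real.cos α) /
        Real.sin α ^ 2 ∧
      (Real.cos θ ^ 2 + Real.cos α ^ 2 - 2 * Real.cos θ * Real.cos α * Real.cos α) /
        Real.sin α ^ 2 ≤ 1 - κ') ∨
      (θ = α ∧ 2 * Real.cos θ ^ 2 / (1 + Real.cos α) ≤ 1 - κ')) :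
    Adm k (Real.cos α) (Real.cos θ) := by
  have hpi := Real.pi_pos
  obtain ⟨κ0, κ1⟩ := hκ
  have lo : ∀ t ∈ Icc κ (Real.pi / 2 - κ), Real.sin κ ≤ Real.cos t := fun t ht => by
    rw [← Real.cos_pi_div_two_sub]
    exact Real.cos_le_cos_of_nonneg_of_le_pi (by linarith [ht.1]) (by linarith) ht.2
  have hi : ∀ t ∈ Icc κ (Real.pi / 2 - κ), Real.cos t ≤ Real.cos κ := fun t ht =>
    Real.cos_le_cos_of_nonneg_of_le_pi κ0.le (by linarith [ht.2]) ht.1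
  have hcκ : 0 ≤ Real.cos κ := Real.cos_nonneg_of_neg_pi_div_two_le_of_le (by linarith) (by linarith)
  have hcκ1 := Real.cos_le_one κ
  have hk4 : k ≤ 1 - Real.cos κ := hk2.trans (by nlinarith)
  have l1 := lo α hα
  have l2 := hi α hα
  refine ⟨hk, hk1.trans l1, by linarith, hk1.trans (lo θ hθ), by linarith [hi θ hθ], hc, ?_⟩
  have hs0 : 0 < Real.sin κ := Real.sin_pos_of_pos_of_lt_pi κ0 (by linarith)
  have hss : Real.sin κ ^ 2 ≤ Real.sin α ^ 2 := by
    nlinarith [Real.sin_sq_add_cos_sq α, Real.sin_sq_add_cos_sq κ]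
  rcases hW with ⟨-, -, hW⟩ | ⟨rfl, -⟩
  · rw [div_le_iff₀ (lt_of_lt_of_le (by positivity) hss)] at hW
    nlinarith [Real.sin_sq_add_cos_sq α]
  · have : (1 - Real.cos κ) ^ 2 ≤ (1 - Real.cos θ) ^ 2 := by
      have : 0 ≤ 1 - Real.cos κ := by linarith
      gcongr
    nlinarith [mul_nonneg (sq_nonneg (1 - Real.cos θ)) (hs0.le.trans l1)]

/-! ### Choice of the rate -/

theorem eventually_Lam_sq_le {r : ℝ} (hr : 0 < r) :
    ∀ᶠ d : ℕ in atTop, 36 ≤ Lam d → 36 * Lam d ^ 2 ≤ 2 ^ (r * d) := by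
  filter_upwards [eventually_le_ell (3 / r)] with d h1 h2
  have h0 : 0 < ell d := lt_of_lt_of_le (by positivity) h1
  have hL := Lam_pos d
  calc 36 * Lam d ^ 2 ≤ Lam d * Lam d ^ 2 := by gcongr
    _ = Lam d ^ (3 : ℝ) := by norm_cast; ring
    _ = 2 ^ ((d : ℝ) / ell d * 3) := by rw [Lam, ← Real.rpow_mul (by norm_num)]
    _ ≤ 2 ^ (r * d) := by
      refine Real.rpow_le_rpow_of_exponent_le (by norm_num) ?_
      rw [div_mul_eq_mul_div, div_le_iff₀ h0]
      rw [div_le_iff₀ hr] at h1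
      nlinarith [(Nat.cast_nonneg d : (0 : ℝ) ≤ d)]

theorem eventually_mul_le_Lam (C : ℝ) : ∀ᶠ d : ℕ in atTop, C * d ≤ Lam d := by
  filter_upwards [eventually_ge_atTop ⌈C⌉₊, eventually_ge_atTop 2,
    eventually_mul_ell_pow_le 2 2] with d h1 h2 h3
  have hd : (1 : ℝ) < d := by exact_mod_cast h2
  have h0 : 0 < ell d := Real.logb_pos (by norm_num) hd
  calc C * d ≤ d * d := by gcongr; exact Nat.ceil_le.1 h1
    _ = 2 ^ ell d * 2 ^ ell d := by
      rw [ell, Real.rpow_logb (by norm_num) (by norm_num) (by linarith)]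
    _ = 2 ^ (2 * ell d) := by rw [two_mul, Real.rpow_add (by norm_num)]
    _ ≤ _ := by
      refine Real.rpow_le_rpow_of_exponent_le (by norm_num) ?_
      rw [le_div_iff₀ h0]
      linarith

theorem eventually_Lam_pow_mul_le_exp (A : ℝ) : ∀ᶠ d : ℕ in atTop, 2 ≤ Lam d →
    2 * Lam d ^ 20 * (2 ^ (A * d)) ^ 2 ≤ Real.exp (Lam d) := by
  filter_upwards [eventually_le_ell 1, eventually_mul_le_Lam (21 + 2 * |A|)] with d h1 h2 h3
  have hL := Lam_pos d
  have h0 : 0 < ell d := by linarith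
  have hd : (0 : ℝ) ≤ d := Nat.cast_nonneg d
  calc 2 * Lam d ^ 20 * (2 ^ (A * d)) ^ 2 ≤ Lam d * Lam d ^ 20 * (2 ^ (A * d)) ^ 2 := by gcongr
    _ = Lam d ^ (21 : ℝ) * (2 ^ (A * d)) ^ (2 : ℝ) := by norm_cast; ring
    _ = 2 ^ ((d : ℝ) / ell d * 21 + A * d * 2) := by
      rw [Lam, ← Real.rpow_mul (by norm_num), ← Real.rpow_mul (by norm_num),
        Real.rpow_add (by norm_num)]
    _ ≤ 2 ^ (Lam d) := by
      refine Real.rpow_le_rpow_of_exponent_le (by norm_num) (le_trans ?_ h2)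
      have h4 : (d : ℝ) / ell d ≤ d := div_le_self hd h1
      nlinarith [mul_le_mul_of_nonneg_right (le_abs_self A) hd]
    _ ≤ Real.exp (Lam d) := by
      rw [← Real.exp_one_rpow]
      have := Real.exp_one_gt_d9
      exact Real.rpow_le_rpow (by norm_num) (by linarith) hL.le

theorem isLittleO_rate {ζ : ℕ → ℝ} (hζ : ζ =o[atTop] fun d : ℕ => (d : ℝ)) :
    (fun d : ℕ => 40 * ((d : ℝ) / ell d) + |ζ d|) =o[atTop] fun d : ℕ => (d : ℝ) := by
  refine IsLittleO.add ?_ hζ.norm_left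
  have h1 : (fun d : ℕ => (ell d)⁻¹) =o[atTop] fun _ : ℕ => (1 : ℝ) :=
    (isLittleO_one_iff ℝ).2 tendsto_ell.inv_tendsto_atTop
  simpa [div_eq_mul_inv] using ((isBigO_refl (fun d : ℕ => (d : ℝ)) atTop).mul_isLittleO h1).const_mul_left 40

end GoodRPC

end

theorem mainTheorem4
    (m N : ℕ → ℕ) (κ : ℝ) (θ θ' α α' : ℕ → ℝ)
    -- `m = 2^{Θ(d)}`
    (hm : ∃ a A : ℝ, 0 < a ∧ ∀ᶠ d : ℕ in atTop,
      (2 : ℝ) ^ (a * d) ≤ m d ∧ (m d : ℝ) ≤ 2 ^ (A * d))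
    -- the number of rotations in each random product code is `2^{o(d / log d)}`
    (hN_pos : ∀ᶠ d in atTop, 1 ≤ N d)
    (hN : (fun d : ℕ => Real.logb 2 (N d)) =o[atTop] fun d : ℕ => (d : ℝ) / Real.logb 2 d)
    (hκ : κ ∈ Ioo 0 (Real.pi / 4))
    (hθ : ∀ᶠ d in atTop, θ d ∈ Icc κ (Real.pi / 2 - κ))
    (hθ' : ∀ᶠ d in atTop, θ' d ∈ Icc κ (Real.pi / 2 - κ))
    (hα : ∀ᶠ d in atTop, α d ∈ Icc κ (Real.pi / 2 - κ))
    (hα' : ∀ᶠ d in atTop, α' d ∈ Icc κ (Real.pi / 2 - κ))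
    (hW₁ : WedgeWellDefined θ α α) (hW₂ : WedgeWellDefined α α θ)
    (hW₁' : WedgeWellDefined θ' α' α') (hW₂' : WedgeWellDefined α' α' θ')
    -- both caps that bound the wedges of `W_d(θ, α ∣ α)` and `W_d(θ', α' ∣ α')` are active
    (hcorner : ∀ᶠ d in atTop, Real.cos (α d) ^ 2 ≤ Real.cos (θ d))
    (hcorner' : ∀ᶠ d in atTop, Real.cos (α' d) ^ 2 ≤ Real.cos (θ' d))
    -- `m p_θ' ≤_d 1`
    (hp : ∃ ζ : ℕ → ℝ, ζ =o[atTop] (fun d : ℕ => (d : ℝ)) ∧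
      ∀ᶠ d in atTop, m d * capP d (θ' d) ≤ 2 ^ ζ d)
    -- `min {m p_α, m p_α', m W_d(θ, α ∣ α), m² W_d(θ', α' ∣ α')} = 2^{Ω(d)}`
    (hmin : ∃ a : ℝ, 0 < a ∧ ∀ᶠ d : ℕ in atTop,
      (2 : ℝ) ^ (a * d) ≤ m d * capP d (α d) ∧
      (2 : ℝ) ^ (a * d) ≤ m d * capP d (α' d) ∧
      (2 : ℝ) ^ (a * d) ≤ m d * wedge d (θ d) (α d) (α d) ∧
      (2 : ℝ) ^ (a * d) ≤ (m d : ℝ) ^ 2 * wedge d (θ' d) (α' d) (α' d)) :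
    ∃ η : ℕ → ℝ, η =o[atTop] (fun d : ℕ => (d : ℝ)) ∧
      ∀ᶠ d in atTop, ENNReal.ofReal (2 ^ (-η d)) ≤
        jointLaw d (m d) (N d) (α d) (α' d)
          {ω | Good (η d) (θ d) (θ' d) (α d) (α' d)
            (range fun i => (ω.1 i : EuclideanSpace ℝ (Fin d)))
            (rpcCode ω.2.1) (rpcCode ω.2.2)} := by
  obtain ⟨r, hr, hmin⟩ := hmin
  obtain ⟨_, A, -, hm⟩ := hm
  obtain ⟨ζ, hζ, hp⟩ := hp
  obtain ⟨κ₁, hκ₁, hW₁⟩ := hW₁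
  obtain ⟨κ₂, hκ₂, hW₁'⟩ := hW₁'
  have hpi := Real.pi_pos
  have hs : 0 < Real.sin κ := Real.sin_pos_of_pos_of_lt_pi hκ.1 (by linarith [hκ.2])
  have hc : 0 < 1 - Real.cos κ := by
    have := Real.cos_lt_cos_of_nonneg_of_le_pi le_rfl (by linarith [hκ.2]) hκ.1
    rw [Real.cos_zero] at this
    linarith
  obtain ⟨k, hk, k1, k2, k3, k4⟩ : ∃ k : ℝ, 0 < k ∧ k ≤ Real.sin κ ∧ k ≤ (1 - Real.cos κ) ^ 2 ∧
      k ≤ κ₁ * Real.sin κ ^ 2 ∧ k ≤ κ₂ * Real.sin κ ^ 2 :=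
    ⟨min (min (Real.sin κ) ((1 - Real.cos κ) ^ 2))
        (min (κ₁ * Real.sin κ ^ 2) (κ₂ * Real.sin κ ^ 2)), by positivity,
      (min_le_left _ _).trans (min_le_left _ _), (min_le_left _ _).trans (min_le_right _ _),
      (min_le_right _ _).trans (min_le_left _ _), (min_le_right _ _).trans (min_le_right _ _)⟩
  refine ⟨_, isLittleO_rate hζ, ?_⟩
  filter_upwards [eventually_dimFacts hk hN_pos hN, hN_pos, hm, hθ, hθ', hα, hα', hcorner,
    hcorner', hW₁, hW₁', hp, hmin, eventually_Lam_sq_le hr,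
    eventually_Lam_pow_mul_le_exp A] with d h hN hm hθ hθ' hα hα' hcor hcor' hW hW' hp hmin hR hX
  obtain ⟨m1, m2, m3, m4⟩ := hmin
  have hL := h.two_le_Lam
  refine le_prob_good h (Adm.of_angles hκ hk k1 k2 k3 hκ₁ hθ hα hcor hW)
    (Adm.of_angles hκ hk k1 k2 k4 hκ₂ hθ' hα' hcor' hW') ⟨0, hN⟩ (hR (by linarith)) m1 m2 m3 m4
    hm.2 (hX (by linarith)) (Z := 2 ^ |ζ d|)
    (Real.one_le_rpow (by norm_num) (abs_nonneg _))
    (hp.trans (Real.rpow_le_rpow_of_exponent_le (by norm_num) (le_abs_self _))) ?_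
  rw [Real.rpow_add (by norm_num), mul_comm 40, Real.rpow_mul (by norm_num)]
  exact congrArg (· * _) (Real.rpow_natCast (Lam d) 40)
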